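/- Let $l,L>0$, $\Omega=(0,l)\times(0,L)\times(0,1)$, $\Gamma_1=\partial\Omega\cap\{x_3=1\}$, $\Gamma_0=\partial\Omega\setminus\Gamma_1$, and let $\mathbf n$ be the outward unit normal. Let $\Gamma_0=\Gamma_0^1\cup\Gamma_0^2$ be a disjoint union of measurable sets. Let $H^{1/2}(\Gamma)$ be the space of restrictions to $\Gamma\subseteq\partial\Omega$ of traces of functions of $H^1(\Omega)$, with the quotient norm, and let $H^{1/2}_{00}(\Gamma)$ be the space of functions on $\Gamma$ whose extension by zero lies in $H^{1/2}(\partial\Omega)$, normed by the $H^{1/2}(\partial\Omega)$-norm of that extension. Let $\widetilde{\mathbf H}^{1/2}_{00}(\Gamma)$ be the space of vector fields $\mathbf v$ with components in $H^{1/2}_{00}(\Gamma)$, $\int_\Gamma\mathbf v\cdot\mathbf n\,dS=0$ and $\mathbf v\cdot\mathbf n=0$ on $\Gamma\setminus\{x_3=0\}$. Put $$\mathbf X=\{\mathbf u\in \mathbf H^1(\Omega):\operatorname{div}\mathbf u=0,\ u_3=0\text{ on }\Gamma_1\},\qquad \mathbf X_0=\{\mathbf u\in\mathbf X:\mathbf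 u=0\text{ on }\Gamma_0\},$$ $$\widetilde{\mathbf X}=\{\mathbf u\in\mathbf X:\mathbf u\cdot\mathbf n=0\text{ on }\Gamma_0\setminus\{x_3=0\}\},\qquad Y=\{S\in H^1(\Omega): S=0\text{ on }\{x_3=0\}\}.$$ Let $Pr>0$, $M,R\ge 0$, $B>0$, $b\in\mathbb R$. Given boundary data $\mathbf g$ on $\Gamma_0^1$, $\mathbf u^0$ on $\Gamma_0^2$, $\phi_1$ on $\Gamma_0\setminus\{x_3=0\}$ and $\phi_2$ on $\{x_3=0\}$, a weak solution is a pair $[\mathbf u,\theta]\in\mathbf X\times H^1(\Omega)$ with $$Pr\int_\Omega\nabla\mathbf u\cdot\nabla\mathbf v+Pr\,M\int_\Omega\nabla\theta\cdot\frac{\partial\mathbf v}{\partial x_3}+\int_\Omega[(\mathbf u\cdot\nabla)\mathbf u]\cdot\mathbf v=\int_\Omega Pr(b+R\theta)v_3\qquad\forall\mathbf v\in\mathbf X_0,$$ $$\int_\Omega[(\mathbf u\cdot\nabla)\theta]W+\int_\Omega\nabla\theta\cdot\nabla W+\int_{\Gamma_1}B\theta W\,dS=\int_{\Gamma_0\setminus\{x_3=0\}}\phi_1W\,dS\qquad\forall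 W\in Y,$$ and $\mathbf u=\mathbf g$ on $\Gamma_0^1$, $\mathbf u=\mathbf u^0$ on $\Gamma_0^2$, $\theta=\phi_2$ on $\{x_3=0\}$. (1) For every $\Lambda>0$ there is $K>0$, depending only on $\Omega$ and $\Lambda$, such that the following holds with $C=K(1+M+B+R)$ for all $Pr,M,R,B,b,\Gamma_0^1,\Gamma_0^2$ as above. Let $\phi_1\in H^{1/2}(\Gamma_0\setminus\{x_3=0\})$, $\phi_2\in H^{1/2}_{00}(\{x_3=0\})$, $\mathbf u^0\in\widetilde{\mathbf H}^{1/2}_{00}(\Gamma_0^2)$, $\mathbf g\in\widetilde{\mathbf H}^{1/2}_{00}(\Gamma_0^1)$, and put $$D=\|\mathbf u^0\|_{H^{1/2}_{00}(\Gamma_0^2)}+\|\mathbf g\|_{H^{1/2}_{00}(\Gamma_0^1)}+\|\phi_1\|_{H^{1/2}(\Gamma_0\setminus\{x_3=0\})}+\|\phi_2\|_{H^{1/2}(\{x_3=0\})}.$$ If $D\le\Lambda$ and $$Pr-C\,(Pr(M+R)+1)\,D>0,$$ then there is exactly one weak solution $[\mathbf u,\theta]\in\widetilde{\mathbf X}\times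 H^1(\Omega)$, and it satisfies $$\|\mathbf u\|_{H^1(\Omega)}+\|\theta\|_{H^1(\Omega)}\le C\,D.$$ (2) For every $\theta_c\in\mathbb R$ there is $\varepsilon>0$ such that for all $Pr>0$, $b\in\mathbb R$, $0\le M<\varepsilon$, $0\le R<\varepsilon$, $0<B<\varepsilon$ and the data $\mathbf u^0=0$, $\mathbf g=0$, $\phi_1=0$, $\phi_2=\theta_c$, the basic conduction state $\mathbf u_b=0$, $\theta_b=\theta_c-\frac{\theta_cB}{1+B}x_3$ is a weak solution, and it is the only one in $\widetilde{\mathbf X}\times H^1(\Omega)$. -/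

import Mathlib

open MeasureTheory Set
open scoped ContDiff ENNReal

namespace RBM

noncomputable section

/-- Points of `ℝ³`; the coordinates `x₁, x₂, x₃` are `x 0, x 1, x 2`. -/
abbrev Pt : Type := Fin 3 → ℝ

/-- Edge lengths of the container. -/
def side (l L : ℝ) : Fin 3 → ℝ := ![l, L, 1]

/-- `Ω = (0,l) × (0,L) × (0,1)`. -/
def box (l L : ℝ) : Set Pt := {x | ∀ i, 0 < x i ∧ x i < side l L i}

/-- The (two-dimensional) cross-section of `Ω` orthogonal to the `i`-th axis. -/
def faceBox (l L : ℝ) (i : Fin 3) : Set (Fin 2 → ℝ) :=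
  {y | ∀ j, 0 < y j ∧ y j < side l L (i.succAbove j)}

/-- The point whose `i`-th coordinate is `a` and whose other coordinates are, in order, `y`. -/
def facePt (i : Fin 3) (a : ℝ) (y : Fin 2 → ℝ) : Pt := i.insertNth (α := fun _ => ℝ) a y

/-- Surface measure `dS` on `∂Ω`: on each of the six faces it is the area. -/
def surf (l L : ℝ) : Measure Pt :=
  ∑ i : Fin 3,
    ((volume.restrict (faceBox l L i)).map (facePt i 0) +
      (volume.restrict (faceBox l L i)).map (facePt i (side l L i)))

/-- Outward unit normal (at every point of `∂Ω` off the edges). -/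
def normal (l L : ℝ) (x : Pt) : Pt := fun i =>
  if x i = 0 then -1 else if x i = side l L i then 1 else 0

/-- `Γ₁ = ∂Ω ∩ {x₃ = 1}`. -/
def Gamma1 (l L : ℝ) : Set Pt := {x ∈ frontier (box l L) | x 2 = 1}

/-- `Γ₀ = ∂Ω \ Γ₁`. -/
def Gamma0 (l L : ℝ) : Set Pt := frontier (box l L) \ Gamma1 l L

/-- The bottom `∂Ω ∩ {x₃ = 0}`. -/
def bottom (l L : ℝ) : Set Pt := {x ∈ frontier (box l L) | x 2 = 0}

/-- The lateral walls `Γ₀ \ {x₃ = 0}`. -/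
def lateral (l L : ℝ) : Set Pt := {x ∈ Gamma0 l L | x 2 ≠ 0}

/-! ### Sobolev spaces -/

/-- `L²(Ω)`. -/
abbrev L2 (l L : ℝ) : Type := Lp ℝ 2 (volume.restrict (box l L))

/-- `L²(∂Ω)`. -/
abbrev L2bd (l L : ℝ) : Type := Lp ℝ 2 (surf l L)

/-- The classical partial derivative `∂φ/∂xᵢ`. -/
def pd (i : Fin 3) (φ : Pt → ℝ) (x : Pt) : ℝ := fderiv ℝ φ x (Pi.single i 1)

/-- Test functions: `C_c^∞(Ω)`. -/
structure IsTest (l L : ℝ) (φ : Pt → ℝ) : Prop where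
  smooth : ContDiff ℝ ∞ φ
  compact : HasCompactSupport φ
  supp : tsupport φ ⊆ box l L

/-- `g` is the weak derivative `∂f/∂xᵢ` in `Ω`. -/
def IsWeakDeriv (l L : ℝ) (i : Fin 3) (f g : L2 l L) : Prop :=
  ∀ φ : Pt → ℝ, IsTest l L φ →
    ∫ x in box l L, f x * pd i φ x = -∫ x in box l L, g x * φ x

theorem IsTest.memLp {l L : ℝ} {φ : Pt → ℝ} (h : IsTest l L φ) :
    MemLp φ 2 (volume.restrict (box l L)) :=
  (h.smooth.continuous.memLp_of_hasCompactSupport h.compact).restrict _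

theorem IsTest.memLp_pd {l L : ℝ} {φ : Pt → ℝ} (h : IsTest l L φ) (i : Fin 3) :
    MemLp (pd i φ) 2 (volume.restrict (box l L)) := by
  have hc : Continuous (pd i φ) :=
    (h.smooth.continuous_fderiv (by simp)).clm_apply continuous_const
  have hs : HasCompactSupport (pd i φ) := h.compact.fderiv_apply (𝕜 := ℝ) (Pi.single i 1)
  exact (hc.memLp_of_hasCompactSupport hs).restrict _

theorem integrable_mul_of {l L : ℝ} (f : L2 l L) {ψ : Pt → ℝ}
    (h : MemLp ψ 2 (volume.restrict (box l L))) :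
    Integrable (fun x => f x * ψ x) (volume.restrict (box l L)) :=
  (Lp.memLp f).integrable_mul h

theorem integral_add_mul {l L : ℝ} (f g : L2 l L) {ψ : Pt → ℝ}
    (h : MemLp ψ 2 (volume.restrict (box l L))) :
    ∫ x in box l L, (f + g : L2 l L) x * ψ x =
      (∫ x in box l L, f x * ψ x) + ∫ x in box l L, g x * ψ x := by
  rw [← integral_add (integrable_mul_of f h) (integrable_mul_of g h)]
  refine integral_congr_ae ?_
  filter_upwards [Lp.coeFn_add f g] with x hx
  rw [hx, Pi.add_apply, add_mul]

theorem integral_smul_mul {l L : ℝ} (c : ℝ) (f : L2 l L) (ψ : Pt → ℝ) :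
    ∫ x in box l L, (c • f : L2 l L) x * ψ x = c * ∫ x in box l L, f x * ψ x := by
  rw [← integral_const_mul]
  refine integral_congr_ae ?_
  filter_upwards [Lp.coeFn_smul c f] with x hx
  rw [hx, Pi.smul_apply, smul_eq_mul, mul_assoc]

theorem isWeakDeriv_zero (l L : ℝ) (i : Fin 3) : IsWeakDeriv l L i 0 0 := by
  intro φ _
  have h1 := integral_smul_mul (0 : ℝ) (0 : L2 l L) (pd i φ)
  have h2 := integral_smul_mul (0 : ℝ) (0 : L2 l L) φ
  rw [smul_zero, zero_mul] at h1 h2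
  rw [h1, h2, neg_zero]

/-- `H¹(Ω)`, as the space of pairs `(f, ∇f)` with `f` and its weak gradient in `L²`.  The inherited
norm is `(‖f‖² + ∑ᵢ ‖∂ᵢf‖²)^{1/2}`. -/
def H1 (l L : ℝ) :
    Submodule ℝ (WithLp 2 (L2 l L × PiLp 2 (fun _ : Fin 3 => L2 l L))) where
  carrier := {p | ∀ i, IsWeakDeriv l L i p.fst (p.snd i)}
  zero_mem' := fun i => isWeakDeriv_zero l L i
  add_mem' := by
    intro p q hp hq i φ hφ
    have h1 := integral_add_mul p.fst q.fst (hφ.memLp_pd i)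
    have h2 := integral_add_mul (p.snd i) (q.snd i) hφ.memLp
    have h3 := hp i φ hφ
    have h4 := hq i φ hφ
    simp only [WithLp.add_fst, WithLp.add_snd, PiLp.add_apply]
    rw [h1, h2, h3, h4]
    ring
  smul_mem' := by
    intro c p hp i φ hφ
    have h1 := integral_smul_mul c p.fst (pd i φ)
    have h2 := integral_smul_mul c (p.snd i) φ
    have h3 := hp i φ hφ
    simp only [WithLp.smul_fst, WithLp.smul_snd, PiLp.smul_apply]
    rw [h1, h2, h3]
    ring

/-- The function underlying an element of `H¹(Ω)`. -/
def fn {l L : ℝ} (u : H1 l L) : L2 l L := u.1.fst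

/-- The weak partial derivative `∂u/∂xᵢ`. -/
def D {l L : ℝ} (i : Fin 3) (u : H1 l L) : L2 l L := u.1.snd i

/-- Vector fields with components in `H¹(Ω)`, with the Euclidean product norm. -/
abbrev VH1 (l L : ℝ) : Type := PiLp 2 (fun _ : Fin 3 => H1 l L)

/-! ### Traces and trace spaces -/

/-- Pairs `(φ|_Ω, φ|_∂Ω)` with `φ` smooth up to the boundary. -/
def smoothPairs (l L : ℝ) : Set (H1 l L × L2bd l L) :=
  {p | ∃ φ : Pt → ℝ, ContDiff ℝ ∞ φ ∧
    fn p.1 =ᵐ[volume.restrict (box l L)] φ ∧ p.2 =ᵐ[surf l L] φ}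

/-- `w` is the boundary value of `u`: there are `φₙ`, smooth up to the boundary, with `φₙ → u` in
`H¹(Ω)` and `φₙ|_∂Ω → w` in `L²(∂Ω)`. -/
def HasTrace {l L : ℝ} (u : H1 l L) (w : L2bd l L) : Prop :=
  (u, w) ∈ closure (smoothPairs l L)

open Classical in
/-- The trace of `u ∈ H¹(Ω)` on `∂Ω`, i.e. the `w` with `HasTrace u w`; it exists and is unique by
the trace theorem. -/
def trace {l L : ℝ} (u : H1 l L) : L2bd l L :=
  if h : ∃ w, HasTrace u w then h.choose else 0

/-- `u = v` on `Γ ⊆ ∂Ω`, in the sense of traces. -/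
def EqOn {l L : ℝ} (u : H1 l L) (v : Pt → ℝ) (Γ : Set Pt) : Prop :=
  trace u =ᵐ[(surf l L).restrict Γ] v

/-- `v ∈ H^{1/2}(Γ)`, i.e. `v` is the restriction to `Γ` of the trace of an `H¹(Ω)` function;
only the values of `v` on `Γ` matter. -/
def MemHalf (l L : ℝ) (Γ : Set Pt) (v : Pt → ℝ) : Prop :=
  ∃ u : H1 l L, EqOn u v Γ

/-- The (quotient) norm of `H^{1/2}(Γ)`. -/
def halfNorm (l L : ℝ) (Γ : Set Pt) (v : Pt → ℝ) : ℝ :=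
  sInf {r | ∃ u : H1 l L, EqOn u v Γ ∧ r = ‖u‖}

/-- `v ∈ H^{1/2}_{00}(Γ)`: the extension of `v` by zero to `∂Ω` is in `H^{1/2}(∂Ω)`. -/
def MemHalf00 (l L : ℝ) (Γ : Set Pt) (v : Pt → ℝ) : Prop :=
  MemHalf l L (frontier (box l L)) (Γ.indicator v)

/-- The norm of `H^{1/2}_{00}(Γ)`: the `H^{1/2}(∂Ω)` norm of the extension by zero. -/
def half00Norm (l L : ℝ) (Γ : Set Pt) (v : Pt → ℝ) : ℝ :=
  halfNorm l L (frontier (box l L)) (Γ.indicator v)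

/-- The normal component `v · n` of a boundary vector field. -/
def dotN (l L : ℝ) (v : Pt → Pt) (x : Pt) : ℝ := ∑ i, v x i * normal l L x i

/-- The space `H̃^{1/2}_{00}(Γ)` of vector fields on `Γ` with components in `H^{1/2}_{00}(Γ)`, zero
total flux, and zero normal component on `Γ \ {x₃ = 0}`. -/
structure MemHalfTilde (l L : ℝ) (Γ : Set Pt) (v : Pt → Pt) : Prop where
  mem : ∀ i, MemHalf00 l L Γ (fun x => v x i)
  flux : ∫ x in Γ, dotN l L v x ∂(surf l L) = 0
  tangential : ∀ᵐ x ∂((surf l L).restrict {x ∈ Γ | x 2 ≠ 0}), dotN l L v x = 0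

/-- The norm of a vector field on `Γ` with components in `H^{1/2}_{00}(Γ)`. -/
def vecHalf00Norm (l L : ℝ) (Γ : Set Pt) (v : Pt → Pt) : ℝ :=
  √(∑ i, half00Norm l L Γ (fun x => v x i) ^ 2)

/-! ### Function spaces of the problem -/

/-- `div u = 0`. -/
def DivFree {l L : ℝ} (u : VH1 l L) : Prop := ∑ i, D i (u i) = 0

/-- `X = {u ∈ H¹ : div u = 0, u₃ = 0 on Γ₁}`. -/
def X (l L : ℝ) : Set (VH1 l L) :=
  {u | DivFree u ∧ EqOn (u 2) 0 (Gamma1 l L)}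

/-- `X₀ = {u ∈ H¹ : div u = 0, u = 0 on Γ₀, u₃ = 0 on Γ₁}`. -/
def X0 (l L : ℝ) : Set (VH1 l L) :=
  {u | DivFree u ∧ (∀ i, EqOn (u i) 0 (Gamma0 l L)) ∧ EqOn (u 2) 0 (Gamma1 l L)}

/-- `Y = {S ∈ H¹ : S = 0 on {x₃ = 0}}`. -/
def Y (l L : ℝ) : Set (H1 l L) := {S | EqOn S 0 (bottom l L)}

/-- `X̃ = {u ∈ X : u · n = 0 on Γ₀ \ {x₃ = 0}}`. -/
def Xt (l L : ℝ) : Set (VH1 l L) :=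
  {u | u ∈ X l L ∧
    ∀ᵐ x ∂((surf l L).restrict (lateral l L)), dotN l L (fun x i => trace (u i) x) x = 0}

/-! ### The forms and the weak formulation -/

/-- `a(u,v) = ∫ ∇u · ∇v`. -/
def formA {l L : ℝ} (u v : VH1 l L) : ℝ :=
  ∫ x in box l L, ∑ i, ∑ j, D i (u j) x * D i (v j) x

/-- `c(u,v,z) = ∫ [(u · ∇)v] · z`. -/
def formC {l L : ℝ} (u v z : VH1 l L) : ℝ :=
  ∫ x in box l L, ∑ j, (∑ i, fn (u i) x * D i (v j) x) * fn (z j) x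

/-- `a₁(θ,W) = ∫ ∇θ · ∇W`. -/
def formA1 {l L : ℝ} (θ W : H1 l L) : ℝ :=
  ∫ x in box l L, ∑ i, D i θ x * D i W x

/-- `b₁(θ,v) = ∫ ∇θ · ∂v/∂x₃`. -/
def formB1 {l L : ℝ} (θ : H1 l L) (v : VH1 l L) : ℝ :=
  ∫ x in box l L, ∑ i, D i θ x * D 2 (v i) x

/-- `c₁(u,θ,W) = ∫ [(u · ∇)θ] W`. -/
def formC1 {l L : ℝ} (u : VH1 l L) (θ W : H1 l L) : ℝ :=
  ∫ x in box l L, (∑ i, fn (u i) x * D i θ x) * fn W x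

/-- `⟨f(θ), v⟩ = ∫ Pr (b + R θ) e₃ · v`. -/
def formF {l L : ℝ} (Pr R b : ℝ) (θ : H1 l L) (v : VH1 l L) : ℝ :=
  ∫ x in box l L, Pr * (b + R * fn θ x) * fn (v 2) x

/-- `[u,θ]` is a weak solution of the stationary Rayleigh–Bénard–Marangoni system, with boundary
data `g` on `Γ₀¹`, `u⁰` on `Γ₀²` (velocity), `φ₁` on the lateral walls (heat flux) and `φ₂` on the
bottom (temperature). -/
structure IsWeakSolution (l L Pr M R B b : ℝ) (Γ01 Γ02 : Set Pt) (u0 g : Pt → Pt)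
    (φ1 φ2 : Pt → ℝ) (u : VH1 l L) (θ : H1 l L) : Prop where
  mem : u ∈ X l L
  momentum : ∀ v ∈ X0 l L,
    Pr * formA u v + Pr * M * formB1 θ v + formC u u v = formF Pr R b θ v
  heat : ∀ W ∈ Y l L,
    formC1 u θ W + formA1 θ W + (∫ x in Gamma1 l L, B * trace θ x * trace W x ∂(surf l L))
      = ∫ x in lateral l L, φ1 x * trace W x ∂(surf l L)
  bc_g : ∀ i, EqOn (u i) (fun x => g x i) Γ01
  bc_u0 : ∀ i, EqOn (u i) (fun x => u0 x i) Γ02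
  bc_phi2 : EqOn θ φ2 (bottom l L)

/-- `[u,θ] ∈ X̃ × H¹(Ω)` is a weak solution. -/
def SolvesInXt (l L Pr M R B b : ℝ) (Γ01 Γ02 : Set Pt) (u0 g : Pt → Pt)
    (φ1 φ2 : Pt → ℝ) (p : VH1 l L × H1 l L) : Prop :=
  p.1 ∈ Xt l L ∧ IsWeakSolution l L Pr M R B b Γ01 Γ02 u0 g φ1 φ2 p.1 p.2

/-- `Γ₀ = Γ₀¹ ∪ Γ₀²` with `Γ₀¹ ∩ Γ₀² = ∅`. -/
structure IsSplit (l L : ℝ) (Γ01 Γ02 : Set Pt) : Prop where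
  meas1 : MeasurableSet Γ01
  meas2 : MeasurableSet Γ02
  union : Γ01 ∪ Γ02 = Gamma0 l L
  disj : Disjoint Γ01 Γ02

/-- The admissible boundary data. -/
structure IsData (l L : ℝ) (Γ01 Γ02 : Set Pt) (u0 g : Pt → Pt) (φ1 φ2 : Pt → ℝ) : Prop where
  mem_phi1 : MemHalf l L (lateral l L) φ1
  mem_phi2 : MemHalf00 l L (bottom l L) φ2
  mem_u0 : MemHalfTilde l L Γ02 u0
  mem_g : MemHalfTilde l L Γ01 g

/-- The sum of the norms of `u⁰`, `g`, `φ₁`, `φ₂`. -/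
def dataNorm (l L : ℝ) (Γ01 Γ02 : Set Pt) (u0 g : Pt → Pt) (φ1 φ2 : Pt → ℝ) : ℝ :=
  vecHalf00Norm l L Γ02 u0 + vecHalf00Norm l L Γ01 g
    + halfNorm l L (lateral l L) φ1 + halfNorm l L (bottom l L) φ2

end

end RBM

open MeasureTheory Set
open scoped ContDiff ENNReal

namespace RBM

noncomputable section

variable {l L : ℝ}

/-! ### Geometry of the box and of its boundary -/

section Geometry

/-! The system is decoupled by freezing the convecting field. For a fixed admissible `u` the heat
equation is linear in the temperature, and once the temperature is known the momentum equation is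
linear in the new velocity. In both equations the convective term is skew-symmetric and drops out of
the energy identity, so Lax–Milgram applies however large `u` is (`FlowForms.exists_heat`,
`FlowForms.exists_mom`). The same energy identities bound the new velocity and its dependence on the
old one. With `t = (1 + M + B + R) D`, the smallness condition implies both `K t ≤ Pr` and `K (M +
R) t ≤ 1`. The map from old to new velocity is then a contraction with factor `1/2` on a ball of
radius proportional to `t`. This gives existence, uniqueness and the linear bound
(`FlowForms.existsUnique_solves`), for abstract forms whose bounds share a single constant `N`.

It remains to supply the analysis on the box. Cosine products are complete in `L²` by
Stone–Weierstrass and are Neumann eigenfunctions, which makes functions smooth up to the boundary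
dense in `H¹` (`dense_smoothH1`). The trace theorem, Green's formula (`green`) and the embedding
into `L⁴` (`eLpNorm_four_le`) are proved for smooth functions and extended by density. Green's
formula gives the skew-symmetry (`convective_skew`) as soon as `(u · n) η` vanishes on the boundary:
`u₃` vanishes on the top, `u · n` on the side walls, and the test function on the bottom. It also
gives the Poincaré inequality and hence coercivity (`poincare`).

The delicate point is to extend the velocity data by a divergence-free field whose norm is bounded
linearly by that of the data. An arbitrary `H¹` extension has a divergence of mean zero, by the flux
condition, so a bounded right inverse of the divergence from mean-zero `L²` functions into `H¹₀`
suffices (`exists_div_eq`). For this, `f` is squeezed into the middle third of the box and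
approximated there by `Δφ + k` with `φ` a Neumann potential, whose gradient is bounded in `H¹` by
`Δφ` in `L²`. At each corner, a weighted sum of reflected and rescaled copies of `∇φ` vanishes on
the three faces through that corner, while its divergence is a weighted sum of copies of `Δφ`; only
one copy sees the middle third, so this sum reproduces `f` (`fold_eq_zero`, `foldS_shrink`). A
partition of unity over the eight corners glues these fields into one that vanishes on the whole
boundary. The terms with derivatives of the partition lie in `H¹` and vanish on the boundary, and
are removed by iterated one-dimensional primitives (`exists_div_correction`). The outcome solves
`div z = f` up to half of `‖f‖`, and a geometric series makes it exact
(`exists_preimage_of_approx`).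

For the conduction state, the forcing terms in the momentum equation are orthogonal to the
divergence-free test fields, and the slope `k = θc B / (1 + B)` is exactly what the Robin condition
on the top requires. The convective form sees only the gradient of the state, which is of size `|θc|
B`; hence the energy estimates for a difference of solutions close for small `M`, `R`, `B`, although
`θc` itself may be large (`FlowForms.Solves.eq_of_small`). -/

theorem side_pos [hl : Fact (0 < l)] [hL : Fact (0 < L)] (i : Fin 3) : 0 < side l L i := by
  have := hl.out
  have := hL.out
  fin_cases i <;> simp [side, *]

theorem box_eq (l L : ℝ) : box l L = univ.pi fun i => Ioo 0 (side l L i) := by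
  ext x; simp [box]

theorem faceBox_eq (l L : ℝ) (i : Fin 3) :
    faceBox l L i = univ.pi fun j => Ioo 0 (side l L (i.succAbove j)) := by
  ext x; simp [faceBox]

theorem isOpen_box (l L : ℝ) : IsOpen (box l L) := by
  rw [box_eq]; exact isOpen_set_pi finite_univ fun i _ => isOpen_Ioo

theorem measurableSet_box (l L : ℝ) : MeasurableSet (box l L) := (isOpen_box l L).measurableSet

theorem isOpen_faceBox (l L : ℝ) (i : Fin 3) : IsOpen (faceBox l L i) := by
  rw [faceBox_eq]; exact isOpen_set_pi finite_univ fun i _ => isOpen_Ioo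

theorem measurableSet_faceBox (l L : ℝ) (i : Fin 3) : MeasurableSet (faceBox l L i) :=
  (isOpen_faceBox l L i).measurableSet

theorem box_subset_Icc (l L : ℝ) : box l L ⊆ Icc 0 (side l L) :=
  fun _ hx => ⟨fun i => (hx i).1.le, fun i => (hx i).2.le⟩

instance : IsFiniteMeasure (volume.restrict (box l L)) :=
  isFiniteMeasure_restrict.2 ((measure_mono (box_subset_Icc l L)).trans_lt
    isCompact_Icc.measure_lt_top).ne

instance (i : Fin 3) : IsFiniteMeasure (volume.restrict (faceBox l L i)) := by
  refine isFiniteMeasure_restrict.2 (lt_of_le_of_lt (measure_mono ?_)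
    (isCompact_Icc (a := (0 : Fin 2 → ℝ)) (b := fun j => side l L (i.succAbove j))).measure_lt_top).ne
  exact fun _ hx => ⟨fun i => (hx i).1.le, fun i => (hx i).2.le⟩

theorem facePt_same (i : Fin 3) (a : ℝ) (y : Fin 2 → ℝ) : facePt i a y i = a := by
  simp [facePt]

theorem facePt_succAbove (i : Fin 3) (a : ℝ) (y : Fin 2 → ℝ) (j : Fin 2) :
    facePt i a y (i.succAbove j) = y j := by
  simp [facePt]

theorem continuous_facePt (i : Fin 3) : Continuous fun p : ℝ × (Fin 2 → ℝ) => facePt i p.1 p.2 := by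
  refine continuous_pi fun k => ?_
  rcases Fin.eq_self_or_eq_succAbove i k with rfl | ⟨j, rfl⟩
  · simp only [facePt_same]; exact continuous_fst
  · simp only [facePt_succAbove]; fun_prop

theorem continuous_facePt_right (i : Fin 3) (a : ℝ) : Continuous (facePt i a) :=
  (continuous_facePt i).comp (Continuous.prodMk_right a)

theorem measurableEmbedding_facePt (i : Fin 3) (a : ℝ) : MeasurableEmbedding (facePt i a) := by
  have hinv : Function.LeftInverse (fun x : Pt => fun j => x (i.succAbove j)) (facePt i a) := by
    intro y; funext j; exact facePt_succAbove i a y j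
  refine (continuous_facePt_right i a).measurableEmbedding hinv.injective

theorem facePt_eq_update (i : Fin 3) (t a : ℝ) (y : Fin 2 → ℝ) :
    facePt i t y = Function.update (facePt i a y) i t := by
  funext k
  rcases Fin.eq_self_or_eq_succAbove i k with rfl | ⟨j, rfl⟩
  · simp [facePt_same]
  · rw [Function.update_of_ne (Fin.succAbove_ne i j)]; simp [facePt_succAbove]

/-- Fubini along the `i`-th axis: Lebesgue measure on the box is the product of the measures on an
edge and on the orthogonal cross-section. -/
theorem measurePreserving_facePt (l L : ℝ) (i : Fin 3) :
    MeasurePreserving (fun p : ℝ × (Fin 2 → ℝ) => facePt i p.1 p.2)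
      ((volume.restrict (Ioo 0 (side l L i))).prod (volume.restrict (faceBox l L i)))
      (volume.restrict (box l L)) := by
  have h := (measurePreserving_piFinSuccAbove
    (fun k : Fin 3 => (volume : Measure ℝ).restrict (Ioo 0 (side l L k))) i).symm
  rw [faceBox_eq, box_eq]
  simp only [volume_pi, Measure.restrict_pi_pi]
  exact h

theorem measurePreserving_facePt_swap (l L : ℝ) (i : Fin 3) :
    MeasurePreserving (fun p : (Fin 2 → ℝ) × ℝ => facePt i p.2 p.1)
      ((volume.restrict (faceBox l L i)).prod (volume.restrict (Ioo 0 (side l L i))))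
      (volume.restrict (box l L)) :=
  (measurePreserving_facePt l L i).comp Measure.measurePreserving_swap

theorem measurableEmbedding_facePt_swap (i : Fin 3) :
    MeasurableEmbedding (fun p : (Fin 2 → ℝ) × ℝ => facePt i p.2 p.1) := by
  have hc : Continuous fun p : (Fin 2 → ℝ) × ℝ => facePt i p.2 p.1 :=
    (continuous_facePt i).comp continuous_swap
  refine hc.measurableEmbedding (Function.LeftInverse.injective
    (g := fun x : Pt => (fun j => x (i.succAbove j), x i)) ?_)
  rintro ⟨y, t⟩
  ext
  · simp [facePt_succAbove]
  · simp [facePt_same]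

theorem integral_box_eq (i : Fin 3) {f : Pt → ℝ} (hf : Integrable f (volume.restrict (box l L))) :
    ∫ x in box l L, f x =
      ∫ y in faceBox l L i, ∫ t in Ioo 0 (side l L i), f (facePt i t y) := by
  have hm := measurePreserving_facePt_swap l L i
  rw [← hm.integral_comp (measurableEmbedding_facePt_swap i), integral_prod]
  exact (hm.integrable_comp hf.aestronglyMeasurable).2 hf

theorem facePt_mem_Icc [Fact (0 < l)] [Fact (0 < L)] {i : Fin 3} {y : Fin 2 → ℝ}
    (hy : y ∈ faceBox l L i) {a : ℝ} (ha : a ∈ Icc 0 (side l L i)) :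
    facePt i a y ∈ Icc 0 (side l L) := by
  constructor <;> intro k <;> rcases Fin.eq_self_or_eq_succAbove i k with rfl | ⟨j, rfl⟩
  · simpa [facePt_same] using ha.1
  · simpa [facePt_succAbove] using (hy j).1.le
  · simpa [facePt_same] using ha.2
  · simpa [facePt_succAbove] using (hy j).2.le

theorem ae_surf_iff {P : Pt → Prop} :
    (∀ᵐ x ∂(surf l L), P x) ↔ ∀ i, (∀ᵐ y ∂(volume.restrict (faceBox l L i)), P (facePt i 0 y)) ∧
      ∀ᵐ y ∂(volume.restrict (faceBox l L i)), P (facePt i (side l L i) y) := by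
  have h0 : ∀ i a, (∀ᵐ x ∂((volume.restrict (faceBox l L i)).map (facePt i a)), P x) ↔
      ∀ᵐ y ∂(volume.restrict (faceBox l L i)), P (facePt i a y) := fun i a =>
    (measurableEmbedding_facePt i a).ae_map_iff
  simp only [surf, Fin.sum_univ_three, ae_add_measure_iff, h0, Fin.forall_fin_succ,
    Fin.forall_fin_zero]
  simp [and_assoc]

/-- To check a property almost everywhere on the boundary it suffices to check it on the six open
faces. -/
theorem ae_surf_of_forall {P : Pt → Prop}
    (h : ∀ i, ∀ y ∈ faceBox l L i, P (facePt i 0 y) ∧ P (facePt i (side l L i) y)) :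
    ∀ᵐ x ∂(surf l L), P x := by
  rw [ae_surf_iff]
  intro i
  constructor
  · exact (ae_restrict_mem (measurableSet_faceBox l L i)).mono fun y hy => (h i y hy).1
  · exact (ae_restrict_mem (measurableSet_faceBox l L i)).mono fun y hy => (h i y hy).2

theorem ae_surf_mem_Icc [Fact (0 < l)] [Fact (0 < L)] :
    ∀ᵐ x ∂(surf l L), x ∈ Icc 0 (side l L) :=
  ae_surf_of_forall fun i _ hy => ⟨facePt_mem_Icc hy ⟨le_rfl, (side_pos i).le⟩,
    facePt_mem_Icc hy ⟨(side_pos i).le, le_rfl⟩⟩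

instance : IsFiniteMeasure (surf l L) := by
  unfold surf
  infer_instance

theorem closure_box [Fact (0 < l)] [Fact (0 < L)] : closure (box l L) = Icc 0 (side l L) := by
  rw [box_eq, closure_pi_set, ← pi_univ_Icc]
  congr 1; funext i
  exact closure_Ioo (side_pos i).ne

theorem frontier_box [Fact (0 < l)] [Fact (0 < L)] :
    frontier (box l L) = Icc 0 (side l L) \ box l L := by
  rw [frontier, closure_box, (isOpen_box l L).interior_eq]

theorem ae_surf_mem_frontier [Fact (0 < l)] [Fact (0 < L)] :
    ∀ᵐ x ∂(surf l L), x ∈ frontier (box l L) := by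
  rw [frontier_box]
  refine ae_surf_of_forall fun i y hy => ⟨⟨facePt_mem_Icc hy ⟨le_rfl, (side_pos i).le⟩, ?_⟩,
    ⟨facePt_mem_Icc hy ⟨(side_pos i).le, le_rfl⟩, ?_⟩⟩
  · intro h; simpa [facePt_same] using (h i).1
  · intro h; simpa [facePt_same] using (h i).2

theorem memLp_box_of_continuous {φ : Pt → ℝ} (h : Continuous φ) (p : ℝ≥0∞) :
    MemLp φ p (volume.restrict (box l L)) := by
  obtain ⟨C, hC⟩ := (isCompact_Icc (a := (0 : Pt)) (b := side l L)).exists_bound_of_continuousOn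
    h.continuousOn
  exact MemLp.of_bound h.aestronglyMeasurable C
    ((ae_restrict_mem (measurableSet_box l L)).mono fun x hx => hC x (box_subset_Icc l L hx))

theorem memLp_surf_of_continuous [Fact (0 < l)] [Fact (0 < L)] {φ : Pt → ℝ} (h : Continuous φ)
    (p : ℝ≥0∞) : MemLp φ p (surf l L) := by
  obtain ⟨C, hC⟩ := (isCompact_Icc (a := (0 : Pt)) (b := side l L)).exists_bound_of_continuousOn
    h.continuousOn
  exact MemLp.of_bound h.aestronglyMeasurable C (ae_surf_mem_Icc.mono fun x hx => hC x hx)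

theorem integrable_box_of_continuous {φ : Pt → ℝ} (h : Continuous φ) :
    Integrable φ (volume.restrict (box l L)) :=
  memLp_one_iff_integrable.1 (memLp_box_of_continuous h 1)

theorem integrable_map_facePt {f : Pt → ℝ} (hf : Integrable f (surf l L)) (i : Fin 3) :
    Integrable f ((volume.restrict (faceBox l L i)).map (facePt i 0)) ∧
      Integrable f ((volume.restrict (faceBox l L i)).map (facePt i (side l L i))) := by
  have h := (integrable_finsetSum_measure.1 hf) i (Finset.mem_univ i)
  exact integrable_add_measure.1 h

theorem integral_surf {f : Pt → ℝ} (hf : Integrable f (surf l L)) :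
    ∫ x, f x ∂(surf l L) = ∑ i, ((∫ y in faceBox l L i, f (facePt i 0 y)) +
      ∫ y in faceBox l L i, f (facePt i (side l L i) y)) := by
  rw [surf, integral_finsetSum_measure (fun i hi => (integrable_finsetSum_measure.1 hf) i hi)]
  refine Finset.sum_congr rfl fun i _ => ?_
  obtain ⟨h1, h2⟩ := integrable_map_facePt hf i
  rw [integral_add_measure h1 h2, (measurableEmbedding_facePt i 0).integral_map,
    (measurableEmbedding_facePt i _).integral_map]

theorem normal_facePt [Fact (0 < l)] [Fact (0 < L)] {i : Fin 3} {y : Fin 2 → ℝ}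
    (hy : y ∈ faceBox l L i) (k : Fin 3) :
    normal l L (facePt i 0 y) k = (if k = i then -1 else 0) ∧
      normal l L (facePt i (side l L i) y) k = if k = i then 1 else 0 := by
  rcases Fin.eq_self_or_eq_succAbove i k with rfl | ⟨j, rfl⟩
  · simp [normal, facePt_same, (side_pos (l := l) (L := L) k).ne']
  · simp [normal, facePt_succAbove, (hy j).1.ne', (hy j).2.ne]

theorem measurable_normal (k : Fin 3) : Measurable fun x => normal l L x k := by
  unfold normal
  refine Measurable.ite ?_ measurable_const (Measurable.ite ?_ measurable_const measurable_const)
  · exact measurableSet_eq_fun (measurable_pi_apply k) measurable_const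
  · exact measurableSet_eq_fun (measurable_pi_apply k) measurable_const

theorem abs_normal_le (x : Pt) (k : Fin 3) : |normal l L x k| ≤ 1 := by
  unfold normal; split_ifs <;> simp

theorem integrable_normal_mul {f : Pt → ℝ} (hf : Integrable f (surf l L)) (k : Fin 3) :
    Integrable (fun x => normal l L x k * f x) (surf l L) :=
  hf.bdd_mul (c := 1) (measurable_normal k).aestronglyMeasurable
    (Filter.Eventually.of_forall fun x => abs_normal_le x k)

/-- The `i`-th component of the normal is zero on the four faces parallel to `eᵢ`, so only the two
faces orthogonal to `eᵢ` contribute, with opposite signs. This is the boundary term of the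
fundamental theorem of calculus along lines parallel to `eᵢ`. -/
theorem integral_normal_mul [Fact (0 < l)] [Fact (0 < L)] {f : Pt → ℝ}
    (hf : Integrable f (surf l L)) (i : Fin 3) :
    ∫ x, normal l L x i * f x ∂(surf l L) =
      (∫ y in faceBox l L i, f (facePt i (side l L i) y)) -
        ∫ y in faceBox l L i, f (facePt i 0 y) := by
  rw [integral_surf (integrable_normal_mul hf i), Finset.sum_eq_single i]
  · have h1 : ∫ y in faceBox l L i, normal l L (facePt i 0 y) i * f (facePt i 0 y) =
        ∫ y in faceBox l L i, - f (facePt i 0 y) :=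
      setIntegral_congr_fun (measurableSet_faceBox l L i)
        (fun y hy => by simp [(normal_facePt hy i).1])
    have h2 : ∫ y in faceBox l L i,
        normal l L (facePt i (side l L i) y) i * f (facePt i (side l L i) y) =
        ∫ y in faceBox l L i, f (facePt i (side l L i) y) :=
      setIntegral_congr_fun (measurableSet_faceBox l L i)
        (fun y hy => by simp [(normal_facePt hy i).2])
    rw [h1, h2, integral_neg]
    ring
  · intro b _ hb
    rw [setIntegral_eq_zero_of_forall_eq_zero (fun y hy => by simp [(normal_facePt hy i).1, hb.symm]),
      setIntegral_eq_zero_of_forall_eq_zero (fun y hy => by simp [(normal_facePt hy i).2, hb.symm]),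
      add_zero]
  · simp

end Geometry

/-! ### Partial derivatives and the divergence theorem for smooth functions -/

section Pd

theorem hasDerivAt_comp_update {φ : Pt → ℝ} {x : Pt} {i : Fin 3} {t : ℝ}
    (h : DifferentiableAt ℝ φ (Function.update x i t)) :
    HasDerivAt (fun t => φ (Function.update x i t)) (pd i φ (Function.update x i t)) t := by
  have h1 := hasDerivAt_update x i t
  exact h.hasFDerivAt.comp_hasDerivAt t h1

theorem pd_eq_of_hasDerivAt {φ : Pt → ℝ} {x : Pt} {i : Fin 3} {c : ℝ}
    (h : DifferentiableAt ℝ φ x)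
    (hd : HasDerivAt (fun t => φ (Function.update x i t)) c (x i)) : pd i φ x = c := by
  have h1 := hasDerivAt_comp_update (φ := φ) (x := x) (i := i) (t := x i) (by simpa using h)
  rw [Function.update_eq_self] at h1
  exact h1.unique hd

theorem contDiff_pd {φ : Pt → ℝ} (h : ContDiff ℝ ∞ φ) (i : Fin 3) : ContDiff ℝ ∞ (pd i φ) :=
  (h.fderiv_right (m := ∞) (by simp)).clm_apply contDiff_const

theorem continuous_pd {φ : Pt → ℝ} (h : ContDiff ℝ ∞ φ) (i : Fin 3) : Continuous (pd i φ) :=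
  (contDiff_pd h i).continuous

theorem differentiable_of_smooth {φ : Pt → ℝ} (h : ContDiff ℝ ∞ φ) : Differentiable ℝ φ :=
  h.differentiable (by simp)

theorem pd_add {φ ψ : Pt → ℝ} {x : Pt} (i : Fin 3) (hφ : DifferentiableAt ℝ φ x)
    (hψ : DifferentiableAt ℝ ψ x) : pd i (fun x => φ x + ψ x) x = pd i φ x + pd i ψ x := by
  unfold pd; rw [fderiv_fun_add hφ hψ]; rfl

theorem pd_sub {φ ψ : Pt → ℝ} {x : Pt} (i : Fin 3) (hφ : DifferentiableAt ℝ φ x)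
    (hψ : DifferentiableAt ℝ ψ x) : pd i (fun x => φ x - ψ x) x = pd i φ x - pd i ψ x := by
  unfold pd; rw [fderiv_fun_sub hφ hψ]; rfl

theorem pd_mul {φ ψ : Pt → ℝ} {x : Pt} (i : Fin 3) (hφ : DifferentiableAt ℝ φ x)
    (hψ : DifferentiableAt ℝ ψ x) :
    pd i (fun x => φ x * ψ x) x = pd i φ x * ψ x + φ x * pd i ψ x := by
  unfold pd; rw [fderiv_fun_mul hφ hψ]; simp; ring

theorem pd_const_mul {φ : Pt → ℝ} {x : Pt} (i : Fin 3) (c : ℝ) (hφ : DifferentiableAt ℝ φ x) :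
    pd i (fun x => c * φ x) x = c * pd i φ x := by
  unfold pd; rw [fderiv_const_mul hφ]; rfl

theorem pd_const (i : Fin 3) (c : ℝ) (x : Pt) : pd i (fun _ => c) x = 0 := by
  simp [pd]

theorem pd_sum {ι : Type*} (s : Finset ι) {φ : ι → Pt → ℝ} {x : Pt} (i : Fin 3)
    (h : ∀ k ∈ s, DifferentiableAt ℝ (φ k) x) :
    pd i (fun x => ∑ k ∈ s, φ k x) x = ∑ k ∈ s, pd i (φ k) x := by
  unfold pd; rw [fderiv_fun_sum h]; simp

/-- The partial derivative of a function of a single coordinate. -/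
theorem pd_comp_coord {a : ℝ → ℝ} {a' : ℝ} {x : Pt} (i k : Fin 3) (h : HasDerivAt a a' (x k)) :
    pd i (fun x : Pt => a (x k)) x = if i = k then a' else 0 := by
  have h2 : HasFDerivAt (fun x : Pt => a (x k)) (a' • (ContinuousLinearMap.proj k : Pt →L[ℝ] ℝ)) x :=
    h.comp_hasFDerivAt x (ContinuousLinearMap.proj k : Pt →L[ℝ] ℝ).hasFDerivAt
  unfold pd
  rw [h2.fderiv]
  by_cases hik : i = k
  · subst hik; simp
  · simp [hik, Ne.symm hik]

theorem pd_comm {φ : Pt → ℝ} (h : ContDiff ℝ ∞ φ) (i j : Fin 3) (x : Pt) :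
    pd i (pd j φ) x = pd j (pd i φ) x := by
  have hd : DifferentiableAt ℝ (fderiv ℝ φ) x :=
    ((h.fderiv_right (m := ∞) (by simp)).differentiable (by simp)) x
  have key : ∀ i j, pd i (pd j φ) x = fderiv ℝ (fderiv ℝ φ) x (Pi.single i 1) (Pi.single j 1) := by
    intro i j
    unfold pd
    rw [fderiv_clm_apply hd (differentiableAt_const _)]
    simp
  rw [key, key]
  exact (h.contDiffAt.isSymmSndFDerivAt (by simpa using ENat.LEInfty.out)) _ _

/-- The divergence theorem in a coordinate direction. -/
theorem integral_pd [Fact (0 < l)] [Fact (0 < L)] {φ : Pt → ℝ} (h : ContDiff ℝ ∞ φ) (i : Fin 3) :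
    ∫ x in box l L, pd i φ x = ∫ x, normal l L x i * φ x ∂(surf l L) := by
  have hs := (side_pos (l := l) (L := L) i)
  have hcont := continuous_pd h i
  have hint := memLp_one_iff_integrable.1 (memLp_surf_of_continuous (l := l) (L := L) h.continuous 1)
  rw [integral_box_eq i (integrable_box_of_continuous hcont), integral_normal_mul hint, ← integral_sub]
  · refine setIntegral_congr_fun (measurableSet_faceBox l L i) fun y hy => ?_
    rw [← integral_Ioc_eq_integral_Ioo, ← intervalIntegral.integral_of_le hs.le]
    refine intervalIntegral.integral_eq_sub_of_hasDerivAt (f := fun t => φ (facePt i t y))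
      (fun t _ => ?_) ?_
    · rw [facePt_eq_update i t 0 y, show (fun t => φ (facePt i t y)) =
        fun t => φ (Function.update (facePt i 0 y) i t) from
        funext fun t => by rw [facePt_eq_update i t 0 y]]
      exact hasDerivAt_comp_update (differentiable_of_smooth h _)
    · apply Continuous.intervalIntegrable
      exact hcont.comp ((continuous_facePt i).comp (Continuous.prodMk_left y))
  · exact ((measurableEmbedding_facePt i _).integrable_map_iff).1 (integrable_map_facePt hint i).2
  · exact ((measurableEmbedding_facePt i _).integrable_map_iff).1 (integrable_map_facePt hint i).1

end Pd

/-! ### Square integrable functions -/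

section L2

variable {α : Type*} [MeasurableSpace α] {ν : Measure α}

theorem inner_Lp_eq (f g : Lp ℝ 2 ν) : inner ℝ f g = ∫ x, f x * g x ∂ν := by
  rw [L2.inner_def]
  refine integral_congr_ae (Filter.Eventually.of_forall fun x => ?_)
  simp [mul_comm]

theorem integrable_mul_Lp (f g : Lp ℝ 2 ν) : Integrable (fun x => f x * g x) ν :=
  (Lp.memLp f).integrable_mul (Lp.memLp g)

theorem inner_Lp_congr {f g : Lp ℝ 2 ν} {φ ψ : α → ℝ} (hf : f =ᵐ[ν] φ) (hg : g =ᵐ[ν] ψ) :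
    inner ℝ f g = ∫ x, φ x * ψ x ∂ν := by
  rw [inner_Lp_eq]
  refine integral_congr_ae ?_
  filter_upwards [hf, hg] with x h1 h2
  rw [h1, h2]

theorem norm_sq_Lp_congr {f : Lp ℝ 2 ν} {φ : α → ℝ} (hf : f =ᵐ[ν] φ) :
    ‖f‖ ^ 2 = ∫ x, φ x ^ 2 ∂ν := by
  rw [← real_inner_self_eq_norm_sq, inner_Lp_congr hf hf]
  simp [sq]

/-- Multiplication by an essentially bounded function, as a bounded operator on `L²`. -/
theorem exists_mulCLM {m : α → ℝ} {C : ℝ} (hm : AEStronglyMeasurable m ν)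
    (hC : ∀ᵐ x ∂ν, |m x| ≤ C) :
    ∃ T : Lp ℝ 2 ν →L[ℝ] Lp ℝ 2 ν, (∀ f, T f =ᵐ[ν] fun x => m x * f x) ∧
      ∀ f, ‖T f‖ ≤ C * ‖f‖ := by
  have hmem : ∀ f : Lp ℝ 2 ν, MemLp (fun x => m x * f x) 2 ν := fun f => by
    have := (Lp.memLp f).mul (p := ∞) (q := 2) (r := 2) (memLp_top_of_bound hm C hC)
    exact this
  have hb : ∀ f : Lp ℝ 2 ν, ‖(hmem f).toLp‖ ≤ C * ‖f‖ := fun f => by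
    refine Lp.norm_le_mul_norm_of_ae_le_mul ?_
    filter_upwards [(hmem f).coeFn_toLp, hC] with x hx h1
    rw [hx, norm_mul]
    exact mul_le_mul_of_nonneg_right h1 (norm_nonneg _)
  refine ⟨LinearMap.mkContinuous
    { toFun := fun f => (hmem f).toLp
      map_add' := fun f g => ?_
      map_smul' := fun c f => ?_ } C hb, fun f => (hmem f).coeFn_toLp, hb⟩
  · refine Lp.ext ?_
    filter_upwards [(hmem (f + g)).coeFn_toLp, (hmem f).coeFn_toLp, (hmem g).coeFn_toLp,
      Lp.coeFn_add (hmem f).toLp (hmem g).toLp, Lp.coeFn_add f g] with x h1 h2 h3 h4 h5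
    rw [h1, h4, Pi.add_apply, h2, h3, h5, Pi.add_apply, mul_add]
  · refine Lp.ext ?_
    filter_upwards [(hmem (c • f)).coeFn_toLp, (hmem f).coeFn_toLp,
      Lp.coeFn_smul c (hmem f).toLp, Lp.coeFn_smul c f] with x h1 h2 h4 h5
    rw [h1, RingHom.id_apply, h4, Pi.smul_apply, h2, h5, Pi.smul_apply, smul_eq_mul, smul_eq_mul]
    ring

end L2

/-! ### The Hilbert space structure of `H¹(Ω)` -/

section Hilbert

/-- The function underlying an element of `H¹(Ω)`, as a bounded operator. -/
def fnL (l L : ℝ) : H1 l L →L[ℝ] L2 l L :=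
  (WithLp.fstL 2 ℝ (L2 l L) (PiLp 2 (fun _ : Fin 3 => L2 l L))).comp (H1 l L).subtypeL

/-- Weak differentiation, as a bounded operator from `H¹(Ω)` to `L²(Ω)`. -/
def DL (l L : ℝ) (i : Fin 3) : H1 l L →L[ℝ] L2 l L :=
  ((PiLp.proj 2 (fun _ : Fin 3 => L2 l L) i).comp
    (WithLp.sndL 2 ℝ (L2 l L) (PiLp 2 (fun _ : Fin 3 => L2 l L)))).comp (H1 l L).subtypeL

@[simp] theorem fnL_apply (u : H1 l L) : fnL l L u = fn u := rfl

@[simp] theorem DL_apply (i : Fin 3) (u : H1 l L) : DL l L i u = D i u := rfl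

theorem fn_add (u v : H1 l L) : fn (u + v) = fn u + fn v := (fnL l L).map_add u v

theorem fn_sub (u v : H1 l L) : fn (u - v) = fn u - fn v := (fnL l L).map_sub u v

theorem fn_smul (c : ℝ) (u : H1 l L) : fn (c • u) = c • fn u := (fnL l L).map_smul c u

theorem D_sub (i : Fin 3) (u v : H1 l L) : D i (u - v) = D i u - D i v := (DL l L i).map_sub u v

theorem isWeakDeriv_D (u : H1 l L) (i : Fin 3) : IsWeakDeriv l L i (fn u) (D i u) := u.2 i

theorem inner_H1 (u v : H1 l L) :
    inner ℝ u v = inner ℝ (fn u) (fn v) + ∑ i, inner ℝ (D i u) (D i v) := by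
  rw [Submodule.coe_inner, WithLp.prod_inner_apply, PiLp.inner_apply]
  rfl

theorem norm_sq_H1 (u : H1 l L) : ‖u‖ ^ 2 = ‖fn u‖ ^ 2 + ∑ i, ‖D i u‖ ^ 2 := by
  simp only [← real_inner_self_eq_norm_sq]
  exact inner_H1 u u

theorem norm_fn_le (u : H1 l L) : ‖fn u‖ ≤ ‖u‖ := by
  refine abs_le_of_sq_le_sq' ?_ (norm_nonneg u) |>.2
  rw [norm_sq_H1]
  have : 0 ≤ ∑ i, ‖D i u‖ ^ 2 := Finset.sum_nonneg fun i _ => sq_nonneg _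
  linarith

theorem norm_D_le (i : Fin 3) (u : H1 l L) : ‖D i u‖ ≤ ‖u‖ := by
  refine abs_le_of_sq_le_sq' ?_ (norm_nonneg u) |>.2
  rw [norm_sq_H1]
  have := Finset.single_le_sum (f := fun i => ‖D i u‖ ^ 2) (fun i _ => sq_nonneg _)
    (Finset.mem_univ i)
  have h2 := sq_nonneg ‖fn u‖
  linarith

/-- In terms of `L²` inner products the condition is visibly closed in the pair `(f, g)`;
completeness of `H¹` rests on this. -/
theorem isWeakDeriv_iff {i : Fin 3} {f g : L2 l L} : IsWeakDeriv l L i f g ↔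
    ∀ φ : Pt → ℝ, ∀ h : IsTest l L φ,
      inner ℝ f (h.memLp_pd i).toLp = - inner ℝ g h.memLp.toLp := by
  refine forall_congr' fun φ => forall_congr' fun h => ?_
  rw [inner_Lp_congr (Filter.EventuallyEq.refl _ _) (h.memLp_pd i).coeFn_toLp,
    inner_Lp_congr (Filter.EventuallyEq.refl _ _) h.memLp.coeFn_toLp]

theorem isClosed_H1 : IsClosed (H1 l L : Set (WithLp 2 (L2 l L × PiLp 2 (fun _ : Fin 3 => L2 l L)))) := by
  have : (H1 l L : Set (WithLp 2 (L2 l L × PiLp 2 (fun _ : Fin 3 => L2 l L)))) =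
      ⋂ i, ⋂ φ, ⋂ h : IsTest l L φ, {p | inner ℝ p.fst (h.memLp_pd i).toLp =
        - inner ℝ (p.snd i) h.memLp.toLp} := by
    ext p
    simp only [mem_iInter, mem_ofPred_eq]
    exact forall_congr' fun i => isWeakDeriv_iff
  rw [this]
  refine isClosed_iInter fun i => isClosed_iInter fun φ => isClosed_iInter fun h => ?_
  have h1 : Continuous fun p : WithLp 2 (L2 l L × PiLp 2 (fun _ : Fin 3 => L2 l L)) => p.fst :=
    (WithLp.fstL 2 ℝ (L2 l L) (PiLp 2 (fun _ : Fin 3 => L2 l L))).continuous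
  have h2 : Continuous fun p : WithLp 2 (L2 l L × PiLp 2 (fun _ : Fin 3 => L2 l L)) => p.snd i :=
    ((PiLp.proj (𝕜 := ℝ) 2 (fun _ : Fin 3 => L2 l L) i).comp
      (WithLp.sndL 2 ℝ (L2 l L) (PiLp 2 (fun _ : Fin 3 => L2 l L)))).continuous
  exact isClosed_eq (h1.inner continuous_const) (h2.inner continuous_const).neg

instance : CompleteSpace (H1 l L) := isClosed_H1.completeSpace_coe

/-- Functions orthogonal to all test functions vanish. -/
theorem eq_zero_of_integral_test {g : L2 l L}
    (h : ∀ φ, IsTest l L φ → ∫ x in box l L, g x * φ x = 0) : g = 0 := by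
  have hloc : LocallyIntegrableOn g (box l L) :=
    IntegrableOn.locallyIntegrableOn ((Lp.memLp g).integrable (by norm_num))
  have := (isOpen_box l L).ae_eq_zero_of_integral_contDiff_smul_eq_zero hloc
    fun φ h1 h2 h3 => by
      have h4 := h φ ⟨h1, h2, h3⟩
      rw [setIntegral_eq_integral_of_forall_compl_eq_zero] at h4
      · simpa [mul_comm] using h4
      · intro x hx
        rw [image_eq_zero_of_notMem_tsupport fun hx' => hx (h3 hx'), mul_zero]
  rw [Lp.eq_zero_iff_ae_eq_zero]
  exact (ae_restrict_iff' (measurableSet_box l L)).2 this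

theorem IsWeakDeriv.unique {i : Fin 3} {f g g' : L2 l L} (h : IsWeakDeriv l L i f g)
    (h' : IsWeakDeriv l L i f g') : g = g' := by
  rw [← sub_eq_zero]
  refine eq_zero_of_integral_test fun φ hφ => ?_
  have h1 := h φ hφ
  have h2 := h' φ hφ
  have h3 := integral_add_mul g (-g') hφ.memLp
  have h4 := integral_smul_mul (-1) g' φ
  rw [neg_one_smul] at h4
  rw [sub_eq_add_neg, h3, h4]
  linarith

/-- Weak derivatives are unique, so the gradient stored in an element of `H¹` carries no information
beyond the function. -/
theorem H1_ext {u v : H1 l L} (h : fn u = fn v) : u = v := by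
  have hD : ∀ i, D i u = D i v := fun i => by
    have h2 := isWeakDeriv_D v i
    rw [← h] at h2
    exact (isWeakDeriv_D u i).unique h2
  have : ‖u - v‖ ^ 2 = 0 := by
    rw [norm_sq_H1, fn_sub, h, sub_self]
    simp [D_sub, hD]
  exact sub_eq_zero.1 (norm_eq_zero.1 (pow_eq_zero_iff (two_ne_zero) |>.1 this))

/-- An element of `H¹(Ω)` from a function and its weak derivatives. -/
def mkH1 (f : L2 l L) (g : Fin 3 → L2 l L) (h : ∀ i, IsWeakDeriv l L i f (g i)) : H1 l L :=
  ⟨WithLp.toLp 2 (f, WithLp.toLp 2 g), h⟩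

@[simp] theorem fn_mkH1 (f : L2 l L) (g : Fin 3 → L2 l L) (h) : fn (mkH1 f g h) = f := rfl

@[simp] theorem D_mkH1 (f : L2 l L) (g : Fin 3 → L2 l L) (h) (i : Fin 3) :
    D i (mkH1 f g h) = g i := rfl

end Hilbert

/-! ### Smooth functions as elements of `H¹(Ω)` -/

section Smooth

theorem IsTest.eq_zero {φ : Pt → ℝ} (h : IsTest l L φ) {x : Pt} (hx : x ∉ box l L) : φ x = 0 :=
  image_eq_zero_of_notMem_tsupport fun h' => hx (h.supp h')

variable [Fact (0 < l)] [Fact (0 < L)]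

/-- Integration by parts against a function vanishing on the two faces orthogonal to `eᵢ`. -/
theorem integral_mul_pd {φ ψ : Pt → ℝ} (hφ : ContDiff ℝ ∞ φ) (hψ : ContDiff ℝ ∞ ψ) (i : Fin 3)
    (h0 : ∀ x : Pt, x i = 0 → φ x * ψ x = 0) (h1 : ∀ x : Pt, x i = side l L i → φ x * ψ x = 0) :
    ∫ x in box l L, φ x * pd i ψ x = - ∫ x in box l L, pd i φ x * ψ x := by
  have h := integral_pd (l := l) (L := L) (hφ.mul hψ) i
  have hz : ∫ x, normal l L x i * (φ x * ψ x) ∂(surf l L) = 0 := by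
    refine integral_eq_zero_of_ae (Filter.Eventually.of_forall fun x => ?_)
    simp only [normal, Pi.zero_apply]
    split_ifs with h2 h3
    · rw [h0 x h2, mul_zero]
    · rw [h1 x h3, mul_zero]
    · rw [zero_mul]
  rw [hz] at h
  have he : ∀ x, pd i (fun x => φ x * ψ x) x = pd i φ x * ψ x + φ x * pd i ψ x := fun x =>
    pd_mul i (differentiable_of_smooth hφ x) (differentiable_of_smooth hψ x)
  simp only [he] at h
  rw [integral_add] at h
  · linarith
  · exact integrable_box_of_continuous ((continuous_pd hφ i).mul hψ.continuous)
  · exact integrable_box_of_continuous (hφ.continuous.mul (continuous_pd hψ i))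

/-- The restriction to `Ω` of a smooth function, as an element of `H¹(Ω)`. -/
def ofSmooth (φ : Pt → ℝ) (h : ContDiff ℝ ∞ φ) : H1 l L :=
  mkH1 (memLp_box_of_continuous h.continuous 2).toLp
    (fun i => (memLp_box_of_continuous (continuous_pd h i) 2).toLp) fun i τ hτ => by
      have h1 : ∫ x in box l L, ((memLp_box_of_continuous h.continuous 2).toLp : L2 l L) x * pd i τ x
          = ∫ x in box l L, φ x * pd i τ x := by
        refine integral_congr_ae ?_
        filter_upwards [(memLp_box_of_continuous (l := l) (L := L) h.continuous 2).coeFn_toLp] with x hx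
        rw [hx]
      have h2 : ∫ x in box l L,
          ((memLp_box_of_continuous (continuous_pd h i) 2).toLp : L2 l L) x * τ x
          = ∫ x in box l L, pd i φ x * τ x := by
        refine integral_congr_ae ?_
        filter_upwards [(memLp_box_of_continuous (l := l) (L := L) (continuous_pd h i) 2).coeFn_toLp]
          with x hx
        rw [hx]
      rw [h1, h2]
      refine integral_mul_pd h hτ.smooth i (fun x hx => ?_) fun x hx => ?_
      · rw [hτ.eq_zero fun h' => (h' i).1.ne' hx, mul_zero]
      · rw [hτ.eq_zero fun h' => (h' i).2.ne hx, mul_zero]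

theorem fn_ofSmooth {φ : Pt → ℝ} (h : ContDiff ℝ ∞ φ) :
    fn (ofSmooth (l := l) (L := L) φ h) =ᵐ[volume.restrict (box l L)] φ :=
  (memLp_box_of_continuous h.continuous 2).coeFn_toLp

theorem D_ofSmooth {φ : Pt → ℝ} (h : ContDiff ℝ ∞ φ) (i : Fin 3) :
    D i (ofSmooth (l := l) (L := L) φ h) =ᵐ[volume.restrict (box l L)] pd i φ :=
  (memLp_box_of_continuous (continuous_pd h i) 2).coeFn_toLp

theorem eq_ofSmooth {u : H1 l L} {φ : Pt → ℝ} (h : ContDiff ℝ ∞ φ)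
    (hu : fn u =ᵐ[volume.restrict (box l L)] φ) : u = ofSmooth φ h :=
  H1_ext (Lp.ext (hu.trans (fn_ofSmooth h).symm))

theorem ofSmooth_add {φ ψ : Pt → ℝ} (hφ : ContDiff ℝ ∞ φ) (hψ : ContDiff ℝ ∞ ψ) :
    ofSmooth (l := l) (L := L) φ hφ + ofSmooth ψ hψ = ofSmooth (fun x => φ x + ψ x) (hφ.add hψ) := by
  refine eq_ofSmooth _ ?_
  rw [fn_add]
  filter_upwards [Lp.coeFn_add (fn (ofSmooth (l := l) (L := L) φ hφ)) (fn (ofSmooth ψ hψ)),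
    fn_ofSmooth (l := l) (L := L) hφ, fn_ofSmooth (l := l) (L := L) hψ] with x h1 h2 h3
  rw [h1, Pi.add_apply, h2, h3]

theorem ofSmooth_smul {φ : Pt → ℝ} (hφ : ContDiff ℝ ∞ φ) (c : ℝ) :
    c • ofSmooth (l := l) (L := L) φ hφ = ofSmooth (fun x => c * φ x) (contDiff_const.mul hφ) := by
  refine eq_ofSmooth _ ?_
  rw [fn_smul]
  filter_upwards [Lp.coeFn_smul c (fn (ofSmooth (l := l) (L := L) φ hφ)),
    fn_ofSmooth (l := l) (L := L) hφ] with x h1 h2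
  rw [h1, Pi.smul_apply, h2, smul_eq_mul]

end Smooth

/-! ### Products of functions of one coordinate -/

section Tensor

/-- The function `x ↦ a₁(x₁) a₂(x₂) a₃(x₃)`. -/
def tens (a : Fin 3 → ℝ → ℝ) (x : Pt) : ℝ := ∏ j, a j (x j)

theorem contDiff_tens {a : Fin 3 → ℝ → ℝ} (h : ∀ j, ContDiff ℝ ∞ (a j)) :
    ContDiff ℝ ∞ (tens a) :=
  contDiff_prod fun j _ => (h j).comp (contDiff_apply ℝ ℝ j)

theorem tens_update (a : Fin 3 → ℝ → ℝ) (i : Fin 3) (b : ℝ → ℝ) (x : Pt) :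
    tens (Function.update a i b) x = b (x i) * ∏ j ∈ Finset.univ.erase i, a j (x j) := by
  unfold tens
  rw [← Finset.mul_prod_erase _ _ (Finset.mem_univ i)]
  congr 1
  · simp
  · refine Finset.prod_congr rfl fun j hj => ?_
    rw [Function.update_of_ne (Finset.ne_of_mem_erase hj)]

theorem tens_eq (a : Fin 3 → ℝ → ℝ) (i : Fin 3) (x : Pt) :
    tens a x = a i (x i) * ∏ j ∈ Finset.univ.erase i, a j (x j) := by
  rw [← tens_update, Function.update_eq_self]

theorem tens_apply_update (a : Fin 3 → ℝ → ℝ) (i : Fin 3) (x : Pt) (t : ℝ) :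
    tens a (Function.update x i t) = a i t * ∏ j ∈ Finset.univ.erase i, a j (x j) := by
  rw [tens_eq a i]
  congr 1
  · simp
  · refine Finset.prod_congr rfl fun j hj => ?_
    rw [Function.update_of_ne (Finset.ne_of_mem_erase hj)]

theorem pd_tens {a : Fin 3 → ℝ → ℝ} (h : ∀ j, Differentiable ℝ (a j)) (i : Fin 3) :
    pd i (tens a) = tens (Function.update a i (deriv (a i))) := by
  funext x
  have hd : DifferentiableAt ℝ (tens a) x := by
    have : Differentiable ℝ fun x : Pt => a 0 (x 0) * a 1 (x 1) * a 2 (x 2) := by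
      have := h 0
      have := h 1
      have := h 2
      fun_prop
    rw [show tens a = fun x : Pt => a 0 (x 0) * a 1 (x 1) * a 2 (x 2) from
      funext fun x => Fin.prod_univ_three _]
    exact this x
  refine pd_eq_of_hasDerivAt hd ?_
  simp only [tens_apply_update, tens_update]
  exact ((h i (x i)).hasDerivAt).mul_const _

end Tensor

/-! ### Cosine products and their completeness -/

section Cosine

/-- The frequency `kᵢ π / sᵢ`. -/
def freq (l L : ℝ) (k : Fin 3 → ℤ) (i : Fin 3) : ℝ := k i * (Real.pi / side l L i)

/-- The cosine products, eigenfunctions of the Neumann Laplacian on the box. -/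
def cosP (l L : ℝ) (k : Fin 3 → ℤ) : Pt → ℝ := tens fun i t => Real.cos (freq l L k i * t)

theorem contDiff_cosP (k : Fin 3 → ℤ) : ContDiff ℝ ∞ (cosP l L k) :=
  contDiff_tens fun j => by fun_prop

/-- The product-to-sum formula in each coordinate, with one term for each of the eight choices of
signs. Frequencies range over `ℤ` so that differences need no case distinction; the span of the
cosine products is therefore an algebra. -/
theorem cosP_mul (k m : Fin 3 → ℤ) (x : Pt) : cosP l L k x * cosP l L m x =
    ∑ ε ∈ Fintype.piFinset (fun _ : Fin 3 => ({1, -1} : Finset ℤ)),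
      (1 / 8) * cosP l L (fun i => k i + ε i * m i) x := by
  have h : ∀ i, Real.cos (freq l L k i * x i) * Real.cos (freq l L m i * x i) =
      ∑ e ∈ ({1, -1} : Finset ℤ), (1 / 2) *
        Real.cos (((k i + e * m i : ℤ) : ℝ) * (Real.pi / side l L i) * x i) := by
    intro i
    rw [Finset.sum_pair (by decide)]
    have e1 : ((k i + 1 * m i : ℤ) : ℝ) * (Real.pi / side l L i) * x i =
        freq l L k i * x i + freq l L m i * x i := by
      unfold freq; push_cast; ring
    have e2 : ((k i + -1 * m i : ℤ) : ℝ) * (Real.pi / side l L i) * x i =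
        freq l L k i * x i - freq l L m i * x i := by
      unfold freq; push_cast; ring
    rw [e1, e2, Real.cos_add, Real.cos_sub]
    ring
  unfold cosP tens
  rw [← Finset.prod_mul_distrib, Finset.prod_congr rfl fun i _ => h i, Finset.prod_univ_sum]
  refine Finset.sum_congr rfl fun ε _ => ?_
  rw [Finset.prod_mul_distrib]
  simp only [Finset.prod_const, Finset.card_univ, Fintype.card_fin]
  norm_num [freq]

variable [Fact (0 < l)] [Fact (0 < L)]

/-- Cosine products restricted to the closed box. -/
def cosK (l L : ℝ) (k : Fin 3 → ℤ) : C(Icc (0 : Pt) (side l L), ℝ) :=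
  ⟨fun x => cosP l L k x, (contDiff_cosP k).continuous.comp continuous_subtype_val⟩

/-- The algebra spanned by the cosine products. -/
def cosAlg (l L : ℝ) : Subalgebra ℝ C(Icc (0 : Pt) (side l L), ℝ) :=
  (Submodule.span ℝ (range (cosK l L))).toSubalgebra
    (Submodule.subset_span ⟨0, by ext x; simp [cosK, cosP, tens, freq]⟩)
    (by
      intro f g hf hg
      have key : ∀ k, ∀ g ∈ Submodule.span ℝ (range (cosK l L)),
          cosK l L k * g ∈ Submodule.span ℝ (range (cosK l L)) := by
        intro k g hg
        induction hg using Submodule.span_induction with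
        | mem g h =>
          obtain ⟨m, rfl⟩ := h
          have : cosK l L k * cosK l L m =
              ∑ ε ∈ Fintype.piFinset (fun _ : Fin 3 => ({1, -1} : Finset ℤ)),
                (1 / 8 : ℝ) • cosK l L (fun i => k i + ε i * m i) := by
            ext x
            simpa [cosK] using cosP_mul k m x
          rw [this]
          exact Submodule.sum_mem _ fun ε _ => Submodule.smul_mem _ _
            (Submodule.subset_span ⟨_, rfl⟩)
        | zero => simp
        | add a b _ _ ha hb => rw [mul_add]; exact Submodule.add_mem _ ha hb
        | smul c a _ ha => rw [mul_smul_comm]; exact Submodule.smul_mem _ _ ha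
      induction hf using Submodule.span_induction with
      | mem f h => obtain ⟨k, rfl⟩ := h; exact key k g hg
      | zero => simp
      | add a b _ _ ha hb => rw [add_mul]; exact Submodule.add_mem _ ha hb
      | smul c a _ ha => rw [smul_mul_assoc]; exact Submodule.smul_mem _ _ ha)

/-- The function `cos (π xᵢ / sᵢ)` is injective in `xᵢ ∈ [0, sᵢ]`, so a coordinate in which two
points differ already separates them. -/
theorem cosAlg_separatesPoints : (cosAlg l L).SeparatesPoints := by
  intro x y hxy
  have : ∃ i, (x : Pt) i ≠ (y : Pt) i := by
    by_contra! h
    exact hxy (Subtype.ext (funext h))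
  obtain ⟨i, hi⟩ := this
  refine ⟨_, ⟨cosK l L (Pi.single i 1), Submodule.subset_span ⟨_, rfl⟩, rfl⟩, ?_⟩
  have hval : ∀ z : Pt, cosP l L (Pi.single i 1) z = Real.cos (Real.pi / side l L i * z i) := by
    intro z
    unfold cosP
    rw [tens_eq _ i, Finset.prod_eq_one]
    · simp [freq]
    · intro j hj
      simp [freq, Finset.ne_of_mem_erase hj]
  have hs := side_pos (l := l) (L := L) i
  have hmem : ∀ z : Icc (0 : Pt) (side l L), Real.pi / side l L i * (z : Pt) i ∈ Icc 0 Real.pi := by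
    intro z
    have h1 := z.2.1 i
    have h2 := z.2.2 i
    constructor
    · exact mul_nonneg (by positivity) h1
    · rw [div_mul_eq_mul_div, div_le_iff₀ hs]
      exact mul_le_mul_of_nonneg_left h2 Real.pi_pos.le
  simp only [cosK, ContinuousMap.coe_mk, hval]
  intro h
  have := Real.injOn_cos (hmem x) (hmem y) h
  exact hi (mul_left_cancel₀ (by positivity) this)

/-- A square integrable function orthogonal to all cosine products vanishes. -/
theorem eq_zero_of_integral_cosP {f : L2 l L}
    (h : ∀ k, ∫ x in box l L, f x * cosP l L k x = 0) : f = 0 := by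
  have hf1 : Integrable f (volume.restrict (box l L)) := (Lp.memLp f).integrable (by norm_num)
  have hspan : ∀ g ∈ Submodule.span ℝ (range (cosK l L)), ∃ G : Pt → ℝ, Continuous G ∧
      (∀ x : Icc (0 : Pt) (side l L), G x = g x) ∧ ∫ x in box l L, f x * G x = 0 := by
    intro g hg
    induction hg using Submodule.span_induction with
    | mem g hg =>
      obtain ⟨k, rfl⟩ := hg
      exact ⟨cosP l L k, (contDiff_cosP k).continuous, fun x => rfl, h k⟩
    | zero => exact ⟨0, continuous_zero, fun x => rfl, by simp⟩
    | add a b _ _ ha hb =>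
      obtain ⟨A, hA, hA1, hA2⟩ := ha
      obtain ⟨B, hB, hB1, hB2⟩ := hb
      refine ⟨A + B, hA.add hB, fun x => by simp [hA1, hB1], ?_⟩
      simp only [Pi.add_apply, mul_add]
      rw [integral_add (integrable_mul_of f (memLp_box_of_continuous hA 2))
        (integrable_mul_of f (memLp_box_of_continuous hB 2)), hA2, hB2, add_zero]
    | smul c a _ ha =>
      obtain ⟨A, hA, hA1, hA2⟩ := ha
      refine ⟨c • A, hA.const_smul c, fun x => by simp [hA1], ?_⟩
      simp only [Pi.smul_apply, smul_eq_mul, mul_left_comm _ c]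
      rw [integral_const_mul, hA2, mul_zero]
  refine eq_zero_of_integral_test fun φ hφ => ?_
  have hcont := hφ.smooth.continuous
  set φK : C(Icc (0 : Pt) (side l L), ℝ) := ⟨fun x => φ x, hcont.comp continuous_subtype_val⟩
  -- By Stone–Weierstrass some `G` in the cosine algebra is within `ε` of the test function in the
  -- supremum norm. Since `f` integrates to zero against `G`, only `φ - G` contributes.
  have hbound : ∀ ε > 0, |∫ x in box l L, f x * φ x| ≤ ε * ∫ x in box l L, |f x| := by
    intro ε hε
    obtain ⟨⟨g, hg⟩, hgε⟩ := ContinuousMap.exists_mem_subalgebra_near_continuousMap_of_separatesPoints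
      (cosAlg l L) cosAlg_separatesPoints φK ε hε
    obtain ⟨G, hG, hG1, hG2⟩ := hspan g hg
    have e : ∫ x in box l L, f x * φ x = ∫ x in box l L, f x * (φ x - G x) := by
      simp only [mul_sub]
      rw [integral_sub (integrable_mul_of f (memLp_box_of_continuous hcont 2))
        (integrable_mul_of f (memLp_box_of_continuous hG 2)), hG2, sub_zero]
    rw [e, ← integral_const_mul ε]
    refine norm_integral_le_of_norm_le (f := fun x => f x * (φ x - G x)) (hf1.norm.const_mul ε) ?_
    refine (ae_restrict_mem (measurableSet_box l L)).mono fun x hx => ?_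
    have h1 := (ContinuousMap.norm_coe_le_norm (g - φK) ⟨x, box_subset_Icc l L hx⟩).trans hgε.le
    have h2 : ‖φ x - G x‖ ≤ ε := by
      rw [norm_sub_rev]
      have := hG1 ⟨x, box_subset_Icc l L hx⟩
      simp only at this
      rw [this]
      exact h1
    rw [norm_mul, mul_comm]
    exact mul_le_mul_of_nonneg_right h2 (norm_nonneg _)
  by_contra hne
  have hI : 0 ≤ ∫ x in box l L, |f x| := integral_nonneg fun x => abs_nonneg _
  have hpos : 0 < |∫ x in box l L, f x * φ x| := abs_pos.2 hne
  -- If the integral `I` were nonzero, this choice of `ε` would bound `|I|` by at most `|I| / 2`.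
  have := hbound (|∫ x in box l L, f x * φ x| / (2 * (1 + ∫ x in box l L, |f x|))) (by positivity)
  rw [div_mul_eq_mul_div, le_div_iff₀ (by positivity)] at this
  nlinarith

end Cosine

/-! ### Cutoff functions -/

section Cutoff

/-- The derivative of the transition function is supported in a bounded interval. The factor `q + 1`
is there because the cutoffs are evaluated at `q = n t - 1`, so that `q + 1 = n t` absorbs the
factor `n` produced by the chain rule. -/
theorem exists_smoothTransition_bound :
    ∃ M, 0 ≤ M ∧ ∀ q : ℝ, |q + 1| * |deriv Real.smoothTransition q| ≤ M := by
  have hc : Continuous fun q : ℝ => (q + 1) * deriv Real.smoothTransition q := by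
    have : Continuous (deriv Real.smoothTransition) :=
      (Real.smoothTransition.contDiff (n := 1)).continuous_deriv (by simp)
    fun_prop
  obtain ⟨M, hM⟩ := (isCompact_Icc (a := (-1 : ℝ)) (b := 2)).exists_bound_of_continuousOn
    hc.continuousOn
  refine ⟨max M 0, le_max_right _ _, fun q => ?_⟩
  by_cases hq : q ∈ Icc (-1 : ℝ) 2
  · rw [← abs_mul]; exact (hM q hq).trans (le_max_left _ _)
  · have h0 : deriv Real.smoothTransition q = 0 := by
      rw [mem_Icc, not_and_or, not_le, not_le] at hq
      rcases hq with hq | hq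
      · have : Real.smoothTransition =ᶠ[nhds q] fun _ => 0 := by
          filter_upwards [Iio_mem_nhds hq] with t ht
          exact Real.smoothTransition.zero_of_nonpos (by have := mem_Iio.1 ht; linarith)
        rw [this.deriv_eq, deriv_const]
      · have : Real.smoothTransition =ᶠ[nhds q] fun _ => 1 := by
          filter_upwards [Ioi_mem_nhds hq] with t ht
          exact Real.smoothTransition.one_of_one_le (by have := mem_Ioi.1 ht; linarith)
        rw [this.deriv_eq, deriv_const]
    simp [h0]

/-- A cutoff on `(0, s)`, vanishing at distance `1 / n` from the end points. -/
def cut (s : ℝ) (n : ℕ) (t : ℝ) : ℝ :=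
  Real.smoothTransition (n * t - 1) * Real.smoothTransition (n * (s - t) - 1)

theorem contDiff_cut (s : ℝ) (n : ℕ) : ContDiff ℝ ∞ (cut s n) :=
  (Real.smoothTransition.contDiff.comp (by fun_prop)).mul
    (Real.smoothTransition.contDiff.comp (by fun_prop))

theorem cut_mem (s : ℝ) (n : ℕ) (t : ℝ) : 0 ≤ cut s n t ∧ cut s n t ≤ 1 :=
  ⟨mul_nonneg (Real.smoothTransition.nonneg _) (Real.smoothTransition.nonneg _),
    mul_le_one₀ (Real.smoothTransition.le_one _) (Real.smoothTransition.nonneg _)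
      (Real.smoothTransition.le_one _)⟩

/-- The conclusion holds on a neighbourhood, not only at `t`, so that the derivative of the cutoff
also vanishes at `t` for large `n`. -/
theorem cut_eventually_one {s t : ℝ} (ht : t ∈ Ioo 0 s) :
    ∀ᶠ n : ℕ in Filter.atTop, ∀ᶠ r in nhds t, cut s n r = 1 := by
  have ht0 := ht.1
  have hts : 0 < s - t := sub_pos.2 ht.2
  obtain ⟨N1, h1⟩ := exists_nat_gt (4 / t)
  obtain ⟨N2, h2⟩ := exists_nat_gt (4 / (s - t))
  filter_upwards [Filter.eventually_ge_atTop (max N1 N2)] with n hn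
  have hn1 : 4 / t < n := h1.trans_le (by exact_mod_cast (le_max_left _ _).trans hn)
  have hn2 : 4 / (s - t) < n := h2.trans_le (by exact_mod_cast (le_max_right _ _).trans hn)
  rw [div_lt_iff₀ ht0] at hn1
  rw [div_lt_iff₀ hts] at hn2
  have o1 : ∀ᶠ r in nhds t, 2 < (n : ℝ) * r :=
    (continuous_const.mul continuous_id).continuousAt.eventually
      (Ioi_mem_nhds (show (2 : ℝ) < n * t by linarith))
  have o2 : ∀ᶠ r in nhds t, 2 < (n : ℝ) * (s - r) :=
    (continuous_const.mul (continuous_const.sub continuous_id)).continuousAt.eventually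
      (Ioi_mem_nhds (show (2 : ℝ) < n * (s - t) by linarith))
  filter_upwards [o1, o2] with r hr1 hr2
  rw [cut, Real.smoothTransition.one_of_one_le (by linarith),
    Real.smoothTransition.one_of_one_le (by linarith), one_mul]

/-- The slope of the cutoff is of order `n` only in layers of width of order `1 / n` at the ends,
where the weight `t (s - t)` is itself of order `1 / n`; the product is bounded uniformly in `n`. -/
theorem exists_deriv_cut_bound (s : ℝ) :
    ∃ M, ∀ (n : ℕ) (t : ℝ), t ∈ Ioo 0 s → t * (s - t) * |deriv (cut s n) t| ≤ M := by
  obtain ⟨M, hM0, hM⟩ := exists_smoothTransition_bound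
  refine ⟨s * M, fun n t ht => ?_⟩
  have hST : Differentiable ℝ Real.smoothTransition :=
    (Real.smoothTransition.contDiff (n := 1)).differentiable (by simp)
  have h1 : HasDerivAt (fun t : ℝ => (n : ℝ) * t - 1) n t := by
    simpa using ((hasDerivAt_id t).const_mul (n : ℝ)).sub_const 1
  have h2 : HasDerivAt (fun t : ℝ => (n : ℝ) * (s - t) - 1) (-n) t := by
    simpa using (((hasDerivAt_id t).const_sub s).const_mul (n : ℝ)).sub_const 1
  have h3 := ((hST _).hasDerivAt.comp t h1).mul ((hST _).hasDerivAt.comp t h2)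
  have h4 : deriv (cut s n) t = deriv Real.smoothTransition (n * t - 1) * n *
      Real.smoothTransition (n * (s - t) - 1) + Real.smoothTransition (n * t - 1) *
      (deriv Real.smoothTransition (n * (s - t) - 1) * -n) := h3.deriv
  have b1 := hM (n * t - 1)
  have b2 := hM (n * (s - t) - 1)
  have ht0 := ht.1.le
  have hts : 0 ≤ s - t := (sub_pos.2 ht.2).le
  rw [sub_add_cancel, abs_mul, Nat.abs_cast, abs_of_nonneg ht0] at b1
  rw [sub_add_cancel, abs_mul, Nat.abs_cast, abs_of_nonneg hts] at b2
  set p := |deriv Real.smoothTransition (n * t - 1)|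
  set q := |deriv Real.smoothTransition (n * (s - t) - 1)|
  have h5 : |deriv (cut s n) t| ≤ p * n + q * n := by
    rw [h4]
    refine (abs_add_le _ _).trans (add_le_add ?_ ?_)
    · rw [abs_mul, abs_mul, Nat.abs_cast, abs_of_nonneg (Real.smoothTransition.nonneg _)]
      exact mul_le_of_le_one_right (by positivity) (Real.smoothTransition.le_one _)
    · rw [abs_mul, abs_mul, abs_neg, Nat.abs_cast, abs_of_nonneg (Real.smoothTransition.nonneg _)]
      exact mul_le_of_le_one_left (by positivity) (Real.smoothTransition.le_one _)
  calc t * (s - t) * |deriv (cut s n) t| ≤ t * (s - t) * (p * n + q * n) :=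
        mul_le_mul_of_nonneg_left h5 (mul_nonneg ht0 hts)
    _ = (s - t) * (n * t * p) + t * (n * (s - t) * q) := by ring
    _ ≤ (s - t) * M + t * M :=
        add_le_add (mul_le_mul_of_nonneg_left b1 hts) (mul_le_mul_of_nonneg_left b2 ht0)
    _ = s * M := by ring

/-- The cutoff on the box. -/
def cutBox (l L : ℝ) (n : ℕ) : Pt → ℝ := tens fun i => cut (side l L i) n

theorem contDiff_cutBox (n : ℕ) : ContDiff ℝ ∞ (cutBox l L n) :=
  contDiff_tens fun _ => contDiff_cut _ _

theorem abs_cutBox_le (n : ℕ) (x : Pt) : |cutBox l L n x| ≤ 1 := by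
  unfold cutBox tens
  rw [Finset.abs_prod]
  refine Finset.prod_le_one (fun i _ => abs_nonneg _) fun i _ => ?_
  rw [abs_of_nonneg (cut_mem _ _ _).1]
  exact (cut_mem _ _ _).2

theorem isTest_mul_cutBox {ψ : Pt → ℝ} (h : ContDiff ℝ ∞ ψ) {n : ℕ} (hn : 0 < n) :
    IsTest l L fun x => ψ x * cutBox l L n x := by
  have hn' : (0 : ℝ) < n := by exact_mod_cast hn
  have hsub : tsupport (fun x => ψ x * cutBox l L n x) ⊆
      Icc (fun _ => (1 : ℝ) / n) (fun i => side l L i - 1 / n) := by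
    refine closure_minimal (fun x hx => ?_) isClosed_Icc
    have hx2 : ∀ i, cut (side l L i) n (x i) ≠ 0 := fun i h0 =>
      hx (mul_eq_zero_of_right _ (by rw [cutBox, tens_eq _ i, h0, zero_mul]))
    constructor <;> intro i
    · by_contra hlt
      rw [not_le, lt_div_iff₀ hn'] at hlt
      exact hx2 i (mul_eq_zero_of_left (Real.smoothTransition.zero_of_nonpos (by linarith)) _)
    · by_contra hlt
      rw [not_le, sub_lt_comm, lt_div_iff₀ hn'] at hlt
      exact hx2 i (mul_eq_zero_of_right _ (Real.smoothTransition.zero_of_nonpos (by linarith)))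
  refine ⟨h.mul (contDiff_cutBox n), isCompact_Icc.of_isClosed_subset (isClosed_tsupport _) hsub,
    hsub.trans fun x hx i => ?_⟩
  have h1 := hx.1 i
  have h2 := hx.2 i
  have h3 : (0 : ℝ) < 1 / n := by positivity
  exact ⟨h3.trans_le h1, by simp only at h2; linarith⟩

/-- Integration by parts in `H¹(Ω)` against a smooth function vanishing on the two faces
orthogonal to `eᵢ`. -/
theorem integral_D_mul_of_vanish (u : H1 l L) (i : Fin 3) {ψ : Pt → ℝ} (hψ : ContDiff ℝ ∞ ψ)
    {C : ℝ} (hC : ∀ x ∈ box l L, |ψ x| ≤ C * (x i * (side l L i - x i))) :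
    ∫ x in box l L, fn u x * pd i ψ x = - ∫ x in box l L, D i u x * ψ x := by
  obtain ⟨M, hM⟩ := exists_deriv_cut_bound (side l L i)
  have hcd : ∀ n, Differentiable ℝ (cut (side l L i) n) := fun n =>
    (contDiff_cut _ n).differentiable (by simp)
  have hpd : ∀ n x, pd i (fun x => ψ x * cutBox l L n x) x = pd i ψ x * cutBox l L n x +
      ψ x * (deriv (cut (side l L i) n) (x i) *
        ∏ j ∈ Finset.univ.erase i, cut (side l L j) n (x j)) := fun n x => by
    rw [pd_mul i (differentiable_of_smooth hψ x) (differentiable_of_smooth (contDiff_cutBox n) x),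
      cutBox, pd_tens (fun j => (contDiff_cut _ n).differentiable (by simp)), tens_update]
  have hprod : ∀ (n : ℕ) (x : Pt), |∏ j ∈ Finset.univ.erase i, cut (side l L j) n (x j)| ≤ 1 := by
    intro n x
    rw [Finset.abs_prod]
    refine Finset.prod_le_one (fun i _ => abs_nonneg _) fun i _ => ?_
    rw [abs_of_nonneg (cut_mem _ _ _).1]
    exact (cut_mem _ _ _).2
  obtain ⟨A, hA⟩ := (isCompact_Icc (a := (0 : Pt)) (b := side l L)).exists_bound_of_continuousOn
    (continuous_pd hψ i).continuousOn
  have hu1 : Integrable (fn u) (volume.restrict (box l L)) := (Lp.memLp _).integrable (by norm_num)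
  have hone : ∀ x ∈ box l L, ∀ᶠ n : ℕ in Filter.atTop, ∀ j, ∀ᶠ r in nhds (x j),
      cut (side l L j) n r = 1 := fun x hx =>
    Filter.eventually_all.2 fun j => cut_eventually_one (hx j)
  -- Dominated convergence. Only the cutoff in the direction `i` gets differentiated, and its large
  -- slope is compensated by the linear vanishing of `ψ` at the two faces orthogonal to `eᵢ`; no
  -- vanishing is needed on the other faces.
  have hlim1 : Filter.Tendsto (fun n : ℕ => ∫ x in box l L, fn u x *
      pd i (fun x => ψ x * cutBox l L n x) x) Filter.atTop
      (nhds (∫ x in box l L, fn u x * pd i ψ x)) := by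
    refine tendsto_integral_of_dominated_convergence (fun x => |fn u x| * (A + |C| * |M|))
      (fun n => ?_) (hu1.norm.mul_const _) (fun n => ?_) ?_
    · exact (Lp.aestronglyMeasurable _).mul
        (continuous_pd (hψ.mul (contDiff_cutBox n)) i).aestronglyMeasurable
    · refine (ae_restrict_mem (measurableSet_box l L)).mono fun x hx => ?_
      rw [norm_mul, hpd]
      refine mul_le_mul_of_nonneg_left ?_ (norm_nonneg _)
      refine (abs_add_le _ _).trans (add_le_add ?_ ?_)
      · rw [abs_mul]
        exact (mul_le_of_le_one_right (abs_nonneg _) (abs_cutBox_le n x)).trans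
          (hA x (box_subset_Icc l L hx))
      · rw [abs_mul, abs_mul, ← mul_assoc]
        refine (mul_le_of_le_one_right (by positivity) (hprod n x)).trans ?_
        have hpos : 0 ≤ x i * (side l L i - x i) :=
          mul_nonneg (hx i).1.le (sub_nonneg.2 (hx i).2.le)
        calc |ψ x| * |deriv (cut (side l L i) n) (x i)|
            ≤ (|C| * (x i * (side l L i - x i))) * |deriv (cut (side l L i) n) (x i)| :=
              mul_le_mul_of_nonneg_right ((hC x hx).trans
                (mul_le_mul_of_nonneg_right (le_abs_self C) hpos)) (abs_nonneg _)
          _ = |C| * (x i * (side l L i - x i) * |deriv (cut (side l L i) n) (x i)|) := by ring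
          _ ≤ |C| * |M| := mul_le_mul_of_nonneg_left ((hM n _ (hx i)).trans (le_abs_self M))
              (abs_nonneg _)
    · refine (ae_restrict_mem (measurableSet_box l L)).mono fun x hx => ?_
      refine tendsto_const_nhds.congr' ?_
      filter_upwards [hone x hx] with n hn
      have h1 : cutBox l L n x = 1 := by
        unfold cutBox tens
        exact Finset.prod_eq_one fun j _ => (hn j).self_of_nhds
      have h2 : deriv (cut (side l L i) n) (x i) = 0 := by
        rw [Filter.EventuallyEq.deriv_eq (f := fun _ => 1) (hn i), deriv_const]
      rw [hpd, h1, h2]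
      ring
  have hD1 : Integrable (D i u) (volume.restrict (box l L)) := (Lp.memLp _).integrable (by norm_num)
  have hDψ : Integrable (fun x => D i u x * ψ x) (volume.restrict (box l L)) :=
    integrable_mul_of _ (memLp_box_of_continuous hψ.continuous 2)
  have hlim2 : Filter.Tendsto (fun n : ℕ => ∫ x in box l L, D i u x *
      (ψ x * cutBox l L n x)) Filter.atTop
      (nhds (∫ x in box l L, D i u x * ψ x)) := by
    refine tendsto_integral_of_dominated_convergence (fun x => |D i u x * ψ x|)
      (fun n => ?_) hDψ.norm (fun n => ?_) ?_
    · exact (Lp.aestronglyMeasurable _).mul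
        (hψ.continuous.mul (contDiff_cutBox n).continuous).aestronglyMeasurable
    · refine Filter.Eventually.of_forall fun x => ?_
      rw [← mul_assoc, norm_mul]
      exact mul_le_of_le_one_right (norm_nonneg _) (abs_cutBox_le n x)
    · refine (ae_restrict_mem (measurableSet_box l L)).mono fun x hx => ?_
      refine tendsto_const_nhds.congr' ?_
      filter_upwards [hone x hx] with n hn
      have h1 : cutBox l L n x = 1 := by
        unfold cutBox tens
        exact Finset.prod_eq_one fun j _ => (hn j).self_of_nhds
      rw [h1, mul_one]
  refine tendsto_nhds_unique hlim1 (hlim2.neg.congr' ?_)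
  filter_upwards [Filter.eventually_gt_atTop 0] with n hn
  exact ((isWeakDeriv_D u i) _ (isTest_mul_cutBox hψ hn)).symm

end Cutoff

/-! ### Density of smooth functions in `H¹(Ω)` -/

section Density

theorem dense_of_orthogonal {E : Type*} [NormedAddCommGroup E] [InnerProductSpace ℝ E]
    [CompleteSpace E] (K : Submodule ℝ E) (h : ∀ u : E, (∀ v ∈ K, inner ℝ u v = 0) → u = 0) :
    Dense (K : Set E) := by
  rw [Submodule.dense_iff_topologicalClosure_eq_top, Submodule.topologicalClosure_eq_top_iff,
    Submodule.eq_bot_iff]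
  exact fun u hu => h u ((Submodule.mem_orthogonal' _ _).1 hu)

theorem deriv_cos_mul (c : ℝ) :
    deriv (fun t => Real.cos (c * t)) = fun t => -(c * Real.sin (c * t)) := by
  funext t
  have := ((hasDerivAt_id' t).const_mul c).cos
  rw [this.deriv]
  ring

theorem pd_cosP (k : Fin 3 → ℤ) (i : Fin 3) (x : Pt) : pd i (cosP l L k) x =
    -(freq l L k i * Real.sin (freq l L k i * x i)) *
      ∏ j ∈ Finset.univ.erase i, Real.cos (freq l L k j * x j) := by
  unfold cosP
  rw [pd_tens fun j => by fun_prop, tens_update, deriv_cos_mul]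

theorem pd_pd_cosP (k : Fin 3 → ℤ) (i : Fin 3) (x : Pt) : pd i (pd i (cosP l L k)) x =
    -(freq l L k i) ^ 2 * cosP l L k x := by
  unfold cosP
  rw [pd_tens fun j => by fun_prop, pd_tens, tens_update]
  · have h2 : HasDerivAt (fun t => - (freq l L k i * Real.sin (freq l L k i * t)))
        (-(freq l L k i) ^ 2 * Real.cos (freq l L k i * x i)) (x i) := by
      have := (((hasDerivAt_id' (x i)).const_mul (freq l L k i)).sin.const_mul (freq l L k i)).neg
      rw [show -(freq l L k i) ^ 2 * Real.cos (freq l L k i * x i) = -(freq l L k i *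
        (Real.cos (freq l L k i * x i) * (freq l L k i * 1))) by ring]
      exact this
    rw [Function.update_self, deriv_cos_mul, h2.deriv, tens_eq _ i, mul_assoc]
    congr 2
    refine Finset.prod_congr rfl fun j hj => ?_
    rw [Function.update_of_ne (Finset.ne_of_mem_erase hj)]
  · intro j
    rcases eq_or_ne j i with rfl | hj
    · rw [Function.update_self, deriv_cos_mul]; fun_prop
    · rw [Function.update_of_ne hj]; fun_prop

variable [Fact (0 < l)] [Fact (0 < L)]

theorem sin_freq_end (k : Fin 3 → ℤ) (i : Fin 3) : Real.sin (freq l L k i * side l L i) = 0 := by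
  have hs := (side_pos (l := l) (L := L) i).ne'
  rw [freq, mul_assoc, div_mul_cancel₀ _ hs]
  exact Real.sin_int_mul_pi _

theorem pd_cosP_face (k : Fin 3 → ℤ) (i : Fin 3) (x : Pt) (hx : x i = 0 ∨ x i = side l L i) :
    pd i (cosP l L k) x = 0 := by
  rw [pd_cosP]
  rcases hx with hx | hx
  · simp [hx]
  · simp [hx, sin_freq_end]

/-- The sine vanishes at both ends, hence is at most `|κ| xᵢ` and at most `|κ| (sᵢ - xᵢ)`.
Multiplying the first bound by `sᵢ - xᵢ`, the second by `xᵢ`, and adding them yields the product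
weight. This is the hypothesis of `integral_D_mul_of_vanish`. -/
theorem abs_pd_cosP_le (k : Fin 3 → ℤ) (i : Fin 3) : ∃ C, ∀ x ∈ box l L,
    |pd i (cosP l L k) x| ≤ C * (x i * (side l L i - x i)) := by
  have hs := side_pos (l := l) (L := L) i
  set κ := freq l L k i with hκ
  refine ⟨2 / side l L i * κ ^ 2, fun x hx => ?_⟩
  have h0 := (hx i).1
  have h1 := sub_pos.2 (hx i).2
  have s1 : |Real.sin (κ * x i)| ≤ |κ| * x i := by
    have := Real.abs_sin_le_abs (x := κ * x i)
    rwa [abs_mul, abs_of_pos h0] at this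
  have s2 : |Real.sin (κ * x i)| ≤ |κ| * (side l L i - x i) := by
    have e : |Real.sin (κ * x i)| = |Real.sin (κ * (side l L i - x i))| := by
      rw [mul_sub, Real.sin_sub, sin_freq_end, zero_mul, zero_sub, abs_neg, abs_mul]
      have hc : |Real.cos (κ * side l L i)| = 1 := by
        have := Real.sin_sq_add_cos_sq (κ * side l L i)
        rw [sin_freq_end] at this
        rw [← sq_eq_sq₀ (abs_nonneg _) zero_le_one, sq_abs]
        linarith
      rw [hc, one_mul]
    rw [e]
    have := Real.abs_sin_le_abs (x := κ * (side l L i - x i))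
    rwa [abs_mul, abs_of_pos h1] at this
  have hp : |∏ j ∈ Finset.univ.erase i, Real.cos (freq l L k j * x j)| ≤ 1 := by
    rw [Finset.abs_prod]
    exact Finset.prod_le_one (fun i _ => abs_nonneg _) fun i _ => Real.abs_cos_le_one _
  have s3 : side l L i * |Real.sin (κ * x i)| ≤ 2 * (|κ| * (x i * (side l L i - x i))) := by
    have a1 := mul_le_mul_of_nonneg_left s1 h1.le
    have a2 := mul_le_mul_of_nonneg_left s2 h0.le
    nlinarith
  rw [pd_cosP, abs_mul, abs_neg, abs_mul]
  refine (mul_le_of_le_one_right (by positivity) hp).trans ?_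
  have s4 : |Real.sin (κ * x i)| ≤ 2 / side l L i * (|κ| * (x i * (side l L i - x i))) := by
    rw [div_mul_eq_mul_div, le_div_iff₀ hs]; linarith
  calc |κ| * |Real.sin (κ * x i)| ≤ |κ| * (2 / side l L i * (|κ| * (x i * (side l L i - x i)))) :=
        mul_le_mul_of_nonneg_left s4 (abs_nonneg _)
    _ = 2 / side l L i * κ ^ 2 * (x i * (side l L i - x i)) := by rw [← sq_abs κ]; ring

/-- The functions of `H¹(Ω)` that are smooth up to the boundary. -/
def smoothH1 (l L : ℝ) [Fact (0 < l)] [Fact (0 < L)] : Submodule ℝ (H1 l L) where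
  carrier := {u | ∃ φ, ∃ h : ContDiff ℝ ∞ φ, u = ofSmooth φ h}
  zero_mem' := ⟨fun _ => 0, contDiff_const, eq_ofSmooth _ (Lp.coeFn_zero ..)⟩
  add_mem' := by
    rintro _ _ ⟨φ, hφ, rfl⟩ ⟨ψ, hψ, rfl⟩
    exact ⟨_, _, ofSmooth_add hφ hψ⟩
  smul_mem' := by
    rintro c _ ⟨φ, hφ, rfl⟩
    exact ⟨_, _, ofSmooth_smul hφ c⟩

/-- If `u` is orthogonal in `H¹` to a cosine product of frequency `κ`, integration by parts (without
boundary terms, by the Neumann condition) turns this into `(1 + |κ|²) ∫ u cos = 0`. So all cosine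
coefficients of `u` vanish, and `u = 0` by completeness. -/
theorem dense_smoothH1 : Dense (smoothH1 l L : Set (H1 l L)) := by
  refine dense_of_orthogonal (E := H1 l L) _ fun u hu => ?_
  have hz : fn u = 0 := by
    refine eq_zero_of_integral_cosP fun k => ?_
    have h1 := hu (ofSmooth (cosP l L k) (contDiff_cosP k)) ⟨_, _, rfl⟩
    rw [inner_H1, inner_Lp_congr Filter.EventuallyEq.rfl (fn_ofSmooth _)] at h1
    have h2 : ∀ i, inner ℝ (D i u) (D i (ofSmooth (l := l) (L := L) (cosP l L k) (contDiff_cosP k))) =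
        freq l L k i ^ 2 * ∫ x in box l L, fn u x * cosP l L k x := by
      intro i
      rw [inner_Lp_congr Filter.EventuallyEq.rfl (D_ofSmooth _ i)]
      obtain ⟨C, hC⟩ := abs_pd_cosP_le (l := l) (L := L) k i
      have h3 := integral_D_mul_of_vanish u i (contDiff_pd (contDiff_cosP k) i) hC
      rw [← integral_const_mul, ← neg_eq_iff_eq_neg.2 h3, ← integral_neg]
      refine integral_congr_ae (Filter.Eventually.of_forall fun x => ?_)
      simp only [pd_pd_cosP]
      ring
    simp only [h2, ← Finset.sum_mul] at h1
    have h4 : 0 ≤ ∑ i, freq l L k i ^ 2 := Finset.sum_nonneg fun i _ => sq_nonneg _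
    have h5 : (1 + ∑ i, freq l L k i ^ 2) * ∫ x in box l L, fn u x * cosP l L k x = 0 := by
      rw [add_mul, one_mul]; exact h1
    exact (mul_eq_zero.1 h5).resolve_left (by positivity)
  exact H1_ext (v := 0) (hz.trans ((fnL l L).map_zero).symm)

end Density

/-! ### The trace theorem -/

section Trace

theorem isClosed_norm_snd_le (C : ℝ) : IsClosed {p : H1 l L × L2bd l L | ‖p.2‖ ≤ C * ‖p.1‖} :=
  isClosed_le continuous_snd.norm (continuous_const.mul continuous_fst.norm)

theorem HasTrace.mem_of_isClosed {u : H1 l L} {w : L2bd l L} (h : HasTrace u w)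
    {S : Set (H1 l L × L2bd l L)} (hS : IsClosed S) (hs : smoothPairs l L ⊆ S) : (u, w) ∈ S := by
  unfold HasTrace at h
  exact (hS.closure_subset_iff.2 hs) h

theorem smoothPairs_add {p q : H1 l L × L2bd l L} (hp : p ∈ smoothPairs l L)
    (hq : q ∈ smoothPairs l L) : p + q ∈ smoothPairs l L := by
  obtain ⟨φ, hφ, h1, h2⟩ := hp
  obtain ⟨ψ, hψ, h3, h4⟩ := hq
  refine ⟨fun x => φ x + ψ x, hφ.add hψ, ?_, ?_⟩
  · rw [Prod.fst_add, fn_add]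
    filter_upwards [h1, h3, Lp.coeFn_add (fn p.1) (fn q.1)] with x a b c
    rw [c, Pi.add_apply, a, b]
  · filter_upwards [h2, h4, Lp.coeFn_add p.2 q.2] with x a b c
    rw [Prod.snd_add, c, Pi.add_apply, a, b]

theorem smoothPairs_smul (c : ℝ) {p : H1 l L × L2bd l L} (hp : p ∈ smoothPairs l L) :
    c • p ∈ smoothPairs l L := by
  obtain ⟨φ, hφ, h1, h2⟩ := hp
  refine ⟨fun x => c * φ x, contDiff_const.mul hφ, ?_, ?_⟩
  · rw [Prod.smul_fst, fn_smul]
    filter_upwards [h1, Lp.coeFn_smul c (fn p.1)] with x a b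
    rw [b, Pi.smul_apply, a, smul_eq_mul]
  · filter_upwards [h2, Lp.coeFn_smul c p.2] with x a b
    rw [Prod.smul_snd, b, Pi.smul_apply, a, smul_eq_mul]

theorem HasTrace.add {u v : H1 l L} {w z : L2bd l L} (h : HasTrace u w) (h' : HasTrace v z) :
    HasTrace (u + v) (w + z) :=
  map_mem_closure₂ (f := fun p q : H1 l L × L2bd l L => p + q) continuous_add h h'
    fun _ hp _ hq => smoothPairs_add hp hq

theorem HasTrace.smul {u : H1 l L} {w : L2bd l L} (c : ℝ) (h : HasTrace u w) :
    HasTrace (c • u) (c • w) :=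
  map_mem_closure (f := fun p : H1 l L × L2bd l L => c • p) (continuous_const_smul c) h
    fun _ hp => smoothPairs_smul c hp

variable [Fact (0 < l)] [Fact (0 < L)]

/-- The affine function `2 xᵢ / sᵢ - 1` runs from `-1` to `1` across the box, so the field with
these components has normal component `1` on every face. It converts surface integrals into volume
integrals. -/
theorem sum_normal_mul_eq_one :
    ∀ᵐ x ∂(surf l L), ∑ i, normal l L x i * (2 / side l L i * x i - 1) = 1 := by
  refine ae_surf_of_forall fun i y hy => ?_
  have hs := (side_pos (l := l) (L := L) i).ne'
  constructor
  · rw [Finset.sum_eq_single i]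
    · rw [(normal_facePt hy i).1, facePt_same]; simp
    · intro k _ hk
      rw [(normal_facePt hy k).1]; simp [hk]
    · simp
  · rw [Finset.sum_eq_single i]
    · rw [(normal_facePt hy i).2, facePt_same, div_mul_cancel₀ _ hs]; norm_num
    · intro k _ hk
      rw [(normal_facePt hy k).2]; simp [hk]
    · simp

/-- The constant of the trace inequality. -/
def traceConst (l L : ℝ) : ℝ := 3 + ∑ i, 2 / side l L i

theorem traceConst_pos : 0 < traceConst l L := by
  have : 0 ≤ ∑ i, 2 / side l L i :=
    Finset.sum_nonneg fun i _ => div_nonneg zero_le_two (side_pos i).le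
  unfold traceConst; linarith

/-- The divergence theorem for `φ²` times the field of `sum_normal_mul_eq_one`, whose components are
bounded by `1` in the box; then `2 |φ ∂ᵢφ| ≤ φ² + (∂ᵢφ)²`. -/
theorem integral_surf_sq_le {φ : Pt → ℝ} (h : ContDiff ℝ ∞ φ) :
    ∫ x, φ x ^ 2 ∂(surf l L) ≤ traceConst l L * ‖ofSmooth (l := l) (L := L) φ h‖ ^ 2 := by
  set ψ : Fin 3 → Pt → ℝ := fun i x => 2 / side l L i * x i - 1 with hψ
  have hψs : ∀ i, ContDiff ℝ ∞ (ψ i) := fun i => by fun_prop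
  have hφ2 : ContDiff ℝ ∞ fun x => φ x ^ 2 := h.pow 2
  have hpdψ : ∀ i x, pd i (ψ i) x = 2 / side l L i := fun i x => by
    have h1 : HasDerivAt (fun t : ℝ => 2 / side l L i * t - 1) (2 / side l L i) (x i) := by
      simpa using ((hasDerivAt_id' (x i)).const_mul (2 / side l L i)).sub_const 1
    rw [hψ, pd_comp_coord i i h1, if_pos rfl]
  have hpd2 : ∀ i x, pd i (fun x => φ x ^ 2) x = 2 * (φ x * pd i φ x) := fun i x => by
    have := pd_mul i (differentiable_of_smooth h x) (differentiable_of_smooth h x)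
    simp only [← sq] at this
    rw [this]; ring
  have hint : ∀ i, Integrable (fun x => φ x ^ 2 * ψ i x) (surf l L) := fun i =>
    memLp_one_iff_integrable.1 (memLp_surf_of_continuous (hφ2.mul (hψs i)).continuous 1)
  have e1 : ∫ x, φ x ^ 2 ∂(surf l L) =
      ∑ i, ∫ x in box l L, pd i (fun x => φ x ^ 2 * ψ i x) x := by
    simp only [fun i => integral_pd (l := l) (L := L) (hφ2.mul (hψs i)) i]
    rw [← integral_finsetSum _ fun i _ => integrable_normal_mul (hint i) i]
    refine integral_congr_ae ?_
    filter_upwards [sum_normal_mul_eq_one (l := l) (L := L)] with x hx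
    have hx' : φ x ^ 2 = φ x ^ 2 * ∑ i, normal l L x i * (2 / side l L i * x i - 1) := by
      rw [hx, mul_one]
    refine hx'.trans ?_
    rw [Finset.mul_sum]
    refine Finset.sum_congr rfl fun i _ => ?_
    simp only [hψ]
    ring
  have hn0 : ‖fn (ofSmooth (l := l) (L := L) φ h)‖ ^ 2 = ∫ x in box l L, φ x ^ 2 :=
    norm_sq_Lp_congr (fn_ofSmooth h)
  have hni : ∀ i, ‖D i (ofSmooth (l := l) (L := L) φ h)‖ ^ 2 = ∫ x in box l L, pd i φ x ^ 2 :=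
    fun i => norm_sq_Lp_congr (D_ofSmooth h i)
  have e2 : ∀ i, ∫ x in box l L, pd i (fun x => φ x ^ 2 * ψ i x) x ≤
      (1 + 2 / side l L i) * ‖fn (ofSmooth (l := l) (L := L) φ h)‖ ^ 2 +
        ‖D i (ofSmooth (l := l) (L := L) φ h)‖ ^ 2 := by
    intro i
    rw [hn0, hni, ← integral_const_mul, ← integral_add]
    · refine setIntegral_mono_on (integrable_box_of_continuous (continuous_pd (hφ2.mul (hψs i)) i))
        ?_ (measurableSet_box l L) fun x hx => ?_
      · exact integrable_box_of_continuous
          ((continuous_const.mul hφ2.continuous).add ((continuous_pd h i).pow 2))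
      · rw [pd_mul i (differentiable_of_smooth hφ2 x) (differentiable_of_smooth (hψs i) x), hpdψ,
          hpd2]
        have hs := side_pos (l := l) (L := L) i
        have hb : |ψ i x| ≤ 1 := by
          have h1 := hx i
          have h2 : 2 / side l L i * x i ≤ 2 := by
            rw [div_mul_eq_mul_div, div_le_iff₀ hs]; linarith
          have h3 : 0 ≤ 2 / side l L i * x i := mul_nonneg (by positivity) h1.1.le
          rw [abs_le]; constructor <;> simp only [hψ] <;> linarith
        have h4 : 2 * (φ x * pd i φ x) * ψ i x ≤ φ x ^ 2 + pd i φ x ^ 2 := by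
          refine (le_abs_self _).trans ?_
          rw [abs_mul]
          refine (mul_le_of_le_one_right (abs_nonneg _) hb).trans ?_
          rw [abs_le]
          constructor <;> nlinarith [sq_nonneg (φ x + pd i φ x), sq_nonneg (φ x - pd i φ x)]
        nlinarith
    · exact integrable_box_of_continuous (continuous_const.mul hφ2.continuous)
    · exact integrable_box_of_continuous ((continuous_pd h i).pow 2)
  rw [e1]
  refine (Finset.sum_le_sum fun i _ => e2 i).trans ?_
  rw [Finset.sum_add_distrib, ← Finset.sum_mul, Finset.sum_add_distrib, norm_sq_H1, traceConst]
  simp only [Finset.sum_const, Finset.card_univ, Fintype.card_fin, nsmul_eq_mul, mul_one]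
  have h1 : 0 ≤ ∑ i, ‖D i (ofSmooth (l := l) (L := L) φ h)‖ ^ 2 :=
    Finset.sum_nonneg fun i _ => sq_nonneg _
  have h2 : 0 ≤ ∑ i, 2 / side l L i :=
    Finset.sum_nonneg fun i _ => div_nonneg zero_le_two (side_pos i).le
  push_cast
  nlinarith

theorem norm_le_of_mem_smoothPairs {p : H1 l L × L2bd l L} (hp : p ∈ smoothPairs l L) :
    ‖p.2‖ ≤ √(traceConst l L) * ‖p.1‖ := by
  obtain ⟨φ, hφ, h1, h2⟩ := hp
  rw [eq_ofSmooth hφ h1]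
  refine abs_le_of_sq_le_sq' ?_ (by positivity) |>.2
  rw [mul_pow, Real.sq_sqrt traceConst_pos.le, norm_sq_Lp_congr h2]
  exact integral_surf_sq_le hφ

theorem HasTrace.norm_le {u : H1 l L} {w : L2bd l L} (h : HasTrace u w) :
    ‖w‖ ≤ √(traceConst l L) * ‖u‖ :=
  h.mem_of_isClosed (isClosed_norm_snd_le (√(traceConst l L)))
    fun _ hp => norm_le_of_mem_smoothPairs hp

theorem HasTrace.unique {u : H1 l L} {w z : L2bd l L} (h : HasTrace u w) (h' : HasTrace u z) :
    w = z := by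
  have h1 := (h.add (h'.smul (-1))).norm_le
  rw [neg_one_smul, neg_one_smul, add_neg_cancel, norm_zero, mul_zero, ← sub_eq_add_neg] at h1
  exact sub_eq_zero.1 (norm_eq_zero.1 (le_antisymm h1 (norm_nonneg _)))

theorem hasTrace_ofSmooth {φ : Pt → ℝ} (h : ContDiff ℝ ∞ φ) :
    HasTrace (ofSmooth (l := l) (L := L) φ h) (memLp_surf_of_continuous h.continuous 2).toLp :=
  subset_closure ⟨φ, h, fn_ofSmooth h, (memLp_surf_of_continuous h.continuous 2).coeFn_toLp⟩

/-- The trace inequality makes the boundary values of a smooth approximating sequence Cauchy in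
`L²(∂Ω)`; their limit is the trace. -/
theorem exists_hasTrace (u : H1 l L) : ∃ w, HasTrace u w := by
  obtain ⟨v, hv, hlim⟩ := mem_closure_iff_seq_limit.1 (dense_smoothH1 u)
  have hw : ∀ n, ∃ w, HasTrace (v n) w := fun n => by
    obtain ⟨φ, hφ, h⟩ := hv n
    rw [h]
    exact ⟨_, hasTrace_ofSmooth hφ⟩
  choose w hw using hw
  have hdist : ∀ n m, dist (w n) (w m) ≤ √(traceConst l L) * dist (v n) (v m) := by
    intro n m
    have h1 := ((hw n).add ((hw m).smul (-1))).norm_le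
    rwa [neg_one_smul, neg_one_smul, ← sub_eq_add_neg, ← sub_eq_add_neg, ← dist_eq_norm,
      ← dist_eq_norm] at h1
  have hcau : CauchySeq w := by
    have hv := hlim.cauchySeq
    rw [Metric.cauchySeq_iff] at hv ⊢
    intro ε hε
    have hpos : 0 < √(traceConst l L) := Real.sqrt_pos.2 traceConst_pos
    obtain ⟨N, hN⟩ := hv (ε / √(traceConst l L)) (by positivity)
    refine ⟨N, fun m hm n hn => (hdist m n).trans_lt ?_⟩
    have := hN m hm n hn
    rwa [lt_div_iff₀' hpos] at this
  obtain ⟨z, hz⟩ := cauchySeq_tendsto_of_complete hcau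
  exact ⟨z, isClosed_closure.mem_of_tendsto (hlim.prodMk_nhds hz)
    (Filter.Eventually.of_forall hw)⟩

theorem hasTrace_trace (u : H1 l L) : HasTrace u (trace u) := by
  have h := exists_hasTrace u
  rw [trace, dif_pos h]
  exact h.choose_spec

theorem HasTrace.eq {u : H1 l L} {w : L2bd l L} (h : HasTrace u w) : trace u = w :=
  (hasTrace_trace u).unique h

theorem trace_ofSmooth {φ : Pt → ℝ} (h : ContDiff ℝ ∞ φ) :
    trace (ofSmooth (l := l) (L := L) φ h) =ᵐ[surf l L] φ := by
  rw [(hasTrace_ofSmooth h).eq]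
  exact MemLp.coeFn_toLp _

/-- The trace, as a bounded operator from `H¹(Ω)` to `L²(∂Ω)`. -/
def trL (l L : ℝ) [Fact (0 < l)] [Fact (0 < L)] : H1 l L →L[ℝ] L2bd l L :=
  LinearMap.mkContinuous
    { toFun := trace
      map_add' := fun u v => ((hasTrace_trace u).add (hasTrace_trace v)).eq
      map_smul' := fun c u => ((hasTrace_trace u).smul c).eq } (√(traceConst l L))
    fun u => (hasTrace_trace u).norm_le

@[simp] theorem trL_apply (u : H1 l L) : trL l L u = trace u := rfl

theorem trace_add (u v : H1 l L) : trace (u + v) = trace u + trace v := (trL l L).map_add u v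

theorem trace_sub (u v : H1 l L) : trace (u - v) = trace u - trace v := (trL l L).map_sub u v

theorem trace_smul (c : ℝ) (u : H1 l L) : trace (c • u) = c • trace u := (trL l L).map_smul c u

theorem trace_zero : trace (0 : H1 l L) = 0 := (trL l L).map_zero

end Trace

/-! ### Green's formula in `H¹(Ω)` -/

section Green

theorem exists_mulCLM_box {ψ : Pt → ℝ} (h : Continuous ψ) :
    ∃ T : L2 l L →L[ℝ] L2 l L, ∀ f, T f =ᵐ[volume.restrict (box l L)] fun x => ψ x * f x := by
  obtain ⟨C, hC⟩ := (isCompact_Icc (a := (0 : Pt)) (b := side l L)).exists_bound_of_continuousOn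
    h.continuousOn
  obtain ⟨T, hT, -⟩ := exists_mulCLM (ν := volume.restrict (box l L)) (m := ψ) (C := C)
    h.aestronglyMeasurable
    ((ae_restrict_mem (measurableSet_box l L)).mono fun x hx => hC x (box_subset_Icc l L hx))
  exact ⟨T, hT⟩

variable [Fact (0 < l)] [Fact (0 < L)]

theorem exists_mulCLM_surf {ψ : Pt → ℝ} (h : Continuous ψ) (i : Fin 3) :
    ∃ T : L2bd l L →L[ℝ] L2bd l L,
      ∀ f, T f =ᵐ[surf l L] fun x => normal l L x i * ψ x * f x := by
  obtain ⟨C, hC⟩ := (isCompact_Icc (a := (0 : Pt)) (b := side l L)).exists_bound_of_continuousOn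
    h.continuousOn
  obtain ⟨T, hT, -⟩ := exists_mulCLM (ν := surf l L) (m := fun x => normal l L x i * ψ x) (C := C)
    ((measurable_normal i).aestronglyMeasurable.mul h.aestronglyMeasurable)
    (ae_surf_mem_Icc.mono fun x hx => by
      rw [abs_mul]
      exact (mul_le_of_le_one_left (abs_nonneg _) (abs_normal_le x i)).trans (hC x hx))
  exact ⟨T, hT⟩

/-- Green's formula in a coordinate direction, with a smooth weight. -/
theorem green (f g : H1 l L) {ψ : Pt → ℝ} (hψ : ContDiff ℝ ∞ ψ) (i : Fin 3) :
    (∫ x in box l L, ψ x * D i f x * fn g x) + (∫ x in box l L, ψ x * fn f x * D i g x) +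
      (∫ x in box l L, pd i ψ x * fn f x * fn g x) =
      ∫ x, normal l L x i * ψ x * trace f x * trace g x ∂(surf l L) := by
  obtain ⟨T, hT⟩ := exists_mulCLM_box (l := l) (L := L) hψ.continuous
  obtain ⟨T', hT'⟩ := exists_mulCLM_box (l := l) (L := L) (continuous_pd hψ i)
  obtain ⟨S, hS⟩ := exists_mulCLM_surf (l := l) (L := L) hψ.continuous i
  have e1 : ∀ f g : H1 l L, inner ℝ (T (DL l L i f)) (fnL l L g) =
      ∫ x in box l L, ψ x * D i f x * fn g x := fun f g =>
    inner_Lp_congr (hT _) Filter.EventuallyEq.rfl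
  have e2 : ∀ f g : H1 l L, inner ℝ (T (fnL l L f)) (DL l L i g) =
      ∫ x in box l L, ψ x * fn f x * D i g x := fun f g =>
    inner_Lp_congr (hT _) Filter.EventuallyEq.rfl
  have e3 : ∀ f g : H1 l L, inner ℝ (T' (fnL l L f)) (fnL l L g) =
      ∫ x in box l L, pd i ψ x * fn f x * fn g x := fun f g =>
    inner_Lp_congr (hT' _) Filter.EventuallyEq.rfl
  have e4 : ∀ f g : H1 l L, inner ℝ (S (trL l L f)) (trL l L g) =
      ∫ x, normal l L x i * ψ x * trace f x * trace g x ∂(surf l L) := fun f g =>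
    inner_Lp_congr (hS _) Filter.EventuallyEq.rfl
  -- For smooth functions the identity is the divergence theorem for `ψ f g`. Each term is bounded
  -- bilinear in `(f, g)`, so density extends it first in `g` and then in `f`.
  have key : ∀ f ∈ (smoothH1 l L : Set (H1 l L)), ∀ g ∈ (smoothH1 l L : Set (H1 l L)),
      inner ℝ (T (DL l L i f)) (fnL l L g) + inner ℝ (T (fnL l L f)) (DL l L i g) +
      inner ℝ (T' (fnL l L f)) (fnL l L g) = inner ℝ (S (trL l L f)) (trL l L g) := by
    rintro _ ⟨φ, hφ, rfl⟩ _ ⟨χ, hχ, rfl⟩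
    simp only [fnL_apply, DL_apply, trL_apply]
    rw [inner_Lp_congr (φ := fun x => ψ x * pd i φ x) (ψ := χ) ((hT (D i (ofSmooth φ hφ))).trans
        ((D_ofSmooth hφ i).mono fun x hx => by simp [hx])) (fn_ofSmooth hχ),
      inner_Lp_congr (φ := fun x => ψ x * φ x) (ψ := pd i χ) ((hT (fn (ofSmooth φ hφ))).trans
        ((fn_ofSmooth hφ).mono fun x hx => by simp [hx])) (D_ofSmooth hχ i),
      inner_Lp_congr (φ := fun x => pd i ψ x * φ x) (ψ := χ) ((hT' (fn (ofSmooth φ hφ))).trans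
        ((fn_ofSmooth hφ).mono fun x hx => by simp [hx])) (fn_ofSmooth hχ),
      inner_Lp_congr (φ := fun x => normal l L x i * ψ x * φ x) (ψ := χ) ((hS (trace (ofSmooth φ hφ))).trans
        ((trace_ofSmooth hφ).mono fun x hx => by simp [hx])) (trace_ofSmooth hχ)]
    have h := integral_pd (l := l) (L := L) ((hψ.mul hφ).mul hχ) i
    rw [← integral_add, ← integral_add]
    · have e : ∀ x, normal l L x i * (ψ x * φ x * χ x) = normal l L x i * ψ x * φ x * χ x :=
        fun x => by ring
      simp only [e] at h
      rw [← h]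
      refine integral_congr_ae (Filter.Eventually.of_forall fun x => ?_)
      have d1 := differentiable_of_smooth hψ x
      have d2 := differentiable_of_smooth hφ x
      have d3 := differentiable_of_smooth hχ x
      simp only
      rw [pd_mul i (d1.fun_mul d2) d3, pd_mul i d1 d2]
      ring
    · exact integrable_box_of_continuous (((hψ.continuous.mul (continuous_pd hφ i)).mul
        hχ.continuous).add ((hψ.continuous.mul hφ.continuous).mul (continuous_pd hχ i)))
    · exact integrable_box_of_continuous (((continuous_pd hψ i).mul hφ.continuous).mul
        hχ.continuous)
    · exact integrable_box_of_continuous ((hψ.continuous.mul (continuous_pd hφ i)).mul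
        hχ.continuous)
    · exact integrable_box_of_continuous ((hψ.continuous.mul hφ.continuous).mul
        (continuous_pd hχ i))
  have key2 : ∀ f ∈ (smoothH1 l L : Set (H1 l L)), ∀ g,
      inner ℝ (T (DL l L i f)) (fnL l L g) + inner ℝ (T (fnL l L f)) (DL l L i g) +
      inner ℝ (T' (fnL l L f)) (fnL l L g) = inner ℝ (S (trL l L f)) (trL l L g) := by
    intro f hf g
    refine congrFun (Continuous.ext_on dense_smoothH1 (f := fun g => inner ℝ (T (DL l L i f)) (fnL l L g)
      + inner ℝ (T (fnL l L f)) (DL l L i g) + inner ℝ (T' (fnL l L f)) (fnL l L g))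
      (g := fun g => inner ℝ (S (trL l L f)) (trL l L g)) ?_ ?_ fun g hg => key f hf g hg) g
    · exact ((continuous_const.inner (fnL l L).continuous).add
        (continuous_const.inner (DL l L i).continuous)).add
        (continuous_const.inner (fnL l L).continuous)
    · exact continuous_const.inner (trL l L).continuous
  rw [← e1, ← e2, ← e3, ← e4]
  refine congrFun (Continuous.ext_on dense_smoothH1 (f := fun f => inner ℝ (T (DL l L i f)) (fnL l L g)
      + inner ℝ (T (fnL l L f)) (DL l L i g) + inner ℝ (T' (fnL l L f)) (fnL l L g))
      (g := fun f => inner ℝ (S (trL l L f)) (trL l L g)) ?_ ?_ fun f hf => key2 f hf g) f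
  · exact (((T.continuous.comp (DL l L i).continuous).inner continuous_const).add
      ((T.continuous.comp (fnL l L).continuous).inner continuous_const)).add
      ((T'.continuous.comp (fnL l L).continuous).inner continuous_const)
  · exact (S.continuous.comp (trL l L).continuous).inner continuous_const

end Green

/-! ### Multiplication by smooth functions -/

section MulSmooth

variable [Fact (0 < l)] [Fact (0 < L)]

/-- Multiplication by a smooth function is bounded on `H¹(Ω)` and commutes with the trace. -/
theorem exists_mulH1 {ψ : Pt → ℝ} (hψ : ContDiff ℝ ∞ ψ) :
    ∃ C : ℝ, 0 ≤ C ∧ ∀ u : H1 l L, ∃ v : H1 l L, ‖v‖ ≤ C * ‖u‖ ∧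
      trace v =ᵐ[surf l L] fun x => ψ x * trace u x := by
  obtain ⟨T, hT⟩ := exists_mulCLM_box (l := l) (L := L) hψ.continuous
  have hT' : ∀ i, ∃ T' : L2 l L →L[ℝ] L2 l L, ∀ f,
      T' f =ᵐ[volume.restrict (box l L)] fun x => pd i ψ x * f x := fun i =>
    exists_mulCLM_box (continuous_pd hψ i)
  choose T' hT' using hT'
  have hb : ∃ A : ℝ, ∀ᵐ x ∂(surf l L), |ψ x| ≤ A := by
    obtain ⟨A, hA⟩ := (isCompact_Icc (a := (0 : Pt)) (b := side l L)).exists_bound_of_continuousOn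
      hψ.continuous.continuousOn
    exact ⟨A, ae_surf_mem_Icc.mono fun x hx => hA x hx⟩
  obtain ⟨A, hA⟩ := hb
  obtain ⟨S, hS, -⟩ := exists_mulCLM (ν := surf l L) hψ.continuous.aestronglyMeasurable hA
  have hw : ∀ u : H1 l L, ∀ i, IsWeakDeriv l L i (T (fn u)) (T (D i u) + T' i (fn u)) := by
    intro u i τ hτ
    have hpsi : IsTest l L fun x => ψ x * τ x :=
      ⟨hψ.mul hτ.smooth, hτ.compact.mul_left, (tsupport_mul_subset_right).trans hτ.supp⟩
    have h := isWeakDeriv_D u i _ hpsi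
    have e1 : ∫ x in box l L, fn u x * pd i (fun x => ψ x * τ x) x =
        (∫ x in box l L, T (fn u) x * pd i τ x) + ∫ x in box l L, T' i (fn u) x * τ x := by
      rw [← integral_add (integrable_mul_of _ (hτ.memLp_pd i)) (integrable_mul_of _ hτ.memLp)]
      refine integral_congr_ae ?_
      filter_upwards [hT (fn u), hT' i (fn u)] with x h1 h2
      rw [h1, h2, pd_mul i (differentiable_of_smooth hψ x) (differentiable_of_smooth hτ.smooth x)]
      ring
    have e2 : ∫ x in box l L, D i u x * (ψ x * τ x) = ∫ x in box l L, T (D i u) x * τ x := by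
      refine integral_congr_ae ?_
      filter_upwards [hT (D i u)] with x h1
      rw [h1]; ring
    rw [integral_add_mul _ _ hτ.memLp]
    rw [e1, e2] at h
    linarith
  set E : H1 l L → H1 l L := fun u => mkH1 (T (fn u)) (fun i => T (D i u) + T' i (fn u)) (hw u)
  have hE : ∀ u, ‖E u‖ ≤ (‖T‖ + ∑ i, (‖T‖ + ‖T' i‖)) * ‖u‖ := by
    intro u
    have h0 : ‖fn (E u)‖ ≤ ‖T‖ * ‖u‖ :=
      (T.le_opNorm _).trans (mul_le_mul_of_nonneg_left (norm_fn_le u) (norm_nonneg _))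
    have hi : ∀ i, ‖D i (E u)‖ ≤ (‖T‖ + ‖T' i‖) * ‖u‖ := fun i => by
      refine (norm_add_le _ _).trans ?_
      rw [add_mul]
      exact add_le_add
        ((T.le_opNorm _).trans (mul_le_mul_of_nonneg_left (norm_D_le i u) (norm_nonneg _)))
        (((T' i).le_opNorm _).trans (mul_le_mul_of_nonneg_left (norm_fn_le u) (norm_nonneg _)))
    have hs : ‖E u‖ ≤ ‖fn (E u)‖ + ∑ i, ‖D i (E u)‖ := by
      refine abs_le_of_sq_le_sq' ?_ (by positivity) |>.2
      rw [norm_sq_H1, Fin.sum_univ_three, Fin.sum_univ_three]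
      nlinarith [norm_nonneg (fn (E u)), norm_nonneg (D 0 (E u)), norm_nonneg (D 1 (E u)),
        norm_nonneg (D 2 (E u)), mul_nonneg (norm_nonneg (fn (E u))) (norm_nonneg (D 0 (E u))),
        mul_nonneg (norm_nonneg (fn (E u))) (norm_nonneg (D 1 (E u))),
        mul_nonneg (norm_nonneg (fn (E u))) (norm_nonneg (D 2 (E u))),
        mul_nonneg (norm_nonneg (D 0 (E u))) (norm_nonneg (D 1 (E u))),
        mul_nonneg (norm_nonneg (D 0 (E u))) (norm_nonneg (D 2 (E u))),
        mul_nonneg (norm_nonneg (D 1 (E u))) (norm_nonneg (D 2 (E u)))]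
    refine hs.trans ?_
    rw [add_mul, Finset.sum_mul]
    exact add_le_add h0 (Finset.sum_le_sum fun i _ => hi i)
  have hEsub : ∀ u v, E u - E v = E (u - v) := fun u v =>
    H1_ext (by rw [fn_sub]; simp [E, fn_sub])
  have hEc : Continuous E := by
    have : LipschitzWith (Real.toNNReal (‖T‖ + ∑ i, (‖T‖ + ‖T' i‖))) E :=
      LipschitzWith.of_dist_le_mul fun u v => by
        rw [dist_eq_norm, dist_eq_norm, hEsub, Real.coe_toNNReal _ (by positivity)]
        exact hE _
    exact this.continuous
  -- Both sides are continuous in `u` and agree for functions smooth up to the boundary.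
  have htr : ∀ u, trace (E u) = S (trace u) := by
    have h1 : Continuous fun u => trace (E u) := (trL l L).continuous.comp hEc
    have h2 : Continuous fun u : H1 l L => S (trace u) := S.continuous.comp (trL l L).continuous
    refine congrFun (Continuous.ext_on dense_smoothH1 h1 h2 ?_)
    rintro _ ⟨φ, hφ, rfl⟩
    have : E (ofSmooth φ hφ) = ofSmooth _ (hψ.mul hφ) := by
      refine eq_ofSmooth _ ?_
      filter_upwards [hT (fn (ofSmooth φ hφ)), fn_ofSmooth (l := l) (L := L) hφ] with x h1 h2
      rw [← h2, ← h1]; rfl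
    simp only [this]
    refine Lp.ext ?_
    filter_upwards [trace_ofSmooth (l := l) (L := L) (hψ.mul hφ),
      hS (trace (ofSmooth (l := l) (L := L) φ hφ)), trace_ofSmooth (l := l) (L := L) hφ]
      with x h1 h2 h3
    rw [h1, h2, h3]
  exact ⟨_, by positivity, fun u => ⟨E u, hE u, by rw [htr]; exact hS _⟩⟩

end MulSmooth

/-! ### The Sobolev inequality -/

section Sobolev

theorem abs_integral_mul_le_sqrt {α : Type*} [MeasurableSpace α] {ν : Measure α} {a b : α → ℝ}
    (ha : MemLp a 2 ν) (hb : MemLp b 2 ν) :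
    |∫ x, a x * b x ∂ν| ≤ √(∫ x, a x ^ 2 ∂ν) * √(∫ x, b x ^ 2 ∂ν) := by
  rw [← inner_Lp_congr ha.coeFn_toLp hb.coeFn_toLp, ← norm_sq_Lp_congr ha.coeFn_toLp,
    ← norm_sq_Lp_congr hb.coeFn_toLp, Real.sqrt_sq (norm_nonneg _), Real.sqrt_sq (norm_nonneg _)]
  exact abs_real_inner_le_norm _ _

variable [Fact (0 < l)] [Fact (0 < L)]

/-- The fundamental theorem of calculus bounds `|g x|` by `|g|` at any other point of the line plus
the integral of `|∂ᵢ g|`; averaging over that point gives the factor `sᵢ⁻¹`. -/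
theorem abs_le_integral_line {g : Pt → ℝ} (hg : ContDiff ℝ ∞ g) (i : Fin 3) {x : Pt}
    (hx : x ∈ box l L) : |g x| ≤ ∫ t in Ioo 0 (side l L i),
      ((side l L i)⁻¹ * |g (Function.update x i t)| + |pd i g (Function.update x i t)|) := by
  have hs := side_pos (l := l) (L := L) i
  set s := side l L i
  have hup : Continuous fun t : ℝ => Function.update x i t := continuous_const.update i continuous_id
  have hgc : Continuous fun t : ℝ => |g (Function.update x i t)| := (hg.continuous.comp hup).abs
  have hpc : Continuous fun t : ℝ => pd i g (Function.update x i t) := (continuous_pd hg i).comp hup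
  set I := ∫ t in (0 : ℝ)..s, |pd i g (Function.update x i t)|
  have h1 : ∀ t ∈ Icc 0 s, |g x| ≤ |g (Function.update x i t)| + I := by
    intro t ht
    have hftc : ∫ r in t..(x i), pd i g (Function.update x i r) =
        g (Function.update x i (x i)) - g (Function.update x i t) :=
      intervalIntegral.integral_eq_sub_of_hasDerivAt
        (f := fun r => g (Function.update x i r))
        (fun r _ => hasDerivAt_comp_update (differentiable_of_smooth hg _))
        (hpc.intervalIntegrable _ _)
    rw [Function.update_eq_self] at hftc
    have hle : |∫ r in t..(x i), pd i g (Function.update x i r)| ≤ I := by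
      refine (intervalIntegral.norm_integral_le_integral_norm_uIoc (f := fun r =>
        pd i g (Function.update x i r)) (μ := volume)).trans ?_
      simp only [I]
      rw [intervalIntegral.integral_of_le hs.le]
      refine setIntegral_mono_set ?_ ?_ ?_
      · exact (hpc.abs.intervalIntegrable 0 s).1
      · exact Filter.Eventually.of_forall fun t => abs_nonneg _
      · refine (Filter.Eventually.of_forall ?_)
        intro r hr
        rcases mem_uIoc.1 hr with h | h
        · exact ⟨ht.1.trans_lt h.1, h.2.trans (hx i).2.le⟩
        · exact ⟨(hx i).1.trans h.1, h.2.trans ht.2⟩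
    rw [hftc] at hle
    have := abs_sub_abs_le_abs_sub (g x) (g (Function.update x i t))
    linarith
  rw [← integral_Ioc_eq_integral_Ioo, ← intervalIntegral.integral_of_le hs.le,
    intervalIntegral.integral_add (f := fun t => s⁻¹ * |g (Function.update x i t)|)
      ((continuous_const.mul hgc).intervalIntegrable _ _) (hpc.abs.intervalIntegrable _ _), intervalIntegral.integral_const_mul]
  have h2 : s * |g x| ≤ (∫ t in (0 : ℝ)..s, |g (Function.update x i t)|) + s * I := by
    have := intervalIntegral.integral_mono_on (g := fun t => |g (Function.update x i t)| + I) hs.le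
      (continuous_const.intervalIntegrable (μ := volume) 0 s)
      ((hgc.add continuous_const).intervalIntegrable (μ := volume) 0 s) h1
    rw [intervalIntegral.integral_add (hgc.intervalIntegrable _ _)
      (continuous_const.intervalIntegrable _ _)] at this
    simpa using this
  have h3 : |g x| = s⁻¹ * (s * |g x|) := by field_simp
  rw [h3]
  refine (mul_le_mul_of_nonneg_left h2 (inv_nonneg.2 hs.le)).trans_eq ?_
  rw [mul_add, ← mul_assoc, inv_mul_cancel₀ hs.ne', one_mul]

/-- The Gagliardo inequality on the box. -/
theorem integral_rpow_le {g : Pt → ℝ} (hg : ContDiff ℝ ∞ g) :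
    ∫ x in box l L, |g x| ^ (3 / 2 : ℝ) ≤
      (∫ x in box l L, ((∑ i, (side l L i)⁻¹) * |g x| + ∑ i, |pd i g x|)) ^ (3 / 2 : ℝ) := by
  set F : Pt → ℝ := fun x => (∑ i, (side l L i)⁻¹) * |g x| + ∑ i, |pd i g x| with hF
  have hA : 0 ≤ ∑ i, (side l L i)⁻¹ := Finset.sum_nonneg fun i _ => inv_nonneg.2 (side_pos i).le
  have hF0 : ∀ x, 0 ≤ F x := fun x =>
    add_nonneg (mul_nonneg hA (abs_nonneg _)) (Finset.sum_nonneg fun i _ => abs_nonneg _)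
  have hFc : Continuous F := by
    have h1 := hg.continuous
    have h2 := fun i => continuous_pd hg i
    exact (continuous_const.mul h1.abs).add (continuous_finsetSum _ fun i _ => (h2 i).abs)
  have hpi : volume.restrict (box l L) =
      Measure.pi fun i => (volume : Measure ℝ).restrict (Ioo 0 (side l L i)) := by
    rw [box_eq, volume_pi, Measure.restrict_pi_pi]
  have hconj : Real.HolderConjugate (Fintype.card (Fin 3)) (3 / 2) := by
    rw [Fintype.card_fin, Real.holderConjugate_iff]; norm_num
  -- The grid-lines inequality in dimension three: a product of three line integrals, each raised to
  -- `1/2`. Since `|g|` is below each of the line integrals, the product dominates `|g| ^ (3/2)`.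
  have hgrid := lintegral_prod_lintegral_pow_le
    (fun i : Fin 3 => (volume : Measure ℝ).restrict (Ioo 0 (side l L i))) hconj
    (f := fun x => ENNReal.ofReal (F x)) hFc.measurable.ennreal_ofReal
  rw [← hpi, Fintype.card_fin] at hgrid
  have hline : ∀ x ∈ box l L, ∀ i, ENNReal.ofReal |g x| ≤
      ∫⁻ t in Ioo 0 (side l L i), ENNReal.ofReal (F (Function.update x i t)) := by
    intro x hx i
    have hup : Continuous fun t : ℝ => Function.update x i t :=
      continuous_const.update i continuous_id
    have hint : ∀ {q : ℝ → ℝ}, Continuous q → IntegrableOn q (Ioo 0 (side l L i)) := fun hq =>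
      (hq.integrableOn_Icc).mono_set Ioo_subset_Icc_self
    rw [← ofReal_integral_eq_lintegral_ofReal (f := fun t => F (Function.update x i t))
      (hint (hFc.comp hup))
      (Filter.Eventually.of_forall fun t => hF0 _)]
    refine ENNReal.ofReal_le_ofReal ((abs_le_integral_line hg i hx).trans ?_)
    refine setIntegral_mono_on (hint ?_) (hint (hFc.comp hup)) measurableSet_Ioo fun t _ => ?_
    · exact (continuous_const.mul (hg.continuous.comp hup).abs).add
        ((continuous_pd hg i).comp hup).abs
    · refine add_le_add (mul_le_mul_of_nonneg_right ?_ (abs_nonneg _)) ?_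
      · exact Finset.single_le_sum (f := fun i => (side l L i)⁻¹)
          (fun i _ => inv_nonneg.2 (side_pos i).le) (Finset.mem_univ i)
      · exact Finset.single_le_sum (f := fun j => |pd j g (Function.update x i t)|)
          (fun i _ => abs_nonneg _) (Finset.mem_univ i)
  have hmain : ∫⁻ x in box l L, ENNReal.ofReal |g x| ^ (3 / 2 : ℝ) ≤
      (∫⁻ x in box l L, ENNReal.ofReal (F x)) ^ (3 / 2 : ℝ) := by
    refine le_trans (setLIntegral_mono' (measurableSet_box l L) fun x hx => ?_) hgrid
    calc ENNReal.ofReal |g x| ^ (3 / 2 : ℝ)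
        = ∏ _i : Fin 3, ENNReal.ofReal |g x| ^ ((1 : ℝ) / ((3 : ℕ) - 1 : ℝ)) := by
          rw [Finset.prod_const, Finset.card_univ, Fintype.card_fin, ← ENNReal.rpow_natCast,
            ← ENNReal.rpow_mul]
          norm_num
      _ ≤ _ := Finset.prod_le_prod' fun i _ =>
          ENNReal.rpow_le_rpow (hline x hx i) (by norm_num)
  have hgc : Continuous fun x => |g x| ^ (3 / 2 : ℝ) :=
    hg.continuous.abs.rpow_const fun x => Or.inr (by norm_num)
  have e1 : ∫⁻ x in box l L, ENNReal.ofReal |g x| ^ (3 / 2 : ℝ) =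
      ENNReal.ofReal (∫ x in box l L, |g x| ^ (3 / 2 : ℝ)) := by
    rw [ofReal_integral_eq_lintegral_ofReal (integrable_box_of_continuous hgc)
      (Filter.Eventually.of_forall fun x => by positivity)]
    refine lintegral_congr fun x => ?_
    rw [ENNReal.ofReal_rpow_of_nonneg (abs_nonneg _) (by norm_num)]
  have hI0 : 0 ≤ ∫ x in box l L, F x := integral_nonneg hF0
  rw [e1, ← ofReal_integral_eq_lintegral_ofReal (integrable_box_of_continuous hFc)
    (Filter.Eventually.of_forall hF0), ENNReal.ofReal_rpow_of_nonneg hI0 (by norm_num)] at hmain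
  exact (ENNReal.ofReal_le_ofReal_iff (by positivity)).1 hmain

/-- A Sobolev constant of the box. -/
def sobConst (l L : ℝ) : ℝ := (∑ i, (side l L i)⁻¹) + 12

theorem sobConst_pos : 0 < sobConst l L := by
  have hA : 0 ≤ ∑ i, (side l L i)⁻¹ := Finset.sum_nonneg fun i _ => inv_nonneg.2 (side_pos i).le
  unfold sobConst; linarith

/-- Apply the Gagliardo inequality to `φ⁴`: the left side becomes `S = ∫ φ⁶`, and on the right
`∂ᵢ(φ⁴) = 4 φ³ ∂ᵢφ` is handled by Cauchy–Schwarz. This gives `S ≤ (√S K)^(3/2)`, that is `√S ≤ K³`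
unless `S = 0`. The `12` in the Sobolev constant is this `4`, once for each direction. -/
theorem integral_pow_six_le {φ : Pt → ℝ} (h : ContDiff ℝ ∞ φ) :
    √(∫ x in box l L, φ x ^ 6) ≤ (sobConst l L * ‖ofSmooth (l := l) (L := L) φ h‖) ^ 3 := by
  set N := ‖ofSmooth (l := l) (L := L) φ h‖
  set A := ∑ i, (side l L i)⁻¹ with hAdef
  have hA : 0 ≤ A := Finset.sum_nonneg fun i _ => inv_nonneg.2 (side_pos i).le
  set S := ∫ x in box l L, φ x ^ 6
  have hS0 : 0 ≤ S := integral_nonneg fun x => by positivity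
  have hc := h.continuous
  have hc3 : Continuous fun x => φ x ^ 3 := hc.pow 3
  have hpc := fun i => continuous_pd h i
  have hg := integral_rpow_le (l := l) (L := L) (h.pow 4)
  have e1 : ∀ x, |φ x ^ 4| ^ (3 / 2 : ℝ) = φ x ^ 6 := fun x => by
    rw [abs_pow, ← Real.rpow_natCast, ← Real.rpow_mul (abs_nonneg _)]
    norm_num
    exact Even.pow_abs (by decide) _
  have e2 : ∀ i x, |pd i (fun x => φ x ^ 4) x| = |φ x ^ 3| * (4 * |pd i φ x|) := fun i x => by
    have hd := differentiable_of_smooth h x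
    have : pd i (fun x => φ x ^ 4) x = 4 * φ x ^ 3 * pd i φ x := by
      unfold pd
      rw [fderiv_fun_pow 4 hd]
      simp
    rw [this, abs_mul, abs_mul, abs_of_pos (show (0 : ℝ) < 4 by norm_num)]
    ring
  simp only [e1, e2] at hg
  have hn0 : ∫ x in box l L, φ x ^ 2 ≤ N ^ 2 := by
    rw [← norm_sq_Lp_congr (fn_ofSmooth (l := l) (L := L) h)]
    exact pow_le_pow_left₀ (norm_nonneg _) (norm_fn_le _) 2
  have hni : ∀ i, ∫ x in box l L, pd i φ x ^ 2 ≤ N ^ 2 := fun i => by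
    rw [← norm_sq_Lp_congr (D_ofSmooth (l := l) (L := L) h i)]
    exact pow_le_pow_left₀ (norm_nonneg _) (norm_D_le i _) 2
  have hN0 : 0 ≤ N := norm_nonneg _
  have hcs : ∀ {q : Pt → ℝ}, Continuous q → ∫ x in box l L, q x ^ 2 ≤ N ^ 2 →
      ∫ x in box l L, |φ x ^ 3| * |q x| ≤ √S * N := by
    intro q hq hqN
    have := abs_integral_mul_le_sqrt
      (memLp_box_of_continuous (l := l) (L := L) hc3.abs 2)
      (memLp_box_of_continuous (l := l) (L := L) hq.abs 2)
    refine (le_abs_self _).trans (this.trans ?_)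
    have e3 : ∀ x, |φ x ^ 3| ^ 2 = φ x ^ 6 := fun x => by rw [sq_abs]; ring
    simp only [e3, sq_abs]
    refine mul_le_mul_of_nonneg_left ?_ (Real.sqrt_nonneg _)
    exact Real.sqrt_le_iff.2 ⟨hN0, hqN⟩
  have hint : ∫ x in box l L, (A * |φ x ^ 4| + ∑ i, |φ x ^ 3| * (4 * |pd i φ x|)) ≤
      √S * (sobConst l L * N) := by
    have e4 : ∀ x, A * |φ x ^ 4| + ∑ i, |φ x ^ 3| * (4 * |pd i φ x|) =
        A * (|φ x ^ 3| * |φ x|) + ∑ i, 4 * (|φ x ^ 3| * |pd i φ x|) := fun x => by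
      congr 1
      · rw [← abs_mul]; ring_nf
      · exact Finset.sum_congr rfl fun i _ => by ring
    simp only [e4]
    rw [integral_add, integral_finsetSum, integral_const_mul]
    · simp only [integral_const_mul]
      calc A * (∫ x in box l L, |φ x ^ 3| * |φ x|) +
            ∑ i, 4 * ∫ x in box l L, |φ x ^ 3| * |pd i φ x|
          ≤ A * (√S * N) + ∑ _i : Fin 3, 4 * (√S * N) := by
            refine add_le_add (mul_le_mul_of_nonneg_left (hcs hc hn0) hA)
              (Finset.sum_le_sum fun i _ => mul_le_mul_of_nonneg_left (hcs (hpc i) (hni i))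
                (by norm_num))
        _ = √S * (sobConst l L * N) := by
            simp [sobConst, ← hAdef]; ring
    · exact fun i _ => integrable_box_of_continuous
        (continuous_const.mul (hc3.abs.mul (hpc i).abs))
    · exact integrable_box_of_continuous (continuous_const.mul (hc3.abs.mul hc.abs))
    · exact integrable_box_of_continuous (continuous_finsetSum _ fun i _ =>
        continuous_const.mul (hc3.abs.mul (hpc i).abs))
  have hK0 : 0 ≤ sobConst l L * N := mul_nonneg sobConst_pos.le hN0
  set K := sobConst l L * N
  have hS1 : S ≤ (√S * K) ^ (3 / 2 : ℝ) := by
    refine hg.trans (Real.rpow_le_rpow (integral_nonneg fun x => ?_) hint (by norm_num))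
    exact add_nonneg (mul_nonneg hA (abs_nonneg _))
      (Finset.sum_nonneg fun i _ => by positivity)
  have hr0 : 0 ≤ √S := Real.sqrt_nonneg _
  have hS2 : S ^ 2 ≤ (√S * K) ^ 3 := by
    have h2 := pow_le_pow_left₀ hS0 hS1 2
    rwa [← Real.rpow_natCast ((√S * K) ^ (3 / 2 : ℝ)), ← Real.rpow_mul (by positivity),
      show (3 / 2 : ℝ) * ((2 : ℕ) : ℝ) = ((3 : ℕ) : ℝ) by norm_num, Real.rpow_natCast] at h2
  have hS3 : √S ^ 3 * √S ≤ √S ^ 3 * K ^ 3 := by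
    have : √S ^ 3 * √S = S ^ 2 := by
      nth_rewrite 3 [← Real.sq_sqrt hS0]; ring
    rw [this, ← mul_pow]; exact hS2
  rcases hr0.eq_or_lt with h0 | h0
  · rw [← h0]; positivity
  · exact le_of_mul_le_mul_left hS3 (by positivity)

/-- Interpolation between `L²` and `L⁶`: Cauchy–Schwarz for `φ · φ³`. -/
theorem integral_pow_four_le {φ : Pt → ℝ} (h : ContDiff ℝ ∞ φ) :
    ∫ x in box l L, φ x ^ 4 ≤ (sobConst l L * ‖ofSmooth (l := l) (L := L) φ h‖) ^ 4 := by
  set N := ‖ofSmooth (l := l) (L := L) φ h‖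
  have hc := h.continuous
  have hN0 : 0 ≤ N := norm_nonneg _
  have hc3 : Continuous fun x => φ x ^ 3 := hc.pow 3
  have h1 := abs_integral_mul_le_sqrt (memLp_box_of_continuous (l := l) (L := L) hc 2)
    (memLp_box_of_continuous (l := l) (L := L) hc3 2)
  have e1 : ∀ x, φ x * φ x ^ 3 = φ x ^ 4 := fun x => by ring
  have e2 : ∀ x, (φ x ^ 3) ^ 2 = φ x ^ 6 := fun x => by ring
  simp only [e1, e2] at h1
  have h2 : √(∫ x in box l L, φ x ^ 2) ≤ N := by
    rw [← norm_sq_Lp_congr (fn_ofSmooth (l := l) (L := L) h), Real.sqrt_sq (norm_nonneg _)]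
    exact norm_fn_le _
  have hs1 : 1 ≤ sobConst l L := by
    have hA : 0 ≤ ∑ i, (side l L i)⁻¹ := Finset.sum_nonneg fun i _ => inv_nonneg.2 (side_pos i).le
    unfold sobConst; linarith
  have h3 : N ≤ sobConst l L * N := le_mul_of_one_le_left hN0 hs1
  calc ∫ x in box l L, φ x ^ 4 ≤ _ := (le_abs_self _).trans h1
    _ ≤ (sobConst l L * N) * (sobConst l L * N) ^ 3 :=
        mul_le_mul (h2.trans h3) (integral_pow_six_le h) (Real.sqrt_nonneg _) (hN0.trans h3)
    _ = (sobConst l L * N) ^ 4 := by ring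

theorem eLpNorm_four_ofSmooth_le {φ : Pt → ℝ} (h : ContDiff ℝ ∞ φ) :
    eLpNorm φ 4 (volume.restrict (box l L)) ≤
      ENNReal.ofReal (sobConst l L * ‖ofSmooth (l := l) (L := L) φ h‖) := by
  have hK : 0 ≤ sobConst l L * ‖ofSmooth (l := l) (L := L) φ h‖ :=
    mul_nonneg sobConst_pos.le (norm_nonneg _)
  rw [(memLp_box_of_continuous (l := l) (L := L) h.continuous 4).eLpNorm_eq_integral_rpow_norm
    (by norm_num) (by norm_num)]
  refine ENNReal.ofReal_le_ofReal ?_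
  have e : ∀ x, ‖φ x‖ ^ (4 : ℝ≥0∞).toReal = φ x ^ 4 := fun x => by
    rw [show (4 : ℝ≥0∞).toReal = ((4 : ℕ) : ℝ) by simp, Real.rpow_natCast, Real.norm_eq_abs,
      Even.pow_abs (by decide)]
  simp only [e]
  rw [show (4 : ℝ≥0∞).toReal = (4 : ℝ) by simp]
  refine (Real.rpow_le_rpow (integral_nonneg fun x => by positivity)
    (integral_pow_four_le h) (by norm_num)).trans_eq ?_
  rw [← Real.rpow_natCast, ← Real.rpow_mul hK]
  norm_num

/-- The embedding of `H¹(Ω)` into `L⁴(Ω)`. -/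
theorem eLpNorm_four_le (u : H1 l L) :
    eLpNorm (fn u) 4 (volume.restrict (box l L)) ≤ ENNReal.ofReal (sobConst l L * ‖u‖) := by
  obtain ⟨v, hv, hlim⟩ := mem_closure_iff_seq_limit.1 (dense_smoothH1 u)
  have hfn : Filter.Tendsto (fun n => fn (v n)) Filter.atTop (nhds (fn u)) :=
    ((fnL l L).continuous.tendsto u).comp hlim
  -- Convergence in `L²` gives a subsequence converging almost everywhere, along which the `L⁴` norm
  -- is lower semicontinuous.
  obtain ⟨ns, hns, hae⟩ := (tendstoInMeasure_of_tendsto_Lp hfn).exists_seq_tendsto_ae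
  have hbound : ∀ n, eLpNorm (fn (v n)) 4 (volume.restrict (box l L)) ≤
      ENNReal.ofReal (sobConst l L * ‖v n‖) := fun n => by
    obtain ⟨φ, hφ, h⟩ := hv n
    rw [h, eLpNorm_congr_ae (fn_ofSmooth hφ)]
    exact eLpNorm_four_ofSmooth_le hφ
  refine (Lp.eLpNorm_lim_le_liminf_eLpNorm (fun n => Lp.aestronglyMeasurable (fn (v (ns n))))
    (fn u) hae).trans ?_
  have hlim2 : Filter.Tendsto (fun n => ENNReal.ofReal (sobConst l L * ‖v (ns n)‖)) Filter.atTop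
      (nhds (ENNReal.ofReal (sobConst l L * ‖u‖))) :=
    ENNReal.tendsto_ofReal ((hlim.comp hns.tendsto_atTop).norm.const_mul _)
  rw [← hlim2.liminf_eq]
  exact Filter.liminf_le_liminf (Filter.Eventually.of_forall fun n => hbound (ns n))

theorem memLp_four (u : H1 l L) : MemLp (fn u) 4 (volume.restrict (box l L)) :=
  ⟨Lp.aestronglyMeasurable _, (eLpNorm_four_le u).trans_lt ENNReal.ofReal_lt_top⟩

end Sobolev

/-! ### Products of functions in `H¹(Ω)` -/

section Product

variable [Fact (0 < l)] [Fact (0 < L)]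

instance : ENNReal.HolderTriple 4 4 2 := ⟨by
  rw [show (4 : ℝ≥0∞) = 2 * 2 by norm_num,
    ENNReal.mul_inv (Or.inl (by norm_num)) (Or.inl (by norm_num)), ← mul_add,
    ENNReal.inv_two_add_inv_two, mul_one]⟩

theorem memLp_mul_fn (u v : H1 l L) :
    MemLp (fun x => fn u x * fn v x) 2 (volume.restrict (box l L)) :=
  (memLp_four v).mul (p := 4) (q := 4) (r := 2) (memLp_four u)

theorem norm_toLp_mul_le (u v : H1 l L) :
    ‖(memLp_mul_fn u v).toLp‖ ≤ sobConst l L ^ 2 * ‖u‖ * ‖v‖ := by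
  have h := eLpNorm_smul_le_mul_eLpNorm (p := 4) (q := 4) (r := 2) (memLp_four v).1 (memLp_four u).1
  have h2 : eLpNorm (fun x => fn u x * fn v x) 2 (volume.restrict (box l L)) ≤
      ENNReal.ofReal (sobConst l L ^ 2 * ‖u‖ * ‖v‖) := by
    refine h.trans ((mul_le_mul' (eLpNorm_four_le u) (eLpNorm_four_le v)).trans_eq ?_)
    rw [← ENNReal.ofReal_mul (mul_nonneg sobConst_pos.le (norm_nonneg _))]
    ring_nf
  rw [Lp.norm_toLp]
  exact ENNReal.toReal_le_of_le_ofReal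
    (mul_nonneg (mul_nonneg (sq_nonneg _) (norm_nonneg _)) (norm_nonneg _)) h2

/-- The product of two functions of `H¹(Ω)`, as a bounded bilinear map into `L²(Ω)`. -/
def prodL (l L : ℝ) [Fact (0 < l)] [Fact (0 < L)] : H1 l L →L[ℝ] H1 l L →L[ℝ] L2 l L :=
  LinearMap.mkContinuous₂ (LinearMap.mk₂ ℝ (fun u v : H1 l L => (memLp_mul_fn u v).toLp)
    (fun u u' v => by
      refine Lp.ext ?_
      filter_upwards [(memLp_mul_fn (u + u') v).coeFn_toLp, (memLp_mul_fn u v).coeFn_toLp,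
        (memLp_mul_fn u' v).coeFn_toLp, Lp.coeFn_add (fn u) (fn u'),
        Lp.coeFn_add (memLp_mul_fn u v).toLp (memLp_mul_fn u' v).toLp] with x h1 h2 h3 h4 h5
      rw [h1, h5, Pi.add_apply, h2, h3, fn_add, h4, Pi.add_apply, add_mul])
    (fun c u v => by
      refine Lp.ext ?_
      filter_upwards [(memLp_mul_fn (c • u) v).coeFn_toLp, (memLp_mul_fn u v).coeFn_toLp,
        Lp.coeFn_smul c (fn u), Lp.coeFn_smul c (memLp_mul_fn u v).toLp] with x h1 h2 h4 h5
      rw [h1, h5, Pi.smul_apply, h2, fn_smul, h4, Pi.smul_apply, smul_eq_mul, smul_eq_mul, mul_assoc])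
    (fun u v v' => by
      refine Lp.ext ?_
      filter_upwards [(memLp_mul_fn u (v + v')).coeFn_toLp, (memLp_mul_fn u v).coeFn_toLp,
        (memLp_mul_fn u v').coeFn_toLp, Lp.coeFn_add (fn v) (fn v'),
        Lp.coeFn_add (memLp_mul_fn u v).toLp (memLp_mul_fn u v').toLp] with x h1 h2 h3 h4 h5
      rw [h1, h5, Pi.add_apply, h2, h3, fn_add, h4, Pi.add_apply, mul_add])
    (fun c u v => by
      refine Lp.ext ?_
      filter_upwards [(memLp_mul_fn u (c • v)).coeFn_toLp, (memLp_mul_fn u v).coeFn_toLp,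
        Lp.coeFn_smul c (fn v), Lp.coeFn_smul c (memLp_mul_fn u v).toLp] with x h1 h2 h4 h5
      rw [h1, h5, Pi.smul_apply, h2, fn_smul, h4, Pi.smul_apply, smul_eq_mul, smul_eq_mul]
      ring))
    (sobConst l L ^ 2) fun u v => norm_toLp_mul_le u v

theorem prodL_ae (u v : H1 l L) :
    prodL l L u v =ᵐ[volume.restrict (box l L)] fun x => fn u x * fn v x :=
  (memLp_mul_fn u v).coeFn_toLp

end Product

/-! ### The `L²` norm of functions on the box -/

section N2

/-- The `L²(Ω)` norm of a function. -/
def n2 (l L : ℝ) (f : Pt → ℝ) : ℝ := √(∫ x in box l L, f x ^ 2)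

theorem n2_nonneg (f : Pt → ℝ) : 0 ≤ n2 l L f := Real.sqrt_nonneg _

theorem n2_sq (f : Pt → ℝ) : n2 l L f ^ 2 = ∫ x in box l L, f x ^ 2 :=
  Real.sq_sqrt (integral_nonneg fun _ => sq_nonneg _)

theorem n2_eq_norm {u : L2 l L} {f : Pt → ℝ} (h : u =ᵐ[volume.restrict (box l L)] f) :
    n2 l L f = ‖u‖ := by
  rw [n2, ← norm_sq_Lp_congr h, Real.sqrt_sq (norm_nonneg _)]

theorem n2_add_le {f g : Pt → ℝ} (hf : MemLp f 2 (volume.restrict (box l L)))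
    (hg : MemLp g 2 (volume.restrict (box l L))) :
    n2 l L (fun x => f x + g x) ≤ n2 l L f + n2 l L g := by
  change n2 l L (f + g) ≤ _
  rw [n2_eq_norm hf.coeFn_toLp, n2_eq_norm hg.coeFn_toLp, n2_eq_norm (hf.add hg).coeFn_toLp,
    MemLp.toLp_add hf hg]
  exact norm_add_le _ _

theorem n2_neg (f : Pt → ℝ) : n2 l L (fun x => - f x) = n2 l L f := by simp [n2]

theorem n2_sub_le {f g : Pt → ℝ} (hf : MemLp f 2 (volume.restrict (box l L)))
    (hg : MemLp g 2 (volume.restrict (box l L))) :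
    n2 l L (fun x => f x - g x) ≤ n2 l L f + n2 l L g := by
  have := n2_add_le hf hg.neg
  simp only [Pi.neg_apply, ← sub_eq_add_neg] at this
  rwa [show n2 l L (-g) = n2 l L g from n2_neg g] at this

theorem n2_zero : n2 l L (fun _ => 0) = 0 := by simp [n2]

theorem n2_sum_le {ι : Type*} (s : Finset ι) {f : ι → Pt → ℝ}
    (hf : ∀ k ∈ s, MemLp (f k) 2 (volume.restrict (box l L))) :
    n2 l L (fun x => ∑ k ∈ s, f k x) ≤ ∑ k ∈ s, n2 l L (f k) := by
  classical
  induction s using Finset.induction_on with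
  | empty => simp [n2_zero]
  | insert a s ha ih =>
    simp only [Finset.sum_insert ha]
    refine (n2_add_le (hf a (Finset.mem_insert_self a s)) (memLp_finsetSum _ fun k hk =>
      hf k (Finset.mem_insert_of_mem hk))).trans ?_
    exact add_le_add le_rfl (ih fun k hk => hf k (Finset.mem_insert_of_mem hk))

theorem n2_mono {f g : Pt → ℝ} (hg : MemLp g 2 (volume.restrict (box l L)))
    (h : ∀ x ∈ box l L, |f x| ≤ |g x|) : n2 l L f ≤ n2 l L g := by
  refine Real.sqrt_le_sqrt (integral_mono_of_nonneg (Filter.Eventually.of_forall fun x => sq_nonneg _)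
    hg.integrable_sq ?_)
  exact (ae_restrict_mem (measurableSet_box l L)).mono fun x hx => sq_le_sq.2 (h x hx)

theorem n2_const_mul (c : ℝ) (f : Pt → ℝ) : n2 l L (fun x => c * f x) = |c| * n2 l L f := by
  simp only [n2, mul_pow]
  rw [integral_const_mul, Real.sqrt_mul (sq_nonneg c), Real.sqrt_sq_eq_abs]

theorem n2_mul_le {m f : Pt → ℝ} {C : ℝ} (hC : ∀ x ∈ box l L, |m x| ≤ C)
    (hC0 : 0 ≤ C) (hf : MemLp f 2 (volume.restrict (box l L))) :
    n2 l L (fun x => m x * f x) ≤ C * n2 l L f := by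
  rw [← abs_of_nonneg hC0, ← n2_const_mul]
  refine n2_mono (hf.const_mul C) fun x hx => ?_
  rw [abs_mul, abs_mul, abs_of_nonneg hC0]
  exact mul_le_mul_of_nonneg_right (hC x hx) (abs_nonneg _)

theorem exists_bound_box {m : Pt → ℝ} (hm : Continuous m) :
    ∃ C, 0 ≤ C ∧ ∀ x ∈ box l L, |m x| ≤ C := by
  obtain ⟨C, hC⟩ := (isCompact_Icc (a := (0 : Pt)) (b := side l L)).exists_bound_of_continuousOn
    hm.continuousOn
  exact ⟨max C 0, le_max_right _ _, fun x hx => (hC x (box_subset_Icc l L hx)).trans (le_max_left _ _)⟩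

/-- The `H¹(Ω)` norm (up to equivalence) of a smooth function. -/
def h1 (l L : ℝ) (f : Pt → ℝ) : ℝ := n2 l L f + ∑ i, n2 l L (pd i f)

theorem h1_nonneg (f : Pt → ℝ) : 0 ≤ h1 l L f :=
  add_nonneg (n2_nonneg _) (Finset.sum_nonneg fun _ _ => n2_nonneg _)

theorem n2_le_h1 (f : Pt → ℝ) : n2 l L f ≤ h1 l L f :=
  le_add_of_nonneg_right (Finset.sum_nonneg fun _ _ => n2_nonneg _)

theorem n2_pd_le_h1 (f : Pt → ℝ) (i : Fin 3) : n2 l L (pd i f) ≤ h1 l L f :=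
  (Finset.single_le_sum (f := fun i => n2 l L (pd i f)) (fun _ _ => n2_nonneg _)
    (Finset.mem_univ i)).trans (le_add_of_nonneg_left (n2_nonneg _))

theorem memLp_smooth {f : Pt → ℝ} (h : ContDiff ℝ ∞ f) : MemLp f 2 (volume.restrict (box l L)) :=
  memLp_box_of_continuous h.continuous 2

theorem h1_le {f : Pt → ℝ} {A : ℝ} (h0 : n2 l L f ≤ A) (hi : ∀ i, n2 l L (pd i f) ≤ A) :
    h1 l L f ≤ 4 * A := by
  unfold h1
  rw [Fin.sum_univ_three]
  linarith [hi 0, hi 1, hi 2]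

theorem h1_const_mul (c : ℝ) {f : Pt → ℝ} (hf : ContDiff ℝ ∞ f) :
    h1 l L (fun x => c * f x) = |c| * h1 l L f := by
  have : ∀ i, pd i (fun x => c * f x) = fun x => c * pd i f x := fun i => funext fun x =>
    pd_const_mul i c (differentiable_of_smooth hf x)
  simp only [h1, this, n2_const_mul, ← Finset.mul_sum, mul_add]

theorem h1_sum_le {ι : Type*} (s : Finset ι) {f : ι → Pt → ℝ} (hf : ∀ k ∈ s, ContDiff ℝ ∞ (f k)) :
    h1 l L (fun x => ∑ k ∈ s, f k x) ≤ ∑ k ∈ s, h1 l L (f k) := by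
  unfold h1
  rw [Finset.sum_add_distrib, Finset.sum_comm]
  refine add_le_add (n2_sum_le s fun k hk => memLp_smooth (hf k hk))
    (Finset.sum_le_sum fun i _ => ?_)
  have : pd i (fun x => ∑ k ∈ s, f k x) = fun x => ∑ k ∈ s, pd i (f k) x := funext fun x =>
    pd_sum s i fun k hk => differentiable_of_smooth (hf k hk) x
  rw [this]
  exact n2_sum_le s fun k hk => memLp_smooth (contDiff_pd (hf k hk) i)

theorem exists_h1_mul_le {m : Pt → ℝ} (hm : ContDiff ℝ ∞ m) :
    ∃ C, 0 ≤ C ∧ ∀ f, ContDiff ℝ ∞ f → h1 l L (fun x => m x * f x) ≤ C * h1 l L f := by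
  obtain ⟨C0, hC0, h0⟩ := exists_bound_box (l := l) (L := L) hm.continuous
  have hb := fun i => exists_bound_box (l := l) (L := L) (continuous_pd hm i)
  choose C1 hC1 hi using hb
  refine ⟨4 * (C0 + ∑ i, C1 i), mul_nonneg zero_le_four
    (add_nonneg hC0 (Finset.sum_nonneg fun i _ => hC1 i)), fun f hf => ?_⟩
  have hS : 0 ≤ ∑ i, C1 i := Finset.sum_nonneg fun i _ => hC1 i
  have hle : ∀ i, C1 i ≤ ∑ i, C1 i := fun i =>
    Finset.single_le_sum (f := C1) (fun i _ => hC1 i) (Finset.mem_univ i)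
  rw [mul_assoc]
  refine h1_le ?_ fun i => ?_
  · refine (n2_mul_le h0 hC0 (memLp_smooth hf)).trans ?_
    exact mul_le_mul (le_add_of_nonneg_right hS) (n2_le_h1 f) (n2_nonneg _) (add_nonneg hC0 hS)
  · have : pd i (fun x => m x * f x) = fun x => pd i m x * f x + m x * pd i f x := funext fun x =>
      pd_mul i (differentiable_of_smooth hm x) (differentiable_of_smooth hf x)
    rw [this]
    refine (n2_add_le (memLp_smooth ((contDiff_pd hm i).mul hf))
      (memLp_smooth (hm.mul (contDiff_pd hf i)))).trans ?_
    have a1 := n2_mul_le (hi i) (hC1 i) (memLp_smooth (l := l) (L := L) hf)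
    have a2 := n2_mul_le h0 hC0 (memLp_smooth (l := l) (L := L) (contDiff_pd hf i))
    have a3 : C1 i * n2 l L f ≤ (∑ i, C1 i) * h1 l L f :=
      mul_le_mul (hle i) (n2_le_h1 f) (n2_nonneg _) hS
    have a4 : C0 * n2 l L (pd i f) ≤ C0 * h1 l L f :=
      mul_le_mul_of_nonneg_left (n2_pd_le_h1 f i) hC0
    linarith

theorem norm_ofSmooth_le [Fact (0 < l)] [Fact (0 < L)] {f : Pt → ℝ} (hf : ContDiff ℝ ∞ f) :
    ‖ofSmooth (l := l) (L := L) f hf‖ ≤ h1 l L f := by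
  refine abs_le_of_sq_le_sq' ?_ (h1_nonneg f) |>.2
  rw [norm_sq_H1, ← n2_eq_norm (fn_ofSmooth hf)]
  simp only [← n2_eq_norm (D_ofSmooth hf _)]
  unfold h1
  have h0 := n2_nonneg (l := l) (L := L) f
  have hi := fun i => n2_nonneg (l := l) (L := L) (pd i f)
  rw [Fin.sum_univ_three, Fin.sum_univ_three]
  nlinarith [mul_nonneg h0 (hi 0), mul_nonneg h0 (hi 1), mul_nonneg h0 (hi 2),
    mul_nonneg (hi 0) (hi 1), mul_nonneg (hi 0) (hi 2), mul_nonneg (hi 1) (hi 2)]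

end N2

/-! ### Composition with diagonal affine maps -/

section Affine

/-- The map `x ↦ (αᵢ + βᵢ xᵢ)ᵢ`. -/
def aff (α β : Pt) (x : Pt) : Pt := fun i => α i + β i * x i

theorem contDiff_aff (α β : Pt) : ContDiff ℝ ∞ (aff α β) :=
  contDiff_pi.2 fun i => by
    simp only [aff]
    fun_prop

theorem lintegral_comp_aff (α : Pt) {β : Pt} (hβ : ∀ i, β i ≠ 0) {g : Pt → ℝ≥0∞}
    (hg : Measurable g) :
    ENNReal.ofReal (∏ i, |β i|) * ∫⁻ x, g (aff α β x) = ∫⁻ x, g x := by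
  have hdet : (Matrix.diagonal β).det ≠ 0 := by
    rw [Matrix.det_diagonal]; exact Finset.prod_ne_zero_iff.2 fun i _ => hβ i
  have h := Real.smul_map_diagonal_volume_pi hdet
  rw [Matrix.det_diagonal, Finset.abs_prod] at h
  have hlin : ∀ x : Pt, aff α β x = α + Matrix.toLin' (Matrix.diagonal β) x := fun x => by
    funext i
    simp [aff, Matrix.mulVec_diagonal]
  have hm : Measurable (Matrix.toLin' (Matrix.diagonal β)) :=
    (LinearMap.continuous_of_finiteDimensional _).measurable
  have hg2 : Measurable fun x : Pt => g (α + x) := hg.comp (measurable_const_add α)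
  calc ENNReal.ofReal (∏ i, |β i|) * ∫⁻ x, g (aff α β x)
      = ENNReal.ofReal (∏ i, |β i|) *
          ∫⁻ x, g (α + x) ∂(Measure.map (Matrix.toLin' (Matrix.diagonal β)) volume) := by
        rw [lintegral_map hg2 hm]
        simp only [hlin]
    _ = ∫⁻ x, g (α + x) := by
        rw [← smul_eq_mul, ← lintegral_smul_measure, h]
    _ = ∫⁻ x, g x := lintegral_add_left_eq_self g α

/-- The Jacobian of the map is at least `(1/6)³ = 1/216`. -/
theorem lintegral_box_comp_aff_le (α : Pt) {β : Pt} (hβ : ∀ i, 1 / 6 ≤ |β i|)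
    (hmaps : MapsTo (aff α β) (box l L) (box l L)) {g : Pt → ℝ≥0∞} (hg : Measurable g) :
    ∫⁻ x in box l L, g (aff α β x) ≤ 216 * ∫⁻ x in box l L, g x := by
  have hβ0 : ∀ i, β i ≠ 0 := fun i h0 => by
    have := hβ i
    rw [h0, abs_zero] at this
    norm_num at this
  have h := lintegral_comp_aff α hβ0 (hg.indicator (measurableSet_box l L))
  rw [lintegral_indicator (measurableSet_box l L)] at h
  rw [← h, ← mul_assoc]
  have h1 : 1 ≤ 216 * ENNReal.ofReal (∏ i, |β i|) := by
    rw [show (216 : ℝ≥0∞) = ENNReal.ofReal 216 by norm_num, ← ENNReal.ofReal_mul (by norm_num),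
      ← ENNReal.ofReal_one]
    refine ENNReal.ofReal_le_ofReal ?_
    have : ∏ _i : Fin 3, (1 / 6 : ℝ) ≤ ∏ i, |β i| :=
      Finset.prod_le_prod (fun _ _ => by norm_num) fun i _ => hβ i
    norm_num at this ⊢
    linarith
  calc ∫⁻ x in box l L, g (aff α β x)
      = ∫⁻ x in box l L, (box l L).indicator g (aff α β x) :=
        setLIntegral_congr_fun (measurableSet_box l L) fun x hx => by
          rw [indicator_of_mem (hmaps hx)]
    _ ≤ ∫⁻ x, (box l L).indicator g (aff α β x) := setLIntegral_le_lintegral _ _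
    _ ≤ _ := le_mul_of_one_le_left' h1

/-- The constant is rounded up: `15² = 225 ≥ 216`. -/
theorem memLp_of_lintegral_le {f h : Pt → ℝ} (hm : Measurable h)
    (hf : MemLp f 2 (volume.restrict (box l L)))
    (hlin : ∫⁻ x in box l L, ‖h x‖ₑ ^ 2 ≤ 216 * ∫⁻ x in box l L, ‖f x‖ₑ ^ 2) :
    MemLp h 2 (volume.restrict (box l L)) ∧ n2 l L h ≤ 15 * n2 l L f := by
  have hsq : ∀ {q : Pt → ℝ}, MemLp q 2 (volume.restrict (box l L)) →
      ∫⁻ x in box l L, ‖q x‖ₑ ^ 2 = ENNReal.ofReal (∫ x in box l L, q x ^ 2) := by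
    intro q hq
    rw [ofReal_integral_eq_lintegral_ofReal hq.integrable_sq
      (Filter.Eventually.of_forall fun x => sq_nonneg _)]
    refine lintegral_congr fun x => ?_
    rw [← ofReal_norm, ← ENNReal.ofReal_pow (norm_nonneg _), Real.norm_eq_abs, sq_abs]
  have hmem : MemLp h 2 (volume.restrict (box l L)) := by
    refine ⟨hm.aestronglyMeasurable, ?_⟩
    rw [eLpNorm_lt_top_iff_lintegral_rpow_enorm_lt_top (by norm_num) (by norm_num)]
    simp only [ENNReal.toReal_ofNat, ENNReal.rpow_ofNat]
    refine hlin.trans_lt ?_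
    rw [hsq hf]
    exact ENNReal.mul_lt_top (by norm_num) ENNReal.ofReal_lt_top
  refine ⟨hmem, ?_⟩
  rw [hsq hf, hsq hmem, show (216 : ℝ≥0∞) = ENNReal.ofReal 216 by norm_num,
    ← ENNReal.ofReal_mul (by norm_num)] at hlin
  have hI : 0 ≤ ∫ x in box l L, f x ^ 2 := integral_nonneg fun x => sq_nonneg _
  have hlin2 := (ENNReal.ofReal_le_ofReal_iff (by positivity)).1 hlin
  refine Real.sqrt_le_iff.2 ⟨mul_nonneg (by norm_num) (n2_nonneg _), ?_⟩
  rw [mul_pow, n2_sq]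
  linarith

theorem memLp_comp_aff (α : Pt) {β : Pt} (hβ : ∀ i, 1 / 6 ≤ |β i|)
    (hmaps : MapsTo (aff α β) (box l L) (box l L)) {f : Pt → ℝ} (hfm : Measurable f)
    (hf : MemLp f 2 (volume.restrict (box l L))) :
    MemLp (fun x => f (aff α β x)) 2 (volume.restrict (box l L)) ∧
      n2 l L (fun x => f (aff α β x)) ≤ 15 * n2 l L f :=
  memLp_of_lintegral_le (hfm.comp (contDiff_aff α β).continuous.measurable) hf
    (lintegral_box_comp_aff_le α hβ hmaps (hfm.enorm.pow_const 2))

theorem pd_comp_aff {f : Pt → ℝ} (hf : ContDiff ℝ ∞ f) (α β : Pt) (i : Fin 3) (x : Pt) :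
    pd i (fun x => f (aff α β x)) x = β i * pd i f (aff α β x) := by
  have hd : DifferentiableAt ℝ (fun x => f (aff α β x)) x :=
    differentiable_of_smooth (hf.comp (contDiff_aff α β)) x
  refine pd_eq_of_hasDerivAt hd ?_
  have e : (fun t => f (aff α β (Function.update x i t))) =
      (fun r => f (Function.update (aff α β x) i r)) ∘ fun t => α i + β i * t := by
    funext t
    simp only [Function.comp]
    congr 1
    funext j
    rcases eq_or_ne j i with rfl | hj
    · simp [aff]
    · simp [aff, hj]
  rw [e]
  have h2 : HasDerivAt (fun t => α i + β i * t) (β i) (x i) := by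
    simpa using ((hasDerivAt_id' (x i)).const_mul (β i)).const_add (α i)
  have h3 := hasDerivAt_comp_update (φ := f) (x := aff α β x) (i := i) (t := α i + β i * x i)
    (differentiable_of_smooth hf _)
  rw [show Function.update (aff α β x) i (α i + β i * x i) = aff α β x from
    Function.update_eq_self i _] at h3
  rw [mul_comm]
  exact HasDerivAt.comp (x i) (by
    rw [show pd i f (aff α β x) = pd i f (aff α β x) from rfl]; exact h3) h2

theorem h1_comp_aff_le (α : Pt) {β : Pt} (hβ : ∀ i, 1 / 6 ≤ |β i|) (hβ1 : ∀ i, |β i| ≤ 1)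
    (hmaps : MapsTo (aff α β) (box l L) (box l L)) {f : Pt → ℝ} (hf : ContDiff ℝ ∞ f) :
    h1 l L (fun x => f (aff α β x)) ≤ 60 * h1 l L f := by
  have h0 := (memLp_comp_aff α hβ hmaps hf.continuous.measurable (memLp_smooth hf)).2
  have hi := fun i => (memLp_comp_aff α hβ hmaps (continuous_pd hf i).measurable
    (memLp_smooth (contDiff_pd hf i))).2
  rw [show (60 : ℝ) * h1 l L f = 4 * (15 * h1 l L f) by ring]
  refine h1_le (h0.trans (mul_le_mul_of_nonneg_left (n2_le_h1 f) (by norm_num))) fun i => ?_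
  rw [show pd i (fun x => f (aff α β x)) = fun x => β i * pd i f (aff α β x) from
    funext fun x => pd_comp_aff hf α β i x, n2_const_mul]
  refine (mul_le_of_le_one_left (n2_nonneg _) (hβ1 i)).trans ((hi i).trans ?_)
  exact mul_le_mul_of_nonneg_left (n2_pd_le_h1 f i) (by norm_num)

end Affine

/-! ### Gradients of Neumann potentials -/

section Neumann

/-- Smooth functions with vanishing normal derivative. -/
structure IsNeumann (l L : ℝ) (φ : Pt → ℝ) : Prop where
  smooth : ContDiff ℝ ∞ φ
  normal : ∀ (i : Fin 3) (x : Pt), x i = 0 ∨ x i = side l L i → pd i φ x = 0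

/-- The normal derivative vanishes on the whole hyperplane, hence so does its derivative in a
direction tangential to it. -/
theorem IsNeumann.pd_pd {φ : Pt → ℝ} (h : IsNeumann l L φ) {i j : Fin 3} (hij : j ≠ i) {x : Pt}
    (hx : x i = 0 ∨ x i = side l L i) : pd j (pd i φ) x = 0 := by
  refine pd_eq_of_hasDerivAt (differentiable_of_smooth (contDiff_pd h.smooth i) x) ?_
  have : (fun t => pd i φ (Function.update x j t)) = fun _ => 0 := by
    funext t
    refine h.normal i _ ?_
    rwa [Function.update_of_ne hij.symm]
  rw [this]
  exact hasDerivAt_const _ _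

/-- The Laplacian. -/
def lap (φ : Pt → ℝ) (x : Pt) : ℝ := ∑ i, pd i (pd i φ) x

theorem contDiff_lap {φ : Pt → ℝ} (h : ContDiff ℝ ∞ φ) : ContDiff ℝ ∞ (lap φ) :=
  ContDiff.sum fun i _ => contDiff_pd (contDiff_pd h i) i

variable [Fact (0 < l)] [Fact (0 < L)]

/-- Two integrations by parts move one derivative across in each direction. The boundary terms
vanish by the Neumann condition, together with its tangential derivative; as the faces are flat, no
curvature term appears. -/
theorem IsNeumann.integral_pd_pd {φ : Pt → ℝ} (h : IsNeumann l L φ) (i j : Fin 3) :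
    ∫ x in box l L, pd i (pd j φ) x ^ 2 =
      ∫ x in box l L, pd i (pd i φ) x * pd j (pd j φ) x := by
  rcases eq_or_ne i j with rfl | hij
  · simp only [sq]
  have hj := contDiff_pd h.smooth j
  have hi := contDiff_pd h.smooth i
  have hij2 := contDiff_pd hj i
  have hii2 := contDiff_pd hi i
  have e1 := integral_mul_pd (l := l) (L := L) hij2 hj i
    (fun x hx => by rw [pd_comm h.smooth i j, h.pd_pd hij.symm (Or.inl hx), zero_mul])
    (fun x hx => by rw [pd_comm h.smooth i j, h.pd_pd hij.symm (Or.inr hx), zero_mul])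
  have e2 := integral_mul_pd (l := l) (L := L) hii2 hj j
    (fun x hx => by rw [h.normal j x (Or.inl hx), mul_zero])
    (fun x hx => by rw [h.normal j x (Or.inr hx), mul_zero])
  have e3 : ∀ x, pd i (pd i (pd j φ)) x = pd j (pd i (pd i φ)) x := fun x => by
    rw [show pd i (pd j φ) = pd j (pd i φ) from funext fun x => pd_comm h.smooth i j x,
      pd_comm hi i j]
  simp only [sq]
  rw [e1, e2]
  simp only [e3]

/-- Summing `integral_pd_pd` over all indices shows that the full Hessian has the same `L²` norm as
the Laplacian. -/
theorem IsNeumann.n2_pd_pd_le {φ : Pt → ℝ} (h : IsNeumann l L φ) (i j : Fin 3) :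
    n2 l L (pd i (pd j φ)) ≤ n2 l L (lap φ) := by
  have hint : ∀ i j, Integrable (fun x => pd i (pd i φ) x * pd j (pd j φ) x)
      (volume.restrict (box l L)) := fun i j => integrable_box_of_continuous
    ((continuous_pd (contDiff_pd h.smooth i) i).mul (continuous_pd (contDiff_pd h.smooth j) j))
  have e : n2 l L (lap φ) ^ 2 = ∑ i, ∑ j, n2 l L (pd i (pd j φ)) ^ 2 := by
    simp only [n2_sq, h.integral_pd_pd]
    simp only [← integral_finsetSum _ fun j _ => hint _ j]
    rw [← integral_finsetSum _ fun i _ => integrable_finsetSum _ fun j _ => hint i j]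
    simp only [lap, sq, Finset.sum_mul_sum]
  refine abs_le_of_sq_le_sq' ?_ (n2_nonneg _) |>.2
  rw [e]
  refine (Finset.single_le_sum (f := fun j => n2 l L (pd i (pd j φ)) ^ 2)
    (fun _ _ => sq_nonneg _) (Finset.mem_univ j)).trans ?_
  exact Finset.single_le_sum (f := fun i => ∑ j, n2 l L (pd i (pd j φ)) ^ 2)
    (fun _ _ => Finset.sum_nonneg fun _ _ => sq_nonneg _) (Finset.mem_univ i)

/-- A Poincaré inequality for `∂ⱼφ`: write `1 = ∂ⱼ xⱼ` in `∫ (∂ⱼφ)²` and integrate by parts. The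
boundary term vanishes at one end because `xⱼ = 0` there, and at the other because `∂ⱼφ = 0`. -/
theorem IsNeumann.n2_pd_le {φ : Pt → ℝ} (h : IsNeumann l L φ) (j : Fin 3) :
    n2 l L (pd j φ) ≤ 2 * side l L j * n2 l L (lap φ) := by
  have hs := side_pos (l := l) (L := L) j
  have hV := contDiff_pd h.smooth j
  have hx : ContDiff ℝ ∞ fun x : Pt => x j := contDiff_apply ℝ ℝ j
  have e := integral_mul_pd (l := l) (L := L) (hV.pow 2) hx j
    (fun x hx => by rw [hx, mul_zero]) (fun x hx => by rw [h.normal j x (Or.inr hx)]; simp)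
  have e1 : ∀ x : Pt, pd j (fun x : Pt => x j) x = 1 := fun x => by
    rw [pd_comp_coord j j (hasDerivAt_id' (x j)), if_pos rfl]
  have e2 : ∀ x, pd j (fun x => pd j φ x ^ 2) x = 2 * (pd j φ x * pd j (pd j φ) x) := fun x => by
    have := pd_mul j (differentiable_of_smooth hV x) (differentiable_of_smooth hV x)
    simp only [← sq] at this
    rw [this]; ring
  simp only [e1, e2, mul_one] at e
  have e3 : ∀ x, 2 * (pd j φ x * pd j (pd j φ) x) * x j =
      2 * (pd j φ x * (x j * pd j (pd j φ) x)) := fun x => by ring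
  simp only [e3] at e
  rw [integral_const_mul, ← n2_sq] at e
  have hcs := abs_integral_mul_le_sqrt (memLp_smooth (l := l) (L := L) hV)
    (memLp_smooth (l := l) (L := L) (hx.mul (contDiff_pd hV j)))
  change _ ≤ n2 l L (pd j φ) * n2 l L (fun x => x j * pd j (pd j φ) x) at hcs
  have hb : n2 l L (fun x => x j * pd j (pd j φ) x) ≤ side l L j * n2 l L (lap φ) := by
    refine (n2_mul_le (C := side l L j) (fun x hx => ?_) hs.le
      (memLp_smooth (contDiff_pd hV j))).trans
      (mul_le_mul_of_nonneg_left (h.n2_pd_pd_le j j) hs.le)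
    rw [abs_of_pos (hx j).1]; exact (hx j).2.le
  have hn := n2_nonneg (l := l) (L := L) (pd j φ)
  have h1 := (abs_le.1 hcs).1
  have h2 : n2 l L (pd j φ) ^ 2 ≤ n2 l L (pd j φ) * (2 * side l L j * n2 l L (lap φ)) := by
    have := mul_le_mul_of_nonneg_left hb hn
    rw [e]; linarith
  rcases hn.eq_or_lt with h0 | h0
  · rw [← h0]; exact mul_nonneg (by positivity) (n2_nonneg _)
  · rw [sq] at h2; exact le_of_mul_le_mul_left h2 h0

/-- The gradient of a Neumann potential is bounded in `H¹(Ω)` by the Laplacian in `L²(Ω)`. -/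
theorem exists_h1_grad_le (l L : ℝ) [Fact (0 < l)] [Fact (0 < L)] : ∃ C, 0 ≤ C ∧
    ∀ φ, IsNeumann l L φ → ∀ j, h1 l L (pd j φ) ≤ C * n2 l L (lap φ) := by
  have hs := fun j => (side_pos (l := l) (L := L) j).le
  refine ⟨4 * (1 + ∑ j, 2 * side l L j), by
    have := Finset.sum_nonneg fun j (_ : j ∈ Finset.univ) => hs j
    rw [← Finset.mul_sum]; positivity, fun φ h j => ?_⟩
  have hle : 2 * side l L j ≤ ∑ j, 2 * side l L j :=
    Finset.single_le_sum (f := fun j => 2 * side l L j)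
      (fun j _ => mul_nonneg zero_le_two (hs j)) (Finset.mem_univ j)
  have hn := n2_nonneg (l := l) (L := L) (lap φ)
  have h0 := hs j
  rw [mul_assoc]
  refine h1_le ((h.n2_pd_le j).trans (mul_le_mul_of_nonneg_right (by linarith) hn)) fun i =>
    (h.n2_pd_pd_le i j).trans (le_mul_of_one_le_left hn (by linarith))

end Neumann

/-! ### Finite sums of smooth tensor products -/

section Tensor

/-- Finite sums of products `a(x₁) b(x₂) c(x₃)` with smooth factors. -/
def TC : Submodule ℝ (Pt → ℝ) :=
  Submodule.span ℝ {f | ∃ a : Fin 3 → ℝ → ℝ, (∀ j, ContDiff ℝ ∞ (a j)) ∧ f = tens a}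

theorem tens_mem_TC {a : Fin 3 → ℝ → ℝ} (h : ∀ j, ContDiff ℝ ∞ (a j)) : tens a ∈ TC :=
  Submodule.subset_span ⟨a, h, rfl⟩

theorem TC_induction {P : (Pt → ℝ) → Prop}
    (ht : ∀ a : Fin 3 → ℝ → ℝ, (∀ j, ContDiff ℝ ∞ (a j)) → P (tens a))
    (h0 : P fun _ => 0) (hadd : ∀ f ∈ TC, ∀ g ∈ TC, P f → P g → P fun x => f x + g x)
    (hsmul : ∀ (c : ℝ), ∀ f ∈ TC, P f → P fun x => c * f x) {f : Pt → ℝ} (hf : f ∈ TC) : P f := by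
  induction hf using Submodule.span_induction with
  | mem f hf => obtain ⟨a, ha, rfl⟩ := hf; exact ht a ha
  | zero => exact h0
  | add f g hf hg h1 h2 => exact hadd f hf g hg h1 h2
  | smul c f hf h => exact hsmul c f hf h

theorem TC_add {f g : Pt → ℝ} (hf : f ∈ TC) (hg : g ∈ TC) : (fun x => f x + g x) ∈ TC :=
  TC.add_mem hf hg

theorem TC_sub {f g : Pt → ℝ} (hf : f ∈ TC) (hg : g ∈ TC) : (fun x => f x - g x) ∈ TC :=
  TC.sub_mem hf hg

theorem TC_const_mul (c : ℝ) {f : Pt → ℝ} (hf : f ∈ TC) : (fun x => c * f x) ∈ TC :=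
  TC.smul_mem c hf

theorem TC_sum {ι : Type*} (s : Finset ι) {f : ι → Pt → ℝ} (h : ∀ k ∈ s, f k ∈ TC) :
    (fun x => ∑ k ∈ s, f k x) ∈ TC := by
  rw [← show ∑ k ∈ s, f k = fun x => ∑ k ∈ s, f k x from by ext x; simp]
  exact TC.sum_mem h

theorem contDiff_TC {f : Pt → ℝ} (hf : f ∈ TC) : ContDiff ℝ ∞ f :=
  TC_induction (P := fun f => ContDiff ℝ ∞ f) (fun _ ha => contDiff_tens ha) contDiff_const
    (fun _ _ _ _ h1 h2 => h1.add h2) (fun _ _ _ h => contDiff_const.mul h) hf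

theorem contDiff_update {a : Fin 3 → ℝ → ℝ} (ha : ∀ j, ContDiff ℝ ∞ (a j)) (i : Fin 3)
    {b : ℝ → ℝ} (hb : ContDiff ℝ ∞ b) (j : Fin 3) : ContDiff ℝ ∞ (Function.update a i b j) := by
  rcases eq_or_ne j i with rfl | hj
  · simpa using hb
  · simpa [hj] using ha j

theorem TC_pd {f : Pt → ℝ} (hf : f ∈ TC) (i : Fin 3) : pd i f ∈ TC := by
  refine TC_induction (P := fun f => pd i f ∈ TC) (fun a ha => ?_) ?_ ?_ ?_ hf
  · rw [pd_tens fun j => (ha j).differentiable (by simp)]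
    exact tens_mem_TC (contDiff_update ha i ((contDiff_infty_iff_deriv.1 (ha i)).2))
  · rw [show pd i (fun _ => (0 : ℝ)) = 0 from funext fun x => pd_const i 0 x]
    exact TC.zero_mem
  · intro f hf g hg h1 h2
    rw [show pd i (fun x => f x + g x) = fun x => pd i f x + pd i g x from funext fun x =>
      pd_add i (differentiable_of_smooth (contDiff_TC hf) x)
        (differentiable_of_smooth (contDiff_TC hg) x)]
    exact TC_add h1 h2
  · intro c f hf h
    rw [show pd i (fun x => c * f x) = fun x => c * pd i f x from funext fun x =>
      pd_const_mul i c (differentiable_of_smooth (contDiff_TC hf) x)]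
    exact TC_const_mul c h

theorem TC_mul {f g : Pt → ℝ} (hf : f ∈ TC) (hg : g ∈ TC) : (fun x => f x * g x) ∈ TC := by
  refine TC_induction (P := fun f => (fun x => f x * g x) ∈ TC) (fun a ha => ?_) ?_ ?_ ?_ hf
  · refine TC_induction (P := fun g => (fun x => tens a x * g x) ∈ TC) (fun b hb => ?_) ?_ ?_ ?_ hg
    · rw [show (fun x => tens a x * tens b x) = tens fun j t => a j t * b j t from
        funext fun x => Finset.prod_mul_distrib.symm]
      exact tens_mem_TC fun j => (ha j).mul (hb j)
    · simp only [mul_zero]; exact TC.zero_mem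
    · intro f hf g hg h1 h2
      simpa only [mul_add] using TC_add h1 h2
    · intro c f hf h
      simpa only [mul_left_comm] using TC_const_mul c h
  · simp only [zero_mul]; exact TC.zero_mem
  · intro f hf g hg h1 h2
    simpa only [add_mul] using TC_add h1 h2
  · intro c f hf h
    simpa only [mul_assoc] using TC_const_mul c h

theorem TC_comp_aff (α β : Pt) {f : Pt → ℝ} (hf : f ∈ TC) : (fun x => f (aff α β x)) ∈ TC := by
  refine TC_induction (P := fun f => (fun x => f (aff α β x)) ∈ TC) (fun a ha => ?_) ?_ ?_ ?_ hf
  · exact tens_mem_TC (a := fun j t => a j (α j + β j * t)) fun j => (ha j).comp (by fun_prop)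
  · exact TC.zero_mem
  · exact fun f hf g hg h1 h2 => TC_add h1 h2
  · exact fun c f hf h => TC_const_mul c h

theorem update_eq_aff (i : Fin 3) (s : ℝ) (x : Pt) :
    Function.update x i s = aff (Pi.single i s) (Function.update 1 i 0) x := by
  funext j
  rcases eq_or_ne j i with rfl | hj
  · simp [aff]
  · simp [aff, hj]

/-- A function of a single coordinate. -/
theorem TC_coord (i : Fin 3) {b : ℝ → ℝ} (hb : ContDiff ℝ ∞ b) : (fun x : Pt => b (x i)) ∈ TC := by
  rw [show (fun x : Pt => b (x i)) = tens (Function.update (fun _ _ => 1) i b) from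
    funext fun x => by rw [tens_update]; simp]
  exact tens_mem_TC (contDiff_update (fun _ => contDiff_const) i hb)

theorem cosP_mem_TC (k : Fin 3 → ℤ) : cosP l L k ∈ TC := tens_mem_TC fun j => by fun_prop

end Tensor

/-! ### Primitives in one coordinate -/

section Primitive

/-- The primitive of `g` in the `i`-th coordinate that vanishes for `xᵢ = 0`. -/
def prim (i : Fin 3) (g : Pt → ℝ) (x : Pt) : ℝ := ∫ t in (0 : ℝ)..(x i), g (Function.update x i t)

/-- The integral of `g` over the `i`-th coordinate. -/
def total (l L : ℝ) (i : Fin 3) (g : Pt → ℝ) (x : Pt) : ℝ :=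
  ∫ t in (0 : ℝ)..(side l L i), g (Function.update x i t)

theorem continuous_comp_update {g : Pt → ℝ} (hg : Continuous g) (x : Pt) (i : Fin 3) :
    Continuous fun t => g (Function.update x i t) :=
  hg.comp (continuous_const.update i continuous_id)

theorem total_eq (i : Fin 3) (g : Pt → ℝ) (x : Pt) :
    total l L i g x = prim i g (Function.update x i (side l L i)) := by
  simp [total, prim]

theorem prim_tens (a : Fin 3 → ℝ → ℝ) (i : Fin 3) :
    prim i (tens a) = tens (Function.update a i fun s => ∫ t in (0 : ℝ)..s, a i t) := by
  funext x
  rw [prim, tens_update, ← intervalIntegral.integral_mul_const]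
  simp only [tens_apply_update]

theorem contDiff_primitive {a : ℝ → ℝ} (ha : ContDiff ℝ ∞ a) :
    ContDiff ℝ ∞ fun s => ∫ t in (0 : ℝ)..s, a t := by
  have hd : ∀ s, HasDerivAt (fun s => ∫ t in (0 : ℝ)..s, a t) (a s) s := fun s =>
    intervalIntegral.integral_hasDerivAt_right (ha.continuous.intervalIntegrable _ _)
      ha.continuous.stronglyMeasurable.stronglyMeasurableAtFilter ha.continuous.continuousAt
  rw [contDiff_infty_iff_deriv]
  refine ⟨fun s => (hd s).differentiableAt, ?_⟩
  rwa [show deriv (fun s => ∫ t in (0 : ℝ)..s, a t) = a from funext fun s => (hd s).deriv]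

theorem prim_add {f g : Pt → ℝ} (hf : Continuous f) (hg : Continuous g) (i : Fin 3) :
    prim i (fun x => f x + g x) = fun x => prim i f x + prim i g x := funext fun x =>
  intervalIntegral.integral_add ((continuous_comp_update hf x i).intervalIntegrable _ _)
    ((continuous_comp_update hg x i).intervalIntegrable _ _)

theorem prim_const_mul (c : ℝ) (f : Pt → ℝ) (i : Fin 3) :
    prim i (fun x => c * f x) = fun x => c * prim i f x := funext fun _ =>
  intervalIntegral.integral_const_mul _ _

/-- A primitive of a tensor product is again a tensor product. Working with finite sums of these
keeps all the fields constructed below smooth without differentiating under an integral sign. -/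
theorem TC_prim {g : Pt → ℝ} (hg : g ∈ TC) (i : Fin 3) : prim i g ∈ TC := by
  refine TC_induction (P := fun g => prim i g ∈ TC) (fun a ha => ?_) ?_ ?_ ?_ hg
  · rw [prim_tens]
    exact tens_mem_TC (contDiff_update ha i (contDiff_primitive (ha i)))
  · rw [show prim i (fun _ => (0 : ℝ)) = 0 from funext fun x => by simp [prim]]
    exact TC.zero_mem
  · intro f hf g hg h1 h2
    rw [prim_add (contDiff_TC hf).continuous (contDiff_TC hg).continuous]
    exact TC_add h1 h2
  · intro c f hf h
    rw [prim_const_mul]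
    exact TC_const_mul c h

theorem total_eq_aff (i : Fin 3) (g : Pt → ℝ) : total l L i g = fun x =>
    prim i g (aff (Pi.single i (side l L i)) (Function.update 1 i 0) x) := funext fun x => by
  rw [total_eq, update_eq_aff]

theorem TC_total {g : Pt → ℝ} (hg : g ∈ TC) (i : Fin 3) : total l L i g ∈ TC := by
  rw [total_eq_aff]
  exact TC_comp_aff _ _ (TC_prim hg i)

theorem pd_prim_same {g : Pt → ℝ} (hg : g ∈ TC) (i : Fin 3) : pd i (prim i g) = g := by
  funext x
  refine pd_eq_of_hasDerivAt (differentiable_of_smooth (contDiff_TC (TC_prim hg i)) x) ?_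
  have hc := continuous_comp_update (contDiff_TC hg).continuous x i
  have h := intervalIntegral.integral_hasDerivAt_right (hc.intervalIntegrable 0 (x i))
    hc.stronglyMeasurable.stronglyMeasurableAtFilter hc.continuousAt
  rw [Function.update_eq_self] at h
  simpa [prim] using h

theorem pd_prim {g : Pt → ℝ} (hg : g ∈ TC) {i j : Fin 3} (hij : j ≠ i) :
    pd j (prim i g) = prim i (pd j g) := by
  refine TC_induction (P := fun g => pd j (prim i g) = prim i (pd j g)) (fun a ha => ?_) ?_ ?_ ?_ hg
  · have hd : ∀ {a : Fin 3 → ℝ → ℝ}, (∀ j, ContDiff ℝ ∞ (a j)) → ∀ j, Differentiable ℝ (a j) :=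
      fun ha j => (ha j).differentiable (by simp)
    rw [prim_tens, pd_tens (hd (contDiff_update ha i (contDiff_primitive (ha i)))),
      pd_tens (hd ha), prim_tens, Function.update_of_ne hij, Function.update_of_ne hij.symm,
      Function.update_comm hij]
  · have : prim i (fun _ => (0 : ℝ)) = fun _ => 0 := funext fun x => by simp [prim]
    rw [this, show pd j (fun _ => (0 : ℝ)) = fun _ => 0 from funext fun x => pd_const j 0 x, this]
  · intro f hf g hg h1 h2
    have hs := fun {f} (hf : f ∈ TC) => differentiable_of_smooth (contDiff_TC hf)
    rw [prim_add (contDiff_TC hf).continuous (contDiff_TC hg).continuous,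
      show pd j (fun x => f x + g x) = fun x => pd j f x + pd j g x from funext fun x =>
        pd_add j (hs hf x) (hs hg x),
      prim_add (contDiff_TC (TC_pd hf j)).continuous (contDiff_TC (TC_pd hg j)).continuous,
      ← h1, ← h2]
    exact funext fun x => pd_add j (hs (TC_prim hf i) x) (hs (TC_prim hg i) x)
  · intro c f hf h
    have hs := fun {f} (hf : f ∈ TC) => differentiable_of_smooth (contDiff_TC hf)
    rw [prim_const_mul, show pd j (fun x => c * f x) = fun x => c * pd j f x from funext fun x =>
        pd_const_mul j c (hs hf x), prim_const_mul, ← h]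
    exact funext fun x => pd_const_mul j c (hs (TC_prim hf i) x)

theorem pd_total_same {g : Pt → ℝ} (hg : g ∈ TC) (i : Fin 3) (x : Pt) :
    pd i (total l L i g) x = 0 := by
  rw [total_eq_aff, pd_comp_aff (contDiff_TC (TC_prim hg i))]
  simp

theorem pd_total {g : Pt → ℝ} (hg : g ∈ TC) {i j : Fin 3} (hij : j ≠ i) :
    pd j (total l L i g) = total l L i (pd j g) := by
  rw [total_eq_aff, total_eq_aff, ← pd_prim hg hij]
  funext x
  rw [pd_comp_aff (contDiff_TC (TC_prim hg i))]
  simp [hij]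

variable [Fact (0 < l)] [Fact (0 < L)]

/-- The bounding line integral does not depend on `xᵢ`, so integrating it over the box costs one
further factor `sᵢ`. -/
theorem n2_le_of_line {g h : Pt → ℝ} (hg : Continuous g) (i : Fin 3)
    (hle : ∀ x ∈ box l L, h x ^ 2 ≤ side l L i * ∫ t in Ioo 0 (side l L i),
      g (Function.update x i t) ^ 2) : n2 l L h ≤ side l L i * n2 l L g := by
  have hs := side_pos (l := l) (L := L) i
  have hg2 : Continuous fun x => g x ^ 2 := by fun_prop
  have hlc : Continuous fun x => ∫ t in Ioo 0 (side l L i), g (Function.update x i t) ^ 2 := by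
    simp only [← integral_Ioc_eq_integral_Ioo, ← intervalIntegral.integral_of_le hs.le]
    refine intervalIntegral.continuous_parametric_intervalIntegral_of_continuous' ?_ _ _
    exact hg2.comp (continuous_fst.update i continuous_snd)
  refine abs_le_of_sq_le_sq' ?_ (mul_nonneg hs.le (n2_nonneg g)) |>.2
  rw [mul_pow, n2_sq, n2_sq]
  calc ∫ x in box l L, h x ^ 2
      ≤ ∫ x in box l L, side l L i * ∫ t in Ioo 0 (side l L i), g (Function.update x i t) ^ 2 :=
        integral_mono_of_nonneg (Filter.Eventually.of_forall fun x => sq_nonneg _)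
          (integrable_box_of_continuous (continuous_const.mul hlc))
          ((ae_restrict_mem (measurableSet_box l L)).mono hle)
    _ = side l L i * ∫ x in box l L, ∫ t in Ioo 0 (side l L i), g (Function.update x i t) ^ 2 :=
        integral_const_mul _ _
    _ = side l L i * (side l L i * ∫ x in box l L, g x ^ 2) := by
        congr 1
        rw [integral_box_eq i (integrable_box_of_continuous hlc),
          integral_box_eq i (integrable_box_of_continuous hg2), ← integral_const_mul]
        congr 1
        funext y
        have : ∀ t r, Function.update (facePt i t y) i r = facePt i r y := fun t r =>
          (facePt_eq_update i r t y).symm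
        simp [this, hs.le]
    _ = _ := by ring

theorem sq_intervalIntegral_le {f : ℝ → ℝ} (hf : Continuous f) {s t : ℝ} (ht : 0 ≤ t) (hts : t ≤ s) :
    (∫ r in (0 : ℝ)..t, f r) ^ 2 ≤ s * ∫ r in Ioo 0 s, f r ^ 2 := by
  have hsub : Ioo 0 t ⊆ Ioo 0 s := Ioo_subset_Ioo_right hts
  have hint : IntegrableOn (fun r => f r ^ 2) (Ioo 0 s) :=
    ((hf.pow 2).integrableOn_Icc (a := 0) (b := s)).mono_set Ioo_subset_Icc_self
  have hm : MemLp f 2 (volume.restrict (Ioo 0 t)) :=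
    (memLp_two_iff_integrable_sq hf.aestronglyMeasurable).2 (hint.mono_set hsub)
  rw [intervalIntegral.integral_of_le ht, integral_Ioc_eq_integral_Ioo]
  have hcs := abs_integral_mul_le_sqrt (ν := volume.restrict (Ioo 0 t)) (memLp_const (1 : ℝ)) hm
  simp only [one_mul, one_pow] at hcs
  have h1 : ∫ _ in Ioo 0 t, (1 : ℝ) = t := by simp [ht]
  rw [h1] at hcs
  have h2 : ∫ r in Ioo 0 t, f r ^ 2 ≤ ∫ r in Ioo 0 s, f r ^ 2 :=
    setIntegral_mono_set hint (Filter.Eventually.of_forall fun _ => sq_nonneg _)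
      hsub.eventuallyLE
  have h0 : 0 ≤ ∫ r in Ioo 0 t, f r ^ 2 := integral_nonneg fun _ => sq_nonneg _
  calc _ ≤ (√t * √(∫ r in Ioo 0 t, f r ^ 2)) ^ 2 := by
        rw [← sq_abs]; exact pow_le_pow_left₀ (abs_nonneg _) hcs 2
    _ = t * ∫ r in Ioo 0 t, f r ^ 2 := by rw [mul_pow, Real.sq_sqrt ht, Real.sq_sqrt h0]
    _ ≤ _ := mul_le_mul hts h2 h0 (ht.trans hts)

theorem n2_prim_le {g : Pt → ℝ} (hg : Continuous g) (i : Fin 3) :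
    n2 l L (prim i g) ≤ side l L i * n2 l L g :=
  n2_le_of_line hg i fun x hx =>
    sq_intervalIntegral_le (continuous_comp_update hg x i) (hx i).1.le (hx i).2.le

theorem n2_total_le {g : Pt → ℝ} (hg : Continuous g) (i : Fin 3) :
    n2 l L (total l L i g) ≤ side l L i * n2 l L g :=
  n2_le_of_line hg i fun x _ =>
    sq_intervalIntegral_le (continuous_comp_update hg x i) (side_pos i).le le_rfl

theorem h1_prim_le {g : Pt → ℝ} (hg : g ∈ TC) (i : Fin 3) :
    h1 l L (prim i g) ≤ 4 * ((1 + side l L i) * h1 l L g) := by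
  have hs := (side_pos (l := l) (L := L) i).le
  have key : ∀ a, a ≤ h1 l L g → side l L i * a ≤ (1 + side l L i) * h1 l L g := fun a ha =>
    (mul_le_mul_of_nonneg_left ha hs).trans
      (mul_le_mul_of_nonneg_right (by linarith) (h1_nonneg g))
  refine h1_le ((n2_prim_le (contDiff_TC hg).continuous i).trans (key _ (n2_le_h1 g))) fun j => ?_
  rcases eq_or_ne j i with rfl | hj
  · rw [pd_prim_same hg]
    exact (n2_le_h1 g).trans (le_mul_of_one_le_left (h1_nonneg g) (by linarith))
  · rw [pd_prim hg hj]
    exact (n2_prim_le (continuous_pd (contDiff_TC hg) j) i).trans (key _ (n2_pd_le_h1 g j))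

theorem h1_total_le {g : Pt → ℝ} (hg : g ∈ TC) (i : Fin 3) :
    h1 l L (total l L i g) ≤ 4 * ((1 + side l L i) * h1 l L g) := by
  have hs := (side_pos (l := l) (L := L) i).le
  have key : ∀ a, a ≤ h1 l L g → side l L i * a ≤ (1 + side l L i) * h1 l L g := fun a ha =>
    (mul_le_mul_of_nonneg_left ha hs).trans
      (mul_le_mul_of_nonneg_right (by linarith) (h1_nonneg g))
  refine h1_le ((n2_total_le (contDiff_TC hg).continuous i).trans (key _ (n2_le_h1 g))) fun j => ?_
  rcases eq_or_ne j i with rfl | hj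
  · rw [show pd j (total l L j g) = fun _ => 0 from funext fun x => pd_total_same hg j x, n2_zero]
    exact mul_nonneg (by linarith) (h1_nonneg g)
  · rw [pd_total hg hj]
    exact (n2_total_le (continuous_pd (contDiff_TC hg) j) i).trans (key _ (n2_pd_le_h1 g j))

end Primitive

/-! ### Inverting the divergence on functions vanishing on the boundary -/

section Correction

/-- `g` vanishes on the hyperplanes `xᵢ = 0` and `xᵢ = sᵢ`. -/
def VanishOn (l L : ℝ) (i : Fin 3) (g : Pt → ℝ) : Prop :=
  ∀ x : Pt, x i = 0 ∨ x i = side l L i → g x = 0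

/-- A bump in the `i`-th coordinate of total mass one, vanishing for `xᵢ ∈ {0, sᵢ}`. -/
def bump (l L : ℝ) (i : Fin 3) (x : Pt) : ℝ := 6 / side l L i ^ 3 * (x i * (side l L i - x i))

theorem TC_bump (i : Fin 3) : bump l L i ∈ TC :=
  TC_coord i (b := fun t => 6 / side l L i ^ 3 * (t * (side l L i - t))) (by fun_prop)

theorem vanishOn_bump (i : Fin 3) : VanishOn l L i (bump l L i) := by
  rintro x (h | h) <;> simp [bump, h]

theorem bump_update {i j : Fin 3} (h : i ≠ j) (x : Pt) (t : ℝ) :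
    bump l L i (Function.update x j t) = bump l L i x := by
  simp [bump, h]

/-- A primitive in the `i`-th coordinate of `g` minus a bump of the same mass. -/
def bog (l L : ℝ) (i : Fin 3) (g : Pt → ℝ) : Pt → ℝ :=
  prim i fun x => g x - bump l L i x * total l L i g x

theorem TC_bog_arg {g : Pt → ℝ} (hg : g ∈ TC) (i : Fin 3) :
    (fun x => g x - bump l L i x * total l L i g x) ∈ TC :=
  TC_sub hg (TC_mul (TC_bump i) (TC_total hg i))

theorem TC_bog {g : Pt → ℝ} (hg : g ∈ TC) (i : Fin 3) : bog l L i g ∈ TC :=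
  TC_prim (TC_bog_arg hg i) i

theorem pd_bog {g : Pt → ℝ} (hg : g ∈ TC) (i : Fin 3) (x : Pt) :
    pd i (bog l L i g) x = g x - bump l L i x * total l L i g x := by
  rw [bog, pd_prim_same (TC_bog_arg hg i)]

theorem VanishOn.prim {g : Pt → ℝ} {i j : Fin 3} (hij : j ≠ i) (h : VanishOn l L j g) :
    VanishOn l L j (prim i g) := fun x hx => by
  have : ∀ t, g (Function.update x i t) = 0 := fun t =>
    h _ (by rwa [Function.update_of_ne hij])
  simp [RBM.prim, this]

theorem VanishOn.total {g : Pt → ℝ} {i j : Fin 3} (hij : j ≠ i) (h : VanishOn l L j g) :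
    VanishOn l L j (total l L i g) := fun x hx => by
  have : ∀ t, g (Function.update x i t) = 0 := fun t =>
    h _ (by rwa [Function.update_of_ne hij])
  simp [RBM.total, this]

theorem VanishOn.bog {g : Pt → ℝ} {i j : Fin 3} (hij : j ≠ i) (h : VanishOn l L j g) :
    VanishOn l L j (bog l L i g) :=
  VanishOn.prim hij fun x hx => by rw [h x hx, (h.total hij) x hx]; simp

theorem VanishOn.mul_left {m g : Pt → ℝ} {i : Fin 3} (h : VanishOn l L i g) :
    VanishOn l L i fun x => m x * g x := fun x hx => by simp [h x hx]

theorem VanishOn.mul_right {m g : Pt → ℝ} {i : Fin 3} (h : VanishOn l L i m) :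
    VanishOn l L i fun x => m x * g x := fun x hx => by simp [h x hx]

variable [Fact (0 < l)] [Fact (0 < L)]

theorem integral_bump (i : Fin 3) (x : Pt) :
    ∫ t in (0 : ℝ)..(side l L i), bump l L i (Function.update x i t) = 1 := by
  have hs := side_pos (l := l) (L := L) i
  simp only [bump, Function.update_self]
  rw [intervalIntegral.integral_const_mul]
  have : ∫ t in (0 : ℝ)..(side l L i), t * (side l L i - t) = side l L i ^ 3 / 6 := by
    simp only [mul_sub]
    rw [intervalIntegral.integral_sub ((by fun_prop : Continuous _).intervalIntegrable _ _)
        ((by fun_prop : Continuous _).intervalIntegrable _ _),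
      intervalIntegral.integral_mul_const, integral_id]
    simp only [← sq, integral_pow]
    ring
  rw [this]
  field_simp

/-- At `xᵢ = 0` the primitive is empty; at `xᵢ = sᵢ` it is the total integral of the argument, which
is zero because the bump has mass one. -/
theorem vanishOn_bog {g : Pt → ℝ} (hg : g ∈ TC) (i : Fin 3) : VanishOn l L i (bog l L i g) := by
  rintro x (h | h)
  · simp [bog, prim, h]
  · have hc := continuous_comp_update (contDiff_TC hg).continuous x i
    have hb := continuous_comp_update (contDiff_TC (TC_bump (l := l) (L := L) i)).continuous x i
    have ht : ∀ t, total l L i g (Function.update x i t) = total l L i g x := fun t => by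
      simp [total]
    simp only [bog, prim, h, ht]
    have hb' : Continuous fun t => bump l L i (Function.update x i t) * total l L i g x :=
      hb.mul continuous_const
    rw [intervalIntegral.integral_sub (hc.intervalIntegrable _ _) (hb'.intervalIntegrable _ _),
      intervalIntegral.integral_mul_const, integral_bump, one_mul, total, sub_self]

theorem exists_h1_total_le (l L : ℝ) [Fact (0 < l)] [Fact (0 < L)] : ∃ C, 0 ≤ C ∧
    ∀ (i : Fin 3), ∀ g ∈ TC, h1 l L (total l L i g) ≤ C * h1 l L g := by
  have hs := fun i => (side_pos (l := l) (L := L) i).le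
  refine ⟨4 * (1 + ∑ i, side l L i), by
    have := Finset.sum_nonneg fun i (_ : i ∈ Finset.univ) => hs i
    positivity, fun i g hg => (h1_total_le hg i).trans ?_⟩
  rw [← mul_assoc]
  refine mul_le_mul_of_nonneg_right ?_ (h1_nonneg g)
  have := Finset.single_le_sum (f := side l L) (fun i _ => hs i) (Finset.mem_univ i)
  linarith

theorem exists_h1_bog_le (l L : ℝ) [Fact (0 < l)] [Fact (0 < L)] : ∃ C, 0 ≤ C ∧
    ∀ (i : Fin 3), ∀ g ∈ TC, h1 l L (bog l L i g) ≤ C * h1 l L g := by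
  have hs := fun i => (side_pos (l := l) (L := L) i).le
  obtain ⟨C1, hC1, h1'⟩ := exists_h1_total_le l L
  have hb := fun i => exists_h1_mul_le (l := l) (L := L) (contDiff_TC (TC_bump (l := l) (L := L) i))
  choose C2 hC2 h2 using hb
  have key : ∀ i, ∃ C, 0 ≤ C ∧ ∀ g ∈ TC, h1 l L (bog l L i g) ≤ C * h1 l L g := by
    intro i
    refine ⟨4 * (1 + side l L i) * (1 + C2 i * C1), by
      have := hs i; have := hC2 i; positivity, fun g hg => ?_⟩
    refine (h1_prim_le (TC_bog_arg hg i) i).trans ?_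
    rw [← mul_assoc, mul_assoc _ (1 + C2 i * C1)]
    refine mul_le_mul_of_nonneg_left ?_ (by have := hs i; positivity)
    have e : h1 l L (fun x => g x - bump l L i x * total l L i g x) ≤
        h1 l L g + h1 l L (fun x => bump l L i x * total l L i g x) := by
      have hg' := contDiff_TC hg
      have hm' := contDiff_TC (TC_mul (TC_bump (l := l) (L := L) i) (TC_total (l := l) (L := L) hg i))
      have hd := n2_sub_le (l := l) (L := L) (memLp_smooth hg') (memLp_smooth hm')
      have hi : ∀ j, n2 l L (pd j fun x => g x - bump l L i x * total l L i g x) ≤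
          n2 l L (pd j g) + n2 l L (pd j fun x => bump l L i x * total l L i g x) := fun j => by
        rw [show (pd j fun x => g x - bump l L i x * total l L i g x) = fun x =>
          pd j g x - pd j (fun x => bump l L i x * total l L i g x) x from funext fun x =>
            pd_sub j (differentiable_of_smooth hg' x) (differentiable_of_smooth hm' x)]
        exact n2_sub_le (memLp_smooth (contDiff_pd hg' j)) (memLp_smooth (contDiff_pd hm' j))
      have := Finset.sum_le_sum fun j (_ : j ∈ Finset.univ) => hi j
      rw [Finset.sum_add_distrib] at this
      unfold h1
      linarith
    have a1 := h2 i _ (contDiff_TC (TC_total (l := l) (L := L) hg i))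
    have a2 := mul_le_mul_of_nonneg_left (h1' i g hg) (hC2 i)
    nlinarith
  choose C hC h using key
  refine ⟨∑ i, C i, Finset.sum_nonneg fun i _ => hC i, fun i g hg => (h i g hg).trans ?_⟩
  exact mul_le_mul_of_nonneg_right
    (Finset.single_le_sum (f := C) (fun i _ => hC i) (Finset.mem_univ i)) (h1_nonneg g)

/-- A smooth function vanishing on the boundary is, up to a multiple of a fixed bump, the
divergence of a smooth field vanishing on the boundary, with bounds in `H¹(Ω)`. -/
theorem exists_div_correction (l L : ℝ) [Fact (0 < l)] [Fact (0 < L)] : ∃ C, 0 ≤ C ∧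
    ∀ e ∈ TC, (∀ i, VanishOn l L i e) → ∃ z : Fin 3 → Pt → ℝ, ∃ m : ℝ,
      (∀ j, z j ∈ TC) ∧ (∀ j i, VanishOn l L i (z j)) ∧
      (∀ x, ∑ j, pd j (z j) x = e x - bump l L 0 x * bump l L 1 x * bump l L 2 x * m) ∧
      ∀ j, h1 l L (z j) ≤ C * h1 l L e := by
  obtain ⟨Ct, hCt, ht⟩ := exists_h1_total_le l L
  obtain ⟨Cb, hCb, hb⟩ := exists_h1_bog_le l L
  have b0 := TC_bump (l := l) (L := L) 0
  have b01 := TC_mul b0 (TC_bump (l := l) (L := L) 1)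
  obtain ⟨C0, hC0, hm0⟩ := exists_h1_mul_le (l := l) (L := L) (contDiff_TC b0)
  obtain ⟨C1, hC1, hm1⟩ := exists_h1_mul_le (l := l) (L := L) (contDiff_TC b01)
  refine ⟨Cb + C0 * (Cb * Ct) + C1 * (Cb * (Ct * Ct)), by positivity, fun e he hv => ?_⟩
  -- Telescoping: `bog 0 e` has `∂₀` equal to `e - b₀ e₁`, with `e₁` the integral of `e` over the
  -- first coordinate. The remainder `b₀ e₁` is treated in the same way in the second coordinate and
  -- `b₀ b₁ e₂` in the third, leaving a multiple of `b₀ b₁ b₂`.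
  set e1 := total l L 0 e with he1
  set e2 := total l L 1 e1 with he2
  have t1 : e1 ∈ TC := TC_total he 0
  have t2 : e2 ∈ TC := TC_total t1 1
  have n1 : h1 l L e1 ≤ Ct * h1 l L e := ht 0 e he
  have n2 : h1 l L e2 ≤ Ct * (Ct * h1 l L e) :=
    (ht 1 e1 t1).trans (mul_le_mul_of_nonneg_left n1 hCt)
  -- After integration over all three coordinates the result is a constant, the total mass of `e`.
  have hm : ∀ x, total l L 2 e2 x = total l L 2 e2 0 := by
    intro x
    have : ∀ t, e2 (Function.update x 2 t) = e2 (Function.update 0 2 t) := by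
      intro t
      simp only [he2, he1, total]
      congr 1; funext r; congr 1; funext q; congr 1
      funext k
      fin_cases k <;> simp [Function.update]
    simp only [total, this]
  refine ⟨![bog l L 0 e, fun x => bump l L 0 x * bog l L 1 e1 x,
    fun x => bump l L 0 x * bump l L 1 x * bog l L 2 e2 x], total l L 2 e2 0, ?_, ?_, ?_, ?_⟩
  · intro j; fin_cases j
    · exact TC_bog he 0
    · exact TC_mul b0 (TC_bog t1 1)
    · exact TC_mul b01 (TC_bog t2 2)
  · have hb0 := vanishOn_bump (l := l) (L := L) 0
    have hb1 := vanishOn_bump (l := l) (L := L) 1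
    intro j i
    fin_cases j <;> fin_cases i
    · exact vanishOn_bog he 0
    · exact (hv 1).bog (by decide)
    · exact (hv 2).bog (by decide)
    · exact hb0.mul_right
    · exact (vanishOn_bog t1 1).mul_left
    · exact (((hv 2).total (by decide)).bog (by decide)).mul_left
    · exact (hb0.mul_right (g := bump l L 1)).mul_right
    · exact (hb1.mul_left (m := bump l L 0)).mul_right
    · exact (vanishOn_bog t2 2).mul_left
  · intro x
    have hs := fun {f} (hf : f ∈ TC) => differentiable_of_smooth (contDiff_TC hf) x
    have q1 : pd 1 (bump l L 0) x = 0 := by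
      refine pd_eq_of_hasDerivAt (hs b0) ?_
      simp only [bump_update (show (0 : Fin 3) ≠ 1 by decide)]
      exact hasDerivAt_const _ _
    have q2 : pd 2 (fun x => bump l L 0 x * bump l L 1 x) x = 0 := by
      refine pd_eq_of_hasDerivAt (hs b01) ?_
      simp only [bump_update (show (0 : Fin 3) ≠ 2 by decide),
        bump_update (show (1 : Fin 3) ≠ 2 by decide)]
      exact hasDerivAt_const _ _
    rw [Fin.sum_univ_three]
    change pd 0 (bog l L 0 e) x + pd 1 (fun x => bump l L 0 x * bog l L 1 e1 x) x +
      pd 2 (fun x => bump l L 0 x * bump l L 1 x * bog l L 2 e2 x) x = _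
    rw [pd_mul 1 (hs b0) (hs (TC_bog t1 1)), pd_mul 2 (hs b01) (hs (TC_bog t2 2)), q1, q2,
      pd_bog he, pd_bog t1, pd_bog t2, hm x]
    ring
  · have hE := h1_nonneg (l := l) (L := L) e
    have p0 : 0 ≤ Cb * h1 l L e := by positivity
    have p1 : 0 ≤ C0 * (Cb * Ct) * h1 l L e := by positivity
    have p2 : 0 ≤ C1 * (Cb * (Ct * Ct)) * h1 l L e := by positivity
    intro j; fin_cases j
    · refine (hb 0 e he).trans ?_
      linarith
    · refine (hm0 _ (contDiff_TC (TC_bog t1 1))).trans ?_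
      have := mul_le_mul_of_nonneg_left ((hb 1 e1 t1).trans (mul_le_mul_of_nonneg_left n1 hCb)) hC0
      linarith
    · refine (hm1 _ (contDiff_TC (TC_bog t2 2))).trans ?_
      have := mul_le_mul_of_nonneg_left ((hb 2 e2 t2).trans (mul_le_mul_of_nonneg_left n2 hCb)) hC1
      linarith

end Correction

/-! ### Folding a field at a corner -/

section Fold

/-- The dilation factors of the reflections used at a corner. -/
def refl : Fin 3 → ℝ := ![1, -1, -1 / 2]

/-- Weights of the reflections for the normal component. -/
def wtN : Fin 3 → ℝ := ![1, 3, -4]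

/-- Weights of the reflections for the tangential components. -/
def wtT : Fin 3 → ℝ := ![1, -3, 2]

/-- The weights for the normal component have to satisfy `∑ wtN = 0` and `∑ wtN · refl = 0`, both
components being required to vanish on the face. Two conditions and one normalization call for three
reflections; the factors `1, -1, -1/2` then force `wtN = (1, 3, -4)`. -/
theorem wtN_mul_refl (q : Fin 3) : wtN q * refl q = wtT q := by
  fin_cases q <;> norm_num [wtN, refl, wtT]

theorem sum_wtN : ∑ q, wtN q = 0 := by
  rw [Fin.sum_univ_three]
  change (1 : ℝ) + 3 + (-4) = 0
  norm_num

theorem sum_wtT : ∑ q, wtT q = 0 := by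
  rw [Fin.sum_univ_three]
  change (1 : ℝ) + (-3) + 2 = 0
  norm_num

/-- Sum over the index `r i` first: nothing but its own weight depends on it. -/
theorem sum_prod_mul_eq_zero {a : Fin 3 → Fin 3 → ℝ} {Ψ : (Fin 3 → Fin 3) → ℝ} (i : Fin 3)
    (ha : ∑ q, a i q = 0) (hΨ : ∀ r q, Ψ (Function.update r i q) = Ψ r) :
    ∑ r : Fin 3 → Fin 3, (∏ k, a k (r k)) * Ψ r = 0 := by
  rw [← (Fin.insertNthEquiv (fun _ : Fin 3 => Fin 3) i).sum_comp, Fintype.sum_prod_type,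
    Finset.sum_comm]
  refine Finset.sum_eq_zero fun y _ => ?_
  have hq : ∀ q, Ψ (Fin.insertNthEquiv (fun _ : Fin 3 => Fin 3) i (q, y)) =
      Ψ (i.insertNth 0 y) := fun q => by
    rw [← hΨ (i.insertNth 0 y) q, Fin.update_insertNth]
    rfl
  simp only [hq, Fin.insertNthEquiv_apply, Fin.prod_univ_succAbove _ i, Fin.insertNth_apply_same,
    Fin.insertNth_apply_succAbove, mul_assoc]
  rw [← Finset.sum_mul, ha, zero_mul]

/-- The corner of the box with label `c`. -/
def cpt (l L : ℝ) (c : Fin 3 → Bool) (i : Fin 3) : ℝ := if c i then side l L i else 0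

/-- The translation part of the folding map. -/
def foldA (l L : ℝ) (c : Fin 3 → Bool) (r : Fin 3 → Fin 3) : Pt := fun i =>
  (cpt l L c i - refl (r i) * cpt l L c i + side l L i) / 3

/-- The linear part of the folding map. -/
def foldB (r : Fin 3 → Fin 3) : Pt := fun i => refl (r i) / 3

theorem foldB_bounds (r : Fin 3 → Fin 3) (i : Fin 3) : 1 / 6 ≤ |foldB r i| ∧ |foldB r i| ≤ 1 := by
  unfold foldB
  generalize r i = q
  fin_cases q <;> norm_num [refl, abs_div]

/-- Coefficients of the folded field. -/
def coef (j : Fin 3) (r : Fin 3 → Fin 3) : ℝ := ∏ i, if i = j then wtN (r i) else wtT (r i)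

/-- The folding at the corner `c` of the gradient of `φ`. -/
def fold (l L : ℝ) (c : Fin 3 → Bool) (φ : Pt → ℝ) (j : Fin 3) (x : Pt) : ℝ :=
  ∑ r, coef j r * 3 * pd j φ (aff (foldA l L c r) (foldB r) x)

/-- The folding at the corner `c` of a scalar function. -/
def foldS (l L : ℝ) (c : Fin 3 → Bool) (p : Pt → ℝ) (x : Pt) : ℝ :=
  ∑ r : Fin 3 → Fin 3, (∏ i, wtT (r i)) * p (aff (foldA l L c r) (foldB r) x)

/-- The chain rule multiplies `∂ⱼ` of the `j`-th component by `refl / 3`, which turns the normal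
weight in direction `j` into the tangential one. All three summands of the divergence thus carry the
same weights, and the divergence of the folded gradient is a fold of the Laplacian. -/
theorem coef_mul_foldB (j : Fin 3) (r : Fin 3 → Fin 3) :
    coef j r * 3 * foldB r j = ∏ i, wtT (r i) := by
  unfold coef foldB
  rw [← Finset.mul_prod_erase _ _ (Finset.mem_univ j),
    ← Finset.mul_prod_erase _ (fun i => wtT (r i)) (Finset.mem_univ j), if_pos rfl,
    ← wtN_mul_refl (r j), Finset.prod_congr rfl fun i hi => if_neg (Finset.ne_of_mem_erase hi)]
  ring

theorem TC_fold (c : Fin 3 → Bool) {φ : Pt → ℝ} (hφ : φ ∈ TC) (j : Fin 3) : fold l L c φ j ∈ TC :=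
  TC_sum _ fun _ _ => TC_const_mul _ (TC_comp_aff _ _ (TC_pd hφ j))

theorem sum_pd_fold (c : Fin 3 → Bool) {φ : Pt → ℝ} (hφ : ContDiff ℝ ∞ φ) (x : Pt) :
    ∑ j, pd j (fold l L c φ j) x = foldS l L c (lap φ) x := by
  have h : ∀ j, pd j (fold l L c φ j) x = ∑ r : Fin 3 → Fin 3, (∏ i, wtT (r i)) *
      pd j (pd j φ) (aff (foldA l L c r) (foldB r) x) := fun j => by
    have hs : ∀ r, DifferentiableAt ℝ (fun x => pd j φ (aff (foldA l L c r) (foldB r) x)) x :=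
      fun r => differentiable_of_smooth
        ((contDiff_pd hφ j).comp (contDiff_aff (foldA l L c r) (foldB r))) x
    unfold fold
    rw [pd_sum _ _ fun r _ => (hs r).const_mul _]
    refine Finset.sum_congr rfl fun r _ => ?_
    rw [pd_const_mul j _ (hs r), pd_comp_aff (contDiff_pd hφ j), ← mul_assoc, coef_mul_foldB]
  simp only [h, foldS, lap, Finset.mul_sum]
  exact Finset.sum_comm

/-- On a face through the corner the reflections in the direction `i` all act as the identity, so
the copies differ only in their weights, which sum to zero for normal and tangential components
alike. -/
theorem fold_eq_zero (c : Fin 3 → Bool) (φ : Pt → ℝ) (j : Fin 3) {x : Pt} {i : Fin 3}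
    (hx : x i = cpt l L c i) : fold l L c φ j x = 0 := by
  unfold fold
  simp only [coef, mul_assoc]
  refine sum_prod_mul_eq_zero (a := fun k q => if k = j then wtN q else wtT q) i ?_ fun r q => ?_
  · by_cases h : i = j
    · simpa [h] using sum_wtN
    · simpa [h] using sum_wtT
  · congr 2
    funext k
    rcases eq_or_ne k i with rfl | hk
    · simp only [aff, foldA, foldB, hx]; ring
    · simp [aff, foldA, foldB, hk]

/-- The weights sum to zero, so folding ignores constants. This is why it is enough to approximate
by Laplacians up to an additive constant. -/
theorem foldS_add_const (c : Fin 3 → Bool) (p : Pt → ℝ) (k : ℝ) (x : Pt) :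
    foldS l L c (fun x => p x + k) x = foldS l L c p x := by
  simp only [foldS, mul_add, Finset.sum_add_distrib]
  rw [sum_prod_mul_eq_zero (a := fun _ => wtT) (Ψ := fun _ => k) 0 sum_wtT fun _ _ => rfl, add_zero]

theorem exists_h1_fold_le (l L : ℝ) [Fact (0 < l)] [Fact (0 < L)]
    (hmaps : ∀ c r, MapsTo (aff (foldA l L c r) (foldB r)) (box l L) (box l L)) :
    ∃ C, 0 ≤ C ∧ ∀ c, ∀ φ ∈ TC, ∀ j, h1 l L (fold l L c φ j) ≤ C * h1 l L (pd j φ) := by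
  refine ⟨∑ j, ∑ r, |coef j r * 3| * 60, by positivity, fun c φ hφ j => ?_⟩
  have hs := fun r => contDiff_TC (TC_comp_aff (foldA l L c r) (foldB r) (TC_pd hφ j))
  refine (h1_sum_le _ fun r _ => contDiff_const.mul (hs r)).trans ?_
  calc _ ≤ ∑ r, |coef j r * 3| * 60 * h1 l L (pd j φ) := Finset.sum_le_sum fun r _ => by
        rw [h1_const_mul _ (hs r), mul_assoc]
        exact mul_le_mul_of_nonneg_left (h1_comp_aff_le _ (fun i => (foldB_bounds r i).1)
          (fun i => (foldB_bounds r i).2) (hmaps c r) (contDiff_TC (TC_pd hφ j))) (abs_nonneg _)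
    _ = (∑ r, |coef j r * 3| * 60) * h1 l L (pd j φ) := (Finset.sum_mul _ _ _).symm
    _ ≤ _ := mul_le_mul_of_nonneg_right
        (Finset.single_le_sum (f := fun j => ∑ r, |coef j r * 3| * 60)
          (fun j _ => by positivity) (Finset.mem_univ j)) (h1_nonneg _)

theorem exists_n2_foldS_le (l L : ℝ)
    (hmaps : ∀ c r, MapsTo (aff (foldA l L c r) (foldB r)) (box l L) (box l L)) :
    ∃ C, 0 ≤ C ∧ ∀ c, ∀ p : Pt → ℝ, Measurable p → MemLp p 2 (volume.restrict (box l L)) →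
      MemLp (foldS l L c p) 2 (volume.restrict (box l L)) ∧
        n2 l L (foldS l L c p) ≤ C * n2 l L p := by
  refine ⟨∑ r : Fin 3 → Fin 3, |∏ i, wtT (r i)| * 15, by positivity, fun c p hp hp2 => ?_⟩
  have hs := fun r => memLp_comp_aff (foldA l L c r) (fun i => (foldB_bounds r i).1) (hmaps c r) hp hp2
  have hs' : ∀ r : Fin 3 → Fin 3, MemLp (fun x => (∏ i, wtT (r i)) *
      p (aff (foldA l L c r) (foldB r) x)) 2 (volume.restrict (box l L)) := fun r =>
    (hs r).1.const_mul _
  refine ⟨memLp_finsetSum _ fun r _ => hs' r, (n2_sum_le _ fun r _ => hs' r).trans ?_⟩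
  rw [Finset.sum_mul]
  refine Finset.sum_le_sum fun r _ => ?_
  rw [n2_const_mul, mul_assoc]
  exact mul_le_mul_of_nonneg_left (hs r).2 (abs_nonneg _)

theorem mapsTo_fold [Fact (0 < l)] [Fact (0 < L)] (c : Fin 3 → Bool) (r : Fin 3 → Fin 3) :
    MapsTo (aff (foldA l L c r) (foldB r)) (box l L) (box l L) := by
  intro x hx i
  have hs := side_pos (l := l) (L := L) i
  obtain ⟨h1, h2⟩ := hx i
  simp only [aff, foldA, foldB, cpt]
  generalize r i = q
  cases c i <;> fin_cases q <;> simp [refl] <;> constructor <;> linarith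

/-- The rescaling of `f` to the middle third of the box, extended by zero. -/
def shrink (l L : ℝ) (f : Pt → ℝ) (x : Pt) : ℝ :=
  (box l L).indicator f (aff (fun i => - side l L i) (fun _ => 3) x)

theorem measurable_shrink {f : Pt → ℝ} (hf : Measurable f) : Measurable (shrink l L f) :=
  (hf.indicator (measurableSet_box l L)).comp (contDiff_aff _ _).continuous.measurable

theorem memLp_shrink {f : Pt → ℝ} (hf : Measurable f) (hf2 : MemLp f 2 (volume.restrict (box l L))) :
    MemLp (shrink l L f) 2 (volume.restrict (box l L)) ∧
      n2 l L (shrink l L f) ≤ 15 * n2 l L f := by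
  refine memLp_of_lintegral_le (measurable_shrink hf) hf2 ?_
  have hm : Measurable fun x => ‖(box l L).indicator f x‖ₑ ^ 2 :=
    (hf.indicator (measurableSet_box l L)).enorm.pow_const 2
  have h := lintegral_comp_aff (fun i => - side l L i) (β := fun _ => 3) (fun _ => by norm_num) hm
  have e : ∫⁻ x, ‖(box l L).indicator f x‖ₑ ^ 2 = ∫⁻ x in box l L, ‖f x‖ₑ ^ 2 := by
    rw [← lintegral_indicator (measurableSet_box l L)]
    refine lintegral_congr fun x => ?_
    by_cases hx : x ∈ box l L <;> simp [hx]
  rw [← e, ← h]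
  refine (setLIntegral_le_lintegral _ _).trans ?_
  rw [← mul_assoc]
  refine le_mul_of_one_le_left' ?_
  norm_num [Fin.prod_univ_three]

/-- The map without reflections carries the box onto its middle third, inverse to the dilation in
`shrink`. Any map with a reflection in some coordinate sends that coordinate outside the middle
third, where the shrunken function is zero. -/
theorem foldS_shrink [Fact (0 < l)] [Fact (0 < L)] (c : Fin 3 → Bool) (f : Pt → ℝ) {x : Pt}
    (hx : x ∈ box l L) : foldS l L c (shrink l L f) x = f x := by
  unfold foldS
  rw [Finset.sum_eq_single (0 : Fin 3 → Fin 3)]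
  · have : aff (fun i => - side l L i) (fun _ => 3) (aff (foldA l L c 0) (foldB 0) x) = x := by
      funext i
      simp only [aff, foldA, foldB, refl, Pi.zero_apply, Matrix.cons_val_zero]
      ring
    rw [shrink, this, indicator_of_mem hx]
    simp [wtT]
  · intro r _ hr
    obtain ⟨i, hi⟩ := Function.ne_iff.1 hr
    have : aff (fun i => - side l L i) (fun _ => 3) (aff (foldA l L c r) (foldB r) x) ∉ box l L := by
      intro h
      obtain ⟨h1, h2⟩ := hx i
      obtain ⟨h3, h4⟩ := h i
      revert hi h3 h4
      simp only [aff, foldA, foldB, cpt, Pi.zero_apply]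
      generalize r i = q
      cases c i <;> fin_cases q <;> simp [refl] <;> intros <;> linarith
    rw [shrink, indicator_of_notMem this, mul_zero]
  · simp

end Fold

/-! ### A smooth partition of unity subordinate to the corners -/

section Partition

/-- The one-dimensional cutoffs at the two ends of an interval. -/
def endCut (s : ℝ) (b : Bool) (t : ℝ) : ℝ :=
  if b then 3 / s ^ 2 * t ^ 2 - 2 / s ^ 3 * t ^ 3 else 1 - (3 / s ^ 2 * t ^ 2 - 2 / s ^ 3 * t ^ 3)

theorem contDiff_endCut (s : ℝ) (b : Bool) : ContDiff ℝ ∞ (endCut s b) := by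
  unfold endCut
  cases b <;> simp <;> fun_prop

theorem hasDerivAt_endCut (s : ℝ) (b : Bool) (t : ℝ) : HasDerivAt (endCut s b)
    ((if b then 1 else -1) * (6 / s ^ 2 * t - 6 / s ^ 3 * t ^ 2)) t := by
  have h : HasDerivAt (fun t : ℝ => 3 / s ^ 2 * t ^ 2 - 2 / s ^ 3 * t ^ 3)
      (3 / s ^ 2 * (2 * t) - 2 / s ^ 3 * (3 * t ^ 2)) t := by
    have h2 := (hasDerivAt_pow 2 t).const_mul (3 / s ^ 2)
    have h3 := (hasDerivAt_pow 3 t).const_mul (2 / s ^ 3)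
    exact (h2.sub h3).congr_deriv (by norm_num)
  cases b
  · exact (h.const_sub 1).congr_deriv (by simp only [Bool.false_eq_true, if_false]; ring)
  · exact h.congr_deriv (by simp only [if_true]; ring)

/-- The partition of unity. -/
def chi (l L : ℝ) (c : Fin 3 → Bool) : Pt → ℝ := tens fun i => endCut (side l L i) (c i)

theorem TC_chi (c : Fin 3 → Bool) : chi l L c ∈ TC := tens_mem_TC fun _ => contDiff_endCut _ _

theorem sum_chi (x : Pt) : ∑ c, chi l L c x = 1 := by
  unfold chi tens
  have h := Finset.prod_univ_sum (fun _ : Fin 3 => (Finset.univ : Finset Bool))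
    fun i b => endCut (side l L i) b (x i)
  rw [Fintype.piFinset_univ] at h
  rw [← h]
  simp [endCut]

variable [Fact (0 < l)] [Fact (0 < L)]

theorem abs_chi_le (c : Fin 3 → Bool) {x : Pt} (hx : x ∈ box l L) : |chi l L c x| ≤ 1 := by
  unfold chi tens
  rw [Finset.abs_prod]
  refine Finset.prod_le_one (fun _ _ => abs_nonneg _) fun i _ => ?_
  have hs := side_pos (l := l) (L := L) i
  obtain ⟨h1, h2⟩ := hx i
  have hy0 : 0 < x i / side l L i := div_pos h1 hs
  have hy1 : x i / side l L i < 1 := (div_lt_one hs).2 h2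
  have e : 3 / side l L i ^ 2 * x i ^ 2 - 2 / side l L i ^ 3 * x i ^ 3 =
      3 * (x i / side l L i) ^ 2 - 2 * (x i / side l L i) ^ 3 := by
    field_simp
  generalize x i / side l L i = y at hy0 hy1 e
  have b1 : 0 ≤ 3 * y ^ 2 - 2 * y ^ 3 := by nlinarith [mul_pos hy0 hy0]
  have b2 : 3 * y ^ 2 - 2 * y ^ 3 ≤ 1 := by nlinarith [mul_pos hy0 hy0, sq_nonneg (1 - y)]
  rw [abs_le]
  simp only [endCut, e]
  split_ifs <;> constructor <;> linarith

theorem endCut_eq_zero (c : Fin 3 → Bool) {x : Pt} {i : Fin 3}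
    (hx : x i = 0 ∨ x i = side l L i) (hc : x i ≠ cpt l L c i) :
    endCut (side l L i) (c i) (x i) = 0 := by
  have hs := (side_pos (l := l) (L := L) i).ne'
  unfold cpt at hc
  rcases hx with h | h <;> rw [h] at hc ⊢ <;> cases hb : c i <;> simp [hb] at hc <;> simp [endCut]
  · field_simp; ring

/-- Complementary to `fold_eq_zero`: each face either passes through the corner, where the fold
vanishes, or does not, where the cutoff vanishes. -/
theorem chi_eq_zero (c : Fin 3 → Bool) {x : Pt} {i : Fin 3}
    (hx : x i = 0 ∨ x i = side l L i) (hc : x i ≠ cpt l L c i) : chi l L c x = 0 := by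
  unfold chi tens
  exact Finset.prod_eq_zero (Finset.mem_univ i) (endCut_eq_zero c hx hc)

/-- The cubic `3 y² - 2 y³` has zero slope at both ends, so the gradient of the cutoff also vanishes
on the faces not through its corner. A linear cutoff would leave an error that does not vanish on
the boundary. -/
theorem pd_chi_eq_zero (c : Fin 3 → Bool) (j : Fin 3) {x : Pt} {i : Fin 3}
    (hx : x i = 0 ∨ x i = side l L i) (hc : x i ≠ cpt l L c i) : pd j (chi l L c) x = 0 := by
  have hs := (side_pos (l := l) (L := L) i).ne'
  unfold chi
  rw [pd_tens fun k => (contDiff_endCut _ _).differentiable (by simp)]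
  refine Finset.prod_eq_zero (Finset.mem_univ i) ?_
  rcases eq_or_ne i j with rfl | hij
  · rw [Function.update_self, (hasDerivAt_endCut _ _ _).deriv]
    rcases hx with h | h <;> rw [h]
    · simp
    · field_simp; simp
  · rw [Function.update_of_ne hij]
    exact endCut_eq_zero c hx hc

end Partition

/-! ### A bounded right inverse of the divergence -/

section Glue

theorem h1_sub_le {f g : Pt → ℝ} (hf : ContDiff ℝ ∞ f) (hg : ContDiff ℝ ∞ g) :
    h1 l L (fun x => f x - g x) ≤ h1 l L f + h1 l L g := by
  have hi : ∀ j, n2 l L (pd j fun x => f x - g x) ≤ n2 l L (pd j f) + n2 l L (pd j g) := fun j => by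
    rw [show (pd j fun x => f x - g x) = fun x => pd j f x - pd j g x from funext fun x =>
      pd_sub j (differentiable_of_smooth hf x) (differentiable_of_smooth hg x)]
    exact n2_sub_le (memLp_smooth (contDiff_pd hf j)) (memLp_smooth (contDiff_pd hg j))
  have := Finset.sum_le_sum fun j (_ : j ∈ Finset.univ) => hi j
  rw [Finset.sum_add_distrib] at this
  have h0 := n2_sub_le (l := l) (L := L) (memLp_smooth hf) (memLp_smooth hg)
  unfold h1
  linarith

/-- Gluing the foldings of the gradient of a Neumann potential. -/
theorem exists_glue (l L : ℝ) [Fact (0 < l)] [Fact (0 < L)] : ∃ C, 0 ≤ C ∧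
    ∀ φ ∈ TC, IsNeumann l L φ → ∃ z : Fin 3 → Pt → ℝ, ∃ m : ℝ,
      (∀ j, z j ∈ TC) ∧ (∀ j i, VanishOn l L i (z j)) ∧
      (∀ x, ∑ j, pd j (z j) x = ∑ c, chi l L c x * foldS l L c (lap φ) x +
        bump l L 0 x * bump l L 1 x * bump l L 2 x * m) ∧
      ∀ j, h1 l L (z j) ≤ C * n2 l L (lap φ) := by
  obtain ⟨Cg, hCg, hg⟩ := exists_h1_grad_le l L
  obtain ⟨Cw, hCw, hw⟩ := exists_h1_fold_le l L mapsTo_fold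
  obtain ⟨Cc, hCc, hc⟩ := exists_div_correction l L
  have hχ := fun c => exists_h1_mul_le (l := l) (L := L) (contDiff_TC (TC_chi (l := l) (L := L) c))
  choose Cχ hCχ hχ using hχ
  have hp := fun (p : (Fin 3 → Bool) × Fin 3) => exists_h1_mul_le (l := l) (L := L)
    (contDiff_TC (TC_pd (TC_chi (l := l) (L := L) p.1) p.2))
  choose Cp hCp hp using hp
  have s1 : 0 ≤ ∑ c, Cχ c := Finset.sum_nonneg fun c _ => hCχ c
  have s2 : 0 ≤ ∑ p, Cp p := Finset.sum_nonneg fun c _ => hCp c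
  refine ⟨(∑ c, Cχ c + Cc * ∑ p, Cp p) * (Cw * Cg), by positivity, fun φ hφ hN => ?_⟩
  have hwt := fun c j => TC_fold (l := l) (L := L) c hφ j
  have hwn : ∀ c j, h1 l L (fold l L c φ j) ≤ Cw * Cg * n2 l L (lap φ) := fun c j => by
    rw [mul_assoc]
    exact (hw c φ hφ j).trans (mul_le_mul_of_nonneg_left (hg φ hN j) hCw)
  set N := Cw * Cg * n2 l L (lap φ) with hNdef
  have hN0 : 0 ≤ N := (h1_nonneg _).trans (hwn (fun _ => true) 0)
  have het : ∀ p : (Fin 3 → Bool) × Fin 3,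
      (fun x => pd p.2 (chi l L p.1) x * fold l L p.1 φ p.2 x) ∈ TC := fun p =>
    TC_mul (TC_pd (TC_chi _) _) (hwt _ _)
  -- The divergence of `∑ χ_c w_c`, with `w_c` the fold at the corner `c`, contains the unwanted
  -- term `∑ ∇χ_c · w_c`. It contains no derivative of `w_c`, so it is bounded in `H¹` and vanishes
  -- on the boundary, which allows it to be corrected up to a bump.
  obtain ⟨z', m, t1, t2, t3, t4⟩ := hc (fun x => ∑ p : (Fin 3 → Bool) × Fin 3,
    pd p.2 (chi l L p.1) x * fold l L p.1 φ p.2 x) (TC_sum _ fun p _ => het p) (by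
      intro i x hx
      refine Finset.sum_eq_zero fun p _ => ?_
      by_cases h : x i = cpt l L p.1 i
      · rw [fold_eq_zero _ _ _ h, mul_zero]
      · rw [pd_chi_eq_zero _ _ hx h, zero_mul])
  have hen : h1 l L (fun x => ∑ p : (Fin 3 → Bool) × Fin 3,
      pd p.2 (chi l L p.1) x * fold l L p.1 φ p.2 x) ≤ (∑ p, Cp p) * N := by
    refine (h1_sum_le _ fun p _ => contDiff_TC (het p)).trans ?_
    rw [Finset.sum_mul]
    exact Finset.sum_le_sum fun p _ => (hp p _ (contDiff_TC (hwt _ _))).trans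
      (mul_le_mul_of_nonneg_left (hwn _ _) (hCp p))
  have hct : ∀ j, (fun x => ∑ c, chi l L c x * fold l L c φ j x) ∈ TC := fun j =>
    TC_sum _ fun c _ => TC_mul (TC_chi c) (hwt c j)
  have hs := fun {f} (hf : f ∈ TC) x => differentiable_of_smooth (contDiff_TC hf) x
  refine ⟨fun j x => ∑ c, chi l L c x * fold l L c φ j x - z' j x, m,
    fun j => TC_sub (hct j) (t1 j), ?_, ?_, ?_⟩
  · intro j i x hx
    simp only [t2 j i x hx, sub_zero]
    refine Finset.sum_eq_zero fun c _ => ?_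
    by_cases h : x i = cpt l L c i
    · rw [fold_eq_zero _ _ _ h, mul_zero]
    · rw [chi_eq_zero c hx h, zero_mul]
  · intro x
    have e1 : ∀ j, pd j (fun x => ∑ c, chi l L c x * fold l L c φ j x - z' j x) x =
        ∑ c, (pd j (chi l L c) x * fold l L c φ j x + chi l L c x * pd j (fold l L c φ j) x)
          - pd j (z' j) x := fun j => by
      rw [pd_sub j (hs (hct j) x) (hs (t1 j) x),
        pd_sum _ _ fun c _ => hs (TC_mul (TC_chi c) (hwt c j)) x]
      congr 1
      exact Finset.sum_congr rfl fun c _ => pd_mul j (hs (TC_chi c) x) (hs (hwt c j) x)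
    simp only [e1, Finset.sum_sub_distrib, t3, Finset.sum_add_distrib]
    rw [Fintype.sum_prod_type, Finset.sum_comm, Finset.sum_comm (f := fun j c =>
      chi l L c x * pd j (fold l L c φ j) x)]
    simp only [← Finset.mul_sum, sum_pd_fold _ hN.smooth]
    ring
  · intro j
    refine (h1_sub_le (contDiff_TC (hct j)) (contDiff_TC (t1 j))).trans ?_
    have a1 : h1 l L (fun x => ∑ c, chi l L c x * fold l L c φ j x) ≤ (∑ c, Cχ c) * N := by
      refine (h1_sum_le _ fun c _ => contDiff_TC (TC_mul (TC_chi c) (hwt c j))).trans ?_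
      rw [Finset.sum_mul]
      exact Finset.sum_le_sum fun c _ => (hχ c _ (contDiff_TC (hwt _ _))).trans
        (mul_le_mul_of_nonneg_left (hwn _ _) (hCχ c))
    have a2 := (t4 j).trans (mul_le_mul_of_nonneg_left hen hCc)
    rw [mul_assoc, ← hNdef, add_mul, mul_assoc]
    exact add_le_add a1 a2

/-- Functions `Δφ + k` with `φ` a Neumann potential. -/
def lapSpace (l L : ℝ) : Submodule ℝ (L2 l L) where
  carrier := {g | ∃ φ ∈ TC, IsNeumann l L φ ∧ ∃ k : ℝ,
    g =ᵐ[volume.restrict (box l L)] fun x => lap φ x + k}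
  zero_mem' := ⟨fun _ => 0, TC.zero_mem, ⟨contDiff_const, fun i x _ => pd_const i 0 x⟩, 0, by
    have : ∀ i : Fin 3, pd i (fun _ : Pt => (0 : ℝ)) = fun _ => 0 := fun i => funext (pd_const i 0)
    filter_upwards [Lp.coeFn_zero ℝ 2 (volume.restrict (box l L))] with x hx
    refine hx.trans ?_
    simp [lap, this]⟩
  add_mem' := by
    rintro g h ⟨φ, hφ, hφN, k, hk⟩ ⟨ψ, hψ, hψN, m, hm⟩
    have e : ∀ i, pd i (fun x => φ x + ψ x) = fun x => pd i φ x + pd i ψ x := fun i => funext fun x =>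
      pd_add i (differentiable_of_smooth hφN.smooth x) (differentiable_of_smooth hψN.smooth x)
    have e2 : ∀ i, pd i (fun x => pd i φ x + pd i ψ x) =
        fun x => pd i (pd i φ) x + pd i (pd i ψ) x := fun i => funext fun x =>
      pd_add i (differentiable_of_smooth (contDiff_pd hφN.smooth i) x)
        (differentiable_of_smooth (contDiff_pd hψN.smooth i) x)
    refine ⟨fun x => φ x + ψ x, TC_add hφ hψ, ⟨hφN.smooth.add hψN.smooth, fun i x hx => ?_⟩,
      k + m, ?_⟩
    · simp only [e, hφN.normal i x hx, hψN.normal i x hx, add_zero]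
    · filter_upwards [hk, hm, Lp.coeFn_add g h] with x h1 h2 h3
      rw [h3, Pi.add_apply, h1, h2]
      simp only [lap, e, e2, Finset.sum_add_distrib]
      ring
  smul_mem' := by
    rintro c g ⟨φ, hφ, hφN, k, hk⟩
    have e : ∀ i, pd i (fun x => c * φ x) = fun x => c * pd i φ x := fun i => funext fun x =>
      pd_const_mul i c (differentiable_of_smooth hφN.smooth x)
    have e2 : ∀ i, pd i (fun x => c * pd i φ x) = fun x => c * pd i (pd i φ) x := fun i =>
      funext fun x => pd_const_mul i c (differentiable_of_smooth (contDiff_pd hφN.smooth i) x)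
    refine ⟨fun x => c * φ x, TC_const_mul c hφ, ⟨contDiff_const.mul hφN.smooth, fun i x hx => ?_⟩,
      c * k, ?_⟩
    · simp only [e, hφN.normal i x hx, mul_zero]
    · filter_upwards [hk, Lp.coeFn_smul c g] with x h1 h3
      rw [h3, Pi.smul_apply, h1]
      simp only [lap, e, e2, ← Finset.mul_sum, smul_eq_mul]
      ring

variable [Fact (0 < l)] [Fact (0 < L)]

/-- A nonconstant cosine product is the Laplacian of itself divided by `-|κ|²`; the constant one is
covered by the additive constant. -/
theorem cosP_mem_lapSpace (k : Fin 3 → ℤ) :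
    (memLp_smooth (contDiff_cosP k)).toLp (cosP l L k) ∈ lapSpace l L := by
  by_cases hk : ∑ i, freq l L k i ^ 2 = 0
  · have h0 : ∀ i, freq l L k i = 0 := fun i => by
      have := (Finset.sum_eq_zero_iff_of_nonneg fun i _ => sq_nonneg (freq l L k i)).1 hk i
        (Finset.mem_univ i)
      exact pow_eq_zero_iff two_ne_zero |>.1 this
    refine ⟨fun _ => 0, TC.zero_mem, ⟨contDiff_const, fun i x _ => pd_const i 0 x⟩, 1, ?_⟩
    have : ∀ i : Fin 3, pd i (fun _ : Pt => (0 : ℝ)) = fun _ => 0 := fun i => funext (pd_const i 0)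
    filter_upwards [(memLp_smooth (l := l) (L := L) (contDiff_cosP (l := l) (L := L) k)).coeFn_toLp]
      with x hx
    rw [hx]
    simp [lap, this, cosP, tens, h0]
  · obtain ⟨c, hc⟩ : ∃ c, c = -(∑ i, freq l L k i ^ 2)⁻¹ := ⟨_, rfl⟩
    have hs := contDiff_cosP (l := l) (L := L) k
    have e : ∀ i, pd i (fun x => c * cosP l L k x) = fun x => c * pd i (cosP l L k) x := fun i =>
      funext fun x => pd_const_mul i c (differentiable_of_smooth hs x)
    have e2 : ∀ i, pd i (fun x => c * pd i (cosP l L k) x) =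
        fun x => c * pd i (pd i (cosP l L k)) x := fun i =>
      funext fun x => pd_const_mul i c (differentiable_of_smooth (contDiff_pd hs i) x)
    refine ⟨fun x => c * cosP l L k x, TC_const_mul c (cosP_mem_TC k),
      ⟨contDiff_const.mul hs, fun i x hx => ?_⟩, 0, ?_⟩
    · simp only [e, pd_cosP_face k i x hx, mul_zero]
    · filter_upwards [(memLp_smooth (l := l) (L := L) (contDiff_cosP (l := l) (L := L) k)).coeFn_toLp]
        with x hx
      rw [hx]
      simp only [lap, e, e2, pd_pd_cosP, ← Finset.mul_sum, ← Finset.sum_mul, add_zero,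
        Finset.sum_neg_distrib]
      rw [hc]
      field_simp

theorem dense_lapSpace : Dense (lapSpace l L : Set (L2 l L)) := by
  refine dense_of_orthogonal _ fun u hu => eq_zero_of_integral_cosP fun k => ?_
  rw [← hu _ (cosP_mem_lapSpace k)]
  exact (inner_Lp_congr Filter.EventuallyEq.rfl (MemLp.coeFn_toLp _)).symm

theorem exists_lap_approx {F : Pt → ℝ} (hF : MemLp F 2 (volume.restrict (box l L))) {ε : ℝ}
    (hε : 0 < ε) : ∃ φ ∈ TC, IsNeumann l L φ ∧ ∃ k : ℝ, n2 l L (fun x => lap φ x + k - F x) < ε := by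
  obtain ⟨g, hg, φ, hφ, hN, k, hk⟩ := Metric.dense_iff.1 dense_lapSpace (hF.toLp F) ε hε
  refine ⟨φ, hφ, hN, k, ?_⟩
  rw [Metric.mem_ball, dist_eq_norm] at hg
  rwa [n2_eq_norm (u := g - hF.toLp F)]
  filter_upwards [hk, hF.coeFn_toLp, Lp.coeFn_sub g (hF.toLp F)] with x h1 h2 h3
  rw [h3, Pi.sub_apply, h1, h2]

theorem integral_pd_eq_zero {f : Pt → ℝ} (hf : ContDiff ℝ ∞ f) {i : Fin 3} (h : VanishOn l L i f) :
    ∫ x in box l L, pd i f x = 0 := by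
  have := integral_mul_pd (l := l) (L := L) (φ := fun _ => 1) contDiff_const hf i
    (fun x hx => by rw [h x (Or.inl hx), mul_zero]) (fun x hx => by rw [h x (Or.inr hx), mul_zero])
  simpa [pd_const] using this

theorem IsNeumann.integral_lap {φ : Pt → ℝ} (h : IsNeumann l L φ) : ∫ x in box l L, lap φ x = 0 := by
  unfold lap
  rw [integral_finsetSum _ fun i _ => integrable_box_of_continuous
    (continuous_pd (contDiff_pd h.smooth i) i)]
  exact Finset.sum_eq_zero fun i _ => integral_pd_eq_zero (contDiff_pd h.smooth i) (h.normal i)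

/-- The Laplacian of a Neumann potential has mean zero, hence is orthogonal to constants. -/
theorem IsNeumann.n2_lap_le {φ : Pt → ℝ} (h : IsNeumann l L φ) (k : ℝ) :
    n2 l L (lap φ) ≤ n2 l L fun x => lap φ x + k := by
  refine Real.sqrt_le_sqrt ?_
  have hc := (contDiff_lap h.smooth).continuous
  have e : ∫ x in box l L, (lap φ x + k) ^ 2 =
      ∫ x in box l L, (lap φ x ^ 2 + 2 * k * lap φ x + k ^ 2) :=
    integral_congr_ae (Filter.Eventually.of_forall fun x => by ring)
  have c1 : Continuous fun x => lap φ x ^ 2 := by fun_prop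
  have c2 : Continuous fun x => 2 * k * lap φ x := by fun_prop
  have c3 : Continuous fun x => lap φ x ^ 2 + 2 * k * lap φ x := by fun_prop
  rw [e, integral_add (integrable_box_of_continuous c3) (integrable_const _),
    integral_add (integrable_box_of_continuous c1) (integrable_box_of_continuous c2),
    integral_const_mul, h.integral_lap, mul_zero, add_zero]
  exact le_add_of_nonneg_right (integral_nonneg fun _ => sq_nonneg _)

theorem integral_bumps_pos : 0 < ∫ x in box l L, bump l L 0 x * bump l L 1 x * bump l L 2 x := by
  have hpos : ∀ x ∈ box l L, 0 < bump l L 0 x * bump l L 1 x * bump l L 2 x := fun x hx => by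
    have : ∀ i, 0 < bump l L i x := fun i => by
      have := side_pos (l := l) (L := L) i
      have := (hx i).1
      have := sub_pos.2 (hx i).2
      unfold bump
      positivity
    exact mul_pos (mul_pos (this 0) (this 1)) (this 2)
  have hc : Continuous fun x => bump l L 0 x * bump l L 1 x * bump l L 2 x :=
    (contDiff_TC (TC_mul (TC_mul (TC_bump 0) (TC_bump 1)) (TC_bump 2))).continuous
  rw [setIntegral_pos_iff_support_of_nonneg_ae
    ((ae_restrict_mem (measurableSet_box l L)).mono fun x hx => (hpos x hx).le)
    (integrable_box_of_continuous hc)]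
  refine lt_of_lt_of_le ?_ (measure_mono (show box l L ⊆ _ from fun x hx =>
    ⟨(hpos x hx).ne', hx⟩))
  refine (isOpen_box l L).measure_pos volume ⟨fun i => side l L i / 2, fun i => ?_⟩
  have := side_pos (l := l) (L := L) i
  constructor <;> linarith

/-- An approximate right inverse of the divergence. -/
theorem exists_approx_div (l L : ℝ) [Fact (0 < l)] [Fact (0 < L)] : ∃ C, 0 ≤ C ∧
    ∀ f : L2 l L, ∫ x in box l L, f x = 0 → ∃ z : Fin 3 → Pt → ℝ,
      (∀ j, ContDiff ℝ ∞ (z j)) ∧ (∀ j i, VanishOn l L i (z j)) ∧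
      n2 l L (fun x => f x - ∑ j, pd j (z j) x) ≤ 1 / 2 * ‖f‖ ∧
      ∀ j, h1 l L (z j) ≤ C * ‖f‖ := by
  obtain ⟨Cz, hCz, hz⟩ := exists_glue l L
  obtain ⟨Cs, hCs, hs⟩ := exists_n2_foldS_le l L mapsTo_fold
  set β : Pt → ℝ := fun x => bump l L 0 x * bump l L 1 x * bump l L 2 x with hβ
  set κ := ∫ x in box l L, β x with hκ
  have hκ0 : 0 < κ := integral_bumps_pos
  have hβs : ContDiff ℝ ∞ β := contDiff_TC (TC_mul (TC_mul (TC_bump 0) (TC_bump 1)) (TC_bump 2))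
  set V := n2 l L fun _ => 1 with hV
  have hV0 : 0 ≤ V := n2_nonneg _
  -- The amplification of the approximation error: eight corners with fold constant `Cs`, plus the
  -- bump whose coefficient is controlled by the same error. The final `1` keeps `A ≥ 1`.
  set A := 8 * Cs * (1 + V / κ * n2 l L β) + 1 with hA
  have hA1 : 1 ≤ A := by
    have := n2_nonneg (l := l) (L := L) β
    have : 0 ≤ 8 * Cs * (1 + V / κ * n2 l L β) := by positivity
    linarith
  refine ⟨Cz * 16, by positivity, fun f hf0 => ?_⟩
  have hfm : Measurable f := (Lp.stronglyMeasurable f).measurable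
  have hfn : n2 l L f = ‖f‖ := n2_eq_norm Filter.EventuallyEq.rfl
  -- The tolerance below is proportional to `‖f‖` and has to be positive, so `f = 0` is treated
  -- apart.
  rcases (norm_nonneg f).eq_or_lt with h0 | h0
  · refine ⟨fun _ _ => 0, fun _ => contDiff_const, fun _ _ _ _ => rfl, ?_, fun j => ?_⟩
    · simp [pd_const, hfn, ← h0]
    · have : ∀ i : Fin 3, pd i (fun _ : Pt => (0 : ℝ)) = fun _ => 0 := fun i =>
        funext (pd_const i 0)
      simp only [h1, this, n2_zero]
      simp [← h0]
  obtain ⟨hS, hSn⟩ := memLp_shrink (l := l) (L := L) hfm (Lp.memLp f)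
  rw [hfn] at hSn
  set ε := ‖f‖ / (2 * A) with hε
  have hε0 : 0 < ε := by positivity
  have hε1 : ε ≤ ‖f‖ := div_le_self h0.le (by linarith)
  obtain ⟨φ, hφ, hN, k, hk⟩ := exists_lap_approx hS hε0
  have hlap := (contDiff_lap hN.smooth)
  set q : Pt → ℝ := fun x => lap φ x + k - shrink l L f x with hq
  have hlk : MemLp (fun x => lap φ x + k) 2 (volume.restrict (box l L)) :=
    memLp_smooth (hlap.add contDiff_const)
  have hqm : Measurable q := (hlap.continuous.measurable.add_const k).sub (measurable_shrink hfm)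
  have hq2 : MemLp q 2 (volume.restrict (box l L)) := hlk.sub hS
  have hln : n2 l L (lap φ) ≤ 16 * ‖f‖ := by
    refine (hN.n2_lap_le k).trans ?_
    have := n2_add_le hq2 hS
    simp only [hq, sub_add_cancel] at this
    linarith
  obtain ⟨z, m, z1, z2, z3, z4⟩ := hz φ hφ hN
  refine ⟨z, fun j => contDiff_TC (z1 j), z2, ?_, fun j => (z4 j).trans ?_⟩
  swap
  · rw [mul_assoc]; exact mul_le_mul_of_nonneg_left hln hCz
  set g : Pt → ℝ := fun x => ∑ c, chi l L c x * foldS l L c q x with hg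
  have hfold : ∀ c, ∀ x ∈ box l L, foldS l L c (lap φ) x = f x + foldS l L c q x := fun c x hx => by
    rw [← foldS_shrink (l := l) (L := L) c f hx, ← foldS_add_const c (lap φ) k]
    simp only [foldS, ← Finset.sum_add_distrib, ← mul_add, hq]
    exact Finset.sum_congr rfl fun r _ => by ring
  -- Folding `Δφ` returns `f` plus the fold of the approximation error `q`. The cutoffs sum to one,
  -- so gluing leaves `f` untouched.
  have hdiv : ∀ x ∈ box l L, ∑ j, pd j (z j) x = f x + (g x + m * β x) := fun x hx => by
    rw [z3, Finset.sum_congr rfl fun c _ => by rw [hfold c x hx]]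
    simp only [mul_add, Finset.sum_add_distrib, ← Finset.sum_mul, sum_chi, one_mul, hg, hβ]
    ring
  have hgc : ∀ c, MemLp (fun x => chi l L c x * foldS l L c q x) 2 (volume.restrict (box l L)) ∧
      n2 l L (fun x => chi l L c x * foldS l L c q x) ≤ Cs * ε := fun c => by
    obtain ⟨a1, a2⟩ := hs c q hqm hq2
    have hcs := (contDiff_TC (TC_chi (l := l) (L := L) c)).continuous
    refine ⟨?_, (n2_mul_le (fun x hx => abs_chi_le c hx) zero_le_one a1).trans ?_⟩
    · refine a1.mono (hcs.aestronglyMeasurable.mul a1.1)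
        ((ae_restrict_mem (measurableSet_box l L)).mono fun x hx => ?_)
      rw [norm_mul]
      exact mul_le_of_le_one_left (norm_nonneg _) (abs_chi_le c hx)
    · rw [one_mul]
      exact a2.trans (mul_le_mul_of_nonneg_left hk.le hCs)
  have hg2 : MemLp g 2 (volume.restrict (box l L)) := memLp_finsetSum _ fun c _ => (hgc c).1
  have hgn : n2 l L g ≤ 8 * Cs * ε := by
    refine (n2_sum_le _ fun c _ => (hgc c).1).trans
      ((Finset.sum_le_sum fun c _ => (hgc c).2).trans (le_of_eq ?_))
    simp; ring
  -- The divergence of a field vanishing on the boundary has mean zero, and so has `f`. The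
  -- coefficient `m` of the bump is therefore determined by the mean of the error and is as small as
  -- the error.
  have hint : ∫ x in box l L, g x = - (m * κ) := by
    have e0 : ∫ x in box l L, ∑ j, pd j (z j) x = 0 := by
      rw [integral_finsetSum _ fun j _ => integrable_box_of_continuous
        (continuous_pd (contDiff_TC (z1 j)) j)]
      exact Finset.sum_eq_zero fun j _ => integral_pd_eq_zero (contDiff_TC (z1 j)) (z2 j j)
    have i1 : Integrable f (volume.restrict (box l L)) := (Lp.memLp f).integrable one_le_two
    have i2 := hg2.integrable one_le_two
    have i3 : Integrable (fun x => m * β x) (volume.restrict (box l L)) :=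
      integrable_box_of_continuous (contDiff_const.mul hβs).continuous
    have i4 : Integrable (fun x => g x + m * β x) (volume.restrict (box l L)) := i2.add i3
    rw [setIntegral_congr_fun (measurableSet_box l L) hdiv, integral_add i1 i4, hf0,
      integral_add i2 i3, integral_const_mul] at e0
    linarith
  have hm : |m| * κ ≤ V * n2 l L g := by
    have := abs_integral_mul_le_sqrt (ν := volume.restrict (box l L)) (memLp_const (1 : ℝ)) hg2
    simp only [one_mul] at this
    rwa [hint, abs_neg, abs_mul, abs_of_pos hκ0] at this
  have hm' : |m| ≤ V / κ * n2 l L g := by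
    rw [div_mul_eq_mul_div, le_div_iff₀ hκ0]; exact hm
  have hfin : n2 l L (fun x => f x - ∑ j, pd j (z j) x) ≤ n2 l L g + |m| * n2 l L β := by
    refine (n2_mono (g := fun x => g x + m * β x)
      (hg2.add (memLp_smooth (contDiff_const.mul hβs))) fun x hx => ?_).trans ?_
    · rw [hdiv x hx, abs_sub_comm, add_sub_cancel_left]
    · refine (n2_add_le hg2 (memLp_smooth (contDiff_const.mul hβs))).trans ?_
      rw [n2_const_mul]
  refine hfin.trans ?_
  have hb0 := n2_nonneg (l := l) (L := L) β
  have hg0 := n2_nonneg (l := l) (L := L) g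
  calc n2 l L g + |m| * n2 l L β ≤ n2 l L g + V / κ * n2 l L g * n2 l L β :=
        add_le_add le_rfl (mul_le_mul_of_nonneg_right hm' hb0)
    _ = n2 l L g * (1 + V / κ * n2 l L β) := by ring
    _ ≤ 8 * Cs * ε * (1 + V / κ * n2 l L β) :=
        mul_le_mul_of_nonneg_right hgn (by positivity)
    _ ≤ A * ε := by rw [hA]; nlinarith
    _ = 1 / 2 * ‖f‖ := by rw [hε]; field_simp

end Glue

/-! ### Hilbert space structure on scalar and vector Sobolev functions -/

section Instances

instance : NormedSpace ℝ (H1 l L) := Submodule.normedSpace _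

instance : InnerProductSpace ℝ (H1 l L) := Submodule.innerProductSpace _

instance : NormedAddCommGroup (VH1 l L) := PiLp.normedAddCommGroup 2 _

instance : NormedSpace ℝ (VH1 l L) := PiLp.normedSpace 2 ℝ _

instance : InnerProductSpace ℝ (VH1 l L) := PiLp.innerProductSpace _

instance : CompleteSpace (VH1 l L) := inferInstance

end Instances

/-! ### An exact bounded right inverse of the divergence -/

section RightInverse

/-- An approximate right inverse of a bounded operator yields an exact one. -/
theorem exists_preimage_of_approx {E G : Type*} [NormedAddCommGroup E] [NormedSpace ℝ E]
    [CompleteSpace E] [NormedAddCommGroup G] [NormedSpace ℝ G] (A : E →L[ℝ] G) (S : Submodule ℝ G)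
    {T : Submodule ℝ E} (hT : IsClosed (T : Set E)) {C : ℝ}
    (h : ∀ f ∈ S, ∃ z ∈ T, A z ∈ S ∧ ‖f - A z‖ ≤ 1 / 2 * ‖f‖ ∧ ‖z‖ ≤ C * ‖f‖)
    {f : G} (hf : f ∈ S) : ∃ z ∈ T, A z = f ∧ ‖z‖ ≤ 2 * (C * ‖f‖) := by
  choose! Z hZ h1 h2 h3 using h
  -- Successive residuals: each is at most half the previous one and stays in `S`, so the
  -- corrections sum to a preimage with twice the original bound.
  set F : ℕ → G := fun n => (fun g => g - A (Z g))^[n] f with hF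
  have hsucc : ∀ n, F (n + 1) = F n - A (Z (F n)) := fun n => by
    simp only [hF, Function.iterate_succ_apply']
  have hS : ∀ n, F n ∈ S := fun n => by
    induction n with
    | zero => exact hf
    | succ n ih => rw [hsucc]; exact S.sub_mem ih (h1 _ ih)
  have hn : ∀ n, ‖F n‖ ≤ (1 / 2) ^ n * ‖f‖ := fun n => by
    induction n with
    | zero => simp [hF]
    | succ n ih =>
      rw [hsucc, pow_succ']
      refine (h2 _ (hS n)).trans ?_
      rw [mul_assoc]
      exact mul_le_mul_of_nonneg_left ih (by norm_num)
  by_cases hC : 0 ≤ C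
  · have hb : ∀ n, ‖Z (F n)‖ ≤ (1 / 2) ^ n * (C * ‖f‖) := fun n => by
      refine (h3 _ (hS n)).trans ((mul_le_mul_of_nonneg_left (hn n) hC).trans_eq ?_)
      ring
    have hg : HasSum (fun n : ℕ => (1 / 2 : ℝ) ^ n * (C * ‖f‖)) (2 * (C * ‖f‖)) :=
      hasSum_geometric_two.mul_right _
    have hs : Summable fun n => Z (F n) := Summable.of_norm_bounded hg.summable hb
    refine ⟨∑' n, Z (F n), hT.mem_of_tendsto hs.hasSum.tendsto_sum_nat
      (Filter.Eventually.of_forall fun n => T.sum_mem fun k _ => hZ _ (hS k)), ?_,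
      tsum_of_norm_bounded hg hb⟩
    have h4 := (hs.hasSum.mapL A).tendsto_sum_nat
    have h5 : ∀ n, ∑ k ∈ Finset.range n, A (Z (F k)) = f - F n := fun n => by
      induction n with
      | zero => simp [hF]
      | succ n ih => rw [Finset.sum_range_succ, ih, hsucc]; abel
    have h6 : Filter.Tendsto F Filter.atTop (nhds 0) := by
      refine squeeze_zero_norm hn ?_
      simpa using (tendsto_pow_atTop_nhds_zero_of_lt_one (by norm_num : (0 : ℝ) ≤ 1 / 2)
        (by norm_num)).mul_const ‖f‖
    refine tendsto_nhds_unique h4 ?_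
    simp only [h5]
    simpa using tendsto_const_nhds.sub h6
  -- A negative `C` is compatible with the bound only for `f = 0`.
  · have h7 := (norm_nonneg _).trans (h3 f hf)
    have hf0 : f = 0 := norm_le_zero_iff.1 (by nlinarith [norm_nonneg f])
    exact ⟨0, T.zero_mem, by simp [hf0], by simp [hf0]⟩

/-- The divergence, as a bounded operator. -/
def divL (l L : ℝ) : VH1 l L →L[ℝ] L2 l L :=
  ∑ i, (DL l L i).comp (PiLp.proj 2 (fun _ : Fin 3 => H1 l L) i)

theorem divL_apply (u : VH1 l L) : divL l L u = ∑ i, D i (u i) := by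
  simp [divL]

theorem norm_VH1_le (u : VH1 l L) {A : ℝ} (hA : 0 ≤ A) (h : ∀ i, ‖u i‖ ≤ A) : ‖u‖ ≤ 3 * A := by
  refine abs_le_of_sq_le_sq' ?_ (by positivity) |>.2
  rw [PiLp.norm_sq_eq_of_L2, Fin.sum_univ_three]
  have := fun i => pow_le_pow_left₀ (norm_nonneg _) (h i) 2
  nlinarith [this 0, this 1, this 2]

variable [Fact (0 < l)] [Fact (0 < L)]

/-- The constant function `1`. -/
def oneH (l L : ℝ) [Fact (0 < l)] [Fact (0 < L)] : H1 l L := ofSmooth (fun _ => 1) contDiff_const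

theorem fn_oneH : fn (oneH l L) =ᵐ[volume.restrict (box l L)] fun _ => 1 := fn_ofSmooth _

theorem trace_oneH : trace (oneH l L) =ᵐ[surf l L] fun _ => 1 := trace_ofSmooth _

theorem D_oneH (i : Fin 3) : D i (oneH l L) = 0 := by
  refine Lp.ext ((D_ofSmooth _ i).trans ?_)
  filter_upwards [Lp.coeFn_zero ℝ 2 (volume.restrict (box l L))] with x hx
  rw [pd_const]
  exact hx.symm

theorem integral_D (u : H1 l L) (i : Fin 3) :
    ∫ x in box l L, D i u x = ∫ x, normal l L x i * trace u x ∂(surf l L) := by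
  have h := green u (oneH l L) (ψ := fun _ => 1) contDiff_const i
  have z : D i (oneH l L) =ᵐ[volume.restrict (box l L)] fun _ => 0 := by
    rw [D_oneH]; exact Lp.coeFn_zero ..
  have e1 : ∫ x in box l L, 1 * D i u x * fn (oneH l L) x = ∫ x in box l L, D i u x :=
    integral_congr_ae (fn_oneH.mono fun x hx => by simp [hx])
  have e2 : ∫ x in box l L, 1 * fn u x * D i (oneH l L) x = 0 := by
    rw [integral_congr_ae (g := fun _ => 0) (z.mono fun x hx => by simp [hx]), integral_zero]
  have e3 : ∫ x, normal l L x i * 1 * trace u x * trace (oneH l L) x ∂(surf l L) =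
      ∫ x, normal l L x i * trace u x ∂(surf l L) :=
    integral_congr_ae (trace_oneH.mono fun x hx => by simp [hx])
  rw [e1, e2, e3] at h
  simpa [pd_const] using h

/-- The trace of a component of a vector field. -/
def trVL (l L : ℝ) [Fact (0 < l)] [Fact (0 < L)] (i : Fin 3) : VH1 l L →L[ℝ] L2bd l L :=
  (trL l L).comp (PiLp.proj 2 (fun _ : Fin 3 => H1 l L) i)

@[simp] theorem trVL_apply (i : Fin 3) (u : VH1 l L) : trVL l L i u = trace (u i) := rfl

/-- Fields with components in `H¹₀(Ω)`. -/
def VH10 (l L : ℝ) [Fact (0 < l)] [Fact (0 < L)] : Submodule ℝ (VH1 l L) where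
  carrier := {u | ∀ i, trVL l L i u = 0}
  zero_mem' := fun i => map_zero _
  add_mem' := fun hu hv i => by rw [map_add, hu i, hv i, add_zero]
  smul_mem' := fun c u hu i => by rw [map_smul, hu i, smul_zero]

theorem isClosed_VH10 : IsClosed (VH10 l L : Set (VH1 l L)) := by
  change IsClosed {u : VH1 l L | ∀ i, trVL l L i u = 0}
  rw [ofPred_forall]
  exact isClosed_iInter fun i => isClosed_eq (trVL l L i).continuous continuous_const

theorem trace_ofSmooth_eq_zero {z : Pt → ℝ} (hz : ContDiff ℝ ∞ z) (h : ∀ i, VanishOn l L i z) :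
    trace (ofSmooth (l := l) (L := L) z hz) = 0 := by
  refine Lp.ext ((trace_ofSmooth hz).trans (Filter.EventuallyEq.trans ?_ (Lp.coeFn_zero ..).symm))
  exact ae_surf_of_forall fun i y _ => ⟨h i _ (Or.inl (facePt_same i _ y)),
    h i _ (Or.inr (facePt_same i _ y))⟩

/-- The divergence has a bounded right inverse from mean-zero functions into `H¹₀(Ω)³`. -/
theorem exists_div_eq (l L : ℝ) [Fact (0 < l)] [Fact (0 < L)] : ∃ C, 0 ≤ C ∧
    ∀ f : L2 l L, ∫ x in box l L, f x = 0 → ∃ z : VH1 l L, (∀ i, trace (z i) = 0) ∧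
      ∑ i, D i (z i) = f ∧ ‖z‖ ≤ C * ‖f‖ := by
  obtain ⟨C, hC, h⟩ := exists_approx_div l L
  -- Mean-zero functions form the orthogonal complement of the constants, a subspace in which the
  -- residuals of the iteration stay.
  have hS : ∀ f : L2 l L, f ∈ (Submodule.span ℝ {fn (oneH l L)})ᗮ ↔ ∫ x in box l L, f x = 0 := by
    intro f
    rw [Submodule.mem_orthogonal_singleton_iff_inner_right,
      inner_Lp_congr fn_oneH Filter.EventuallyEq.rfl]
    simp
  refine ⟨2 * (3 * C), by positivity, fun f hf => ?_⟩
  have key : ∀ f ∈ (Submodule.span ℝ {fn (oneH l L)})ᗮ, ∃ z ∈ VH10 l L,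
      divL l L z ∈ (Submodule.span ℝ {fn (oneH l L)})ᗮ ∧ ‖f - divL l L z‖ ≤ 1 / 2 * ‖f‖ ∧
        ‖z‖ ≤ 3 * C * ‖f‖ := by
    intro f hf
    obtain ⟨z, z1, z2, z3, z4⟩ := h f ((hS f).1 hf)
    have hz0 : ∀ i, trace (ofSmooth (l := l) (L := L) (z i) (z1 i)) = 0 := fun i =>
      trace_ofSmooth_eq_zero (z1 i) (z2 i)
    refine ⟨WithLp.toLp 2 fun i => ofSmooth (z i) (z1 i), hz0, ?_, ?_, ?_⟩
    · rw [hS, divL_apply]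
      have e : (∑ i, D i (ofSmooth (l := l) (L := L) (z i) (z1 i)) : L2 l L)
          =ᵐ[volume.restrict (box l L)] fun x => ∑ i, pd i (z i) x := by
        refine (Lp.coeFn_finsetSum _ _).trans ?_
        filter_upwards [ae_all_iff.2 fun i => D_ofSmooth (l := l) (L := L) (z1 i) i] with x hx
        simp [hx]
      rw [integral_congr_ae e, integral_finsetSum _ fun j _ => integrable_box_of_continuous
        (continuous_pd (z1 j) j)]
      exact Finset.sum_eq_zero fun j _ => integral_pd_eq_zero (z1 j) (z2 j j)
    · refine le_trans (le_of_eq ?_) z3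
      rw [n2_eq_norm (u := f - ∑ i, D i (ofSmooth (l := l) (L := L) (z i) (z1 i)))]
      · rw [divL_apply]
      · filter_upwards [ae_all_iff.2 fun i => D_ofSmooth (l := l) (L := L) (z1 i) i,
          Lp.coeFn_sub f (∑ i, D i (ofSmooth (l := l) (L := L) (z i) (z1 i))),
          Lp.coeFn_finsetSum Finset.univ fun i => D i (ofSmooth (l := l) (L := L) (z i) (z1 i))]
          with x h1 h2 h3
        rw [h2, Pi.sub_apply, h3]
        simp [h1]
    · rw [mul_assoc]
      exact norm_VH1_le _ (by positivity) fun i => (norm_ofSmooth_le (z1 i)).trans (z4 i)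
  obtain ⟨z, hz0, hz1, hz2⟩ := exists_preimage_of_approx (divL l L) _
    (isClosed_VH10 (l := l) (L := L)) key ((hS f).2 hf)
  refine ⟨z, hz0, ?_, ?_⟩
  · rw [← divL_apply]; exact hz1
  · rw [mul_assoc]; exact hz2

end RightInverse

/-! ### The abstract coupled system -/

section Abstract

/-- The last step of every energy estimate below: `w²` is at most `N K w`, and one factor `w`
cancels. -/
theorem le_of_energy {w N A K : ℝ} (hw : 0 ≤ w) (hN : 0 ≤ N) (hK : 0 ≤ K) (h : w ^ 2 ≤ N * A)
    (hA : A ≤ K * w) : w ≤ N * K := by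
  rcases hw.eq_or_lt with h0 | h0
  · rw [← h0]; positivity
  · refine le_of_mul_le_mul_right ?_ h0
    calc w * w = w ^ 2 := (sq _).symm
      _ ≤ N * A := h
      _ ≤ N * (K * w) := mul_le_mul_of_nonneg_left hA hN
      _ = N * K * w := by ring

variable {E : Type*} [NormedAddCommGroup E] [InnerProductSpace ℝ E] [CompleteSpace E]

/-- The Lax–Milgram theorem on a closed subspace. -/
theorem exists_solution_of_coercive (S : Submodule ℝ E) (hS : IsClosed (S : Set E))
    (b : E →L[ℝ] E →L[ℝ] ℝ) (F : E →L[ℝ] ℝ) {α : ℝ} (hα : 0 < α)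
    (hb : ∀ w ∈ S, α * ‖w‖ ^ 2 ≤ b w w) : ∃ w ∈ S, ∀ v ∈ S, b w v = F v := by
  have : CompleteSpace S := hS.completeSpace_coe
  set b' : S →L[ℝ] S →L[ℝ] ℝ := b.bilinearComp S.subtypeL S.subtypeL with hb'
  have hc : IsCoercive b' := ⟨α, hα, fun w => by
    have := hb w w.2
    rw [mul_assoc, ← sq]
    exact this⟩
  set f : S := (InnerProductSpace.toDual ℝ S).symm (F.comp S.subtypeL) with hf
  refine ⟨hc.continuousLinearEquivOfBilin.symm f, Subtype.mem _, fun v hv => ?_⟩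
  have h1 := hc.continuousLinearEquivOfBilin_apply (hc.continuousLinearEquivOfBilin.symm f) ⟨v, hv⟩
  rw [ContinuousLinearEquiv.apply_symm_apply] at h1
  have h2 : inner ℝ f (⟨v, hv⟩ : S) = (F.comp S.subtypeL) ⟨v, hv⟩ :=
    InnerProductSpace.toDual_symm_apply
  exact h1.symm.trans h2

/-- Every coset of a closed subspace has an element of least norm. -/
theorem exists_min_norm (S : Submodule ℝ E) (hS : IsClosed (S : Set E)) (x : E) :
    ∃ y, y - x ∈ S ∧ ∀ z, z - x ∈ S → ‖y‖ ≤ ‖z‖ := by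
  obtain ⟨v, hv, h⟩ := S.exists_norm_eq_iInf_of_complete_subspace hS.isComplete x
  refine ⟨x - v, by simpa using hv, fun z hz => ?_⟩
  rw [h]
  have : ‖x - (x - z)‖ = ‖z‖ := by simp
  rw [← this]
  exact ciInf_le ⟨0, by rintro _ ⟨w, rfl⟩; exact norm_nonneg _⟩
    (⟨x - z, by rw [← neg_sub]; exact S.neg_mem hz⟩ : (S : Set E))

variable {V H : Type*} [NormedAddCommGroup V] [InnerProductSpace ℝ V]
  [NormedAddCommGroup H] [InnerProductSpace ℝ H]

variable (V H) in
/-- The forms of a stationary flow coupled to a heat equation, with one constant `N` for all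
their bounds. -/
structure FlowForms where
  X0 : Submodule ℝ V
  Y : Submodule ℝ H
  adm : Submodule ℝ V
  closed_X0 : IsClosed (X0 : Set V)
  closed_Y : IsClosed (Y : Set H)
  X0_le : X0 ≤ adm
  a : V →L[ℝ] V →L[ℝ] ℝ
  a1 : H →L[ℝ] H →L[ℝ] ℝ
  bd : H →L[ℝ] H →L[ℝ] ℝ
  b1 : H →L[ℝ] V →L[ℝ] ℝ
  f : H →L[ℝ] V →L[ℝ] ℝ
  c : V →L[ℝ] V →L[ℝ] V →L[ℝ] ℝ
  c1 : V →L[ℝ] H →L[ℝ] H →L[ℝ] ℝ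
  N : ℝ
  one_le : 1 ≤ N
  a_le : ∀ u v, |a u v| ≤ N * ‖u‖ * ‖v‖
  a1_le : ∀ u v, |a1 u v| ≤ N * ‖u‖ * ‖v‖
  b1_le : ∀ u v, |b1 u v| ≤ N * ‖u‖ * ‖v‖
  f_le : ∀ u v, |f u v| ≤ N * ‖u‖ * ‖v‖
  c_le : ∀ u v w, |c u v w| ≤ N * ‖u‖ * ‖v‖ * ‖w‖
  c1_le : ∀ u v w, |c1 u v w| ≤ N * ‖u‖ * ‖v‖ * ‖w‖
  a_coercive : ∀ w ∈ X0, ‖w‖ ^ 2 ≤ N * a w w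
  a1_coercive : ∀ η ∈ Y, ‖η‖ ^ 2 ≤ N * a1 η η
  bd_nonneg : ∀ η, 0 ≤ bd η η
  c_skew : ∀ u ∈ adm, ∀ w ∈ X0, c u w w = 0
  c1_skew : ∀ u ∈ adm, ∀ η ∈ Y, c1 u η η = 0

namespace FlowForms

variable (F : FlowForms V H)

/-- `θ` solves the heat equation with convecting field `u`. -/
def Heat (B : ℝ) (ℓ : H →L[ℝ] ℝ) (u : V) (θ : H) : Prop :=
  ∀ W ∈ F.Y, F.c1 u θ W + F.a1 θ W + B * F.bd θ W = ℓ W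

/-- `u'` solves the momentum equation with convecting field `u` and temperature `θ`. -/
def Mom (Pr M R : ℝ) (u u' : V) (θ : H) : Prop :=
  ∀ v ∈ F.X0, Pr * F.a u' v + Pr * M * F.b1 θ v + F.c u u' v = Pr * R * F.f θ v

variable {F}

/-- Test the difference of the two equations with `δ = θ1 - θ2`: `c1 u1 δ δ` vanishes, the Robin
term has a good sign, and only `c1 (u1 - u2) θ2 δ` is left. The bound of that term is a parameter
because the conduction state satisfies a sharper one than the general estimate. -/
theorem Heat.norm_sub_le_of_bound {B κ : ℝ} (hB : 0 ≤ B) (hκ : 0 ≤ κ) {ℓ : H →L[ℝ] ℝ} {u1 u2 : V}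
    {θ1 θ2 : H} (hu : u1 ∈ F.adm) (hθ : θ1 - θ2 ∈ F.Y) (h1 : F.Heat B ℓ u1 θ1)
    (h2 : F.Heat B ℓ u2 θ2) (hb : ∀ W, |F.c1 (u1 - u2) θ2 W| ≤ κ * ‖W‖) :
    ‖θ1 - θ2‖ ≤ F.N * κ := by
  have hN := zero_le_one.trans F.one_le
  refine le_of_energy (norm_nonneg _) hN hκ (F.a1_coercive _ hθ) ?_
  have e1 := h1 _ hθ
  have e2 := h2 _ hθ
  have e3 := F.c1_skew u1 hu _ hθ
  have e4 := mul_nonneg hB (F.bd_nonneg (θ1 - θ2))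
  have e5 := neg_le_of_abs_le (hb (θ1 - θ2))
  set δ := θ1 - θ2 with hδ
  have s1 : F.a1 δ δ = F.a1 θ1 δ - F.a1 θ2 δ := F.a1.map_sub₂ θ1 θ2 δ
  have s2 : F.bd δ δ = F.bd θ1 δ - F.bd θ2 δ := F.bd.map_sub₂ θ1 θ2 δ
  have s3 : F.c1 u1 δ δ = F.c1 u1 θ1 δ - F.c1 u1 θ2 δ := (F.c1 u1).map_sub₂ θ1 θ2 δ
  have s4 : F.c1 (u1 - u2) θ2 δ = F.c1 u1 θ2 δ - F.c1 u2 θ2 δ := by rw [map_sub F.c1]; rfl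
  rw [s2] at e4
  rw [s3] at e3
  rw [s4] at e5
  rw [s1]
  linarith

theorem Heat.norm_sub_le {B : ℝ} (hB : 0 ≤ B) {ℓ : H →L[ℝ] ℝ} {u1 u2 : V} {θ1 θ2 : H}
    (hu : u1 ∈ F.adm) (hθ : θ1 - θ2 ∈ F.Y) (h1 : F.Heat B ℓ u1 θ1) (h2 : F.Heat B ℓ u2 θ2) :
    ‖θ1 - θ2‖ ≤ F.N * (F.N * ‖u1 - u2‖ * ‖θ2‖) :=
  have hN := zero_le_one.trans F.one_le
  h1.norm_sub_le_of_bound hB (by positivity) hu hθ h2 fun W => F.c1_le _ _ W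

/-- Test with `θ - Θ`. As the lift `Θ` vanishes on the top, the Robin term contributes only its
nonnegative part, and the bound does not depend on `B`. -/
theorem Heat.norm_le {B D : ℝ} (hB : 0 ≤ B) (hD : 0 ≤ D) {ℓ : H →L[ℝ] ℝ} {u : V} {θ Θ : H}
    (hu : u ∈ F.adm) (hθ : θ - Θ ∈ F.Y) (h : F.Heat B ℓ u θ) (hΘ : ∀ W, F.bd Θ W = 0)
    (hΘn : ‖Θ‖ ≤ F.N * D) (hℓ : ∀ W, |ℓ W| ≤ F.N * D * ‖W‖) :
    ‖θ‖ ≤ 3 * F.N ^ 3 * (1 + ‖u‖) * D := by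
  have hN1 := F.one_le
  have hN := zero_le_one.trans F.one_le
  have key : ‖θ - Θ‖ ≤ F.N * (F.N * D + F.N * (F.N * D) + F.N * ‖u‖ * (F.N * D)) := by
    refine le_of_energy (norm_nonneg _) hN (by positivity) (F.a1_coercive _ hθ) ?_
    have e1 := h _ hθ
    have e3 := F.c1_skew u hu _ hθ
    have e4 := mul_nonneg hB (F.bd_nonneg (θ - Θ))
    have e5 := neg_le_of_abs_le (F.c1_le u Θ (θ - Θ))
    have e6 := neg_le_of_abs_le (F.a1_le Θ (θ - Θ))
    have e7 := le_of_abs_le (hℓ (θ - Θ))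
    set δ := θ - Θ with hδ
    have s1 : F.a1 δ δ = F.a1 θ δ - F.a1 Θ δ := F.a1.map_sub₂ θ Θ δ
    have s2 : F.bd δ δ = F.bd θ δ - F.bd Θ δ := F.bd.map_sub₂ θ Θ δ
    have s3 : F.c1 u δ δ = F.c1 u θ δ - F.c1 u Θ δ := (F.c1 u).map_sub₂ θ Θ δ
    rw [s2, hΘ, sub_zero] at e4
    rw [s3] at e3
    rw [s1]
    have b1 : F.N * ‖Θ‖ * ‖δ‖ ≤ F.N * (F.N * D) * ‖δ‖ := by gcongr
    have b2 : F.N * ‖u‖ * ‖Θ‖ * ‖δ‖ ≤ F.N * ‖u‖ * (F.N * D) * ‖δ‖ := by gcongr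
    linarith
  have t : ‖θ‖ ≤ ‖θ - Θ‖ + ‖Θ‖ := by simpa using norm_add_le (θ - Θ) Θ
  have p1 : F.N * D ≤ F.N ^ 3 * D := mul_le_mul_of_nonneg_right (le_self_pow₀ hN1 (by norm_num)) hD
  have p2 : F.N ^ 2 * D ≤ F.N ^ 3 * D :=
    mul_le_mul_of_nonneg_right (pow_le_pow_right₀ hN1 (by norm_num)) hD
  have p3 : 0 ≤ F.N ^ 3 * D * ‖u‖ := by positivity
  nlinarith

/-- The energy identity for the difference of the new velocities. The convection of `u2'` by `u1 -
u2` survives and is divided by `Pr`; the coupling to the temperature already carries a factor `Pr`,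
so it enters with `M + R` alone. -/
theorem Mom.norm_sub_le {Pr M R : ℝ} (hPr : 0 < Pr) (hM : 0 ≤ M) (hR : 0 ≤ R) {u1 u2 u1' u2' : V}
    {θ1 θ2 : H} (hu : u1 ∈ F.adm) (hu' : u1' - u2' ∈ F.X0) (h1 : F.Mom Pr M R u1 u1' θ1)
    (h2 : F.Mom Pr M R u2 u2' θ2) :
    ‖u1' - u2'‖ ≤ F.N ^ 2 * ‖u2'‖ / Pr * ‖u1 - u2‖ + F.N ^ 2 * (M + R) * ‖θ1 - θ2‖ := by
  have hN := zero_le_one.trans F.one_le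
  have key : ‖u1' - u2'‖ ≤ F.N * (F.N * ‖u1 - u2‖ * ‖u2'‖ / Pr + F.N * (M + R) * ‖θ1 - θ2‖) := by
    refine le_of_energy (norm_nonneg _) hN (by positivity) (F.a_coercive _ hu') ?_
    have e1 := h1 _ hu'
    have e2 := h2 _ hu'
    have e3 := F.c_skew u1 hu _ hu'
    have e5 := neg_le_of_abs_le (F.c_le (u1 - u2) u2' (u1' - u2'))
    have e6 := neg_le_of_abs_le (F.b1_le (θ1 - θ2) (u1' - u2'))
    have e7 := le_of_abs_le (F.f_le (θ1 - θ2) (u1' - u2'))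
    set δ := u1' - u2' with hδ
    have s1 : F.a δ δ = F.a u1' δ - F.a u2' δ := F.a.map_sub₂ u1' u2' δ
    have s2 : F.b1 (θ1 - θ2) δ = F.b1 θ1 δ - F.b1 θ2 δ := F.b1.map_sub₂ θ1 θ2 δ
    have s3 : F.c u1 δ δ = F.c u1 u1' δ - F.c u1 u2' δ := (F.c u1).map_sub₂ u1' u2' δ
    have s4 : F.c (u1 - u2) u2' δ = F.c u1 u2' δ - F.c u2 u2' δ := by rw [map_sub F.c]; rfl
    have s5 : F.f (θ1 - θ2) δ = F.f θ1 δ - F.f θ2 δ := F.f.map_sub₂ θ1 θ2 δ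
    have b6 := mul_le_mul_of_nonneg_left e6 (mul_nonneg hPr.le hM)
    have b7 := mul_le_mul_of_nonneg_left e7 (mul_nonneg hPr.le hR)
    rw [s3] at e3
    rw [s4] at e5
    rw [s2] at b6
    rw [s5] at b7
    refine le_of_mul_le_mul_left ?_ hPr
    have : Pr * ((F.N * ‖u1 - u2‖ * ‖u2'‖ / Pr + F.N * (M + R) * ‖θ1 - θ2‖) * ‖δ‖) =
        F.N * ‖u1 - u2‖ * ‖u2'‖ * ‖δ‖ + Pr * (F.N * (M + R) * ‖θ1 - θ2‖) * ‖δ‖ := by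
      field_simp
    rw [this, s1]
    linarith
  refine key.trans_eq ?_
  ring

/-- The energy identity for `u' - U`; the viscous and convective terms of the lift `U` produce the
first two summands. -/
theorem Mom.norm_le {Pr M R D : ℝ} (hPr : 0 < Pr) (hM : 0 ≤ M) (hR : 0 ≤ R) (hD : 0 ≤ D)
    {u u' U : V} {θ : H} (hu : u ∈ F.adm) (hu' : u' - U ∈ F.X0) (h : F.Mom Pr M R u u' θ)
    (hU : ‖U‖ ≤ F.N * D) :
    ‖u'‖ ≤ 2 * F.N ^ 3 * D + F.N ^ 3 * D / Pr * ‖u‖ + F.N ^ 2 * (M + R) * ‖θ‖ := by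
  have hN1 := F.one_le
  have hN := zero_le_one.trans F.one_le
  have key : ‖u' - U‖ ≤ F.N * (F.N * (F.N * D) + F.N * ‖u‖ * (F.N * D) / Pr +
      F.N * (M + R) * ‖θ‖) := by
    refine le_of_energy (norm_nonneg _) hN (by positivity) (F.a_coercive _ hu') ?_
    have e1 := h _ hu'
    have e3 := F.c_skew u hu _ hu'
    have e4 := neg_le_of_abs_le (F.a_le U (u' - U))
    have e5 := neg_le_of_abs_le (F.c_le u U (u' - U))
    have e6 := neg_le_of_abs_le (F.b1_le θ (u' - U))
    have e7 := le_of_abs_le (F.f_le θ (u' - U))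
    set δ := u' - U with hδ
    have s1 : F.a δ δ = F.a u' δ - F.a U δ := F.a.map_sub₂ u' U δ
    have s3 : F.c u δ δ = F.c u u' δ - F.c u U δ := (F.c u).map_sub₂ u' U δ
    have b4 := mul_le_mul_of_nonneg_left e4 hPr.le
    have b6 := mul_le_mul_of_nonneg_left e6 (mul_nonneg hPr.le hM)
    have b7 := mul_le_mul_of_nonneg_left e7 (mul_nonneg hPr.le hR)
    rw [s3] at e3
    have c1 : Pr * (F.N * ‖U‖ * ‖δ‖) ≤ Pr * (F.N * (F.N * D) * ‖δ‖) := by gcongr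
    have c2 : F.N * ‖u‖ * ‖U‖ * ‖δ‖ ≤ F.N * ‖u‖ * (F.N * D) * ‖δ‖ := by gcongr
    refine le_of_mul_le_mul_left ?_ hPr
    have : Pr * ((F.N * (F.N * D) + F.N * ‖u‖ * (F.N * D) / Pr + F.N * (M + R) * ‖θ‖) * ‖δ‖) =
        Pr * (F.N * (F.N * D) * ‖δ‖) + F.N * ‖u‖ * (F.N * D) * ‖δ‖ +
          Pr * (F.N * (M + R) * ‖θ‖) * ‖δ‖ := by
      field_simp
    rw [this, s1]
    linarith
  have t : ‖u'‖ ≤ ‖u' - U‖ + ‖U‖ := by simpa using norm_add_le (u' - U) U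
  have p1 : F.N * D ≤ F.N ^ 3 * D := mul_le_mul_of_nonneg_right (le_self_pow₀ hN1 (by norm_num)) hD
  have e : F.N * (F.N * (F.N * D) + F.N * ‖u‖ * (F.N * D) / Pr + F.N * (M + R) * ‖θ‖) =
    F.N ^ 3 * D + F.N ^ 3 * D / Pr * ‖u‖ + F.N ^ 2 * (M + R) * ‖θ‖ := by ring
  linarith

/-- By skew-symmetry the convective term does not affect coercivity, so Lax–Milgram applies on `Y`
with the constant `1 / N` for every admissible `u`. -/
theorem exists_heat [CompleteSpace H] {B : ℝ} (hB : 0 ≤ B) (ℓ : H →L[ℝ] ℝ) {u : V}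
    (hu : u ∈ F.adm) (Θ : H) : ∃ θ, θ - Θ ∈ F.Y ∧ F.Heat B ℓ u θ := by
  have hN : 0 < F.N := zero_lt_one.trans_le F.one_le
  obtain ⟨η, hη, h⟩ := exists_solution_of_coercive F.Y F.closed_Y (F.c1 u + F.a1 + B • F.bd)
    (ℓ - (F.c1 u + F.a1 + B • F.bd) Θ) (α := F.N⁻¹) (by positivity) fun w hw => by
      have e1 := F.c1_skew u hu w hw
      have e2 := mul_nonneg hB (F.bd_nonneg w)
      have e3 := F.a1_coercive w hw
      rw [inv_mul_le_iff₀ hN]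
      simp only [add_apply, smul_apply, smul_eq_mul, e1]
      nlinarith
  refine ⟨η + Θ, by simpa using hη, fun W hW => ?_⟩
  have := h W hW
  simp only [add_apply, smul_apply, smul_eq_mul,
    sub_apply] at this
  simp only [map_add, add_apply]
  linarith

/-- As in `exists_heat`, with coercivity constant `Pr / N`; the temperature terms go to the
right-hand side. -/
theorem exists_mom [CompleteSpace V] {Pr : ℝ} (hPr : 0 < Pr) (M R : ℝ) {u : V}
    (hu : u ∈ F.adm) (U : V) (θ : H) : ∃ u', u' - U ∈ F.X0 ∧ F.Mom Pr M R u u' θ := by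
  have hN : 0 < F.N := zero_lt_one.trans_le F.one_le
  obtain ⟨η, hη, h⟩ := exists_solution_of_coercive F.X0 F.closed_X0 (Pr • F.a + F.c u)
    ((Pr * R) • F.f θ - (Pr * M) • F.b1 θ - (Pr • F.a + F.c u) U) (α := F.N⁻¹ * Pr) (by positivity)
    fun w hw => by
      have e1 := F.c_skew u hu w hw
      have e3 := F.a_coercive w hw
      rw [mul_assoc, inv_mul_le_iff₀ hN]
      simp only [add_apply, smul_apply, smul_eq_mul, e1]
      nlinarith
  refine ⟨η + U, by simpa using hη, fun W hW => ?_⟩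
  have := h W hW
  simp only [add_apply, smul_apply, smul_eq_mul,
    sub_apply] at this
  simp only [map_add, add_apply]
  linarith

/-- Solutions of the coupled system with prescribed boundary values. -/
def Solves (F : FlowForms V H) (Pr M R B : ℝ) (ℓ : H →L[ℝ] ℝ) (U : V) (Θ : H) (p : V × H) : Prop :=
  p.1 - U ∈ F.X0 ∧ p.2 - Θ ∈ F.Y ∧ F.Mom Pr M R p.1 p.1 p.2 ∧ F.Heat B ℓ p.1 p.2

/-- Small data: unique solvability of the coupled system, with bounds. -/
theorem existsUnique_solves [CompleteSpace V] [CompleteSpace H] {Λ Pr M R B D : ℝ}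
    (hΛ : 0 < Λ) (hPr : 0 < Pr) (hM : 0 ≤ M) (hR : 0 ≤ R) (hB : 0 ≤ B) (hD : 0 ≤ D) (hDΛ : D ≤ Λ)
    {ℓ : H →L[ℝ] ℝ} {U : V} {Θ : H} (hUa : U ∈ F.adm) (hU : ‖U‖ ≤ F.N * D)
    (hΘ : ∀ W, F.bd Θ W = 0) (hΘn : ‖Θ‖ ≤ F.N * D) (hℓ : ∀ W, |ℓ W| ≤ F.N * D * ‖W‖)
    (hsmall : 0 < Pr - 100 * F.N ^ 12 * (1 + Λ) * (1 + M + B + R) * (Pr * (M + R) + 1) * D) :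
    (∃! p : V × H, F.Solves Pr M R B ℓ U Θ p) ∧ ∀ p : V × H, F.Solves Pr M R B ℓ U Θ p →
      ‖p.1‖ + ‖p.2‖ ≤ 100 * F.N ^ 12 * (1 + Λ) * (1 + M + B + R) * D := by
  set N := F.N with hNdef
  have hN1 : 1 ≤ N := F.one_le
  have hN := zero_le_one.trans hN1
  set K := 100 * N ^ 12 * (1 + Λ) with hK
  set s := 1 + M + B + R with hs
  set σ := M + R with hσ
  set t := s * D with ht
  have hs1 : 1 ≤ s := by linarith
  have hσ0 : 0 ≤ σ := by linarith
  have ht0 : 0 ≤ t := by positivity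
  have hDt : D ≤ t := le_mul_of_one_le_left hD hs1
  have hσD : σ * D ≤ t := mul_le_mul_of_nonneg_right (by linarith) hD
  have hpow : ∀ n ≤ 12, N ^ n ≤ N ^ 12 := fun n hn => pow_le_pow_right₀ hN1 hn
  have hNpos : 0 ≤ N ^ 12 := by positivity
  have hKN : 100 * N ^ 12 ≤ K := le_mul_of_one_le_right (by positivity) (by linarith)
  have hK0 : 0 < K := by positivity
  -- The smallness condition is split in two: dropping `Pr (M + R)` gives this inequality, which
  -- controls the velocity convection, and dropping the `1` gives the next one, which controls the
  -- coupling to the temperature.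
  have hKPr : K * t ≤ Pr := by
    have : 0 ≤ K * s * (Pr * σ) * D := by positivity
    rw [ht]; linarith
  have hKσ : K * (σ * t) ≤ 1 := by
    refine le_of_mul_le_mul_left ?_ hPr
    have : 0 ≤ K * s * 1 * D := by positivity
    rw [ht]; linarith
  have small1 : ∀ c, 0 ≤ c → ∀ q, q * c ≤ K → c * t / Pr * q ≤ 1 := fun c hc q hq => by
    rw [div_mul_eq_mul_div, div_le_one hPr]
    have := mul_le_mul_of_nonneg_right hq ht0
    linarith
  have small2 : ∀ c, 0 ≤ c → ∀ q, q * c ≤ K → c * (σ * t) * q ≤ 1 := fun c hc q hq => by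
    have := mul_le_mul_of_nonneg_right hq (mul_nonneg hσ0 ht0)
    linarith
  -- Any radius `ρ` with `5 N⁵ t + ρ / 4 ≤ ρ` is preserved by the a priori bound below; the factor
  -- `8` leaves room.
  set ρ := 8 * N ^ 5 * t with hρ
  have hρ0 : 0 ≤ ρ := by positivity
  have adm_of : ∀ {u}, u - U ∈ F.X0 → u ∈ F.adm := fun {u} hu => by
    have := F.adm.add_mem (F.X0_le hu) hUa
    simpa using this
  -- the a priori bound
  have step : ∀ u u' θ, u - U ∈ F.X0 → u' - U ∈ F.X0 → θ - Θ ∈ F.Y → F.Mom Pr M R u u' θ →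
      F.Heat B ℓ u θ → ‖u'‖ ≤ 5 * N ^ 5 * t + 1 / 4 * ‖u‖ := by
    intro u u' θ hu hu' hθ hm hh
    have e1 := hh.norm_le hB hD (adm_of hu) hθ hΘ hΘn hℓ
    have e2 := hm.norm_le hPr hM hR hD (adm_of hu) hu' hU
    have p1 : N ^ 3 * D / Pr * ‖u‖ ≤ 1 / 8 * ‖u‖ := by
      refine mul_le_mul_of_nonneg_right ?_ (norm_nonneg u)
      have := small1 (N ^ 3) (by positivity) 8 (by linarith [hpow 3 (by norm_num)])
      have : N ^ 3 * D / Pr ≤ N ^ 3 * t / Pr := by gcongr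
      linarith
    have p2 : 3 * N ^ 5 * (σ * D) * ‖u‖ ≤ 1 / 8 * ‖u‖ := by
      refine mul_le_mul_of_nonneg_right ?_ (norm_nonneg u)
      have := small2 (3 * N ^ 5) (by positivity) 8 (by linarith [hpow 5 (by norm_num)])
      have : 3 * N ^ 5 * (σ * D) ≤ 3 * N ^ 5 * (σ * t) := by gcongr
      linarith
    have p3 : N ^ 2 * σ * ‖θ‖ ≤ 3 * N ^ 5 * (σ * D) * (1 + ‖u‖) := by
      refine (mul_le_mul_of_nonneg_left e1 (by positivity)).trans_eq ?_
      ring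
    have p4 : 2 * N ^ 3 * D ≤ 2 * N ^ 5 * t := by
      have := pow_le_pow_right₀ hN1 (show 3 ≤ 5 by norm_num)
      gcongr
    have p5 : 3 * N ^ 5 * (σ * D) ≤ 3 * N ^ 5 * t := by gcongr
    linarith
  -- the contraction estimate
  have contr : ∀ u1 u2 u1' u2' θ1 θ2, u1 - U ∈ F.X0 → u2 - U ∈ F.X0 → u1' - U ∈ F.X0 →
      u2' - U ∈ F.X0 → θ1 - Θ ∈ F.Y → θ2 - Θ ∈ F.Y → F.Mom Pr M R u1 u1' θ1 →
      F.Mom Pr M R u2 u2' θ2 → F.Heat B ℓ u1 θ1 → F.Heat B ℓ u2 θ2 → ‖u2‖ ≤ ρ → ‖u2'‖ ≤ ρ →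
      ‖u1' - u2'‖ ≤ 1 / 2 * ‖u1 - u2‖ := by
    intro u1 u2 u1' u2' θ1 θ2 hu1 hu2 hu1' hu2' hθ1 hθ2 m1 m2 k1 k2 b1 b2
    have d1 : u1' - u2' ∈ F.X0 := by simpa using F.X0.sub_mem hu1' hu2'
    have d2 : θ1 - θ2 ∈ F.Y := by simpa using F.Y.sub_mem hθ1 hθ2
    have e1 := k1.norm_sub_le hB (adm_of hu1) d2 k2
    have e2 := m1.norm_sub_le hPr hM hR (adm_of hu1) d1 m2
    have e3 := k2.norm_le hB hD (adm_of hu2) hθ2 hΘ hΘn hℓ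
    have q1 : N ^ 2 * ‖u2'‖ / Pr ≤ 1 / 4 := by
      have := small1 (8 * N ^ 7) (by positivity) 4 (by linarith [hpow 7 (by norm_num)])
      have h2 : N ^ 2 * ‖u2'‖ / Pr ≤ N ^ 2 * ρ / Pr := by gcongr
      have h3 : N ^ 2 * ρ / Pr = 8 * N ^ 7 * t / Pr := by rw [hρ]; ring
      linarith
    -- The heat bound contains `1 + ‖u2‖`, which is quadratic in the data once multiplied by `D`.
    -- One factor is bounded by `Λ`, whence the factor `1 + Λ` in `K`.
    have q2 : N ^ 2 * σ * (N * (N * ‖θ2‖)) ≤ 1 / 4 := by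
      have h1 : 1 + ‖u2‖ ≤ s * (1 + 8 * N ^ 5 * Λ) := by
        have : ρ ≤ 8 * N ^ 5 * (s * Λ) := by rw [hρ, ht]; gcongr
        linarith
      have h2 : N ^ 2 * σ * (N * (N * ‖θ2‖)) ≤
          N ^ 2 * σ * (N * (N * (3 * N ^ 3 * (s * (1 + 8 * N ^ 5 * Λ)) * D))) := by
        have : ‖θ2‖ ≤ 3 * N ^ 3 * (s * (1 + 8 * N ^ 5 * Λ)) * D := e3.trans (by gcongr)
        gcongr
      have h3 : N ^ 2 * σ * (N * (N * (3 * N ^ 3 * (s * (1 + 8 * N ^ 5 * Λ)) * D))) =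
          (3 * N ^ 7 + 24 * N ^ 12 * Λ) * (σ * t) := by rw [ht]; ring
      have h4 := small2 (3 * N ^ 7 + 24 * N ^ 12 * Λ) (by positivity) 4 (by
        have : 0 ≤ N ^ 12 * Λ := by positivity
        rw [hK]
        linarith [hpow 7 (by norm_num)])
      linarith
    have r1 := mul_le_mul_of_nonneg_right q1 (norm_nonneg (u1 - u2))
    have r2 := mul_le_mul_of_nonneg_right q2 (norm_nonneg (u1 - u2))
    have r3 := mul_le_mul_of_nonneg_left e1 (show 0 ≤ N ^ 2 * σ by positivity)
    linarith
  have bound : ∀ p : V × H, F.Solves Pr M R B ℓ U Θ p → ‖p.1‖ ≤ ρ := by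
    rintro p ⟨h1, h2, h3, h4⟩
    have := step _ _ _ h1 h1 h2 h3 h4
    rw [hρ]
    have : 0 ≤ N ^ 5 * t := by positivity
    linarith
  refine ⟨?_, ?_⟩
  swap
  · intro p hp
    have h1 := bound p hp
    have h2 := hp.2.2.2.norm_le hB hD (adm_of hp.1) hp.2.1 hΘ hΘn hℓ
    have h3 : 3 * N ^ 3 * (1 + ‖p.1‖) * D ≤ 3 * N ^ 3 * t + 24 * N ^ 8 * Λ * t := by
      calc 3 * N ^ 3 * (1 + ‖p.1‖) * D ≤ 3 * N ^ 3 * (1 + ρ) * D := by gcongr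
        _ = 3 * N ^ 3 * D + 24 * N ^ 8 * D * t := by rw [hρ]; ring
        _ ≤ 3 * N ^ 3 * t + 24 * N ^ 8 * Λ * t := by gcongr
    have h4 : 8 * N ^ 5 + 3 * N ^ 3 + 24 * N ^ 8 * Λ ≤ K := by
      have := mul_le_mul_of_nonneg_right (hpow 8 (by norm_num)) hΛ.le
      have : 0 ≤ N ^ 12 * Λ := by positivity
      rw [hK]
      linarith [hpow 3 (by norm_num), hpow 5 (by norm_num)]
    have h5 := mul_le_mul_of_nonneg_right h4 ht0
    have h6 : K * s * D = K * t := by rw [ht]; ring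
    rw [h6]
    linarith
  -- The solution map is made total with a dummy value where `u` has the wrong boundary values.
  · have hex : ∀ u, ∃ p : V × H, u - U ∈ F.X0 → p.1 - U ∈ F.X0 ∧ p.2 - Θ ∈ F.Y ∧
        F.Mom Pr M R u p.1 p.2 ∧ F.Heat B ℓ u p.2 := fun u => by
      by_cases hu : u - U ∈ F.X0
      · obtain ⟨θ, h1, h2⟩ := exists_heat hB ℓ (adm_of hu) Θ
        obtain ⟨u', h3, h4⟩ := exists_mom hPr M R (adm_of hu) U θ
        exact ⟨(u', θ), fun _ => ⟨h3, h1, h4, h2⟩⟩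
      · exact ⟨0, fun h => absurd h hu⟩
    choose T hT using hex
    set S : Set V := {u | u - U ∈ F.X0 ∧ ‖u‖ ≤ ρ} with hS
    have hSc : IsComplete S := by
      refine IsClosed.isComplete (IsClosed.inter ?_ ?_)
      · exact F.closed_X0.preimage (continuous_id.sub continuous_const)
      · exact isClosed_le continuous_norm continuous_const
    have hmaps : MapsTo (fun u => (T u).1) S S := fun u hu => by
      obtain ⟨h1, h2, h3, h4⟩ := hT u hu.1
      refine ⟨h1, (step _ _ _ hu.1 h1 h2 h3 h4).trans ?_⟩
      have := hu.2
      have : 0 ≤ N ^ 5 * t := by positivity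
      rw [hρ] at *
      linarith
    have hcontr : ContractingWith (1 / 2) (hmaps.restrict (fun u => (T u).1) S S) := by
      refine ⟨by norm_num, LipschitzWith.of_dist_le_mul fun x y => ?_⟩
      obtain ⟨h1, h2, h3, h4⟩ := hT x x.2.1
      obtain ⟨g1, g2, g3, g4⟩ := hT y y.2.1
      rw [Subtype.dist_eq, Subtype.dist_eq, dist_eq_norm, dist_eq_norm]
      have := contr _ _ _ _ _ _ x.2.1 y.2.1 h1 g1 h2 g2 h3 g3 h4 g4 y.2.2 (hmaps y.2).2
      simpa using this
    have hUS : U ∈ S := by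
      refine ⟨by simp, hU.trans ?_⟩
      have a1 : N ≤ N ^ 5 := le_self_pow₀ hN1 (by norm_num)
      have a2 : N * D ≤ N ^ 5 * t := mul_le_mul a1 hDt hD (by positivity)
      have : 0 ≤ N ^ 5 * t := by positivity
      rw [hρ]
      linarith
    obtain ⟨u, huS, hfix, -⟩ := hcontr.exists_fixedPoint' hSc hmaps hUS (edist_ne_top _ _)
    have hfix' : (T u).1 = u := hfix
    obtain ⟨h1, h2, h3, h4⟩ := hT u huS.1
    rw [hfix'] at h1 h3
    refine ⟨(u, (T u).2), ⟨h1, h2, h3, h4⟩, ?_⟩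
    -- The contraction estimate requires only the second velocity to lie in the ball. Compared with
    -- the fixed point, any solution is at a distance of at most half its own, hence equal to it;
    -- the heat estimate then identifies the temperatures.
    intro q hq
    have hqρ := bound q hq
    obtain ⟨g1, g2, g3, g4⟩ := hq
    have hc := contr _ _ _ _ _ _ g1 h1 g1 h1 g2 h2 g3 h3 g4 h4 huS.2 huS.2
    have hz : ‖q.1 - u‖ ≤ 0 := by linarith [norm_nonneg (q.1 - u)]
    have hu : q.1 = u := sub_eq_zero.1 (norm_le_zero_iff.1 hz)
    have d2 : q.2 - (T u).2 ∈ F.Y := by simpa using F.Y.sub_mem g2 h2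
    have e1 := g4.norm_sub_le hB (adm_of g1) d2 h4
    rw [hu, sub_self, norm_zero, mul_zero, zero_mul, mul_zero] at e1
    exact Prod.ext hu (sub_eq_zero.1 (norm_le_zero_iff.1 e1))

/-- Uniqueness of a conduction state with small temperature gradient. -/
theorem Solves.eq_of_small {Pr M R B κ : ℝ} (hPr : 0 < Pr) (hM : 0 ≤ M) (hR : 0 ≤ R)
    (hB : 0 ≤ B) (hκ : 0 ≤ κ) {θ : H} (h0 : F.Solves Pr M R B 0 0 θ (0, θ))
    (hb : ∀ u W, |F.c1 u θ W| ≤ κ * ‖u‖ * ‖W‖) (hsmall : F.N ^ 3 * κ * (M + R) < 1) {p : V × H}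
    (hp : F.Solves Pr M R B 0 0 θ p) : p = (0, θ) := by
  obtain ⟨h1, h2, h3, h4⟩ := hp
  obtain ⟨-, -, g3, g4⟩ := h0
  have hN := zero_le_one.trans F.one_le
  have e1 := h4.norm_sub_le_of_bound hB (κ := κ * ‖p.1 - 0‖) (by positivity)
    (F.X0_le (by simpa using h1)) h2 g4 fun W => hb _ W
  have e2 := h3.norm_sub_le hPr hM hR (F.X0_le (by simpa using h1)) h1 g3
  simp only [sub_zero, norm_zero, mul_zero, zero_div, zero_mul, zero_add] at e1 e2
  -- The reference velocity is zero, so the estimates read `‖p.1‖ ≤ N² (M + R) ‖δθ‖` and `‖δθ‖ ≤ N κ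
  -- ‖p.1‖`; combined, they are contradictory unless `p.1 = 0`.
  have e3 := mul_le_mul_of_nonneg_left e1 (show 0 ≤ F.N ^ 2 * (M + R) by positivity)
  have hu : ‖p.1‖ = 0 := by
    by_contra hne
    have hpos : 0 < ‖p.1‖ := lt_of_le_of_ne (norm_nonneg _) (Ne.symm hne)
    have := mul_lt_mul_of_pos_right hsmall hpos
    linarith
  rw [hu, mul_zero, mul_zero] at e1
  exact Prod.ext (norm_eq_zero.1 hu) (sub_eq_zero.1 (norm_le_zero_iff.1 e1))

end FlowForms

end Abstract

/-! ### Parts of the boundary -/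

section Boundary

theorem measurableSet_Gamma1 : MeasurableSet (Gamma1 l L) :=
  isClosed_frontier.measurableSet.inter
    (measurableSet_eq_fun (measurable_pi_apply 2) measurable_const)

theorem measurableSet_bottom : MeasurableSet (bottom l L) :=
  isClosed_frontier.measurableSet.inter
    (measurableSet_eq_fun (measurable_pi_apply 2) measurable_const)

theorem measurableSet_Gamma0 : MeasurableSet (Gamma0 l L) :=
  isClosed_frontier.measurableSet.diff measurableSet_Gamma1

theorem measurableSet_lateral : MeasurableSet (lateral l L) :=
  measurableSet_Gamma0.inter
    (measurableSet_eq_fun (measurable_pi_apply 2) measurable_const).compl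

theorem bottom_subset_Gamma0 : bottom l L ⊆ Gamma0 l L := fun x hx =>
  ⟨hx.1, fun h => by have := hx.2.symm.trans h.2; norm_num at this⟩

theorem lateral_subset_Gamma0 : lateral l L ⊆ Gamma0 l L := fun _ hx => hx.1

theorem frontier_cases {x : Pt} (hx : x ∈ frontier (box l L)) :
    x ∈ Gamma1 l L ∨ x ∈ bottom l L ∨ x ∈ lateral l L := by
  by_cases h1 : x ∈ Gamma1 l L
  · exact Or.inl h1
  · by_cases h0 : x 2 = 0
    · exact Or.inr (Or.inl ⟨hx, h0⟩)
    · exact Or.inr (Or.inr ⟨⟨hx, h1⟩, h0⟩)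

theorem eqOn_iff {u : H1 l L} {v : Pt → ℝ} {Γ : Set Pt} (hΓ : MeasurableSet Γ) :
    EqOn u v Γ ↔ ∀ᵐ x ∂(surf l L), x ∈ Γ → trace u x = v x := by
  unfold EqOn
  exact ae_restrict_iff' hΓ

/-- Restriction of boundary functions to `Γ`. -/
theorem exists_indL {Γ : Set Pt} (hΓ : MeasurableSet Γ) :
    ∃ T : L2bd l L →L[ℝ] L2bd l L, ∀ w, T w =ᵐ[surf l L] Γ.indicator w := by
  obtain ⟨T, hT, -⟩ := exists_mulCLM (ν := surf l L) (m := Γ.indicator fun _ => (1 : ℝ)) (C := 1)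
    (measurable_const.indicator hΓ).aestronglyMeasurable (Filter.Eventually.of_forall fun x => by
      by_cases hx : x ∈ Γ <;> simp [hx])
  refine ⟨T, fun w => (hT w).trans (Filter.Eventually.of_forall fun x => ?_)⟩
  by_cases hx : x ∈ Γ <;> simp [hx]

theorem EqOn.mono {u : H1 l L} {f : Pt → ℝ} {Γ Γ' : Set Pt} (h : EqOn u f Γ) (hs : Γ' ⊆ Γ) :
    EqOn u f Γ' := ae_restrict_of_ae_restrict_of_subset hs h

variable [Fact (0 < l)] [Fact (0 < L)]

/-- Off the edges, the normal on `{x₃ = 1}` is `e₃` and that on the other walls is horizontal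
unless `x₃ = 0`. -/
theorem ae_normal : ∀ᵐ x ∂(surf l L), (x 2 = 1 → ∀ k, normal l L x k = if k = 2 then 1 else 0) ∧
    (x 2 = 0 → ∀ k, normal l L x k = if k = 2 then -1 else 0) := by
  have hs2 : side l L 2 = 1 := rfl
  refine ae_surf_of_forall fun i y hy => ?_
  rcases Fin.eq_self_or_eq_succAbove i 2 with h | ⟨j, hj⟩
  · subst h
    have h0 := facePt_same 2 0 y
    have h1 := facePt_same 2 (side l L 2) y
    refine ⟨⟨fun h => ?_, fun _ k => (normal_facePt hy k).1⟩,
      ⟨fun _ k => (normal_facePt hy k).2, fun h => ?_⟩⟩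
    · rw [h0] at h; norm_num at h
    · rw [h1, hs2] at h; norm_num at h
  · have hy' := hy j
    rw [← hj, hs2] at hy'
    have e : ∀ a, facePt i a y 2 = y j := fun a => by
      have := facePt_succAbove i a y j
      rwa [← hj] at this
    simp only [e]
    refine ⟨⟨fun h => ?_, fun h => ?_⟩, ⟨fun h => ?_, fun h => ?_⟩⟩ <;> linarith

/-- The functions vanishing on `Γ`. -/
def vanish (l L : ℝ) [Fact (0 < l)] [Fact (0 < L)] (Γ : Set Pt) : Submodule ℝ (H1 l L) where
  carrier := {u | EqOn u 0 Γ}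
  zero_mem' := by
    change trace (0 : H1 l L) =ᵐ[_] _
    rw [trace_zero]
    exact ae_restrict_of_ae (Lp.coeFn_zero ..)
  add_mem' := by
    intro u v hu hv
    change trace (u + v) =ᵐ[_] _
    rw [trace_add]
    filter_upwards [hu, hv, ae_restrict_of_ae (Lp.coeFn_add (trace u) (trace v))] with x h1 h2 h3
    rw [h3, Pi.add_apply, h1, h2]; simp
  smul_mem' := by
    intro c u hu
    change trace (c • u) =ᵐ[_] _
    rw [trace_smul]
    filter_upwards [hu, ae_restrict_of_ae (Lp.coeFn_smul c (trace u))] with x h1 h3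
    rw [h3, Pi.smul_apply, h1]; simp

theorem mem_vanish {u : H1 l L} {Γ : Set Pt} : u ∈ vanish l L Γ ↔ EqOn u 0 Γ := Iff.rfl

theorem isClosed_vanish {Γ : Set Pt} (hΓ : MeasurableSet Γ) :
    IsClosed (vanish l L Γ : Set (H1 l L)) := by
  obtain ⟨T, hT⟩ := exists_indL (l := l) (L := L) hΓ
  have : (vanish l L Γ : Set (H1 l L)) = {u | T (trL l L u) = 0} := by
    ext u
    change EqOn u 0 Γ ↔ T (trace u) = 0
    rw [eqOn_iff hΓ]
    constructor
    · intro h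
      refine Lp.ext (((hT _).trans ?_).trans (Lp.coeFn_zero ..).symm)
      filter_upwards [h] with x hx
      by_cases hxΓ : x ∈ Γ
      · simp [hxΓ, hx hxΓ]
      · simp [hxΓ]
    · intro h
      have h2 := hT (trace u)
      rw [h] at h2
      filter_upwards [h2, Lp.coeFn_zero ℝ 2 (surf l L)] with x h3 h4 hx
      rw [indicator_of_mem hx] at h3
      rw [← h3]; exact h4
  rw [this]
  exact isClosed_eq (T.continuous.comp (trL l L).continuous) continuous_const

theorem eqOn_sub {u v : H1 l L} {f : Pt → ℝ} {Γ : Set Pt} (hu : EqOn u f Γ) (hv : EqOn v f Γ) :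
    EqOn (u - v) 0 Γ := by
  unfold EqOn at *
  rw [trace_sub]
  filter_upwards [hu, hv, ae_restrict_of_ae (Lp.coeFn_sub (trace u) (trace v))] with x h1 h2 h3
  rw [h3, Pi.sub_apply, h1, h2]; simp

theorem eqOn_of_sub {u v : H1 l L} {f : Pt → ℝ} {Γ : Set Pt} (hu : EqOn (u - v) 0 Γ)
    (hv : EqOn v f Γ) : EqOn u f Γ := by
  unfold EqOn at *
  rw [trace_sub] at hu
  filter_upwards [hu, hv, ae_restrict_of_ae (Lp.coeFn_sub (trace u) (trace v))] with x h1 h2 h3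
  rw [h3, Pi.sub_apply, h2] at h1
  simpa [sub_eq_zero] using h1

/-- The infimum in the `H^{1/2}` norm is attained. -/
theorem exists_halfNorm {Γ : Set Pt} (hΓ : MeasurableSet Γ) {v : Pt → ℝ} (h : MemHalf l L Γ v) :
    ∃ u : H1 l L, EqOn u v Γ ∧ ‖u‖ ≤ halfNorm l L Γ v := by
  obtain ⟨u0, hu0⟩ := h
  -- The admissible extensions form a coset of a closed subspace of a Hilbert space, so one of least
  -- norm exists.
  obtain ⟨u, hu, hmin⟩ := exists_min_norm (E := H1 l L) (vanish l L Γ) (isClosed_vanish hΓ) u0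
  refine ⟨u, eqOn_of_sub hu hu0, le_csInf ⟨_, u0, hu0, rfl⟩ ?_⟩
  rintro _ ⟨w, hw, rfl⟩
  exact hmin w (eqOn_sub hw hu0)

end Boundary

/-! ### Energy identities -/

section Energy

theorem X0_subset_Y {w : VH1 l L} (hw : w ∈ X0 l L) (j : Fin 3) : w j ∈ Y l L :=
  (hw.2.1 j).mono bottom_subset_Gamma0

theorem X0_subset_Xt {w : VH1 l L} (hw : w ∈ X0 l L) : w ∈ Xt l L := by
  refine ⟨⟨hw.1, hw.2.2⟩, ?_⟩
  filter_upwards [ae_all_iff.2 fun i => (hw.2.1 i).mono lateral_subset_Gamma0] with x hx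
  simp [dotN, hx]

variable [Fact (0 < l)] [Fact (0 < L)]

/-- For admissible `u` the normal flux is concentrated on the bottom. -/
theorem dotN_mul_trace {u : VH1 l L} (hu : u ∈ Xt l L) {η : H1 l L} (hη : η ∈ Y l L) :
    ∀ᵐ x ∂(surf l L), (∑ i, normal l L x i * trace (u i) x) * trace η x = 0 := by
  have h1 := (eqOn_iff measurableSet_Gamma1).1 hu.1.2
  have h2 := (ae_restrict_iff' measurableSet_lateral).1 hu.2
  have h3 := (eqOn_iff measurableSet_bottom).1 hη
  filter_upwards [h1, h2, h3, ae_surf_mem_frontier, ae_normal] with x a1 a2 a3 a4 a5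
  -- On the top the flux is `u₃ = 0`, on the bottom the test function vanishes, and on the side
  -- walls `u · n = 0`.
  rcases frontier_cases a4 with h | h | h
  · have := a1 h
    simp [a5.1 h.2, this]
  · rw [a3 h]; simp
  · have := a2 h
    unfold dotN at this
    simp only [mul_comm (normal l L x _), this, zero_mul]

/-- The convective term is skew-symmetric. -/
theorem convective_skew {u : VH1 l L} (hdiv : DivFree u) {η : H1 l L}
    (h : ∀ᵐ x ∂(surf l L), (∑ i, normal l L x i * trace (u i) x) * trace η x = 0) :
    ∑ i, inner ℝ (D i η) (prodL l L (u i) η) = 0 := by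
  -- The functional `ψ ↦ ∑ ∫ uᵢ (∂ᵢη ψ + η ∂ᵢψ)`. For smooth `ψ` it vanishes by Green's formula for
  -- `uᵢ` and `η` with weight `ψ`, using `div u = 0`. It is continuous in `ψ`, so density permits `ψ
  -- = η`, where it is twice the convective term. The triple product of Sobolev functions is never
  -- integrated by parts directly.
  set G : H1 l L →L[ℝ] ℝ := ∑ i, ((innerSL ℝ (D i η)).comp (prodL l L (u i)) +
    (innerSL ℝ (prodL l L (u i) η)).comp (DL l L i)) with hG
  have hGa : ∀ ψ, G ψ = ∑ i, (inner ℝ (D i η) (prodL l L (u i) ψ) +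
      inner ℝ (prodL l L (u i) η) (D i ψ)) := fun ψ => by
    simp [hG]
  have hsm : ∀ φ (hφ : ContDiff ℝ ∞ φ), G (ofSmooth φ hφ) = 0 := by
    intro φ hφ
    rw [hGa]
    have e1 : ∀ i, inner ℝ (D i η) (prodL l L (u i) (ofSmooth φ hφ)) =
        ∫ x in box l L, φ x * fn (u i) x * D i η x := fun i => by
      rw [inner_Lp_congr Filter.EventuallyEq.rfl ((prodL_ae _ _).trans
        ((fn_ofSmooth hφ).mono fun x hx => show _ = fn (u i) x * φ x by simp only [hx]))]
      refine integral_congr_ae (Filter.Eventually.of_forall fun x => ?_)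
      ring
    have e2 : ∀ i, inner ℝ (prodL l L (u i) η) (D i (ofSmooth φ hφ)) =
        ∫ x in box l L, pd i φ x * fn (u i) x * fn η x := fun i => by
      rw [inner_Lp_congr (prodL_ae _ _) (D_ofSmooth hφ i)]
      refine integral_congr_ae (Filter.Eventually.of_forall fun x => ?_)
      ring
    simp only [e1, e2]
    have hg := fun i => green (u i) η hφ i
    obtain ⟨T, hT⟩ := exists_mulCLM_box (l := l) (L := L) hφ.continuous
    have e3 : ∀ i, ∫ x in box l L, φ x * D i (u i) x * fn η x =
        inner ℝ (D i (u i)) (T (fn η)) := fun i => by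
      rw [inner_Lp_congr Filter.EventuallyEq.rfl (hT _)]
      refine integral_congr_ae (Filter.Eventually.of_forall fun x => ?_)
      ring
    have e4 : ∑ i, ∫ x in box l L, φ x * D i (u i) x * fn η x = 0 := by
      simp only [e3]
      rw [← sum_inner, show ∑ i, D i (u i) = 0 from hdiv, inner_zero_left]
    have e5 : ∑ i, ∫ x, normal l L x i * φ x * trace (u i) x * trace η x ∂(surf l L) = 0 := by
      rw [← integral_finsetSum]
      · rw [← integral_zero Pt ℝ (μ := surf l L)]
        refine integral_congr_ae (h.mono fun x hx => ?_)
        have : ∑ i, normal l L x i * φ x * trace (u i) x * trace η x =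
            φ x * ((∑ i, normal l L x i * trace (u i) x) * trace η x) := by
          rw [Finset.sum_mul, Finset.mul_sum]
          exact Finset.sum_congr rfl fun i _ => by ring
        simp only [this, hx, mul_zero]
      · intro i _
        obtain ⟨S, hS⟩ := exists_mulCLM_surf (l := l) (L := L) hφ.continuous i
        refine (integrable_mul_Lp (S (trace (u i))) (trace η)).congr ?_
        filter_upwards [hS (trace (u i))] with x hx
        rw [hx]
    have e6 := Finset.sum_congr rfl fun i (_ : i ∈ Finset.univ) => hg i
    rw [Finset.sum_add_distrib, Finset.sum_add_distrib, e4, e5, zero_add] at e6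
    rw [Finset.sum_add_distrib]
    exact e6
  have hz : ∀ ψ, G ψ = 0 := fun ψ => by
    have : Dense (smoothH1 l L : Set (H1 l L)) := dense_smoothH1
    refine congrFun (Continuous.ext_on this G.continuous continuous_const ?_) ψ
    rintro _ ⟨φ, hφ, rfl⟩
    exact hsm φ hφ
  have := hz η
  rw [hGa] at this
  simp only [real_inner_comm (D _ η), ← two_mul, ← Finset.mul_sum] at this
  rcases mul_eq_zero.1 this with h2 | h2
  · norm_num at h2
  · simpa only [real_inner_comm] using h2

/-- The Poincaré inequality for functions vanishing on the bottom. -/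
theorem poincare {η : H1 l L} (hη : η ∈ Y l L) : ‖fn η‖ ≤ 2 * ‖D 2 η‖ := by
  -- The weight vanishes on the top and `η` on the bottom, so Green's formula in the vertical
  -- direction has no boundary term.
  have hψ : ContDiff ℝ ∞ fun x : Pt => x 2 - 1 := by fun_prop
  have h := green η η hψ 2
  have hb := (eqOn_iff measurableSet_bottom).1 hη
  have e1 : ∫ x, normal l L x 2 * (x 2 - 1) * trace η x * trace η x ∂(surf l L) = 0 := by
    rw [← integral_zero Pt ℝ (μ := surf l L)]
    refine integral_congr_ae ?_
    filter_upwards [hb, ae_surf_mem_frontier, ae_surf_of_forall (l := l) (L := L)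
      (P := fun x => x 2 = 0 ∨ x 2 = 1 ∨ normal l L x 2 = 0) fun i y hy => by
        rcases eq_or_ne i 2 with rfl | hi
        · exact ⟨Or.inl (facePt_same 2 _ y), Or.inr (Or.inl (facePt_same 2 _ y))⟩
        · exact ⟨Or.inr (Or.inr (by rw [(normal_facePt hy 2).1, if_neg hi.symm])),
            Or.inr (Or.inr (by rw [(normal_facePt hy 2).2, if_neg hi.symm]))⟩] with x h1 h2 h3
    rcases h3 with h | h | h
    · simp [h1 ⟨h2, h⟩]
    · simp [h]
    · simp [h]
  have e2 : ∀ x, pd 2 (fun x : Pt => x 2 - 1) x = 1 := fun x => by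
    have h1 : HasDerivAt (fun t : ℝ => t - 1) 1 (x 2) := (hasDerivAt_id' (x 2)).sub_const 1
    rw [pd_comp_coord 2 2 h1, if_pos rfl]
  simp only [e2, one_mul] at h
  rw [e1, ← inner_Lp_eq, real_inner_self_eq_norm_sq] at h
  obtain ⟨T, hT, hTn⟩ := exists_mulCLM (ν := volume.restrict (box l L)) (m := fun x : Pt => x 2 - 1)
    (C := 1) hψ.continuous.aestronglyMeasurable
    ((ae_restrict_mem (measurableSet_box l L)).mono fun x hx => by
      have h2 := hx 2
      have : side l L 2 = 1 := rfl
      rw [this] at h2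
      rw [abs_le]; constructor <;> linarith)
  have e3 : ∫ x in box l L, (x 2 - 1) * D 2 η x * fn η x = inner ℝ (T (D 2 η)) (fn η) :=
    (inner_Lp_congr (hT _) Filter.EventuallyEq.rfl).symm
  have e4 : ∫ x in box l L, (x 2 - 1) * fn η x * D 2 η x = inner ℝ (T (D 2 η)) (fn η) := by
    rw [← e3]
    exact integral_congr_ae (Filter.Eventually.of_forall fun x => by ring)
  rw [e3, e4] at h
  have e5 := neg_le_of_abs_le (abs_real_inner_le_norm (T (D 2 η)) (fn η))
  have e6 := mul_le_mul_of_nonneg_right (hTn (D 2 η)) (norm_nonneg (fn η))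
  rw [one_mul] at e6
  have := le_of_energy (norm_nonneg (fn η)) zero_le_one (K := 2 * ‖D 2 η‖) (by positivity)
    (A := ‖fn η‖ ^ 2) (by rw [one_mul]) (by linarith)
  rwa [one_mul] at this

/-- The constant is `1 + 2²`, with `2` from the Poincaré inequality. -/
theorem norm_sq_le_of_mem_Y {η : H1 l L} (hη : η ∈ Y l L) : ‖η‖ ^ 2 ≤ 5 * ∑ i, ‖D i η‖ ^ 2 := by
  have h := pow_le_pow_left₀ (norm_nonneg _) (poincare hη) 2
  rw [norm_sq_H1, Fin.sum_univ_three]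
  nlinarith [sq_nonneg ‖D 0 η‖, sq_nonneg ‖D 1 η‖]

/-- Divergence-free fields without normal flux are orthogonal to gradients. -/
theorem sum_integral_pd_mul {v : VH1 l L} (hv : v ∈ X0 l L) {q : Pt → ℝ} (hq : ContDiff ℝ ∞ q) :
    ∑ i, ∫ x in box l L, pd i q x * fn (v i) x = 0 := by
  have hz : ∀ᵐ x ∂(surf l L), ∑ i, normal l L x i * trace (v i) x = 0 := by
    have h1 := (eqOn_iff measurableSet_Gamma1).1 hv.2.2
    have h2 := ae_all_iff.2 fun i => (eqOn_iff measurableSet_Gamma0).1 (hv.2.1 i)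
    filter_upwards [h1, h2, ae_surf_mem_frontier, ae_normal] with x a1 a2 a3 a4
    by_cases h : x ∈ Gamma1 l L
    · simp [a4.1 h.2, a1 h]
    · exact Finset.sum_eq_zero fun i _ => by rw [a2 i ⟨a3, h⟩]; simp
  have hg := fun i => green (v i) (oneH l L) hq i
  have e1 : ∀ i, ∫ x in box l L, q x * D i (v i) x * fn (oneH l L) x =
      ∫ x in box l L, q x * D i (v i) x := fun i =>
    integral_congr_ae (fn_oneH.mono fun x hx => by simp [hx])
  have e2 : ∀ i, ∫ x in box l L, q x * fn (v i) x * D i (oneH l L) x = 0 := fun i => by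
    have z : D i (oneH l L) =ᵐ[volume.restrict (box l L)] fun _ => 0 := by
      rw [D_oneH]; exact Lp.coeFn_zero ..
    rw [integral_congr_ae (g := fun _ => 0) (z.mono fun x hx => by simp [hx]), integral_zero]
  have e3 : ∀ i, ∫ x in box l L, pd i q x * fn (v i) x * fn (oneH l L) x =
      ∫ x in box l L, pd i q x * fn (v i) x := fun i =>
    integral_congr_ae (fn_oneH.mono fun x hx => by simp [hx])
  have e4 : ∀ i, ∫ x, normal l L x i * q x * trace (v i) x * trace (oneH l L) x ∂(surf l L) =
      ∫ x, normal l L x i * q x * trace (v i) x ∂(surf l L) := fun i =>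
    integral_congr_ae (trace_oneH.mono fun x hx => by simp [hx])
  simp only [e1, e2, e3, e4, add_zero] at hg
  have hsum := Finset.sum_congr rfl fun i (_ : i ∈ Finset.univ) => hg i
  have hqL := memLp_smooth (l := l) (L := L) hq
  have e5 : ∑ i, ∫ x in box l L, q x * D i (v i) x = 0 := by
    have : ∀ i, ∫ x in box l L, q x * D i (v i) x = inner ℝ (D i (v i)) (hqL.toLp q) := fun i => by
      rw [inner_Lp_congr Filter.EventuallyEq.rfl hqL.coeFn_toLp]
      exact integral_congr_ae (Filter.Eventually.of_forall fun x => mul_comm _ _)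
    simp only [this]
    rw [← sum_inner, show ∑ i, D i (v i) = 0 from hv.1, inner_zero_left]
  have e6 : ∑ i, ∫ x, normal l L x i * q x * trace (v i) x ∂(surf l L) = 0 := by
    rw [← integral_finsetSum]
    · rw [← integral_zero Pt ℝ (μ := surf l L)]
      refine integral_congr_ae (hz.mono fun x hx => ?_)
      have : ∑ i, normal l L x i * q x * trace (v i) x =
          q x * ∑ i, normal l L x i * trace (v i) x := by
        rw [Finset.mul_sum]
        exact Finset.sum_congr rfl fun i _ => by ring
      simp only [this, hx, mul_zero]
    · intro i _
      obtain ⟨S, hS⟩ := exists_mulCLM_surf (l := l) (L := L) hq.continuous i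
      exact ((Lp.memLp (S (trace (v i)))).integrable one_le_two).congr (hS _)
  rw [Finset.sum_add_distrib, e5, e6, zero_add] at hsum
  exact hsum

end Energy

set_option maxSynthPendingDepth 3

/-! ### The forms of the weak formulation as bounded multilinear maps -/

section Multilinear

variable {E G K : Type*} [NormedAddCommGroup E] [InnerProductSpace ℝ E] [NormedAddCommGroup G]
  [InnerProductSpace ℝ G] [NormedAddCommGroup K] [InnerProductSpace ℝ K]

variable (E) in
/-- Bounded linear functionals. -/
abbrev Lin : Type _ := E →L[ℝ] ℝ

variable (E K) in
/-- Bounded bilinear forms. -/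
abbrev Bil : Type _ := E →L[ℝ] K →L[ℝ] ℝ

variable (E K) in
/-- Bounded trilinear forms. -/
abbrev Tri : Type _ := K →L[ℝ] E →L[ℝ] E →L[ℝ] ℝ

variable (E) in
/-- Subspaces of an inner product space. -/
abbrev Subsp : Type _ := Submodule ℝ E

/-- `(u, v) ↦ ⟪A u, B v⟫`. -/
def innerForm (A : E →L[ℝ] G) (B : K →L[ℝ] G) : Bil E K :=
  (isBoundedBilinearMap_inner (𝕜 := ℝ) (E := G)).toContinuousLinearMap.bilinearComp A B

@[simp] theorem innerForm_apply (A : E →L[ℝ] G) (B : K →L[ℝ] G) (u : E) (v : K) :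
    innerForm A B u v = inner ℝ (A u) (B v) := rfl

/-- `(u, v) ↦ ∑ i, ⟪A i u, B i v⟫`. -/
def innerSum {ι : Type*} [Fintype ι] (A : ι → E →L[ℝ] G) (B : ι → K →L[ℝ] G) :
    Bil E K := ∑ i, innerForm (A i) (B i)

theorem innerSum_apply {ι : Type*} [Fintype ι] (A : ι → E →L[ℝ] G) (B : ι → K →L[ℝ] G) (u : E)
    (v : K) : innerSum A B u v = ∑ i, inner ℝ (A i u) (B i v) := by
  simp [innerSum]

/-- `(k, u, v) ↦ ∑ i, ⟪A i u, Q i k v⟫`. -/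
def innerSum₃ {ι : Type*} [Fintype ι] (A : ι → E →L[ℝ] G) (Q : ι → K →L[ℝ] E →L[ℝ] G) :
    Tri E K :=
  ∑ i, ((ContinuousLinearMap.compL ℝ E G ℝ).comp
    (innerForm (A i) (ContinuousLinearMap.id ℝ G))).flip.comp (Q i)

theorem innerSum₃_apply {ι : Type*} [Fintype ι] (A : ι → E →L[ℝ] G) (Q : ι → K →L[ℝ] E →L[ℝ] G)
    (k : K) (u v : E) : innerSum₃ A Q k u v = ∑ i, inner ℝ (A i u) (Q i k v) := by
  simp [innerSum₃]

theorem exists_bound₂ (c : Bil E K) :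
    ∃ N, 0 ≤ N ∧ ∀ u v, |c u v| ≤ N * ‖u‖ * ‖v‖ :=
  ⟨‖c‖, norm_nonneg c, c.le_opNorm₂⟩

theorem exists_bound₃ (c : Tri E K) :
    ∃ N, 0 ≤ N ∧ ∀ k u v, |c k u v| ≤ N * ‖k‖ * ‖u‖ * ‖v‖ := by
  refine ⟨‖c‖, norm_nonneg c, fun k u v => ((c k).le_opNorm₂ u v).trans ?_⟩
  gcongr
  exact c.le_opNorm k

end Multilinear

section Forms

/-- The `i`-th component of a vector field. -/
def compV (l L : ℝ) (i : Fin 3) : VH1 l L →L[ℝ] H1 l L := PiLp.proj 2 (fun _ : Fin 3 => H1 l L) i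

@[simp] theorem compV_apply (i : Fin 3) (u : VH1 l L) : compV l L i u = u i := rfl

/-- `formA` as a bounded bilinear form. -/
def bilA (l L : ℝ) : Bil (VH1 l L) (VH1 l L) :=
  innerSum (fun p : Fin 3 × Fin 3 => (DL l L p.1).comp (compV l L p.2))
    fun p => (DL l L p.1).comp (compV l L p.2)

/-- `formA1` as a bounded bilinear form. -/
def bilA1 (l L : ℝ) : Bil (H1 l L) (H1 l L) := innerSum (DL l L) (DL l L)

/-- `formB1` as a bounded bilinear form. -/
def bilB1 (l L : ℝ) : Bil (H1 l L) (VH1 l L) :=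
  innerSum (DL l L) fun i => (DL l L 2).comp (compV l L i)

/-- The buoyancy form `(θ, v) ↦ ∫ θ v₃`. -/
def bilF (l L : ℝ) : Bil (H1 l L) (VH1 l L) :=
  innerForm (fnL l L) ((fnL l L).comp (compV l L 2))

theorem bilA_apply (u v : VH1 l L) : bilA l L u v = ∑ i, ∑ j, inner ℝ (D i (u j)) (D i (v j)) := by
  unfold bilA
  rw [innerSum_apply, Fintype.sum_prod_type]
  rfl

theorem bilA1_apply (θ W : H1 l L) : bilA1 l L θ W = ∑ i, inner ℝ (D i θ) (D i W) :=
  innerSum_apply ..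

theorem bilB1_apply (θ : H1 l L) (v : VH1 l L) :
    bilB1 l L θ v = ∑ i, inner ℝ (D i θ) (D 2 (v i)) :=
  innerSum_apply ..

theorem bilA_eq (u v : VH1 l L) : bilA l L u v = formA u v := by
  unfold formA
  rw [bilA_apply, integral_finsetSum]
  · refine Finset.sum_congr rfl fun i _ => ?_
    rw [integral_finsetSum _ fun j _ => integrable_mul_Lp _ _]
    exact Finset.sum_congr rfl fun j _ => inner_Lp_eq _ _
  · exact fun i _ => integrable_finsetSum _ fun j _ => integrable_mul_Lp _ _

theorem bilA1_eq (θ W : H1 l L) : bilA1 l L θ W = formA1 θ W := by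
  unfold formA1
  rw [bilA1_apply, integral_finsetSum _ fun j _ => integrable_mul_Lp _ _]
  exact Finset.sum_congr rfl fun j _ => inner_Lp_eq _ _

theorem bilB1_eq (θ : H1 l L) (v : VH1 l L) : bilB1 l L θ v = formB1 θ v := by
  unfold formB1
  rw [bilB1_apply, integral_finsetSum _ fun j _ => integrable_mul_Lp _ _]
  exact Finset.sum_congr rfl fun j _ => inner_Lp_eq _ _

theorem bilF_eq (θ : H1 l L) (v : VH1 l L) :
    bilF l L θ v = ∫ x in box l L, fn θ x * fn (v 2) x := by
  exact inner_Lp_eq _ _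

variable [Fact (0 < l)] [Fact (0 < L)]

/-- `formC1` as a bounded trilinear form. -/
def triC1 (l L : ℝ) [Fact (0 < l)] [Fact (0 < L)] :
    Tri (H1 l L) (VH1 l L) :=
  innerSum₃ (DL l L) fun i => (prodL l L).comp (compV l L i)

/-- `formC` as a bounded trilinear form. -/
def triC (l L : ℝ) [Fact (0 < l)] [Fact (0 < L)] :
    Tri (VH1 l L) (VH1 l L) :=
  innerSum₃ (fun p : Fin 3 × Fin 3 => (DL l L p.2).comp (compV l L p.1))
    fun p => (prodL l L).bilinearComp (compV l L p.2) (compV l L p.1)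

theorem triC1_apply (u : VH1 l L) (θ W : H1 l L) :
    triC1 l L u θ W = ∑ i, inner ℝ (D i θ) (prodL l L (u i) W) :=
  innerSum₃_apply ..

theorem triC_apply (u v z : VH1 l L) :
    triC l L u v z = ∑ j, ∑ i, inner ℝ (D i (v j)) (prodL l L (u i) (z j)) := by
  unfold triC
  rw [innerSum₃_apply, Fintype.sum_prod_type]
  rfl

theorem inner_D_prodL (θ W w : H1 l L) (i : Fin 3) :
    Integrable (fun x => fn w x * D i θ x * fn W x) (volume.restrict (box l L)) ∧
      inner ℝ (D i θ) (prodL l L w W) = ∫ x in box l L, fn w x * D i θ x * fn W x := by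
  have h : (fun x => D i θ x * prodL l L w W x) =ᵐ[volume.restrict (box l L)]
      fun x => fn w x * D i θ x * fn W x := by
    filter_upwards [prodL_ae w W] with x hx
    rw [hx]; ring
  exact ⟨(integrable_mul_Lp _ _).congr h, by rw [inner_Lp_eq, integral_congr_ae h]⟩

theorem triC1_eq (u : VH1 l L) (θ W : H1 l L) : triC1 l L u θ W = formC1 u θ W := by
  unfold formC1
  simp only [Finset.sum_mul]
  rw [triC1_apply, integral_finsetSum _ fun i _ => (inner_D_prodL _ _ _ i).1]
  exact Finset.sum_congr rfl fun i _ => (inner_D_prodL _ _ _ i).2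

theorem triC_eq (u v z : VH1 l L) : triC l L u v z = formC u v z := by
  unfold formC
  simp only [Finset.sum_mul]
  rw [triC_apply, integral_finsetSum]
  · refine Finset.sum_congr rfl fun j _ => ?_
    rw [integral_finsetSum _ fun i _ => (inner_D_prodL _ _ _ i).1]
    exact Finset.sum_congr rfl fun i _ => (inner_D_prodL _ _ _ i).2
  · exact fun j _ => integrable_finsetSum _ fun i _ => (inner_D_prodL _ _ _ i).1

/-- The boundary integral over a measurable part of the boundary, as a bounded bilinear form. -/
theorem exists_bdForm {Γ : Set Pt} (hΓ : MeasurableSet Γ) :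
    ∃ S : Bil (H1 l L) (H1 l L), ∀ θ W,
      S θ W = ∫ x in Γ, trace θ x * trace W x ∂(surf l L) := by
  obtain ⟨T, hT⟩ := exists_indL (l := l) (L := L) hΓ
  refine ⟨innerForm (T.comp (trL l L)) (trL l L), fun θ W => ?_⟩
  rw [innerForm_apply, ← integral_indicator hΓ]
  change inner ℝ (T (trace θ)) (trace W) = _
  rw [inner_Lp_congr (hT _) Filter.EventuallyEq.rfl]
  refine integral_congr_ae (Filter.Eventually.of_forall fun x => ?_)
  by_cases hx : x ∈ Γ <;> simp [hx]

end Forms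

/-! ### The spaces of the weak formulation as subspaces -/

section Spaces

variable [Fact (0 < l)] [Fact (0 < L)]

/-- `X` as a subspace. -/
def subX (l L : ℝ) [Fact (0 < l)] [Fact (0 < L)] : Subsp (VH1 l L) :=
  (LinearMap.ker (divL l L).toLinearMap) ⊓
    (vanish l L (Gamma1 l L)).comap (compV l L 2).toLinearMap

/-- `X₀` as a subspace. -/
def subX0 (l L : ℝ) [Fact (0 < l)] [Fact (0 < L)] : Subsp (VH1 l L) :=
  subX l L ⊓ ⨅ i, (vanish l L (Gamma0 l L)).comap (compV l L i).toLinearMap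

theorem mem_subX {u : VH1 l L} : u ∈ subX l L ↔ u ∈ X l L := by
  change divL l L u = 0 ∧ EqOn (u 2) 0 _ ↔ _
  rw [divL_apply]
  rfl

theorem mem_subX0 {u : VH1 l L} : u ∈ subX0 l L ↔ u ∈ X0 l L := by
  rw [subX0, Submodule.mem_inf, mem_subX, Submodule.mem_iInf]
  exact ⟨fun h => ⟨h.1.1, h.2, h.1.2⟩, fun h => ⟨⟨h.1, h.2.2⟩, h.2.1⟩⟩

theorem isClosed_subX0 : IsClosed (subX0 l L : Set (VH1 l L)) := by
  have e : (subX0 l L : Set (VH1 l L)) = ({u | divL l L u = 0} ∩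
      compV l L 2 ⁻¹' (vanish l L (Gamma1 l L))) ∩
        ⋂ i, compV l L i ⁻¹' (vanish l L (Gamma0 l L)) := by
    simp only [subX0, subX, Submodule.coe_inf, Submodule.coe_iInf]
    rfl
  rw [e]
  refine ((isClosed_eq (divL l L).continuous continuous_const).inter
    ((isClosed_vanish measurableSet_Gamma1).preimage (compV l L 2).continuous)).inter
      (isClosed_iInter fun i =>
        (isClosed_vanish measurableSet_Gamma0).preimage (compV l L i).continuous)

/-- `X̃` as a subspace. -/
def subXt (l L : ℝ) [Fact (0 < l)] [Fact (0 < L)] : Subsp (VH1 l L) where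
  carrier := Xt l L
  zero_mem' := by
    refine X0_subset_Xt (mem_subX0.1 (subX0 l L).zero_mem)
  add_mem' := by
    intro u v hu hv
    refine ⟨mem_subX.1 ((subX l L).add_mem (mem_subX.2 hu.1) (mem_subX.2 hv.1)), ?_⟩
    filter_upwards [hu.2, hv.2, ae_restrict_of_ae (ae_all_iff.2 fun i =>
      Lp.coeFn_add (trace (u i)) (trace (v i)))] with x h1 h2 h3
    have e : ∀ i, trace ((u + v) i) x = trace (u i) x + trace (v i) x := fun i => by
      rw [PiLp.add_apply, trace_add]; exact h3 i
    simp only [dotN, e, add_mul, Finset.sum_add_distrib] at h1 h2 ⊢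
    rw [h1, h2, add_zero]
  smul_mem' := by
    intro c u hu
    refine ⟨mem_subX.1 ((subX l L).smul_mem c (mem_subX.2 hu.1)), ?_⟩
    filter_upwards [hu.2, ae_restrict_of_ae (ae_all_iff.2 fun i =>
      Lp.coeFn_smul c (trace (u i)))] with x h1 h3
    have e : ∀ i, trace ((c • u) i) x = c * trace (u i) x := fun i => by
      rw [PiLp.smul_apply, trace_smul]; exact h3 i
    simp only [dotN, e, mul_assoc, ← Finset.mul_sum] at h1 ⊢
    rw [h1, mul_zero]

theorem mem_subXt {u : VH1 l L} : u ∈ subXt l L ↔ u ∈ Xt l L := Iff.rfl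

end Spaces

/-! ### Coercivity, skew-symmetry and assembly of the concrete flow forms -/

section FlowForms

/-- The constant `N` is the sum of all the operator bounds involved. The prescribed lower bound `C`
makes room for the constants of the boundary lifts, so that one `N` serves for everything. -/
theorem FlowForms.exists_of_coercive {V H : Type*} [NormedAddCommGroup V] [InnerProductSpace ℝ V]
    [NormedAddCommGroup H] [InnerProductSpace ℝ H] {X0 adm : Subsp V} {Y : Subsp H}
    (closed_X0 : IsClosed (X0 : Set V)) (closed_Y : IsClosed (Y : Set H)) (X0_le : X0 ≤ adm)
    (a : Bil V V) (a1 bd : Bil H H) (b1 f : Bil H V) (c : Tri V V) (c1 : Tri H V) {C₀ : ℝ}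
    (a_coercive : ∀ w ∈ X0, ‖w‖ ^ 2 ≤ C₀ * a w w) (a1_coercive : ∀ η ∈ Y, ‖η‖ ^ 2 ≤ C₀ * a1 η η)
    (a_nonneg : ∀ w, 0 ≤ a w w) (a1_nonneg : ∀ η, 0 ≤ a1 η η) (bd_nonneg : ∀ η, 0 ≤ bd η η)
    (c_skew : ∀ u ∈ adm, ∀ w ∈ X0, c u w w = 0) (c1_skew : ∀ u ∈ adm, ∀ η ∈ Y, c1 u η η = 0)
    (C : ℝ) :
    ∃ F : FlowForms V H, C ≤ F.N ∧ F.X0 = X0 ∧ F.Y = Y ∧ F.adm = adm ∧ F.a = a ∧ F.a1 = a1 ∧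
      F.bd = bd ∧ F.b1 = b1 ∧ F.f = f ∧ F.c = c ∧ F.c1 = c1 := by
  obtain ⟨N1, h1, B1⟩ := exists_bound₂ a
  obtain ⟨N2, h2, B2⟩ := exists_bound₂ a1
  obtain ⟨N3, h3, B3⟩ := exists_bound₂ b1
  obtain ⟨N4, h4, B4⟩ := exists_bound₂ f
  obtain ⟨N5, h5, B5⟩ := exists_bound₃ c
  obtain ⟨N6, h6, B6⟩ := exists_bound₃ c1
  obtain ⟨N, hN⟩ : ∃ N : ℝ, N = 1 + |C₀| + |C| + N1 + N2 + N3 + N4 + N5 + N6 := ⟨_, rfl⟩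
  have h0 := abs_nonneg C
  have h7 := abs_nonneg C₀
  have h8 := le_abs_self C
  have key : C₀ ≤ N := by linarith [le_abs_self C₀]
  exact ⟨{  X0 := X0, Y := Y, adm := adm, closed_X0 := closed_X0, closed_Y := closed_Y
            X0_le := X0_le
            a := a, a1 := a1, bd := bd, b1 := b1, f := f, c := c, c1 := c1, N := N
            one_le := by linarith
            a_le := fun u v => (B1 u v).trans (by gcongr; linarith)
            a1_le := fun u v => (B2 u v).trans (by gcongr; linarith)
            b1_le := fun u v => (B3 u v).trans (by gcongr; linarith)
            f_le := fun u v => (B4 u v).trans (by gcongr; linarith)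
            c_le := fun u v w => (B5 u v w).trans (by gcongr; linarith)
            c1_le := fun u v w => (B6 u v w).trans (by gcongr; linarith)
            a_coercive := fun w hw => (a_coercive w hw).trans
              (mul_le_mul_of_nonneg_right key (a_nonneg w))
            a1_coercive := fun η hη => (a1_coercive η hη).trans
              (mul_le_mul_of_nonneg_right key (a1_nonneg η))
            bd_nonneg := bd_nonneg, c_skew := c_skew, c1_skew := c1_skew },
    by linarith, rfl, rfl, rfl, rfl, rfl, rfl, rfl, rfl, rfl, rfl⟩

theorem bilA_nonneg (w : VH1 l L) : 0 ≤ bilA l L w w := by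
  rw [bilA_apply]
  exact Finset.sum_nonneg fun i _ => Finset.sum_nonneg fun j _ => real_inner_self_nonneg

theorem bilA1_nonneg (η : H1 l L) : 0 ≤ bilA1 l L η η := by
  rw [bilA1_apply]
  exact Finset.sum_nonneg fun i _ => real_inner_self_nonneg

variable [Fact (0 < l)] [Fact (0 < L)]

theorem bilA_coercive {w : VH1 l L} (hw : w ∈ X0 l L) : ‖w‖ ^ 2 ≤ 5 * bilA l L w w := by
  rw [PiLp.norm_sq_eq_of_L2, bilA_apply, Finset.sum_comm, Finset.mul_sum]
  refine Finset.sum_le_sum fun j _ => ?_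
  simp only [real_inner_self_eq_norm_sq]
  exact norm_sq_le_of_mem_Y (X0_subset_Y hw j)

theorem bilA1_coercive {η : H1 l L} (h : η ∈ Y l L) : ‖η‖ ^ 2 ≤ 5 * bilA1 l L η η := by
  rw [bilA1_apply]
  simp only [real_inner_self_eq_norm_sq]
  exact norm_sq_le_of_mem_Y h

theorem triC1_skew {u : VH1 l L} (hu : u ∈ Xt l L) {η : H1 l L} (h : η ∈ Y l L) :
    triC1 l L u η η = 0 := by
  rw [triC1_apply]
  exact convective_skew hu.1.1 (dotN_mul_trace hu h)

theorem triC_skew {u : VH1 l L} (hu : u ∈ Xt l L) {w : VH1 l L} (h : w ∈ X0 l L) :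
    triC l L u w w = 0 := by
  rw [triC_apply]
  exact Finset.sum_eq_zero fun j _ =>
    convective_skew hu.1.1 (dotN_mul_trace hu (X0_subset_Y h j))

/-- `F` consists of the spaces and forms of the Rayleigh–Bénard–Marangoni system. -/
structure IsFlow (F : FlowForms (VH1 l L) (H1 l L)) : Prop where
  X0_eq : F.X0 = subX0 l L
  Y_eq : F.Y = vanish l L (bottom l L)
  adm_eq : F.adm = subXt l L
  a_eq : F.a = bilA l L
  a1_eq : F.a1 = bilA1 l L
  b1_eq : F.b1 = bilB1 l L
  f_eq : F.f = bilF l L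
  c_eq : F.c = triC l L
  c1_eq : F.c1 = triC1 l L
  bd_eq : ∀ θ W, F.bd θ W = ∫ x in Gamma1 l L, trace θ x * trace W x ∂(surf l L)

theorem exists_isFlow (l L C : ℝ) [Fact (0 < l)] [Fact (0 < L)] :
    ∃ F : FlowForms (VH1 l L) (H1 l L), IsFlow F ∧ C ≤ F.N := by
  obtain ⟨S, hS⟩ := exists_bdForm (l := l) (L := L) measurableSet_Gamma1
  have hSn : ∀ η, 0 ≤ S η η := fun η => by
    rw [hS]
    exact integral_nonneg fun x => mul_self_nonneg _
  obtain ⟨F, h0, h1, h2, h3, h4, h5, h6, h7, h8, h9, h10⟩ :=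
    FlowForms.exists_of_coercive (X0 := subX0 l L) (adm := subXt l L) (Y := vanish l L (bottom l L))
      isClosed_subX0 (isClosed_vanish measurableSet_bottom)
      (fun u hu => X0_subset_Xt (mem_subX0.1 hu)) (bilA l L) (bilA1 l L) S (bilB1 l L) (bilF l L)
      (triC l L) (triC1 l L) (fun w hw => bilA_coercive (mem_subX0.1 hw))
      (fun η hη => bilA1_coercive hη) bilA_nonneg bilA1_nonneg hSn
      (fun u hu w hw => triC_skew hu (mem_subX0.1 hw)) (fun u hu η hη => triC1_skew hu hη) C
  exact ⟨F, ⟨h1, h2, h3, h4, h5, h7, h8, h9, h10, fun θ W => by rw [h6, hS]⟩, h0⟩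

end FlowForms

/-! ### Lifting the boundary data -/

section Lift

theorem halfNorm_nonneg (Γ : Set Pt) (v : Pt → ℝ) : 0 ≤ halfNorm l L Γ v := by
  refine Real.sInf_nonneg ?_
  rintro _ ⟨u, -, rfl⟩
  exact norm_nonneg u

theorem dataNorm_nonneg (Γ01 Γ02 : Set Pt) (u0 g : Pt → Pt) (φ1 φ2 : Pt → ℝ) :
    0 ≤ dataNorm l L Γ01 Γ02 u0 g φ1 φ2 := by
  have h1 := halfNorm_nonneg (l := l) (L := L) (lateral l L) φ1
  have h2 := halfNorm_nonneg (l := l) (L := L) (bottom l L) φ2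
  unfold dataNorm vecHalf00Norm
  positivity

theorem MemHalf00.memHalf_bottom {φ : Pt → ℝ} (h : MemHalf00 l L (bottom l L) φ) :
    MemHalf l L (bottom l L) φ := by
  obtain ⟨u, hu⟩ := h
  refine ⟨u, ?_⟩
  have h1 := (eqOn_iff isClosed_frontier.measurableSet).1 hu
  refine (eqOn_iff measurableSet_bottom).2 (h1.mono fun x hx hb => ?_)
  rw [hx hb.1, indicator_of_mem hb]

theorem sum_normal_mul_trace {Γ : Set Pt} {v : Pt → Pt} {u : VH1 l L}
    (h : ∀ i, trace (u i) =ᵐ[surf l L] Γ.indicator fun x => v x i) :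
    ∀ᵐ x ∂(surf l L), ∑ i, trace (u i) x * normal l L x i = Γ.indicator (dotN l L v) x := by
  filter_upwards [ae_all_iff.2 h] with x hx
  simp only [hx]
  by_cases hxΓ : x ∈ Γ <;> simp [hxΓ, dotN]

variable [Fact (0 < l)] [Fact (0 < L)]

theorem exists_vecHalf00Norm {Γ : Set Pt} {v : Pt → Pt}
    (h : ∀ i, MemHalf00 l L Γ fun x => v x i) :
    ∃ u : VH1 l L, (∀ i, trace (u i) =ᵐ[surf l L] Γ.indicator fun x => v x i) ∧
      ‖u‖ ≤ vecHalf00Norm l L Γ v := by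
  choose w hw hn using fun i => exists_halfNorm isClosed_frontier.measurableSet (h i)
  refine ⟨WithLp.toLp 2 w, fun i => ?_, ?_⟩
  · filter_upwards [(eqOn_iff isClosed_frontier.measurableSet).1 (hw i), ae_surf_mem_frontier]
      with x h1 h2
    exact h1 h2
  · rw [PiLp.norm_eq_of_L2, vecHalf00Norm]
    refine Real.sqrt_le_sqrt (Finset.sum_le_sum fun i _ => ?_)
    exact pow_le_pow_left₀ (norm_nonneg _) (hn i) 2

/-- The mean of the divergence is the boundary flux. For data without flux the divergence of any
extension is thus in the range of the divergence on `H¹₀`. -/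
theorem integral_sum_D {Γ : Set Pt} (hΓ : MeasurableSet Γ) {v : Pt → Pt} {u : VH1 l L}
    (h : ∀ i, trace (u i) =ᵐ[surf l L] Γ.indicator fun x => v x i) :
    ∫ x in box l L, (∑ i, D i (u i) : L2 l L) x = ∫ x in Γ, dotN l L v x ∂(surf l L) := by
  have hL : ∀ i, Integrable (D i (u i)) (volume.restrict (box l L)) := fun i =>
    (Lp.memLp (D i (u i))).integrable one_le_two
  have hT : ∀ i, Integrable (fun x => normal l L x i * trace (u i) x) (surf l L) := fun i =>
    integrable_normal_mul ((Lp.memLp (trace (u i))).integrable one_le_two) i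
  have e : (∑ i, D i (u i) : L2 l L) =ᵐ[volume.restrict (box l L)] fun x => ∑ i, D i (u i) x :=
    (Lp.coeFn_finsetSum _ _).trans (Filter.Eventually.of_forall fun x => Finset.sum_apply _ _ _)
  rw [integral_congr_ae e, integral_finsetSum _ fun i _ => hL i]
  simp only [integral_D]
  rw [← integral_finsetSum _ fun i _ => hT i, ← integral_indicator hΓ]
  refine integral_congr_ae ((sum_normal_mul_trace h).mono fun x hx => ?_)
  simp only [← hx, mul_comm]

/-- Tangential boundary data without flux extend to admissible divergence-free fields. -/
theorem exists_velocity_lift (l L : ℝ) [Fact (0 < l)] [Fact (0 < L)] :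
    ∃ C : ℝ, 0 ≤ C ∧ ∀ Γ : Set Pt, MeasurableSet Γ → Γ ⊆ Gamma0 l L → ∀ v : Pt → Pt,
      MemHalfTilde l L Γ v → ∃ U : VH1 l L, U ∈ Xt l L ∧
        (∀ i, trace (U i) =ᵐ[surf l L] Γ.indicator fun x => v x i) ∧
        ‖U‖ ≤ C * vecHalf00Norm l L Γ v := by
  obtain ⟨C, hC, hdiv⟩ := exists_div_eq l L
  refine ⟨1 + 3 * C, by positivity, fun Γ hΓ hΓ0 v hv => ?_⟩
  obtain ⟨h, ht, hn⟩ := exists_vecHalf00Norm hv.mem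
  -- An extension of least norm need not be divergence-free; subtracting a field in `H¹₀` with the
  -- same divergence repairs this without changing the trace.
  obtain ⟨z, hz0, hzd, hzn⟩ := hdiv (∑ i, D i (h i)) (by rw [integral_sum_D hΓ ht, hv.flux])
  have htr : ∀ i, trace ((h - z) i) =ᵐ[surf l L] Γ.indicator fun x => v x i := fun i => by
    rw [PiLp.sub_apply, trace_sub, hz0, sub_zero]
    exact ht i
  refine ⟨h - z, ⟨⟨?_, ?_⟩, ?_⟩, htr, ?_⟩
  · change ∑ i, D i ((h - z) i) = 0
    simp only [PiLp.sub_apply, D_sub, Finset.sum_sub_distrib, hzd, sub_self]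
  · refine (eqOn_iff measurableSet_Gamma1).2 ((htr 2).mono fun x hx h1 => ?_)
    rw [hx, indicator_of_notMem fun h2 => (hΓ0 h2).2 h1]
    rfl
  · have hm : MeasurableSet {x | x ∈ Γ ∧ x 2 ≠ 0} := hΓ.inter
      (measurableSet_eq_fun (measurable_pi_apply 2) measurable_const).compl
    refine (ae_restrict_iff' measurableSet_lateral).2 ?_
    filter_upwards [sum_normal_mul_trace htr, (ae_restrict_iff' hm).1 hv.tangential]
      with x h1 h2 h3
    unfold dotN at h2 ⊢
    rw [h1]
    by_cases hx : x ∈ Γ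
    · rw [indicator_of_mem hx]
      exact h2 ⟨hx, h3.2⟩
    · rw [indicator_of_notMem hx]
  · have hd : ‖∑ i, D i (h i)‖ ≤ 3 * ‖h‖ := by
      refine (norm_sum_le_of_le _ fun i _ =>
        (norm_D_le i (h i)).trans (PiLp.norm_apply_le h i)).trans ?_
      simp
    calc ‖h - z‖ ≤ ‖h‖ + ‖z‖ := norm_sub_le _ _
      _ ≤ ‖h‖ + C * (3 * ‖h‖) := by gcongr; exact hzn.trans (by gcongr)
      _ = (1 + 3 * C) * ‖h‖ := by ring
      _ ≤ _ := by gcongr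

/-- Bottom temperatures extend to functions vanishing at the top. -/
theorem exists_temperature_lift (l L : ℝ) [Fact (0 < l)] [Fact (0 < L)] :
    ∃ C : ℝ, 0 ≤ C ∧ ∀ φ : Pt → ℝ, MemHalf l L (bottom l L) φ → ∃ Θ : H1 l L,
      EqOn Θ φ (bottom l L) ∧ EqOn Θ 0 (Gamma1 l L) ∧ ‖Θ‖ ≤ C * halfNorm l L (bottom l L) φ := by
  -- The factor `1 - x₃` is `1` on the bottom and `0` on the top, so the lift stays out of the Robin
  -- term.
  have hψ : ContDiff ℝ ∞ fun x : Pt => 1 - x 2 := by fun_prop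
  obtain ⟨C, hC, hmul⟩ := exists_mulH1 (l := l) (L := L) hψ
  refine ⟨C, hC, fun φ hφ => ?_⟩
  obtain ⟨u, hu, hn⟩ := exists_halfNorm measurableSet_bottom hφ
  obtain ⟨Θ, hΘ, ht⟩ := hmul u
  refine ⟨Θ, ?_, ?_, hΘ.trans (by gcongr)⟩
  · rw [eqOn_iff measurableSet_bottom] at hu ⊢
    filter_upwards [hu, ht] with x h1 h2 h3
    rw [h2, h1 h3, h3.2]; ring
  · rw [eqOn_iff measurableSet_Gamma1]
    filter_upwards [ht] with x h2 h3
    rw [h2, h3.2]; simp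

/-- The lateral heat flux as a bounded functional. -/
theorem exists_flux_functional (l L : ℝ) [Fact (0 < l)] [Fact (0 < L)] :
    ∃ C : ℝ, 0 ≤ C ∧ ∀ φ : Pt → ℝ, MemHalf l L (lateral l L) φ → ∃ ℓ : Lin (H1 l L),
      (∀ W, ℓ W = ∫ x in lateral l L, φ x * trace W x ∂(surf l L)) ∧
      ∀ W, |ℓ W| ≤ C * halfNorm l L (lateral l L) φ * ‖W‖ := by
  obtain ⟨S, hS⟩ := exists_bdForm (l := l) (L := L) measurableSet_lateral
  obtain ⟨C, hC, hb⟩ := exists_bound₂ S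
  refine ⟨C, hC, fun φ hφ => ?_⟩
  -- The flux datum is the trace of some `u`, so the functional is the bounded boundary form
  -- evaluated at `u`.
  obtain ⟨u, hu, hn⟩ := exists_halfNorm measurableSet_lateral hφ
  refine ⟨S u, fun W => ?_, fun W => (hb u W).trans (by gcongr)⟩
  rw [hS]
  exact integral_congr_ae (Filter.Eventually.mono hu fun x hx => by simp only [hx])

end Lift

/-! ### The weak formulation in terms of the abstract forms -/

section Weak

variable [Fact (0 < l)] [Fact (0 < L)]

/-- The constant field `e₃` is the gradient of `x₃`, hence orthogonal to `X₀`. -/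
theorem integral_fn_eq_zero {v : VH1 l L} (hv : v ∈ X0 l L) :
    ∫ x in box l L, fn (v 2) x = 0 := by
  have hq : ContDiff ℝ ∞ fun x : Pt => x 2 := by fun_prop
  have h := sum_integral_pd_mul hv hq
  have e : ∀ i x, pd i (fun x : Pt => x 2) x = if i = 2 then 1 else 0 := fun i x =>
    pd_comp_coord i 2 (hasDerivAt_id' (x 2))
  simpa [e, Fin.sum_univ_three] using h

/-- The part of the buoyancy proportional to `b` is a gradient and is invisible to divergence-free
test fields; this is why no constant depends on `b`. -/
theorem formF_eq (Pr R b : ℝ) (θ : H1 l L) {v : VH1 l L} (hv : v ∈ X0 l L) :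
    formF Pr R b θ v = Pr * R * bilF l L θ v := by
  have hi : Integrable (fun x => fn (v 2) x) (volume.restrict (box l L)) :=
    (Lp.memLp (fn (v 2))).integrable one_le_two
  have e : ∀ x, Pr * (b + R * fn θ x) * fn (v 2) x =
      Pr * b * fn (v 2) x + Pr * R * (fn θ x * fn (v 2) x) := fun x => by ring
  unfold formF
  simp only [e]
  rw [integral_add (hi.const_mul _) ((integrable_mul_Lp _ _).const_mul _), integral_const_mul,
    integral_const_mul, integral_fn_eq_zero hv, mul_zero, zero_add, bilF_eq]

variable {F : FlowForms (VH1 l L) (H1 l L)}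

theorem IsFlow.mom_iff (hF : IsFlow F) {Pr M R : ℝ} (b : ℝ) {u : VH1 l L} {θ : H1 l L} :
    F.Mom Pr M R u u θ ↔ ∀ v ∈ X0 l L,
      Pr * formA u v + Pr * M * formB1 θ v + formC u u v = formF Pr R b θ v := by
  unfold FlowForms.Mom
  rw [hF.X0_eq, hF.a_eq, hF.b1_eq, hF.c_eq, hF.f_eq]
  simp only [mem_subX0, bilA_eq, bilB1_eq, triC_eq]
  exact forall₂_congr fun v hv => by rw [formF_eq Pr R b θ hv]

theorem IsFlow.heat_iff (hF : IsFlow F) {B : ℝ} {ℓ : Lin (H1 l L)} {φ : Pt → ℝ}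
    (hℓ : ∀ W, ℓ W = ∫ x in lateral l L, φ x * trace W x ∂(surf l L)) {u : VH1 l L}
    {θ : H1 l L} : F.Heat B ℓ u θ ↔ ∀ W ∈ Y l L,
      formC1 u θ W + formA1 θ W + (∫ x in Gamma1 l L, B * trace θ x * trace W x ∂(surf l L))
        = ∫ x in lateral l L, φ x * trace W x ∂(surf l L) := by
  unfold FlowForms.Heat
  rw [hF.Y_eq, hF.a1_eq, hF.c1_eq]
  simp only [hF.bd_eq, bilA1_eq, triC1_eq, hℓ, mul_assoc, integral_const_mul]
  rfl

/-- Since the two parts exhaust `Γ₀`, the boundary conditions say that the difference from a lift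
lies in `X₀`, respectively `Y`. Membership in the admissible space follows, because the lift and
`X₀` are both admissible. -/
theorem IsFlow.solves_iff (hF : IsFlow F) {Pr M R B : ℝ} (b : ℝ) {Γ01 Γ02 : Set Pt}
    (hs : IsSplit l L Γ01 Γ02) {u0 g : Pt → Pt} {φ1 φ2 : Pt → ℝ} {ℓ : Lin (H1 l L)}
    (hℓ : ∀ W, ℓ W = ∫ x in lateral l L, φ1 x * trace W x ∂(surf l L)) {U : VH1 l L}
    (hU : U ∈ Xt l L) (hg : ∀ i, EqOn (U i) (fun x => g x i) Γ01)
    (hu0 : ∀ i, EqOn (U i) (fun x => u0 x i) Γ02) {Θ : H1 l L} (hΘ : EqOn Θ φ2 (bottom l L))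
    (p : VH1 l L × H1 l L) :
    SolvesInXt l L Pr M R B b Γ01 Γ02 u0 g φ1 φ2 p ↔ F.Solves Pr M R B ℓ U Θ p := by
  have h1 : Γ01 ⊆ Gamma0 l L := hs.union ▸ subset_union_left
  have h2 : Γ02 ⊆ Gamma0 l L := hs.union ▸ subset_union_right
  have hX : p.1 - U ∈ F.X0 ↔ p.1 - U ∈ X0 l L := by rw [hF.X0_eq, mem_subX0]
  have hY : p.2 - Θ ∈ F.Y ↔ EqOn (p.2 - Θ) 0 (bottom l L) := by rw [hF.Y_eq, mem_vanish]
  unfold FlowForms.Solves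
  rw [hX, hY, hF.mom_iff b, hF.heat_iff hℓ]
  constructor
  · rintro ⟨ht, hw⟩
    refine ⟨?_, eqOn_sub hw.bc_phi2 hΘ, hw.momentum, hw.heat⟩
    have hd := mem_subX.1 ((subX l L).sub_mem (mem_subX.2 ht.1) (mem_subX.2 hU.1))
    refine ⟨hd.1, fun i => ?_, hd.2⟩
    have e1 := eqOn_sub (hw.bc_g i) (hg i)
    have e2 := eqOn_sub (hw.bc_u0 i) (hu0 i)
    rw [eqOn_iff hs.meas1] at e1
    rw [eqOn_iff hs.meas2] at e2
    refine (eqOn_iff measurableSet_Gamma0).2 ?_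
    filter_upwards [e1, e2] with x a1 a2 hx
    rw [← hs.union] at hx
    exact hx.elim a1 a2
  · rintro ⟨hd, hb, hm, hh⟩
    have ht : p.1 ∈ Xt l L := by
      have := (subXt l L).add_mem (mem_subXt.2 (X0_subset_Xt hd)) (mem_subXt.2 hU)
      rwa [sub_add_cancel] at this
    exact ⟨ht, ht.1, hm, hh, fun i => eqOn_of_sub ((hd.2.1 i).mono h1) (hg i),
      fun i => eqOn_of_sub ((hd.2.1 i).mono h2) (hu0 i), eqOn_of_sub hb hΘ⟩

end Weak

/-! ### Small data -/

section SmallData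

/-- Unique solvability for small data. -/
theorem exists_const_existsUnique (l L : ℝ) [Fact (0 < l)] [Fact (0 < L)] {Λ : ℝ} (hΛ : 0 < Λ) :
    ∃ K : ℝ, 0 < K ∧ ∀ Pr M R B b : ℝ, 0 < Pr → 0 ≤ M → 0 ≤ R → 0 < B →
      ∀ Γ01 Γ02 : Set Pt, IsSplit l L Γ01 Γ02 →
      ∀ (u0 g : Pt → Pt) (φ1 φ2 : Pt → ℝ), IsData l L Γ01 Γ02 u0 g φ1 φ2 →
        dataNorm l L Γ01 Γ02 u0 g φ1 φ2 ≤ Λ →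
        0 < Pr - K * (1 + M + B + R) * (Pr * (M + R) + 1) * dataNorm l L Γ01 Γ02 u0 g φ1 φ2 →
        (∃! p : VH1 l L × H1 l L, SolvesInXt l L Pr M R B b Γ01 Γ02 u0 g φ1 φ2 p) ∧
        ∀ p : VH1 l L × H1 l L, SolvesInXt l L Pr M R B b Γ01 Γ02 u0 g φ1 φ2 p →
          ‖p.1‖ + ‖p.2‖ ≤ K * (1 + M + B + R) * dataNorm l L Γ01 Γ02 u0 g φ1 φ2 := by
  obtain ⟨C1, hC1, hvel⟩ := exists_velocity_lift l L
  obtain ⟨C2, hC2, htemp⟩ := exists_temperature_lift l L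
  obtain ⟨C3, hC3, hflux⟩ := exists_flux_functional l L
  -- With `N` above the three lifting constants, all lifts are bounded by `N D`, as the abstract
  -- theorem demands. The forms depend only on the box, so `K` depends only on the box and `Λ`.
  obtain ⟨F, hF, hN⟩ := exists_isFlow l L (C1 + C2 + C3)
  have hN1 := F.one_le
  refine ⟨100 * F.N ^ 12 * (1 + Λ), by positivity, ?_⟩
  intro Pr M R B b hPr hM hR hB Γ01 Γ02 hs u0 g φ1 φ2 hd hDΛ hsmall
  have h1 : Γ01 ⊆ Gamma0 l L := hs.union ▸ subset_union_left
  have h2 : Γ02 ⊆ Gamma0 l L := hs.union ▸ subset_union_right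
  obtain ⟨U1, hU1, ht1, hn1⟩ := hvel Γ01 hs.meas1 h1 g hd.mem_g
  obtain ⟨U2, hU2, ht2, hn2⟩ := hvel Γ02 hs.meas2 h2 u0 hd.mem_u0
  obtain ⟨Θ, hΘ, hΘ1, hΘn⟩ := htemp φ2 hd.mem_phi2.memHalf_bottom
  obtain ⟨ℓ, hℓ, hℓn⟩ := hflux φ1 hd.mem_phi1
  have hD := dataNorm_nonneg (l := l) (L := L) Γ01 Γ02 u0 g φ1 φ2
  have hDdef : dataNorm l L Γ01 Γ02 u0 g φ1 φ2 = vecHalf00Norm l L Γ02 u0 +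
    vecHalf00Norm l L Γ01 g + halfNorm l L (lateral l L) φ1 + halfNorm l L (bottom l L) φ2 := rfl
  have n1 : 0 ≤ vecHalf00Norm l L Γ02 u0 := Real.sqrt_nonneg _
  have n2 : 0 ≤ vecHalf00Norm l L Γ01 g := Real.sqrt_nonneg _
  have n3 := halfNorm_nonneg (l := l) (L := L) (lateral l L) φ1
  have n4 := halfNorm_nonneg (l := l) (L := L) (bottom l L) φ2
  generalize dataNorm l L Γ01 Γ02 u0 g φ1 φ2 = D at *
  have hU : U1 + U2 ∈ Xt l L := (subXt l L).add_mem (mem_subXt.2 hU1) (mem_subXt.2 hU2)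
  have htr : ∀ i, ∀ᵐ x ∂(surf l L), trace ((U1 + U2) i) x =
      Γ01.indicator (fun x => g x i) x + Γ02.indicator (fun x => u0 x i) x := fun i => by
    filter_upwards [ht1 i, ht2 i, Lp.coeFn_add (trace (U1 i)) (trace (U2 i))] with x a1 a2 a3
    rw [PiLp.add_apply, trace_add, a3, Pi.add_apply, a1, a2]
  -- Each lift has zero trace off its own part of the boundary, so by disjointness their sum takes
  -- both data.
  have hg : ∀ i, EqOn ((U1 + U2) i) (fun x => g x i) Γ01 := fun i =>
    (eqOn_iff hs.meas1).2 ((htr i).mono fun x hx h => by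
      rw [hx, indicator_of_mem h, indicator_of_notMem (disjoint_left.1 hs.disj h), add_zero])
  have hu0 : ∀ i, EqOn ((U1 + U2) i) (fun x => u0 x i) Γ02 := fun i =>
    (eqOn_iff hs.meas2).2 ((htr i).mono fun x hx h => by
      rw [hx, indicator_of_mem h, indicator_of_notMem (disjoint_right.1 hs.disj h), zero_add])
  simp only [hF.solves_iff b hs hℓ hU hg hu0 hΘ]
  refine F.existsUnique_solves hΛ hPr hM hR hB.le hD hDΛ ?_ ?_ ?_ ?_ ?_ hsmall
  · rw [hF.adm_eq]
    exact hU
  · refine (norm_add_le _ _).trans ((add_le_add hn1 hn2).trans ?_)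
    rw [← mul_add]
    exact mul_le_mul (by linarith) (by linarith) (by linarith) (by linarith)
  · intro W
    rw [hF.bd_eq, ← integral_zero Pt ℝ (μ := (surf l L).restrict (Gamma1 l L))]
    exact integral_congr_ae (Filter.Eventually.mono hΘ1 fun x hx => by simp [hx])
  · exact hΘn.trans (mul_le_mul (by linarith) (by linarith) n4 (by linarith))
  · intro W
    refine (hℓn W).trans (mul_le_mul_of_nonneg_right ?_ (norm_nonneg W))
    exact mul_le_mul (by linarith) (by linarith) n3 (by linarith)

end SmallData

/-! ### The conduction state -/

section Conduction

theorem FlowForms.solves_zero {V H : Type*} [NormedAddCommGroup V] [InnerProductSpace ℝ V]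
    [NormedAddCommGroup H] [InnerProductSpace ℝ H] {F : FlowForms V H} {Pr M R B : ℝ} {θ : H}
    (hb1 : ∀ v ∈ F.X0, F.b1 θ v = 0) (hf : ∀ v ∈ F.X0, F.f θ v = 0)
    (ha1 : ∀ W ∈ F.Y, F.a1 θ W + B * F.bd θ W = 0) : F.Solves Pr M R B 0 0 θ (0, θ) :=
  ⟨by simp, by simp, fun v hv => by simp [hb1 v hv, hf v hv],
    fun W hW => by simpa using ha1 W hW⟩

theorem FlowForms.c1_le_of_eq {V H : Type*} [NormedAddCommGroup V] [InnerProductSpace ℝ V]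
    [NormedAddCommGroup H] [InnerProductSpace ℝ H] {F : FlowForms V H} {c1 : Tri H V}
    (h : F.c1 = c1) {k κ : ℝ} (hk : |k| ≤ κ) {θ θ' : H}
    (hθ : ∀ u W, c1 u θ W = k * c1 u θ' W) (u : V) (W : H) :
    |F.c1 u θ W| ≤ κ * (F.N * ‖θ'‖) * ‖u‖ * ‖W‖ := by
  have hκ := (abs_nonneg k).trans hk
  have h1 := F.c1_le u θ' W
  rw [h] at h1 ⊢
  rw [hθ, abs_mul]
  calc |k| * |c1 u θ' W| ≤ κ * (F.N * ‖u‖ * ‖θ'‖ * ‖W‖) := by gcongr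
    _ = _ := by ring

theorem contDiff_affine (a k : ℝ) : ContDiff ℝ ∞ fun x : Pt => a - k * x 2 := by fun_prop

variable [Fact (0 < l)] [Fact (0 < L)]

/-- The function `a - k x₃`. -/
def affineH (l L a k : ℝ) [Fact (0 < l)] [Fact (0 < L)] : H1 l L :=
  ofSmooth (fun x => a - k * x 2) (contDiff_affine a k)

theorem fn_affineH (a k : ℝ) :
    fn (affineH l L a k) =ᵐ[volume.restrict (box l L)] fun x => a - k * x 2 :=
  fn_ofSmooth _

theorem trace_affineH (a k : ℝ) : trace (affineH l L a k) =ᵐ[surf l L] fun x => a - k * x 2 :=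
  trace_ofSmooth _

theorem D_affineH (a k : ℝ) (i : Fin 3) :
    D i (affineH l L a k) =ᵐ[volume.restrict (box l L)] fun _ => if i = 2 then -k else 0 := by
  refine (D_ofSmooth _ i).trans (Filter.Eventually.of_forall fun x => ?_)
  exact pd_comp_coord (a := fun t => a - k * t) i 2
    (by simpa using ((hasDerivAt_id' (x 2)).const_mul k).const_sub a)

theorem D_affineH_eq (a k : ℝ) (i : Fin 3) :
    D i (affineH l L a k) = k • D i (affineH l L 0 1) := by
  refine Lp.ext ?_
  filter_upwards [D_affineH (l := l) (L := L) a k i, D_affineH (l := l) (L := L) 0 1 i,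
    Lp.coeFn_smul k (D i (affineH l L 0 1))] with x h1 h2 h3
  rw [h1, h3, Pi.smul_apply, h2]
  split_ifs <;> simp

theorem sum_inner_D_affineH (a k : ℝ) (f : Fin 3 → L2 l L) :
    ∑ i, inner ℝ (D i (affineH l L a k)) (f i) = -k * ∫ x in box l L, f 2 x := by
  have e : ∀ i, inner ℝ (D i (affineH l L a k)) (f i) =
      ∫ x in box l L, (if i = 2 then -k else 0) * f i x := fun i =>
    inner_Lp_congr (D_affineH a k i) Filter.EventuallyEq.rfl
  simp only [e, integral_const_mul]
  simp

/-- Convection sees only the gradient, which does not involve `a` and is proportional to the slope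
`k`. The form is therefore small with `k`, however large the temperature. -/
theorem triC1_affineH (a k : ℝ) (u : VH1 l L) (W : H1 l L) :
    triC1 l L u (affineH l L a k) W = k * triC1 l L u (affineH l L 0 1) W := by
  rw [triC1_apply, triC1_apply, Finset.mul_sum]
  exact Finset.sum_congr rfl fun i _ => by rw [D_affineH_eq, real_inner_smul_left]

/-- The form reduces to `-k ∫ ∂₃v₃`, a boundary integral of `v₃`, which vanishes on all of `∂Ω`. -/
theorem bilB1_affineH (a k : ℝ) {v : VH1 l L} (hv : v ∈ X0 l L) :
    bilB1 l L (affineH l L a k) v = 0 := by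
  rw [bilB1_apply, sum_inner_D_affineH a k fun i => D 2 (v i), integral_D]
  have h1 := (eqOn_iff measurableSet_Gamma1).1 hv.2.2
  have h2 := (eqOn_iff measurableSet_Gamma0).1 (hv.2.1 2)
  rw [integral_congr_ae (g := fun _ => 0), integral_zero, mul_zero]
  filter_upwards [h1, h2, ae_surf_mem_frontier] with x a1 a2 a3
  by_cases h : x ∈ Gamma1 l L
  · simp [a1 h]
  · simp [a2 ⟨a3, h⟩]

/-- The field `(a - k x₃) e₃` is the gradient of `a x₃ - k x₃² / 2`, hence orthogonal to `X₀`. -/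
theorem bilF_affineH (a k : ℝ) {v : VH1 l L} (hv : v ∈ X0 l L) :
    bilF l L (affineH l L a k) v = 0 := by
  have hq : ContDiff ℝ ∞ fun x : Pt => a * x 2 - k / 2 * x 2 ^ 2 := by fun_prop
  have h := sum_integral_pd_mul hv hq
  have e : ∀ i x, pd i (fun x : Pt => a * x 2 - k / 2 * x 2 ^ 2) x =
      if i = 2 then a - k * x 2 else 0 := fun i x => by
    refine pd_comp_coord (a := fun t => a * t - k / 2 * t ^ 2) i 2 ?_
    refine (((hasDerivAt_id' (x 2)).const_mul a).sub
      (((hasDerivAt_id' (x 2)).pow 2).const_mul (k / 2))).congr_deriv ?_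
    push_cast
    ring
  rw [bilF_eq, ← h]
  simp only [e, Fin.sum_univ_three]
  simp only [Fin.reduceEq, if_false, if_true, zero_mul, integral_zero, zero_add]
  exact integral_congr_ae ((fn_affineH a k).mono fun x hx =>
    congrArg (· * fn (v 2) x) hx)

/-- The form is `-k ∫ ∂₃W`; in the resulting boundary integral the bottom drops out because `W`
vanishes there, and the side walls because their normal is horizontal. -/
theorem bilA1_affineH (a k : ℝ) {W : H1 l L} (hW : W ∈ Y l L) :
    bilA1 l L (affineH l L a k) W = -k * ∫ x in Gamma1 l L, trace W x ∂(surf l L) := by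
  rw [bilA1_apply, sum_inner_D_affineH a k fun i => D i W, integral_D,
    ← integral_indicator measurableSet_Gamma1]
  congr 1
  refine integral_congr_ae ?_
  filter_upwards [(eqOn_iff measurableSet_bottom).1 hW, ae_surf_mem_frontier, ae_normal]
    with x h1 h2 h3
  rcases frontier_cases h2 with h | h | h
  · rw [indicator_of_mem h, h3.1 h.2 2]; simp
  · have : x ∉ Gamma1 l L := (bottom_subset_Gamma0 h).2
    rw [indicator_of_notMem this, h1 h]; simp
  · have hn : x ∉ Gamma1 l L := h.1.2
    have h1' : x 2 ≠ side l L 2 := fun h' => hn ⟨h2, h'⟩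
    rw [indicator_of_notMem hn, normal, if_neg h.2, if_neg h1', zero_mul]

theorem integral_trace_affineH (a k : ℝ) {W : H1 l L} :
    ∫ x in Gamma1 l L, trace (affineH l L a k) x * trace W x ∂(surf l L) =
      (a - k) * ∫ x in Gamma1 l L, trace W x ∂(surf l L) := by
  rw [← integral_const_mul]
  refine integral_congr_ae ((ae_restrict_iff' measurableSet_Gamma1).2 ?_)
  filter_upwards [trace_affineH (l := l) (L := L) a k] with x hx h
  rw [hx, h.2, mul_one]

/-- The conduction state solves the system with zero velocity data. -/
theorem IsFlow.solves_affineH {F : FlowForms (VH1 l L) (H1 l L)} (hF : IsFlow F) {Pr M R B : ℝ}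
    {a k : ℝ} (h : B * (a - k) = k) :
    F.Solves Pr M R B 0 0 (affineH l L a k) (0, affineH l L a k) := by
  refine FlowForms.solves_zero (fun v hv => ?_) (fun v hv => ?_) fun W hW => ?_
  · rw [hF.X0_eq, mem_subX0] at hv
    rw [hF.b1_eq, bilB1_affineH a k hv]
  · rw [hF.X0_eq, mem_subX0] at hv
    rw [hF.f_eq, bilF_affineH a k hv]
  · rw [hF.Y_eq, mem_vanish] at hW
    -- Both terms are multiples of the integral of `W` over the top, with factors `-k` and `B (a -
    -- k)`; the Robin condition makes them cancel.
    rw [hF.bd_eq, integral_trace_affineH, hF.a1_eq, bilA1_affineH a k hW, ← mul_assoc, h]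
    ring

/-- Uniqueness of the conduction state. -/
theorem exists_const_conduction (l L θc : ℝ) [Fact (0 < l)] [Fact (0 < L)] :
    ∃ ε : ℝ, 0 < ε ∧ ∀ Pr M R B b : ℝ, 0 < Pr → 0 ≤ M → M < ε → 0 ≤ R → R < ε → 0 < B → B < ε →
      ∀ Γ01 Γ02 : Set Pt, IsSplit l L Γ01 Γ02 →
        ∃ p : VH1 l L × H1 l L, p.1 = 0 ∧
          fn p.2 =ᵐ[volume.restrict (box l L)] (fun x => θc - θc * B / (1 + B) * x 2) ∧
          SolvesInXt l L Pr M R B b Γ01 Γ02 0 0 0 (fun _ => θc) p ∧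
          ∀ q : VH1 l L × H1 l L,
            SolvesInXt l L Pr M R B b Γ01 Γ02 0 0 0 (fun _ => θc) q → q = p := by
  obtain ⟨F, hF, -⟩ := exists_isFlow l L 1
  have hN := zero_le_one.trans F.one_le
  obtain ⟨A, hA⟩ : ∃ A : ℝ, A = F.N ^ 4 * |θc| * ‖affineH l L 0 1‖ := ⟨_, rfl⟩
  have hA0 : 0 ≤ A := by rw [hA]; positivity
  -- Uniqueness requires `A B (M + R) < 1`. As `ε ≤ 1/2`, the sum `M + R` is at most `1`, and `A B ≤
  -- A ε < 1`.
  refine ⟨1 / (2 * (A + 1)), by positivity, ?_⟩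
  intro Pr M R B b hPr hM hMε hR hRε hB hBε Γ01 Γ02 hs
  obtain ⟨k, hk⟩ : ∃ k : ℝ, k = θc * B / (1 + B) := ⟨_, rfl⟩
  have hB1 : 1 + B ≠ 0 := by positivity
  have hk1 : B * (θc - k) = k := by rw [hk]; field_simp; ring
  -- Smallness of `B` compensates for an arbitrary `θc`.
  have hk2 : |k| ≤ |θc| * B := by
    rw [hk, abs_div, abs_mul, abs_of_pos hB, abs_of_pos (by positivity : 0 < 1 + B)]
    exact div_le_self (by positivity) (by linarith)
  have hz : ∀ i, EqOn ((0 : VH1 l L) i) (fun _ => 0) (frontier (box l L)) := fun _ =>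
    (vanish l L (frontier (box l L))).zero_mem
  have hfr : Gamma0 l L ⊆ frontier (box l L) := fun x hx => hx.1
  have h1 : Γ01 ⊆ Gamma0 l L := hs.union ▸ subset_union_left
  have h2 : Γ02 ⊆ Gamma0 l L := hs.union ▸ subset_union_right
  have hbot : EqOn (affineH l L θc k) (fun _ => θc) (bottom l L) := by
    refine (eqOn_iff measurableSet_bottom).2 ?_
    filter_upwards [trace_affineH (l := l) (L := L) θc k] with x hx h
    rw [hx, h.2, mul_zero, sub_zero]
  have hℓ : ∀ W : H1 l L, (0 : Lin (H1 l L)) W =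
      ∫ x in lateral l L, (0 : Pt → ℝ) x * trace W x ∂(surf l L) := fun W => by simp
  have hiff := hF.solves_iff (Pr := Pr) (M := M) (R := R) (B := B) b hs (u0 := 0) (g := 0) hℓ
    (mem_subXt.1 (subXt l L).zero_mem) (fun i => (hz i).mono (h1.trans hfr))
    (fun i => (hz i).mono (h2.trans hfr)) hbot
  have hsol := hF.solves_affineH (Pr := Pr) (M := M) (R := R) hk1
  refine ⟨(0, affineH l L θc k), rfl, ?_, (hiff _).2 hsol, fun q hq => ?_⟩
  · rw [← hk]
    exact fn_affineH θc k
  · refine FlowForms.Solves.eq_of_small hPr hM hR hB.le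
      (κ := |θc| * B * (F.N * ‖affineH l L 0 1‖)) (by positivity) hsol ?_ ?_ ((hiff q).1 hq)
    · exact FlowForms.c1_le_of_eq hF.c1_eq hk2 (triC1_affineH θc k)
    · have e : F.N ^ 3 * (|θc| * B * (F.N * ‖affineH l L 0 1‖)) * (M + R) = A * (B * (M + R)) := by
        rw [hA]; ring
      obtain ⟨ε, hε⟩ : ∃ ε : ℝ, ε = 1 / (2 * (A + 1)) := ⟨_, rfl⟩
      rw [← hε] at hMε hRε hBε
      have hεA : ε * (2 * (A + 1)) = 1 := by rw [hε]; field_simp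
      have hε0 : 0 < ε := hB.trans hBε
      have hε1 : 2 * ε ≤ 1 := by nlinarith
      have e2 : B * (M + R) ≤ ε * 1 :=
        mul_le_mul hBε.le (by linarith) (by linarith) hε0.le
      rw [e]
      nlinarith

end Conduction

end

end RBM

theorem mainTheorem2 (l L : ℝ) (hl : 0 < l) (hL : 0 < L) :
    (∀ Λ : ℝ, 0 < Λ → ∃ K : ℝ, 0 < K ∧
      ∀ Pr M R B b : ℝ, 0 < Pr → 0 ≤ M → 0 ≤ R → 0 < B →
      ∀ Γ01 Γ02 : Set RBM.Pt, RBM.IsSplit l L Γ01 Γ02 →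
      ∀ (u0 g : RBM.Pt → RBM.Pt) (φ1 φ2 : RBM.Pt → ℝ),
        RBM.IsData l L Γ01 Γ02 u0 g φ1 φ2 →
        RBM.dataNorm l L Γ01 Γ02 u0 g φ1 φ2 ≤ Λ →
        0 < Pr - K * (1 + M + B + R) * (Pr * (M + R) + 1)
              * RBM.dataNorm l L Γ01 Γ02 u0 g φ1 φ2 →
        (∃! p : RBM.VH1 l L × RBM.H1 l L,
          RBM.SolvesInXt l L Pr M R B b Γ01 Γ02 u0 g φ1 φ2 p) ∧
        ∀ p : RBM.VH1 l L × RBM.H1 l L,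
          RBM.SolvesInXt l L Pr M R B b Γ01 Γ02 u0 g φ1 φ2 p →
          ‖p.1‖ + ‖p.2‖ ≤
            K * (1 + M + B + R) * RBM.dataNorm l L Γ01 Γ02 u0 g φ1 φ2) ∧
    (∀ θc : ℝ, ∃ ε : ℝ, 0 < ε ∧
      ∀ Pr M R B b : ℝ, 0 < Pr → 0 ≤ M → M < ε → 0 ≤ R → R < ε → 0 < B → B < ε →
      ∀ Γ01 Γ02 : Set RBM.Pt, RBM.IsSplit l L Γ01 Γ02 →
        ∃ p : RBM.VH1 l L × RBM.H1 l L,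
          p.1 = 0 ∧
          RBM.fn p.2 =ᵐ[MeasureTheory.volume.restrict (RBM.box l L)]
            (fun x => θc - θc * B / (1 + B) * x 2) ∧
          RBM.SolvesInXt l L Pr M R B b Γ01 Γ02 0 0 0 (fun _ => θc) p ∧
          ∀ q : RBM.VH1 l L × RBM.H1 l L,
            RBM.SolvesInXt l L Pr M R B b Γ01 Γ02 0 0 0 (fun _ => θc) q → q = p) := by
  have := Fact.mk hl
  have := Fact.mk hL
  exact ⟨fun _ hΛ => RBM.exists_const_existsUnique l L hΛ,
    fun θc => RBM.exists_const_conduction l L θc⟩
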